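/- Let $R=(R^\#,d_R)$ be a ($\mathbb Z$-graded) commutative dg algebra over $\mathbb R$ with a nilpotent dg ideal $I$, and let $\mathfrak g$ be a curved $L_\infty$-algebra over $(R,I)$, i.e. a graded $R^\#$-module, finitely generated and projective (locally free of finite rank), with graded symmetric degree $+1$ brackets $\ell_n$ ($n\ge 0$) on $\mathfrak g[1]$ satisfying the higher Jacobi identities, where $\ell_n$ is $R$-multilinear for $n\ne 1$, $\ell_1$ is a derivation over $d_R$, and $\ell_0\in I\cdot\mathfrak g[1]$. * Let $C^*(\mathfrak g)=\widehat{\mathrm{Sym}}_R(\mathfrak g^\vee[-1])=\prod_n \mathrm{Sym}^n_R(\mathfrak g^\vee[-1])$ be the Chevalley–Eilenberg complex and $C^*_{red}(\mathfrak g)=C^*(\mathfrak g)/R$. * The translation-invariant obstruction-deformation complex $\mathcal O_{loc}(\Omega^*(\mathbb R)\otimes\mathfrak g[1])^{\mathbb R}$ of one-dimensional Chern–Simons theory consists of the formal power series $F=(F_n)_{n\ge 1}$ of functionals (taken modulo constants) on $\Omega^*(\mathbb R)\otimes_{\mathbb R}\mathfrak g[1]$, where each $F_n$ is a graded symmetric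 $R$-multilinear $R$-valued functional that is local (a finite sum of integrals $\int_{\mathbb R}(D_{1}\phi_1)\cdots(D_{n}\phi_n)\,d\mu$ with differential operators $D_i$ and smooth densities $d\mu$, evaluated when at least one $\phi_i$ has compact support) and is invariant under translations of $\mathbb R$. Its differential $d+\{I_{CS},-\}$ is the Chevalley–Eilenberg differential of the $L_\infty$-algebra $\Omega^*(\mathbb R)\otimes\mathfrak g$ (including $d_R$ acting on values). * Let $\Omega^*(\mathbb R)^{\mathbb R}$ be the complex of translation-invariant forms on $\mathbb R$. * Let $\Omega^1_{cl}(B\mathfrak g)$ be the (product) total complex of the truncated de Rham complex $\Omega^1(B\mathfrak g)\to\Omega^2(B\mathfrak g)\to\cdots$ of $B\mathfrak g$ (forms relative to $R$, $\mathcal O(B\mathfrak g)=C^*(\mathfrak g)$), with $\Omega^1$ in position $0$. Then all of these are cochain complexes, and: 1. There is a quasi-isomorphism $$\Omega^*(\mathbb R)^{\mathbb R}[1]\otimes_{\mathbb R}C^*_{red}(\mathfrak g)\;\xrightarrow{\ \simeq\ }\;\mathcal O_{loc}(\Omega^*(\mathbb R)\otimes\mathfrak g[1])^{\mathbb R},$$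 and an isomorphism of complexes $\Omega^*(\mathbb R)^{\mathbb R}[1]\otimes_{\mathbb R}C^*_{red}(\mathfrak g)\cong C^*_{red}(\mathfrak g)\oplus C^*_{red}(\mathfrak g)[1]$. The resulting quasi-isomorphism from $C^*_{red}(\mathfrak g)\oplus C^*_{red}(\mathfrak g)[1]$ can be taken linear over the graded ring $R^\#$ (with the Koszul sign rule). 2. There is an $R^\#$-linear quasi-isomorphism $C^*_{red}(\mathfrak g)\to\Omega^1_{cl}(B\mathfrak g)$, hence one $C^*_{red}(\mathfrak g)\oplus C^*_{red}(\mathfrak g)[1]\to\Omega^1_{cl}(B\mathfrak g)\oplus\Omega^1_{cl}(B\mathfrak g)[1]$. Consequently the translation-invariant obstruction-deformation complex is quasi-isomorphic to $\Omega^1_{cl}(B\mathfrak g)\oplus\Omega^1_{cl}(B\mathfrak g)[1]$. -/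

import Mathlib

open CategoryTheory MonoidalCategory
open scoped ContDiff

namespace ChernSimons

/-! ### Graded objects, commutative dg algebras -/

section Graded

/-- A homogeneous element of an internally `ℤ`-graded real vector space, with its degree. -/
structure Homog {M : Type*} [AddCommGroup M] [Module ℝ M] (𝓜 : ℤ → Submodule ℝ M) where
  deg : ℤ
  val : M
  mem : val ∈ 𝓜 deg

/-- `(A, d)`, with the grading `𝓐`, is a (graded-)commutative dg algebra over `ℝ`, with
differential of degree `+1`. -/
structure IsCDGA {A : Type*} [Ring A] [Algebra ℝ A] (𝓐 : ℤ → Submodule ℝ A)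
    (d : A →ₗ[ℝ] A) : Prop where
  one_mem : (1 : A) ∈ 𝓐 0
  mul_mem : ∀ i j x y, x ∈ 𝓐 i → y ∈ 𝓐 j → x * y ∈ 𝓐 (i + j)
  mul_comm : ∀ i j x y, x ∈ 𝓐 i → y ∈ 𝓐 j → x * y = (i * j).negOnePow • (y * x)
  d_mem : ∀ i x, x ∈ 𝓐 i → d x ∈ 𝓐 (i + 1)
  d_d : ∀ x, d (d x) = 0
  leibniz : ∀ i x y, x ∈ 𝓐 i → d (x * y) = d x * y + i.negOnePow • (x * d y)

/-- `I` is a nilpotent dg ideal of `(R, d)`. -/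
structure IsNilpotentDGIdeal {R : Type*} [Ring R] [Algebra ℝ R] (𝓡 : ℤ → Submodule ℝ R)
    [GradedAlgebra 𝓡] (d : R →ₗ[ℝ] R) (I : Ideal R) : Prop where
  homogeneous : I.IsHomogeneous 𝓡
  d_mem : ∀ x ∈ I, d x ∈ I
  nilpotent : ∃ n : ℕ, ∀ l : List R, l.length = n → (∀ x ∈ l, x ∈ I) → l.prod = 0

end Graded

/-! ### Chevalley–Eilenberg differentials -/

section ChevalleyEilenberg

/-- All ways of splitting a word `v₁ ⋯ vₙ` in graded letters as `v_S`, `v_{Sᶜ}` for `S ⊆ {1, …, n}`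
(orders preserved), together with the Koszul sign of `v₁ ⋯ vₙ ↦ v_S v_{Sᶜ}`. -/
def unshuffles {H : Type*} (deg : H → ℤ) : List H → List (ℤˣ × List H × List H)
  | [] => [(1, [], [])]
  | v :: l => (unshuffles deg l).flatMap fun u =>
      [(u.1, v :: u.2.1, u.2.2),
       ((deg v * (u.2.1.map deg).sum).negOnePow * u.1, u.2.1, v :: u.2.2)]

theorem sum_map_smul' {M : Type*} [AddCommGroup M] [Module ℝ M] {α : Type*} (c : ℝ)
    (m : List α) (f : α → M) : (m.map fun x => c • f x).sum = c • (m.map f).sum := by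
  induction m with
  | nil => simp
  | cons x m ih => simp [ih, smul_add]

open Classical in
/-- The Chevalley–Eilenberg differential on functionals of degree `p`,
`(D F)(v₁, …, vₙ) = d_R (F(v₁, …, vₙ)) - (-1)^p ∑_S ± F(b(v_S), v_{Sᶜ})`,
where `b` lists the homogeneous terms of all the brackets of `v_S` (so that `b` is the odd vector
field of the `L_∞`-structure). Functionals are only considered on the words with `Adm`. -/
noncomputable def ceDiff {R : Type*} [Ring R] [Algebra ℝ R] (dR : R →ₗ[ℝ] R) {H : Type*}
    (deg : H → ℤ) (b : List H → List H) (Adm : List H → Prop) (p : ℤ) :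
    (List H → R) →ₗ[ℝ] (List H → R) where
  toFun F l := if Adm l then
      dR (F l) - p.negOnePow •
        ((unshuffles deg l).map fun u => u.1 • ((b u.2.1).map fun w => F (w :: u.2.2)).sum).sum
      else 0
  map_add' F G := by
    funext l
    by_cases h : Adm l
    · simp only [h, if_true, Pi.add_apply, map_add, List.sum_map_add, smul_add]
      abel
    · simp [h]
  map_smul' c F := by
    funext l
    by_cases h : Adm l
    · simp only [h, if_true, Pi.smul_apply, map_smul, RingHom.id_apply, sum_map_smul', smul_sub,
        smul_comm _ c]
    · simp [h]

end ChevalleyEilenberg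

/-! ### Curved `L_∞`-algebras and their cochains -/

section LInfty

variable {R : Type} [Ring R] [Algebra ℝ R] (𝓡 : ℤ → Submodule ℝ R) [GradedAlgebra 𝓡]
  (dR : R →ₗ[ℝ] R) (I : Ideal R)
  {V : Type} [AddCommGroup V] [Module ℝ V] [Module R V] (𝓥 : ℤ → Submodule ℝ V)

/-- A curved `L_∞`-algebra `𝔤` over the commutative dg algebra `(R, dR)` with nilpotent ideal `I`,
given on the graded `R`-module `V = 𝔤[1]`. With this shift all brackets `ℓ₀, ℓ₁, ℓ₂, …` are graded
symmetric of degree `+1`; `br [v₁, …, vₙ]` is the `n`-ary bracket. The unary bracket is a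
derivation over `dR`, the other ones are `R`-multilinear, the curvature vanishes modulo `I`. -/
structure CurvedLInfty where
  br : List (Homog 𝓥) → V
  mem : ∀ l, br l ∈ 𝓥 ((l.map Homog.deg).sum + 1)
  add : ∀ (x y z : Homog 𝓥) (l), y.deg = x.deg → z.deg = x.deg → z.val = x.val + y.val →
    br (z :: l) = br (x :: l) + br (y :: l)
  smul : ∀ (a : ℤ), ∀ r ∈ 𝓡 a, ∀ (x z : Homog 𝓥) (l), l ≠ [] → z.deg = a + x.deg →
    z.val = r • x.val → br (z :: l) = a.negOnePow • r • br (x :: l)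
  smul_one : ∀ (a : ℤ), ∀ r ∈ 𝓡 a, ∀ (x z : Homog 𝓥), z.deg = a + x.deg →
    z.val = r • x.val → br [z] = dR r • x.val + a.negOnePow • r • br [x]
  swap : ∀ (x y : Homog 𝓥) (l₁ l₂), br (l₁ ++ x :: y :: l₂) =
    (x.deg * y.deg).negOnePow • br (l₁ ++ y :: x :: l₂)
  curvature : br [] ∈ Submodule.span R {v : V | ∃ r ∈ I, ∃ w : V, v = r • w}
  jacobi : ∀ l, ((unshuffles Homog.deg l).map fun u =>
    u.1 • br (⟨_, br u.2.1, mem u.2.1⟩ :: u.2.2)).sum = 0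

variable {𝓡 dR I 𝓥}

/-- The `n`-ary bracket as a homogeneous element. -/
def CurvedLInfty.brH (𝔤 : CurvedLInfty 𝓡 dR I 𝓥) (l : List (Homog 𝓥)) : Homog 𝓥 :=
  ⟨(l.map Homog.deg).sum + 1, 𝔤.br l, 𝔤.mem l⟩

variable (𝓡 𝓥)

/-- `F`, a sequence of functions `F(v₁, …, vₙ)` with values in `R`, is an element of degree `p` of
the completed symmetric algebra `∏ₙ Symⁿ(V^∨)`, `V = 𝔤[1]`, modulo constants: its components are
graded symmetric, `R`-multilinear and homogeneous of degree `p`, and there is no component for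
`n = 0`. -/
structure IsReducedCochain (p : ℤ) (F : List (Homog 𝓥) → R) : Prop where
  nil : F [] = 0
  mem : ∀ l, F l ∈ 𝓡 (p + (l.map Homog.deg).sum)
  add : ∀ (x y z : Homog 𝓥) (l), y.deg = x.deg → z.deg = x.deg → z.val = x.val + y.val →
    F (z :: l) = F (x :: l) + F (y :: l)
  smul : ∀ (a : ℤ), ∀ r ∈ 𝓡 a, ∀ (x z : Homog 𝓥) (l), z.deg = a + x.deg →
    z.val = r • x.val → F (z :: l) = (a * p).negOnePow • (r * F (x :: l))
  swap : ∀ (x y : Homog 𝓥) (l₁ l₂), F (l₁ ++ x :: y :: l₂) =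
    (x.deg * y.deg).negOnePow • F (l₁ ++ y :: x :: l₂)

/-- The reduced Chevalley–Eilenberg cochains of degree `p`. -/
def reducedCochains (p : ℤ) : Submodule ℝ (List (Homog 𝓥) → R) where
  carrier := {F | IsReducedCochain 𝓡 𝓥 p F}
  zero_mem' := ⟨rfl, fun _ => zero_mem _, by simp, by simp, by simp⟩
  add_mem' := by
    intro F G hF hG
    refine ⟨by simp [hF.nil, hG.nil], fun l => add_mem (hF.mem l) (hG.mem l), ?_, ?_, ?_⟩
    · intro x y z l h1 h2 h3
      simp only [Pi.add_apply, hF.add x y z l h1 h2 h3, hG.add x y z l h1 h2 h3]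
      abel
    · intro a r hr x z l h1 h2
      simp only [Pi.add_apply, hF.smul a r hr x z l h1 h2, hG.smul a r hr x z l h1 h2, mul_add,
        smul_add]
    · intro x y l₁ l₂
      simp only [Pi.add_apply, hF.swap x y l₁ l₂, hG.swap x y l₁ l₂, smul_add]
  smul_mem' := by
    intro c F hF
    refine ⟨by simp [hF.nil], fun l => Submodule.smul_mem _ _ (hF.mem l), ?_, ?_, ?_⟩
    · intro x y z l h1 h2 h3
      simp only [Pi.smul_apply, hF.add x y z l h1 h2 h3, smul_add]
    · intro a r hr x z l h1 h2
      simp only [Pi.smul_apply, hF.smul a r hr x z l h1 h2, mul_smul_comm, smul_comm _ c]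
    · intro x y l₁ l₂
      simp only [Pi.smul_apply, hF.swap x y l₁ l₂, smul_comm _ c]

end LInfty

/-! ### Cochains on `A ⊗ 𝔤` for a commutative dg algebra `A` -/

section Tensor

variable {R : Type} [Ring R] [Algebra ℝ R] (𝓡 : ℤ → Submodule ℝ R) [GradedAlgebra 𝓡]
  {dR : R →ₗ[ℝ] R} {I : Ideal R}
  {V : Type} [AddCommGroup V] [Module ℝ V] [Module R V] (𝓥 : ℤ → Submodule ℝ V)
  {A : Type} [Ring A] [Algebra ℝ A] (𝓐 : ℤ → Submodule ℝ A)

/-- Homogeneous pure tensors `a ⊗ v ∈ A ⊗ V`. A multilinear function on `A ⊗ V` is the same as a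
function of pure tensors that is multilinear in the `a`'s and in the `v`'s. -/
abbrev PureTensor := Homog 𝓐 × Homog 𝓥

/-- The degree of `a ⊗ v`. -/
def tdeg {𝓥 : ℤ → Submodule ℝ V} {𝓐 : ℤ → Submodule ℝ A} (t : PureTensor 𝓥 𝓐) : ℤ :=
  t.1.deg + t.2.deg

/-- The exponent of the Koszul sign of `ℓ (a₁ ⊗ v₁) ⋯ (aₙ ⊗ vₙ) ↦ (a₁ ⋯ aₙ) ⊗ ℓ(v₁ ⋯ vₙ)` for an
operation `ℓ` of degree `e`. -/
def koszulExp {𝓥 : ℤ → Submodule ℝ V} {𝓐 : ℤ → Submodule ℝ A} (e : ℤ) :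
    List (PureTensor 𝓥 𝓐) → ℤ
  | [] => 0
  | t :: l => t.1.deg * e + koszulExp (e + t.2.deg) l

variable {𝓥 𝓐} in
/-- The product `a₁ ⋯ aₙ` of homogeneous elements. -/
def prodH {dA : A →ₗ[ℝ] A} (hA : IsCDGA 𝓐 dA) : List (Homog 𝓐) → Homog 𝓐
  | [] => ⟨0, 1, hA.one_mem⟩
  | a :: l => ⟨a.deg + (prodH hA l).deg, a.val * (prodH hA l).val,
      hA.mul_mem _ _ _ _ a.mem (prodH hA l).mem⟩

variable {𝓡 𝓥 𝓐} in
/-- The `L_∞`-structure on `A ⊗ 𝔤`: the brackets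
`(a₁ ⊗ v₁, …, aₙ ⊗ vₙ) ↦ ± (a₁ ⋯ aₙ) ⊗ ℓₙ(v₁, …, vₙ)`, and the extra term `a ⊗ v ↦ d a ⊗ v` in the
unary one. -/
def tensorBr {dA : A →ₗ[ℝ] A} (hA : IsCDGA 𝓐 dA) (𝔤 : CurvedLInfty 𝓡 dR I 𝓥)
    (l : List (PureTensor 𝓥 𝓐)) : List (PureTensor 𝓥 𝓐) :=
  (⟨(prodH hA (l.map Prod.fst)).deg,
      (koszulExp 1 l).negOnePow • (prodH hA (l.map Prod.fst)).val,
      by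
        rcases Int.units_eq_one_or (koszulExp 1 l).negOnePow with h | h <;> rw [h]
        · simpa using (prodH hA (l.map Prod.fst)).mem
        · simpa using (prodH hA (l.map Prod.fst)).mem⟩, 𝔤.brH (l.map Prod.snd)) ::
  match l with
  | [t] => [(⟨t.1.deg + 1, dA t.1.val, hA.d_mem _ _ t.1.mem⟩, t.2)]
  | _ => []

/-- `F`, a function of words of pure tensors, is a graded symmetric `R`-multilinear functional of
degree `p` on the words in `A ⊗ V` that satisfy `Adm` (and is set to `0` on the other words). -/
structure IsTensorCochain (Adm : List (PureTensor 𝓥 𝓐) → Prop) (p : ℤ)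
    (F : List (PureTensor 𝓥 𝓐) → R) : Prop where
  zero : ∀ l, ¬ Adm l → F l = 0
  mem : ∀ l, F l ∈ 𝓡 (p + (l.map tdeg).sum)
  add_left : ∀ (x y z : Homog 𝓐) (v : Homog 𝓥) (l), Adm ((x, v) :: l) → Adm ((y, v) :: l) →
    y.deg = x.deg → z.deg = x.deg → z.val = x.val + y.val →
    F ((z, v) :: l) = F ((x, v) :: l) + F ((y, v) :: l)
  smul_left : ∀ (c : ℝ) (x z : Homog 𝓐) (v : Homog 𝓥) (l), Adm ((x, v) :: l) →
    z.deg = x.deg → z.val = c • x.val → F ((z, v) :: l) = c • F ((x, v) :: l)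
  add_right : ∀ (a : Homog 𝓐) (x y z : Homog 𝓥) (l), y.deg = x.deg → z.deg = x.deg →
    z.val = x.val + y.val → F ((a, z) :: l) = F ((a, x) :: l) + F ((a, y) :: l)
  smul_right : ∀ (e : ℤ), ∀ r ∈ 𝓡 e, ∀ (a : Homog 𝓐) (x z : Homog 𝓥) (l),
    z.deg = e + x.deg → z.val = r • x.val →
    F ((a, z) :: l) = (e * (p + a.deg)).negOnePow • (r * F ((a, x) :: l))
  swap : ∀ (x y : PureTensor 𝓥 𝓐) (l₁ l₂), F (l₁ ++ x :: y :: l₂) =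
    (tdeg x * tdeg y).negOnePow • F (l₁ ++ y :: x :: l₂)

/-- The graded symmetric `R`-multilinear functionals of degree `p` on admissible words. -/
def tensorCochains (Adm : List (PureTensor 𝓥 𝓐) → Prop) (p : ℤ) :
    Submodule ℝ (List (PureTensor 𝓥 𝓐) → R) where
  carrier := {F | IsTensorCochain 𝓡 𝓥 𝓐 Adm p F}
  zero_mem' := ⟨by simp, fun _ => zero_mem _, by simp, by simp, by simp, by simp, by simp⟩
  add_mem' := by
    intro F G hF hG
    refine ⟨fun l h => by simp [hF.zero l h, hG.zero l h],
      fun l => add_mem (hF.mem l) (hG.mem l), ?_, ?_, ?_, ?_, ?_⟩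
    · intro x y z v l h1 h2 h3 h4 h5
      simp only [Pi.add_apply, hF.add_left x y z v l h1 h2 h3 h4 h5,
        hG.add_left x y z v l h1 h2 h3 h4 h5]
      abel
    · intro c x z v l h1 h2 h3
      simp only [Pi.add_apply, hF.smul_left c x z v l h1 h2 h3, hG.smul_left c x z v l h1 h2 h3,
        smul_add]
    · intro a x y z l h1 h2 h3
      simp only [Pi.add_apply, hF.add_right a x y z l h1 h2 h3, hG.add_right a x y z l h1 h2 h3]
      abel
    · intro e r hr a x z l h1 h2
      simp only [Pi.add_apply, hF.smul_right e r hr a x z l h1 h2,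
        hG.smul_right e r hr a x z l h1 h2, mul_add, smul_add]
    · intro x y l₁ l₂
      simp only [Pi.add_apply, hF.swap x y l₁ l₂, hG.swap x y l₁ l₂, smul_add]
  smul_mem' := by
    intro c F hF
    refine ⟨fun l h => by simp [hF.zero l h],
      fun l => Submodule.smul_mem _ _ (hF.mem l), ?_, ?_, ?_, ?_, ?_⟩
    · intro x y z v l h1 h2 h3 h4 h5
      simp only [Pi.smul_apply, hF.add_left x y z v l h1 h2 h3 h4 h5, smul_add]
    · intro c' x z v l h1 h2 h3
      simp only [Pi.smul_apply, hF.smul_left c' x z v l h1 h2 h3, smul_comm _ c]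
    · intro a x y z l h1 h2 h3
      simp only [Pi.smul_apply, hF.add_right a x y z l h1 h2 h3, smul_add]
    · intro e r hr a x z l h1 h2
      simp only [Pi.smul_apply, hF.smul_right e r hr a x z l h1 h2, mul_smul_comm, smul_comm _ c]
    · intro x y l₁ l₂
      simp only [Pi.smul_apply, hF.swap x y l₁ l₂, smul_comm _ c]

end Tensor

/-! ### Differential forms on the line -/

section Forms

/-- Smooth real functions on `ℝ`. -/
def Smooth : Subalgebra ℝ (ℝ → ℝ) where
  carrier := {f | ContDiff ℝ ∞ f}
  mul_mem' := by
    intro f g hf hg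
    exact ContDiff.mul (Set.mem_ofPred.1 hf) (Set.mem_ofPred.1 hg)
  add_mem' := by
    intro f g hf hg
    exact ContDiff.add (Set.mem_ofPred.1 hf) (Set.mem_ofPred.1 hg)
  algebraMap_mem' c := (contDiff_const : ContDiff ℝ ∞ fun _ : ℝ => c)

theorem Smooth.contDiff (f : Smooth) : ContDiff ℝ ∞ (f : ℝ → ℝ) := f.2

/-- The derivative of a smooth function. -/
noncomputable def Smooth.deriv : Smooth →ₗ[ℝ] Smooth where
  toFun f := ⟨_root_.deriv (f : ℝ → ℝ), (contDiff_infty_iff_deriv.1 f.2).2⟩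
  map_add' f g := by
    ext x
    exact deriv_add ((contDiff_infty_iff_deriv.1 f.2).1 x) ((contDiff_infty_iff_deriv.1 g.2).1 x)
  map_smul' c f := by
    ext x
    exact deriv_const_smul c ((contDiff_infty_iff_deriv.1 f.2).1 x)

theorem Smooth.deriv_mul (f g : Smooth) :
    Smooth.deriv (f * g) = Smooth.deriv f * g + f * Smooth.deriv g := by
  ext x
  exact _root_.deriv_mul ((contDiff_infty_iff_deriv.1 f.2).1 x)
    ((contDiff_infty_iff_deriv.1 g.2).1 x)

/-- The translate `x ↦ f (x + t)`. -/
def Smooth.translate (t : ℝ) : Smooth →ₗ[ℝ] Smooth where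
  toFun f := ⟨fun x => (f : ℝ → ℝ) (x + t), (Smooth.contDiff f).comp (contDiff_id.add contDiff_const)⟩
  map_add' _ _ := rfl
  map_smul' _ _ := rfl

theorem Smooth.deriv_translate (t : ℝ) (f : Smooth) :
    Smooth.deriv (Smooth.translate t f) = Smooth.translate t (Smooth.deriv f) := by
  ext x
  exact deriv_comp_add_const (f : ℝ → ℝ) t x

/-- For a commutative `ℝ`-algebra `B`, the grading on `B[θ] = B ⊕ Bθ`, `θ² = 0`, with `B` in degree
`0` and `θ` in degree `s ≠ 0`. -/
def dualGrading (B : Type) [CommRing B] [Algebra ℝ B] (s : ℤ) (i : ℤ) :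
    Submodule ℝ (DualNumber B) where
  carrier := {a | (i ≠ 0 → a.fst = 0) ∧ (i ≠ s → a.snd = 0)}
  zero_mem' := by simp
  add_mem' := by
    rintro a b ⟨h1, h2⟩ ⟨h3, h4⟩
    exact ⟨fun h => by simp [h1 h, h3 h], fun h => by simp [h2 h, h4 h]⟩
  smul_mem' := by
    rintro c a ⟨h1, h2⟩
    exact ⟨fun h => by simp [h1 h], fun h => by simp [h2 h]⟩

/-- The de Rham algebra `Ω^*(ℝ) = C^∞(ℝ) ⊕ C^∞(ℝ) dx`. -/
abbrev Forms : Type := DualNumber Smooth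

/-- The grading of `Ω^*(ℝ)` by the form degree. -/
abbrev formGrading : ℤ → Submodule ℝ Forms := dualGrading Smooth 1

/-- The exterior derivative `f + g dx ↦ f' dx`. -/
noncomputable def extD : Forms →ₗ[ℝ] Forms where
  toFun a := TrivSqZeroExt.inr (Smooth.deriv a.fst)
  map_add' a b := TrivSqZeroExt.ext (by simp [-DualNumber.inr_eq_smul_eps])
    (by simp [-DualNumber.inr_eq_smul_eps])
  map_smul' c a := TrivSqZeroExt.ext (by simp [-DualNumber.inr_eq_smul_eps])
    (by simp [-DualNumber.inr_eq_smul_eps])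

/-- Translation of forms, `f + g dx ↦ f(x + t) + g(x + t) dx`. -/
def translateForm (t : ℝ) : Forms →ₗ[ℝ] Forms where
  toFun a := TrivSqZeroExt.inl (Smooth.translate t a.fst) +
    TrivSqZeroExt.inr (Smooth.translate t a.snd)
  map_add' a b := by
    ext <;> simp
  map_smul' c a := by
    ext <;> simp

theorem isCDGA_forms : IsCDGA formGrading extD where
  one_mem := by simp [dualGrading]
  mul_mem := by
    rintro i j x y ⟨h1, h2⟩ ⟨h3, h4⟩
    refine ⟨fun h => ?_, fun h => ?_⟩
    · by_cases hi : i = 0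
      · simp [h3 (by omega)]
      · simp [h1 hi]
    · by_cases hi : i = 0
      · simp [h2 (by omega), h4 (by omega)]
      · by_cases hj : j = 0
        · simp [h1 hi, h2 (by omega)]
        · simp [h1 hi, h3 hj]
  mul_comm := by
    rintro i j x y ⟨h1, h2⟩ ⟨h3, h4⟩
    by_cases hi : i = 0
    · subst hi; simp [mul_comm x y]
    · by_cases hj : j = 0
      · subst hj; simp [mul_comm x y]
      · have : x * y = 0 := by ext <;> simp [h1 hi, h3 hj]
        simp [mul_comm y x, this]
  d_mem := by
    rintro i x ⟨h1, -⟩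
    exact ⟨fun _ => by simp [extD, -DualNumber.inr_eq_smul_eps], fun h => by simp [extD, -DualNumber.inr_eq_smul_eps, h1 (by omega)]⟩
  d_d x := by simp [extD, -DualNumber.inr_eq_smul_eps]
  leibniz := by
    rintro i x y ⟨h1, h2⟩
    by_cases hi : i = 0
    · subst hi
      ext1
      · simp [extD, -DualNumber.inr_eq_smul_eps]
      · simp [extD, -DualNumber.inr_eq_smul_eps, Smooth.deriv_mul, mul_comm, add_comm]
    · ext1
      · rcases Int.units_eq_one_or i.negOnePow with h | h <;> simp [extD, -DualNumber.inr_eq_smul_eps, h]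
      · rcases Int.units_eq_one_or i.negOnePow with h | h <;> simp [extD, -DualNumber.inr_eq_smul_eps, h, h1 hi]

theorem translateForm_mem (t : ℝ) (i : ℤ) (a : Forms) (h : a ∈ formGrading i) :
    translateForm t a ∈ formGrading i :=
  ⟨fun hi => by simp [translateForm, -DualNumber.inr_eq_smul_eps, h.1 hi], fun hi => by simp [translateForm, -DualNumber.inr_eq_smul_eps, h.2 hi]⟩

/-- Translation of homogeneous forms. -/
def translateH (t : ℝ) (a : Homog formGrading) : Homog formGrading :=
  ⟨a.deg, translateForm t a.val, translateForm_mem t _ _ a.mem⟩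

/-- The coefficient function of a homogeneous form: `f` for `f`, and `g` for `g dx`. -/
def coeff (a : Homog formGrading) : ℝ → ℝ := ((a.val.fst + a.val.snd : Smooth) : ℝ → ℝ)

/-- The differential `∂/∂ε` on `ℝ[ε]`. -/
noncomputable def epsD : DualNumber ℝ →ₗ[ℝ] DualNumber ℝ where
  toFun a := TrivSqZeroExt.inl a.snd
  map_add' a b := TrivSqZeroExt.ext (by simp) (by simp)
  map_smul' c a := TrivSqZeroExt.ext (by simp) (by simp)

/-- The grading of `ℝ[ε]` with `ε` in degree `-1`. -/
abbrev epsGrading : ℤ → Submodule ℝ (DualNumber ℝ) := dualGrading ℝ (-1)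

theorem isCDGA_eps : IsCDGA epsGrading epsD where
  one_mem := by simp [dualGrading]
  mul_mem := by
    rintro i j x y ⟨h1, h2⟩ ⟨h3, h4⟩
    refine ⟨fun h => ?_, fun h => ?_⟩
    · by_cases hi : i = 0
      · simp [h3 (by omega)]
      · simp [h1 hi]
    · by_cases hi : i = 0
      · simp [h2 (by omega), h4 (by omega)]
      · by_cases hj : j = 0
        · simp [h1 hi, h2 (by omega)]
        · simp [h1 hi, h3 hj]
  mul_comm := by
    rintro i j x y ⟨h1, h2⟩ ⟨h3, h4⟩
    by_cases hi : i = 0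
    · subst hi; simp [mul_comm x y]
    · by_cases hj : j = 0
      · subst hj; simp [mul_comm x y]
      · have : x * y = 0 := by ext <;> simp [h1 hi, h3 hj]
        simp [mul_comm y x, this]
  d_mem := by
    rintro i x ⟨-, h2⟩
    exact ⟨fun h => by simp [epsD, h2 (by omega)], fun _ => by simp [epsD]⟩
  d_d x := by simp [epsD]
  leibniz := by
    rintro i x y ⟨h1, h2⟩
    by_cases hi : i = 0
    · subst hi
      ext <;> simp [epsD, h2 (by omega)]
    · by_cases hs : i = -1
      · subst hs
        ext <;> simp [epsD, h1 (by omega)]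
      · rcases Int.units_eq_one_or i.negOnePow with h | h <;> ext <;>
          simp [epsD, h1 hi, h2 hs, h]

end Forms

/-! ### Cochain complexes -/

section Complexes

/-- A family of subspaces `S p` of a vector space `M`, with operators `D p` on `M`. -/
structure ComplexData (M : Type) [AddCommGroup M] [Module ℝ M] where
  S : ℤ → Submodule ℝ M
  D : ℤ → M →ₗ[ℝ] M

variable {M : Type} [AddCommGroup M] [Module ℝ M]

/-- The operators map `S p` to `S (p + 1)` and square to zero. -/
structure ComplexData.IsComplex (K : ComplexData M) : Prop where
  maps : ∀ p, ∀ x ∈ K.S p, K.D p x ∈ K.S (p + 1)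
  sq : ∀ p, ∀ x ∈ K.S p, K.D (p + 1) (K.D p x) = 0

/-- The resulting cochain complex of real vector spaces. -/
def ComplexData.IsComplex.cpx {K : ComplexData M} (h : K.IsComplex) :
    CochainComplex (ModuleCat.{0} ℝ) ℤ :=
  CochainComplex.of (fun p => ModuleCat.of ℝ (K.S p))
    (fun p => ModuleCat.ofHom ((K.D p).restrict (h.maps p)))
    (fun p => by
      ext x
      exact h.sq p x.1 x.2)

/-- The element of `M` underlying an element of the complex. -/
def ComplexData.IsComplex.val {K : ComplexData M} (h : K.IsComplex) (p : ℤ) (x : h.cpx.X p) : M :=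
  Subtype.val (p := fun y => y ∈ K.S p) x

/-- The translation-invariant forms `Ω^*(ℝ)^ℝ`, with the exterior derivative. -/
noncomputable def invariantForms : ComplexData (Forms) where
  S i := formGrading i ⊓ ⨅ t : ℝ, LinearMap.ker (translateForm t - LinearMap.id)
  D _ := extD

theorem isComplex_invariantForms : invariantForms.IsComplex where
  maps := by
    rintro p x ⟨h1, h2⟩
    refine ⟨isCDGA_forms.d_mem _ _ h1, ?_⟩
    simp only [SetLike.mem_coe, Submodule.mem_iInf, LinearMap.mem_ker, LinearMap.sub_apply,
      LinearMap.id_apply, sub_eq_zero] at h2 ⊢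
    intro t
    calc translateForm t (extD x) = extD (translateForm t x) := by
          refine TrivSqZeroExt.ext ?_ ?_ <;>
            simp [translateForm, extD, -DualNumber.inr_eq_smul_eps, Smooth.deriv_translate]
      _ = extD x := congrArg extD (h2 t)
  sq _ x _ := isCDGA_forms.d_d x

end Complexes

/-! ### The three complexes -/

section Main

variable {R : Type} [Ring R] [Algebra ℝ R] {𝓡 : ℤ → Submodule ℝ R} [GradedAlgebra 𝓡]
  {dR : R →ₗ[ℝ] R} {I : Ideal R}
  {V : Type} [AddCommGroup V] [Module ℝ V] [Module R V] {𝓥 : ℤ → Submodule ℝ V}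

/-- The reduced Chevalley–Eilenberg complex `C_red^*(𝔤) = C^*(𝔤) / R`. -/
noncomputable def reducedCE (𝔤 : CurvedLInfty 𝓡 dR I 𝓥) :
    ComplexData (List (Homog 𝓥) → R) where
  S p := reducedCochains 𝓡 𝓥 p
  D p := ceDiff dR Homog.deg (fun l => [𝔤.brH l]) (fun l => l ≠ []) p

/-- Words `φ₁ ⋯ φₙ` of fields `φᵢ ∈ Ω^*(ℝ) ⊗ 𝔤[1]`, at least one of which has compact support. -/
def Proper (l : List (PureTensor 𝓥 formGrading)) : Prop := ∃ t ∈ l, HasCompactSupport (coeff t.1)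

/-- The functional `F` is local: each component `Fₙ(φ₁, …, φₙ)` is a finite sum of integrals
`∫ (D_{α,1} φ₁) ⋯ (D_{α,n} φₙ) dμ_α` with `dμ_α = c_α dx` a smooth density. For fields `f ⊗ v` and
`f dx ⊗ v`, the differentiations act on the coefficient functions `f`, and `P α` collects the
dependence on the form degrees and on the elements of `𝔤[1]`. -/
def IsLocal (F : List (PureTensor 𝓥 formGrading) → R) : Prop :=
  ∀ n : ℕ, ∃ (ι : Type) (_ : Fintype ι) (c : ι → Smooth) (m : ι → Fin n → ℕ)
    (P : ι → (Fin n → ℤ × Homog 𝓥) → R),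
    ∀ φ : Fin n → PureTensor 𝓥 formGrading, Proper (List.ofFn φ) →
      F (List.ofFn φ) = ∑ α, (∫ x : ℝ, (c α : ℝ → ℝ) x *
        ∏ i, iteratedDeriv (m α i) (coeff (φ i).1) x) • P α fun i => ((φ i).1.deg, (φ i).2)

variable (R 𝓥) in
/-- The local functionals. -/
def localFunctionals : Submodule ℝ (List (PureTensor 𝓥 formGrading) → R) where
  carrier := {F | IsLocal F}
  zero_mem' n := ⟨Empty, inferInstance, nofun, nofun, nofun, by simp⟩
  add_mem' := by
    intro F G hF hG n
    obtain ⟨ι, _, c, m, P, h⟩ := hF n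
    obtain ⟨ι', _, c', m', P', h'⟩ := hG n
    refine ⟨ι ⊕ ι', inferInstance, Sum.elim c c', Sum.elim m m', Sum.elim P P', fun φ hφ => ?_⟩
    simp [h φ hφ, h' φ hφ]
  smul_mem' := by
    intro a F hF n
    obtain ⟨ι, _, c, m, P, h⟩ := hF n
    refine ⟨ι, inferInstance, c, m, fun α => a • P α, fun φ hφ => ?_⟩
    simp [h φ hφ, Finset.smul_sum, smul_comm a]

variable (R 𝓥) in
/-- The functionals that are invariant under translations of `ℝ`. -/
def invariantFunctionals : Submodule ℝ (List (PureTensor 𝓥 formGrading) → R) where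
  carrier := {F | ∀ (t : ℝ) (l), Proper l → F (l.map fun φ => (translateH t φ.1, φ.2)) = F l}
  zero_mem' _ _ _ := rfl
  add_mem' hF hG t l hl := congrArg₂ (· + ·) (hF t l hl) (hG t l hl)
  smul_mem' a _ hF t l hl := congrArg (a • ·) (hF t l hl)

/-- The translation-invariant obstruction-deformation complex
`(O_loc(Ω^*(ℝ) ⊗ 𝔤[1])^ℝ, d + {I_CS, -})`, modulo constants: translation-invariant local
functionals of the fields in `Ω^*(ℝ) ⊗ 𝔤[1]`, with the Chevalley–Eilenberg differential of the
`L_∞`-algebra `Ω^*(ℝ) ⊗ 𝔤`. A local functional is evaluated on words of smooth fields with at least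
one compactly supported entry; its values there are determined by those on words of compactly
supported fields. -/
noncomputable def obstructionDeformation (𝔤 : CurvedLInfty 𝓡 dR I 𝓥) :
    ComplexData (List (PureTensor 𝓥 formGrading) → R) where
  S p := tensorCochains 𝓡 𝓥 formGrading Proper p ⊓ localFunctionals R 𝓥 ⊓
    invariantFunctionals R 𝓥
  D p := ceDiff dR tdeg (tensorBr isCDGA_forms 𝔤) Proper p

/-- The truncated de Rham complex `Ω^1(B𝔤) → Ω^2(B𝔤) → ⋯` of the dg manifold `B𝔤`, with `Ω^k` in
position `k`, totalized by products. Forms on `B𝔤` are functions on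
`T[1]B𝔤 = B(ℝ[ε] ⊗ 𝔤)`, where `|ε| = -1`: a `k`-form is a functional on words with exactly `k`
entries `ε ⊗ v`, the brackets of `𝔤` extended `ε`-linearly give the internal differential, and the
derivation `∂/∂ε` gives the de Rham differential. -/
noncomputable def truncatedDeRham (𝔤 : CurvedLInfty 𝓡 dR I 𝓥) :
    ComplexData (List (PureTensor 𝓥 epsGrading) → R) where
  S p := tensorCochains 𝓡 𝓥 epsGrading (fun l => ∃ t ∈ l, t.1.deg = -1) p
  D p := ceDiff dR tdeg (tensorBr isCDGA_eps 𝔤) (fun l => ∃ t ∈ l, t.1.deg = -1) p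

/-- The complex `Ω^1_cl(B𝔤)`, with `Ω^1` in position `0`. -/
noncomputable def closedOneForms {𝔤 : CurvedLInfty 𝓡 dR I 𝓥} (h : (truncatedDeRham 𝔤).IsComplex) :
    CochainComplex (ModuleCat.{0} ℝ) ℤ :=
  h.cpx⟦(1 : ℤ)⟧

end Main

/-- Compatibility of a chain map `f` with the action of the graded ring `R`, up to the Koszul sign
`(-1)^{|r| s}`. Here `i` and `j` embed the terms of the complexes in `R`-modules. -/
def IsRLinear {R : Type} [Ring R] [Algebra ℝ R] (𝓡 : ℤ → Submodule ℝ R) {M N : Type}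
    [AddCommGroup M] [Module R M] [AddCommGroup N] [Module R N]
    {K L : CochainComplex (ModuleCat.{0} ℝ) ℤ} (i : ∀ p, K.X p → M) (j : ∀ p, L.X p → N) (s : ℤ)
    (f : K ⟶ L) : Prop :=
  ∀ (a : ℤ), ∀ r ∈ 𝓡 a, ∀ (p : ℤ) (x : K.X p) (y : K.X (p + a)), i (p + a) y = r • i p x →
    j (p + a) (f.f (p + a) y) = (a * s).negOnePow • r • j p (f.f p x)

end ChernSimons

open ChernSimons Limits

namespace ChernSimons

/-! ### Sums over unshuffles -/

/-! All three complexes consist of graded symmetric functions on words, with differential `d_R`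
minus a signed odd vector field whose Taylor coefficients are the brackets. The square of an odd
vector field involves only nested brackets, because two brackets of disjoint subwords cancel against
each other; so `D² = 0` reduces to the Jacobi identities (`IsVectorField.vf_vf`,
`IsVectorField.ceDiff_ceDiff`). For `A ⊗ 𝔤` these follow from those of `𝔤`, graded commutativity of
`A` and the Leibniz rule (`unshSum_tensor`, `jacobi_tensorBr`).

The comparison maps all have the form `push φ`: multiply the left factors `aᵢ ∈ A`, apply a linear
functional `φ : A → ℝ`, and multiply by a cochain of the right factors. With `φ` the coefficient of
`ε` this is the de Rham differential; with `φ` the integral of the function part, respectively of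
the one-form part, it gives the two summands in the field theory. These maps are injective. An
injective chain map is a quasi-isomorphism as soon as every cochain whose differential lies in the
image can be moved into the image by a coboundary (`quasiIso_of_injective`).

To move a cochain, the differential is split into a part acting on `A` alone, a linear part (`d_R`
and `ℓ₁`) and the remaining brackets. An operator that contracts the first part, and is built from
operations on `A`, commutes with the linear part. It therefore moves a cochain into the image up to
an error from the remaining brackets. That error has higher order for a filtration in which a letter
has weight one and an element of `I` weight two: a bracket of several letters shortens words, while
the curvature lengthens them by one letter but gains a factor in `I`. Since `I` is nilpotent, on
words of bounded length only finitely many corrections are nonzero, and iterating converges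
(`exists_of_step`).

For `B𝔤` the contraction is multiplication by `ε` divided by the number of letters, the usual
Poincaré homotopy (`dOp_epsOp`, `eps_step`).

For fields on the line, integration by parts and the fundamental lemma of the calculus of variations
show that translation-invariant local functionals are integrals of polydifferential operators with
constant coefficients (`diffOps_of_translate`, `mem_obstruction_iff`). Contraction with the Euler
field `x ∂/∂x` would be the natural homotopy, but it breaks translation invariance. It is corrected
by measuring `x` from the mean position of the fields, so that only differences of positions occur
(`homotopyOp`). Its commutator with the exterior derivative is `Δ = W - P` (`laplaceOp_eq`): `W`
multiplies a monomial by the number of derivatives plus the number of one-forms, and `P` is a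
projection commuting with `W`. Hence on words of fixed length `Δ` is annihilated by a polynomial
with distinct integer roots. Polynomials in `Δ` supply both the projection onto its kernel and an
inverse off the kernel. The kernel consists of functionals without derivatives, which are exactly
the integrals of cochains of `𝔤` (`exists_of_laplaceOp_eq_zero`), so `field_step` follows.

Finally, the invariant forms are `ℝ ⊕ ℝ dx` with zero differential, so tensoring with their shift
gives a complex plus its shift (`tensorInvariantIso`). -/

theorem negOnePow_congr {m n : ℤ} (h : Even (m - n)) : m.negOnePow = n.negOnePow :=
  (Int.negOnePow_eq_iff m n).2 h

section Unshuffles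

variable {H : Type*} {deg : H → ℤ} {N : Type*} [AddCommGroup N]

/-- The total degree of a word. -/
def wdeg (deg : H → ℤ) (l : List H) : ℤ := (l.map deg).sum

@[simp] theorem wdeg_nil : wdeg deg [] = 0 := rfl

@[simp] theorem wdeg_cons (v : H) (l : List H) : wdeg deg (v :: l) = deg v + wdeg deg l := by
  simp [wdeg]

@[simp] theorem wdeg_append (l l' : List H) :
    wdeg deg (l ++ l') = wdeg deg l + wdeg deg l' := by
  simp [wdeg]

theorem wdeg_perm {l l' : List H} (h : l.Perm l') : wdeg deg l = wdeg deg l' :=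
  (h.map deg).sum_eq

variable (deg) in
/-- The sum of `± f(v_S, v_{Sᶜ})` over all unshuffles of a word. -/
def unshSum (l : List H) (f : List H → List H → N) : N :=
  ((unshuffles deg l).map fun u => u.1 • f u.2.1 u.2.2).sum

@[simp] theorem unshSum_nil (f : List H → List H → N) : unshSum deg [] f = f [] [] := by
  simp [unshSum, unshuffles]

theorem unshSum_cons (v : H) (l : List H) (f : List H → List H → N) :
    unshSum deg (v :: l) f = unshSum deg l (fun a c => f (v :: a) c) +
      unshSum deg l (fun a c => (deg v * wdeg deg a).negOnePow • f a (v :: c)) := by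
  simp only [unshSum, unshuffles, wdeg]
  induction unshuffles deg l with
  | nil => simp
  | cons u m ih =>
    simp only [List.flatMap_cons, List.map_append, List.sum_append, ih, List.map_cons, List.map_nil,
      List.sum_cons, List.sum_nil, smul_smul]
    rw [mul_comm u.1]
    abel

theorem perm_of_mem_unshuffles {l : List H} {u : ℤˣ × List H × List H}
    (h : u ∈ unshuffles deg l) : (u.2.1 ++ u.2.2).Perm l := by
  induction l generalizing u with
  | nil => simp [unshuffles] at h; simp [h]
  | cons v l ih =>
    simp only [unshuffles, List.mem_flatMap] at h
    obtain ⟨w, hw, h⟩ := h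
    simp only [List.mem_cons, List.not_mem_nil, or_false] at h
    rcases h with rfl | rfl
    · exact (ih hw).cons v
    · exact List.perm_middle.trans ((ih hw).cons v)

theorem unshSum_congr {l : List H} {f g : List H → List H → N}
    (h : ∀ a c, (a ++ c).Perm l → f a c = g a c) : unshSum deg l f = unshSum deg l g := by
  unfold unshSum
  congr 1
  exact List.map_congr_left fun u hu => by rw [h _ _ (perm_of_mem_unshuffles hu)]

theorem unshSum_add (l : List H) (f g : List H → List H → N) :
    unshSum deg l (fun a c => f a c + g a c) = unshSum deg l f + unshSum deg l g := by
  simp only [unshSum, smul_add, List.sum_map_add]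

theorem map_unshSum {N' : Type*} [AddCommGroup N'] (φ : N →+ N') (l : List H)
    (f : List H → List H → N) : φ (unshSum deg l f) = unshSum deg l fun a c => φ (f a c) := by
  simp only [unshSum, map_list_sum, List.map_map, Function.comp_def, Units.smul_def, map_zsmul]

theorem unshSum_smul (s : ℤˣ) (l : List H) (f : List H → List H → N) :
    unshSum deg l (fun a c => s • f a c) = s • unshSum deg l f := by
  have := map_unshSum (deg := deg) (DistribSMul.toAddMonoidHom N s) l f
  exact this.symm

theorem unshSum_zero (l : List H) : unshSum deg l (fun _ _ => (0 : N)) = 0 := by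
  have := map_unshSum (deg := deg) (0 : N →+ N) l (fun _ _ => 0)
  exact this.symm

theorem unshSum_eq_zero {l : List H} {f : List H → List H → N}
    (h : ∀ a c, (a ++ c).Perm l → f a c = 0) : unshSum deg l f = 0 :=
  (unshSum_congr h).trans (unshSum_zero l)

/-- Coassociativity of the unshuffle coproduct: both sides run over the ordered splittings of `l`
into three subwords, and the induction decides which of the three receives the first letter. -/
theorem unshSum_assoc (l : List H) (f : List H → List H → List H → N) :
    unshSum deg l (fun a c => unshSum deg a fun a' a'' => f a' a'' c) =
      unshSum deg l fun a c => unshSum deg c fun a' c' => f a a' c' := by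
  induction l generalizing f with
  | nil => simp
  | cons v l ih =>
    simp only [unshSum_cons, unshSum_add]
    rw [ih (fun a' a'' c => f (v :: a') a'' c), add_assoc]
    congr 1
    rw [ih (fun a' a'' c => (deg v * wdeg deg a').negOnePow • f a' (v :: a'') c)]
    simp only [smul_add, unshSum_add, unshSum_smul]
    congr 1
    -- The sign for passing a whole subword depends only on its total degree, so it can be
    -- distributed over a further splitting.
    have : ∀ a c : List H, (deg v * wdeg deg a).negOnePow •
        unshSum deg a (fun a' a'' => f a' a'' (v :: c)) =
        unshSum deg a fun a' a'' => (deg v * wdeg deg a').negOnePow •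
          (deg v * wdeg deg a'').negOnePow • f a' a'' (v :: c) := by
      intro a c
      rw [← unshSum_smul]
      refine unshSum_congr fun a' a'' h => ?_
      rw [smul_smul, ← Int.negOnePow_add, ← mul_add, ← wdeg_append, wdeg_perm h]
    simp only [this]
    rw [ih (fun a' a'' c => (deg v * wdeg deg a').negOnePow •
          (deg v * wdeg deg a'').negOnePow • f a' a'' (v :: c))]
    simp only [unshSum_smul]

/-- Cocommutativity: exchange `S` with its complement, at the cost of the Koszul sign of the two
halves. -/
theorem unshSum_comm (l : List H) (f : List H → List H → N) :
    unshSum deg l f =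
      unshSum deg l fun a c => (wdeg deg a * wdeg deg c).negOnePow • f c a := by
  induction l generalizing f with
  | nil => simp
  | cons v l ih =>
    simp only [unshSum_cons]
    rw [add_comm, ih (fun a c => f (v :: a) c)]
    congr 1
    · rw [ih]
      refine unshSum_congr fun a c _ => ?_
      rw [smul_smul, ← Int.negOnePow_add, wdeg_cons]
      congr 2; ring
    · refine unshSum_congr fun a c _ => ?_
      rw [smul_smul, ← Int.negOnePow_add]
      congr 1
      refine negOnePow_congr ?_
      simp only [wdeg_cons]
      refine ⟨-(deg v * wdeg deg a), by ring⟩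

/-- Compatibility of a sum over unshuffles with a transposition of two letters. -/
theorem unshSum_swap (x y : H) (l₁ l₂ : List H) (f : List H → List H → N)
    (h1 : ∀ m₁ m₂ c, (m₁ ++ m₂ ++ c).Perm (l₁ ++ l₂) → f (m₁ ++ x :: y :: m₂) c =
      (deg x * deg y).negOnePow • f (m₁ ++ y :: x :: m₂) c)
    (h2 : ∀ a m₁ m₂, (a ++ (m₁ ++ m₂)).Perm (l₁ ++ l₂) → f a (m₁ ++ x :: y :: m₂) =
      (deg x * deg y).negOnePow • f a (m₁ ++ y :: x :: m₂)) :
    unshSum deg (l₁ ++ x :: y :: l₂) f =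
      (deg x * deg y).negOnePow • unshSum deg (l₁ ++ y :: x :: l₂) f := by
  induction l₁ generalizing f with
  | nil =>
    simp only [List.nil_append, unshSum_cons, smul_add, ← unshSum_smul, smul_smul,
      ← Int.negOnePow_add, wdeg_cons]
    -- Four terms, according to the halves that receive `x` and `y`. If both lie in one half, `h1`
    -- or `h2` applies; the two mixed terms are those of the other side in the opposite order.
    refine (congrArg₂ _ (congrArg₂ _
      (unshSum_congr (g := fun a c => (deg x * deg y).negOnePow • f (y :: x :: a) c)
        fun a c hp => h1 [] a c hp)
      (unshSum_congr (g := fun a c =>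
        (deg x * deg y + deg y * (deg x + wdeg deg a)).negOnePow • f (x :: a) (y :: c))
        fun a c hp => ?_)) (congrArg₂ _
      (unshSum_congr (g := fun a c =>
        (deg x * deg y + deg x * wdeg deg a).negOnePow • f (y :: a) (x :: c)) fun a c hp => ?_)
      (unshSum_congr (g := fun a c =>
        (deg x * deg y + (deg x * wdeg deg a + deg y * wdeg deg a)).negOnePow • f a (y :: x :: c))
        fun a c hp => ?_))).trans (by simp only [List.nil_append]; abel)
    · congr 1
      exact negOnePow_congr ⟨-(deg x * deg y), by ring⟩
    · congr 2; ring
    · rw [show f a (x :: y :: c) = _ from h2 a [] c hp, smul_smul, ← Int.negOnePow_add]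
      simp only [List.nil_append]
      congr 2; ring
  | cons v l₁ ih =>
    simp only [List.cons_append, unshSum_cons, smul_add]
    congr 1
    · refine ih _ (fun m₁ m₂ c hp => ?_) fun a m₁ m₂ hp => ?_
      · exact h1 (v :: m₁) m₂ c (by simpa using hp)
      · exact h2 (v :: a) m₁ m₂ (by simpa using hp)
    · refine ih _ (fun m₁ m₂ c hp => ?_) fun a m₁ m₂ hp => ?_
      · rw [h1 m₁ m₂ (v :: c) ?_, smul_comm]
        · simp [add_left_comm]
        · exact List.perm_middle.trans (by simpa using hp)
      · rw [show v :: (m₁ ++ x :: y :: m₂) = (v :: m₁) ++ x :: y :: m₂ from rfl,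
          h2 a (v :: m₁) m₂ ?_, smul_comm]
        · rfl
        · exact List.perm_middle.trans (by simpa using hp)

/-- Only the term with `S = ∅`. -/
theorem unshSum_left_nil (l : List H) (k : List H → N) :
    unshSum deg l (fun a c => if a = [] then k c else 0) = k l := by
  induction l generalizing k with
  | nil => simp
  | cons v l ih =>
    simp only [unshSum_cons, List.cons_ne_nil, if_false, unshSum_zero, zero_add]
    rw [← ih (fun c => k (v :: c))]
    refine unshSum_congr fun a c _ => ?_
    by_cases h : a = [] <;> simp [h]

end Unshuffles

/-! ### Graded symmetric cochains and odd vector fields -/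

section Cochains

set_option linter.unusedSectionVars false

variable {R : Type*} [Ring R] [Algebra ℝ R] (𝓡 : ℤ → Submodule ℝ R)
  {H : Type*} (deg : H → ℤ) (Rel : ℤ → ℤ → R → R → H → H → H → Prop) (Adm : List H → Prop)

/-- Graded symmetric functions of degree `p` on the admissible words in `H`, which are linear with
respect to the relations `z = r x + s y`, `|r| = a`, `|s| = b`, given by `Rel a b r s z x y`. -/
structure IsCochain (p : ℤ) (F : List H → R) : Prop where
  zero : ∀ l, ¬ Adm l → F l = 0
  mem : ∀ l, F l ∈ 𝓡 (p + wdeg deg l)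
  lin : ∀ {a b : ℤ} {r s : R} {x y z : H} {l : List H}, r ∈ 𝓡 a → s ∈ 𝓡 b → Rel a b r s z x y →
    Adm (x :: l) → Adm (y :: l) →
    F (z :: l) = (a * p).negOnePow • (r * F (x :: l)) + (b * p).negOnePow • (s * F (y :: l))
  swap : ∀ (x y : H) (l₁ l₂), F (l₁ ++ x :: y :: l₂) =
    (deg x * deg y).negOnePow • F (l₁ ++ y :: x :: l₂)

/-- The sum of `F(w, c)` over the terms `w` of the bracket of `a`. -/
def brSum (b : List H → List H) (F : List H → R) (a c : List H) : R :=
  ((b a).map fun w => F (w :: c)).sum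

/-- The action of the vector field with Taylor coefficients `b`. -/
def vf (b : List H → List H) (F : List H → R) (l : List H) : R := unshSum deg l (brSum b F)

/-- The conditions on the set of admissible words and on the relations. -/
structure Admissible : Prop where
  perm : ∀ {l l'}, l.Perm l' → Adm l → Adm l'
  rel_deg : ∀ {a b : ℤ} {r s : R} {x y z : H}, Rel a b r s z x y →
    deg z = a + deg x ∧ deg z = b + deg y
  rel : ∀ {a b : ℤ} {r s : R} {x y z : H} {l : List H}, Rel a b r s z x y → Adm (x :: l) →
    Adm (y :: l) → Adm (z :: l)

/-- `b` lists the terms of graded symmetric operations of degree `e`. -/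
structure IsVectorField (e : ℤ) (b : List H → List H) : Prop where
  deg_eq : ∀ {a w}, w ∈ b a → deg w = wdeg deg a + e
  adm : ∀ {a c w}, w ∈ b a → Adm (a ++ c) → Adm (w :: c)
  swap : ∀ {p F}, IsCochain 𝓡 deg Rel Adm p F → ∀ x y l₁ l₂ c, Adm (l₁ ++ x :: y :: l₂ ++ c) →
    brSum b F (l₁ ++ x :: y :: l₂) c = (deg x * deg y).negOnePow • brSum b F (l₁ ++ y :: x :: l₂) c

variable {𝓡 deg Rel Adm}

theorem units_smul_mem {p : Submodule ℝ R} (u : ℤˣ) {x : R} (h : x ∈ p) : u • x ∈ p := by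
  rcases Int.units_eq_one_or u with rfl | rfl
  · simpa using h
  · simpa using h

theorem map_units_smul' {M N : Type*} [AddCommGroup M] [AddCommGroup N] [Module ℝ M] [Module ℝ N]
    (f : M →ₗ[ℝ] N) (u : ℤˣ) (x : M) : f (u • x) = u • f x := by
  rw [Units.smul_def, map_zsmul, Units.smul_def]

theorem unshSum_mem {p : Submodule ℝ R} {l : List H} {f : List H → List H → R}
    (h : ∀ a c, (a ++ c).Perm l → f a c ∈ p) : unshSum deg l f ∈ p := by
  refine list_sum_mem fun x hx => ?_
  obtain ⟨u, hu, rfl⟩ := List.mem_map.1 hx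
  exact units_smul_mem _ (h _ _ (perm_of_mem_unshuffles hu))

theorem list_sum_units_smul {α N : Type*} [AddCommGroup N] (u : ℤˣ) (m : List α) (f : α → N) :
    (m.map fun x => u • f x).sum = u • (m.map f).sum := by
  induction m with
  | nil => simp
  | cons x m ih => simp [ih, smul_add]

theorem brSum_smul (u : ℤˣ) (b : List H → List H) (F : List H → R) (a c : List H) :
    ((b a).map fun w => u • F (w :: c)).sum = u • brSum b F a c :=
  list_sum_units_smul ..

theorem brSum_congr {b : List H → List H} {F G : List H → R} {a c : List H}
    (h : ∀ w ∈ b a, F (w :: c) = G (w :: c)) : brSum b F a c = brSum b G a c := by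
  unfold brSum
  rw [List.map_congr_left h]

theorem brSum_eq_zero {b : List H → List H} {F : List H → R} {a c : List H}
    (h : ∀ w ∈ b a, F (w :: c) = 0) : brSum b F a c = 0 :=
  List.sum_eq_zero fun x hx => by
    obtain ⟨w, hw, rfl⟩ := List.mem_map.1 hx
    exact h w hw

theorem brSum_mem {p : Submodule ℝ R} {b : List H → List H} {F : List H → R} {a c : List H}
    (h : ∀ w ∈ b a, F (w :: c) ∈ p) : brSum b F a c ∈ p :=
  list_sum_mem fun x hx => by
    obtain ⟨w, hw, rfl⟩ := List.mem_map.1 hx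
    exact h w hw

theorem brSum_add (b : List H → List H) (F G : List H → R) (a c : List H) :
    brSum b (F + G) a c = brSum b F a c + brSum b G a c := by
  simp [brSum, List.sum_map_add]

theorem brSum_map (φ : R →ₗ[ℝ] R) (b : List H → List H) (F : List H → R) (a c : List H) :
    brSum b (fun l => φ (F l)) a c = φ (brSum b F a c) := by
  simp [brSum, map_list_sum, Function.comp_def]

theorem vf_congr {b : List H → List H} {F G : List H → R} {l : List H}
    (h : ∀ a c w, (a ++ c).Perm l → w ∈ b a → F (w :: c) = G (w :: c)) :
    vf deg b F l = vf deg b G l :=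
  unshSum_congr fun a c hp => brSum_congr fun w hw => h a c w hp hw

theorem vf_add (b : List H → List H) (F G : List H → R) (l : List H) :
    vf deg b (F + G) l = vf deg b F l + vf deg b G l := by
  simp only [vf, ← unshSum_add]
  exact unshSum_congr fun a c _ => brSum_add ..

theorem vf_smul (u : ℤˣ) (b : List H → List H) (F : List H → R) (l : List H) :
    vf deg b (u • F) l = u • vf deg b F l := by
  simp only [vf, ← unshSum_smul]
  exact unshSum_congr fun a c _ => brSum_smul ..

theorem vf_map (φ : R →ₗ[ℝ] R) (b : List H → List H) (F : List H → R) (l : List H) :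
    vf deg b (fun l => φ (F l)) l = φ (vf deg b F l) := by
  rw [vf, vf, ← LinearMap.toAddMonoidHom_coe, map_unshSum]
  exact unshSum_congr fun a c _ => brSum_map ..

theorem ceDiff_apply (dR : R →ₗ[ℝ] R) (b : List H → List H) (p : ℤ) (F : List H → R) {l : List H}
    (h : Adm l) : ceDiff dR deg b Adm p F l = dR (F l) - p.negOnePow • vf deg b F l := by
  simp [ceDiff, h, vf, unshSum, brSum]

theorem ceDiff_of_not (dR : R →ₗ[ℝ] R) (b : List H → List H) (p : ℤ) (F : List H → R)
    {l : List H} (h : ¬ Adm l) : ceDiff dR deg b Adm p F l = 0 := by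
  simp [ceDiff, h]

theorem IsVectorField.adm' {e : ℤ} {b : List H → List H} (hA : Admissible deg Rel Adm)
    (hb : IsVectorField 𝓡 deg Rel Adm e b) {l a c : List H} {w : H} (hl : Adm l)
    (hp : (a ++ c).Perm l) (hw : w ∈ b a) : Adm (w :: c) :=
  hb.adm hw (hA.perm hp.symm hl)

theorem IsVectorField.vf_mem {e p : ℤ} {b : List H → List H} {F : List H → R}
    (hb : IsVectorField 𝓡 deg Rel Adm e b) (hF : IsCochain 𝓡 deg Rel Adm p F) (l : List H) :
    vf deg b F l ∈ 𝓡 (p + e + wdeg deg l) := by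
  refine unshSum_mem fun a c hp => brSum_mem fun w hw => ?_
  have := hF.mem (w :: c)
  rwa [wdeg_cons, hb.deg_eq hw, show p + (wdeg deg a + e + wdeg deg c) =
    p + e + wdeg deg (a ++ c) by rw [wdeg_append]; ring, wdeg_perm hp] at this

theorem IsVectorField.vf_swap {e p : ℤ} {b : List H → List H} {F : List H → R}
    (hA : Admissible deg Rel Adm)
    (hb : IsVectorField 𝓡 deg Rel Adm e b) (hF : IsCochain 𝓡 deg Rel Adm p F) (x y : H)
    (l₁ l₂ : List H) (h : Adm (l₁ ++ x :: y :: l₂)) :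
    vf deg b F (l₁ ++ x :: y :: l₂) =
      (deg x * deg y).negOnePow • vf deg b F (l₁ ++ y :: x :: l₂) := by
  refine unshSum_swap x y l₁ l₂ _ (fun m₁ m₂ c hp => ?_) fun a m₁ m₂ hp => ?_
  · refine hb.swap hF x y m₁ m₂ c (hA.perm ?_ h)
    calc l₁ ++ x :: y :: l₂ |>.Perm (x :: y :: (l₁ ++ l₂)) :=
          List.perm_middle.trans (List.Perm.cons _ List.perm_middle)
      _ |>.Perm (x :: y :: (m₁ ++ m₂ ++ c)) := ((hp.symm.cons _).cons _)
      _ |>.Perm (m₁ ++ x :: y :: m₂ ++ c) := by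
          rw [List.append_assoc, List.append_assoc]
          exact (List.perm_middle.trans (List.Perm.cons _ List.perm_middle)).symm
  · rw [brSum, brSum, ← list_sum_units_smul]
    congr 1
    refine List.map_congr_left fun w _ => ?_
    exact hF.swap x y (w :: m₁) m₂

theorem smul_mul_smul_aux (u v : ℤˣ) (r x : R) : u • (r * (v • x)) = (u * v) • (r * x) := by
  rw [mul_smul_comm, smul_smul]

/-- The function `k` records the failure of linearity of the unary bracket. It contributes only when
the distinguished letter is alone in the bracket, whence the case `a = []` and the single term `k
l`. -/
theorem IsVectorField.vf_lin {e p : ℤ} {b : List H → List H} {F : List H → R}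
    (hA : Admissible deg Rel Adm)
    (hb : IsVectorField 𝓡 deg Rel Adm e b) (hF : IsCochain 𝓡 deg Rel Adm p F)
    {i j : ℤ} {r s : R} {x y z : H} {l : List H} (hr : r ∈ 𝓡 i) (hs : s ∈ 𝓡 j)
    (hz : Rel i j r s z x y) (hx : Adm (x :: l)) (hy : Adm (y :: l)) (k : List H → R)
    (hk : ∀ a c, (a ++ c).Perm l → brSum b F (z :: a) c =
      (i * (p + e)).negOnePow • (r * brSum b F (x :: a) c) +
      (j * (p + e)).negOnePow • (s * brSum b F (y :: a) c) + if a = [] then k c else 0) :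
    vf deg b F (z :: l) = (i * (p + e)).negOnePow • (r * vf deg b F (x :: l)) +
      (j * (p + e)).negOnePow • (s * vf deg b F (y :: l)) + k l := by
  obtain ⟨hdx, hdy⟩ := hA.rel_deg hz
  have hmul : ∀ (t : R) (u : ℤˣ) (f : List H → List H → R) (l : List H),
      u • (t * unshSum deg l f) = unshSum deg l fun a c => u • (t * f a c) := by
    intro t u f l
    rw [← AddMonoidHom.coe_mulLeft, map_unshSum, ← unshSum_smul]
  -- When the distinguished letter stays outside the bracket it is moved in front of the bracket
  -- term `w`, linearity of `F` is used there, and it is moved back. The degree `e` of the bracket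
  -- turns `p` into `p + e`.
  have h2 : ∀ a c, (a ++ c).Perm l → (deg z * wdeg deg a).negOnePow • brSum b F a (z :: c) =
      (i * (p + e)).negOnePow • (r * ((deg x * wdeg deg a).negOnePow • brSum b F a (x :: c))) +
      (j * (p + e)).negOnePow •
        (s * ((deg y * wdeg deg a).negOnePow • brSum b F a (y :: c))) := by
    intro a c hp
    have hw : ∀ w ∈ b a, F (w :: z :: c) =
        (i * (p + wdeg deg a + e)).negOnePow • (r * F (w :: x :: c)) +
        (j * (p + wdeg deg a + e)).negOnePow • (s * F (w :: y :: c)) := by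
      intro w hw
      have hax : ∀ v : H, Adm (v :: l) → Adm (v :: w :: c) := fun v hv =>
        hA.perm (List.Perm.swap _ _ _) (hb.adm hw
          (hA.perm ((hp.symm.cons v).trans List.perm_middle.symm) hv) : Adm (w :: v :: c))
      have e1 := hF.swap w z [] c
      have e2 := hF.swap w x [] c
      have e3 := hF.swap w y [] c
      simp only [List.nil_append] at e1 e2 e3
      rw [e1, e2, e3, hF.lin hr hs hz (hax x hx) (hax y hy), smul_add, smul_mul_smul_aux,
        smul_mul_smul_aux, smul_smul, smul_smul, ← Int.negOnePow_add, ← Int.negOnePow_add,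
        ← Int.negOnePow_add, ← Int.negOnePow_add, hb.deg_eq hw]
      congr 1
      · congr 1
        refine negOnePow_congr ⟨0, ?_⟩
        rw [hdx]; ring
      · congr 1
        refine negOnePow_congr ⟨0, ?_⟩
        rw [hdy]; ring
    have : brSum b F a (z :: c) = (i * (p + wdeg deg a + e)).negOnePow • (r * brSum b F a (x :: c)) +
        (j * (p + wdeg deg a + e)).negOnePow • (s * brSum b F a (y :: c)) := by
      simp only [brSum, List.map_congr_left hw, List.sum_map_add, ← List.sum_map_mul_left,
        list_sum_units_smul]
    rw [this, smul_add, smul_mul_smul_aux, smul_mul_smul_aux, smul_smul, smul_smul,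
        ← Int.negOnePow_add, ← Int.negOnePow_add, ← Int.negOnePow_add, ← Int.negOnePow_add]
    congr 1
    · congr 1
      refine negOnePow_congr ⟨i * wdeg deg a, ?_⟩
      rw [hdx]; ring
    · congr 1
      refine negOnePow_congr ⟨j * wdeg deg a, ?_⟩
      rw [hdy]; ring
  simp only [vf, unshSum_cons, mul_add r, mul_add s, smul_add, hmul]
  rw [unshSum_congr hk, unshSum_congr h2]
  simp only [unshSum_add, unshSum_left_nil]
  generalize (i * (p + e)).negOnePow = u, (j * (p + e)).negOnePow = v
  abel

/-- Linearity over `R` survives because the two failures cancel: `d_R (r F)` produces `(d_R r) F` by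
the Leibniz rule, and the unary bracket, a derivation over `d_R`, produces the same term, which is
the inhomogeneous term of `hlin`. -/
theorem IsVectorField.ceDiff_mem {p : ℤ} {b : List H → List H} {F : List H → R}
    {dR : R →ₗ[ℝ] R} (hR : IsCDGA 𝓡 dR) (hA : Admissible deg Rel Adm)
    (hb : IsVectorField 𝓡 deg Rel Adm 1 b) (hF : IsCochain 𝓡 deg Rel Adm p F)
    (hlin : ∀ {i j : ℤ} {r s : R} {x y z : H} {a c : List H}, r ∈ 𝓡 i → s ∈ 𝓡 j →
      Rel i j r s z x y → Adm (x :: (a ++ c)) → Adm (y :: (a ++ c)) → brSum b F (z :: a) c =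
      (i * (p + 1)).negOnePow • (r * brSum b F (x :: a) c) +
      (j * (p + 1)).negOnePow • (s * brSum b F (y :: a) c) + if a = [] then
      p.negOnePow • ((i * p).negOnePow • (dR r * F (x :: c)) +
        (j * p).negOnePow • (dR s * F (y :: c))) else 0) :
    IsCochain 𝓡 deg Rel Adm (p + 1) (ceDiff dR deg b Adm p F) where
  zero l h := ceDiff_of_not _ _ _ _ h
  mem l := by
    by_cases h : Adm l
    · rw [ceDiff_apply _ _ _ _ h]
      refine sub_mem ?_ (units_smul_mem _ (hb.vf_mem hF l))
      rw [add_right_comm]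
      exact hR.d_mem _ _ (hF.mem l)
    · rw [ceDiff_of_not _ _ _ _ h]; exact zero_mem _
  lin := by
    intro i j r s x y z l hr hs hz hx hy
    rw [ceDiff_apply _ _ _ _ hx, ceDiff_apply _ _ _ _ hy,
      ceDiff_apply _ _ _ _ (hA.rel hz hx hy), hF.lin hr hs hz hx hy,
      hb.vf_lin hA hF hr hs hz hx hy _ fun a c hp => hlin hr hs hz
        (hA.perm (hp.symm.cons x) hx) (hA.perm (hp.symm.cons y) hy),
      map_add, map_units_smul', map_units_smul', hR.leibniz i r _ hr, hR.leibniz j s _ hs]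
    simp only [smul_add, mul_sub, smul_sub, smul_smul, mul_smul_comm, ← Int.negOnePow_add]
    rw [mul_add, mul_add, mul_one, mul_one]
    have e1 : ∀ i : ℤ, (p + (i * p + i)).negOnePow = (i * p + i + p).negOnePow := by
      intro i; rw [add_comm]
    have e2 : ∀ i : ℤ, (p + (p + i * p)).negOnePow = (i * p).negOnePow := fun i =>
      negOnePow_congr ⟨p, by ring⟩
    simp only [e1, e2]
    generalize (i * p).negOnePow = u1, (j * p).negOnePow = u2, (i * p + i).negOnePow = u3,
      (j * p + j).negOnePow = u4, (i * p + i + p).negOnePow = u5, (j * p + j + p).negOnePow = u6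
    abel
  swap x y l₁ l₂ := by
    have hperm : (l₁ ++ x :: y :: l₂).Perm (l₁ ++ y :: x :: l₂) :=
      (List.Perm.swap y x l₂).append_left l₁
    by_cases h : Adm (l₁ ++ x :: y :: l₂)
    · rw [ceDiff_apply _ _ _ _ h, ceDiff_apply _ _ _ _ (hA.perm hperm h), hF.swap,
        hb.vf_swap hA hF _ _ _ _ h, map_units_smul', smul_sub, smul_comm p.negOnePow]
    · rw [ceDiff_of_not _ _ _ _ h,
        ceDiff_of_not _ _ _ _ fun h' => h (hA.perm hperm.symm h'), smul_zero]

theorem eq_zero_of_eq_neg' {x : R} (h : x = -x) : x = 0 := by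
  have h2 : (2 : ℝ) • x = 0 := by rw [two_smul]; nth_rewrite 1 [h]; simp
  exact (smul_eq_zero_iff_right two_ne_zero).1 h2

theorem list_sum_sum_comm {α β : Type*} (m : List α) (n : List β) (f : α → β → R) :
    (m.map fun x => (n.map fun y => f x y).sum).sum =
      (n.map fun y => (m.map fun x => f x y).sum).sum := by
  induction m with
  | nil => simp
  | cons a m ih => simp [ih, List.sum_map_add]

/-- The square of an odd vector field only involves the nested brackets. -/
theorem IsVectorField.vf_vf {p : ℤ} {b : List H → List H} {F : List H → R}
    (hb : IsVectorField 𝓡 deg Rel Adm 1 b) (hF : IsCochain 𝓡 deg Rel Adm p F) (l : List H) :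
    vf deg b (vf deg b F) l = unshSum deg l fun A c => unshSum deg A fun a a' =>
      ((b a).map fun w => brSum b F (w :: a') c).sum := by
  -- The terms with two brackets of disjoint subwords `a` and `a'`. Both bracket letters are odd
  -- relative to their arguments, so exchanging the subwords reverses the sign and the sum equals
  -- its own negative.
  let T : List H → List H → List H → R := fun a a' c =>
    ((b a).map fun w => brSum b F a' (w :: c)).sum
  have hT : ∀ A c, unshSum deg A (fun a a' =>
      ((wdeg deg a + 1) * wdeg deg a').negOnePow • T a a' c) = 0 := by
    intro A c
    refine eq_zero_of_eq_neg' ?_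
    conv_lhs => rw [unshSum_comm]
    rw [show ∀ x : R, -x = (-1 : ℤˣ) • x by simp, ← unshSum_smul]
    refine unshSum_congr fun a a' _ => ?_
    have : T a' a c = ((wdeg deg a + 1) * (wdeg deg a' + 1)).negOnePow • T a a' c := by
      simp only [T, brSum]
      rw [list_sum_sum_comm]
      rw [← list_sum_units_smul]
      congr 1
      refine List.map_congr_left fun w hw => ?_
      rw [← list_sum_units_smul]
      congr 1
      refine List.map_congr_left fun w' hw' => ?_
      have := hF.swap w w' [] c
      rw [hb.deg_eq hw, hb.deg_eq hw'] at this
      exact this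
    rw [this, smul_smul, smul_smul, smul_smul, ← Int.negOnePow_one, ← Int.negOnePow_add,
      ← Int.negOnePow_add, ← Int.negOnePow_add]
    congr 1
    refine negOnePow_congr ⟨wdeg deg a * wdeg deg a' + wdeg deg a, by ring⟩
  -- The letter `w` created by the first bracket either enters the second bracket, giving a nested
  -- term, or stays outside, giving a term of type `T`.
  have h1 : ∀ a c, brSum b (vf deg b F) a c = (unshSum deg c fun a' c' =>
      ((b a).map fun w => brSum b F (w :: a') c').sum) + unshSum deg c fun a' c' =>
      ((wdeg deg a + 1) * wdeg deg a').negOnePow • T a a' c' := by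
    intro a c
    have : ∀ w ∈ b a, vf deg b F (w :: c) = (unshSum deg c fun a' c' => brSum b F (w :: a') c') +
        unshSum deg c fun a' c' =>
          ((wdeg deg a + 1) * wdeg deg a').negOnePow • brSum b F a' (w :: c') := by
      intro w hw
      rw [vf, unshSum_cons, hb.deg_eq hw]
    rw [brSum, List.map_congr_left this, List.sum_map_add]
    have hs : ∀ f : H → List H → List H → R, ((b a).map fun w => unshSum deg c (f w)).sum =
        unshSum deg c fun a' c' => ((b a).map fun w => f w a' c').sum := by
      intro f
      induction b a with
      | nil => simp [unshSum_zero]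
      | cons w m ih => simp [ih, unshSum_add]
    rw [hs, hs]
    congr 1
    refine unshSum_congr fun a' c' _ => ?_
    exact list_sum_units_smul ..
  have h2 : vf deg b (vf deg b F) l = unshSum deg l (fun a c => unshSum deg c fun a' c' =>
      ((b a).map fun w => brSum b F (w :: a') c').sum) + unshSum deg l fun a c =>
      unshSum deg c fun a' c' => ((wdeg deg a + 1) * wdeg deg a').negOnePow • T a a' c' := by
    rw [← unshSum_add]
    exact unshSum_congr fun a c _ => h1 a c
  rw [h2, ← unshSum_assoc, ← unshSum_assoc,
    unshSum_eq_zero (f := fun a c => unshSum deg a fun a' a'' =>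
      ((wdeg deg a' + 1) * wdeg deg a'').negOnePow • T a' a'' c) fun a c _ => hT a c, add_zero]

/-- The mixed terms in `d_R` and the vector field cancel because the sign in front of the vector
field alternates with `p`; `d_R² = 0`, and the square of the vector field is the sum of nested
brackets. -/
theorem IsVectorField.ceDiff_ceDiff {p : ℤ} {b : List H → List H} {F : List H → R}
    {dR : R →ₗ[ℝ] R} (hR : IsCDGA 𝓡 dR) (hA : Admissible deg Rel Adm)
    (hb : IsVectorField 𝓡 deg Rel Adm 1 b) (hF : IsCochain 𝓡 deg Rel Adm p F)
    (hjac : ∀ A c, Adm (A ++ c) → (unshSum deg A fun a a' =>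
      ((b a).map fun w => brSum b F (w :: a') c).sum) = 0) :
    ceDiff dR deg b Adm (p + 1) (ceDiff dR deg b Adm p F) = 0 := by
  funext l
  by_cases h : Adm l
  · have e1 : vf deg b (ceDiff dR deg b Adm p F) l =
        vf deg b ((fun l => dR (F l)) + (-p.negOnePow) • vf deg b F) l :=
      vf_congr fun a c w hp hw => by
        rw [ceDiff_apply _ _ _ _ (hb.adm' hA h hp hw)]
        simp [sub_eq_add_neg]
    have e2 : vf deg b (vf deg b F) l = 0 := by
      rw [hb.vf_vf hF]
      exact unshSum_eq_zero fun A c hp => hjac A c (hA.perm hp.symm h)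
    rw [ceDiff_apply _ _ _ _ h, ceDiff_apply _ _ _ _ h, e1, vf_add, vf_smul, e2, vf_map, map_sub,
      hR.d_d, map_units_smul', Int.negOnePow_succ]
    simp
  · rw [ceDiff_of_not _ _ _ _ h]; rfl

end Cochains

/-! ### The Chevalley–Eilenberg complex -/

section CE

set_option linter.unusedSectionVars false

variable {R : Type} [Ring R] [Algebra ℝ R] {𝓡 : ℤ → Submodule ℝ R} [GradedAlgebra 𝓡]
  {dR : R →ₗ[ℝ] R} {I : Ideal R}
  {V : Type} [AddCommGroup V] [Module ℝ V] [Module R V] {𝓥 : ℤ → Submodule ℝ V}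

theorem Homog.ext' {M : Type*} [AddCommGroup M] [Module ℝ M] {𝓜 : ℤ → Submodule ℝ M}
    {x y : Homog 𝓜} (h : x.deg = y.deg) (h' : x.val = y.val) : x = y := by
  cases x; cases y; cases h; cases h'; rfl

/-- The relation `z = r x + s y` between homogeneous elements of a graded module. -/
structure ModRel (a b : ℤ) (r s : R) (z x y : Homog 𝓥) : Prop where
  deg_left : z.deg = a + x.deg
  deg_right : z.deg = b + y.deg
  val : z.val = r • x.val + s • y.val

theorem admissible_ne_nil :
    Admissible (R := R) (Homog.deg (𝓜 := 𝓥)) ModRel (fun l => l ≠ []) where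
  perm h h' := fun h0 => h' (by subst h0; exact h.eq_nil)
  rel_deg h := ⟨h.deg_left, h.deg_right⟩
  rel _ _ _ := List.cons_ne_nil _ _

theorem algebraMap_mem_zero (c : ℝ) : algebraMap ℝ R c ∈ 𝓡 0 := by
  rw [Algebra.algebraMap_eq_smul_one]
  exact Submodule.smul_mem _ _ SetLike.GradedOne.one_mem

section

variable [SetLike.GradedSMul 𝓡 𝓥]

theorem homog_smul_mem {a : ℤ} {r : R} (hr : r ∈ 𝓡 a) {n : ℤ} {x : Homog 𝓥}
    (h : n = a + x.deg) : r • x.val ∈ 𝓥 n := by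
  rw [h]
  exact SetLike.GradedSMul.smul_mem hr x.mem

/-- The single relation `z = r x + s y` encodes additivity (`r = s = 1`) and homogeneity (`s = 0`),
so the general results on vector fields need one linearity axiom only. -/
theorem mem_reducedCochains_iff {p : ℤ} {F : List (Homog 𝓥) → R} :
    F ∈ reducedCochains 𝓡 𝓥 p ↔ IsCochain 𝓡 Homog.deg ModRel (fun l => l ≠ []) p F := by
  constructor
  · intro (h : IsReducedCochain 𝓡 𝓥 p F)
    refine ⟨fun l hl => ?_, h.mem, fun {a b r s x y z l} hr hs hz _ _ => ?_, h.swap⟩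
    · rw [not_not.1 hl, h.nil]
    · rw [h.add ⟨z.deg, r • x.val, homog_smul_mem hr hz.deg_left⟩
        ⟨z.deg, s • y.val, homog_smul_mem hs hz.deg_right⟩ z l rfl rfl hz.val,
        h.smul a r hr x ⟨z.deg, r • x.val, homog_smul_mem hr hz.deg_left⟩ l
          hz.deg_left rfl, h.smul b s hs y ⟨z.deg, s • y.val, homog_smul_mem hs hz.deg_right⟩ l
          hz.deg_right rfl]
  · intro h
    refine (⟨h.zero [] (by simp), h.mem, fun x y z l h1 h2 h3 => ?_,
      fun a r hr x z l h1 h2 => ?_, h.swap⟩ : IsReducedCochain 𝓡 𝓥 p F)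
    · have := h.lin (a := 0) (b := 0) (r := 1) (s := 1) (x := x) (y := y) (z := z) (l := l)
        SetLike.GradedOne.one_mem SetLike.GradedOne.one_mem
        ⟨by omega, by omega, by rw [h3, one_smul, one_smul]⟩ (by simp) (by simp)
      simpa using this
    · have := h.lin (a := a) (b := a) (r := r) (s := 0) (x := x) (y := x) (z := z) (l := l)
        hr (zero_mem _) ⟨h1, h1, by rw [h2, zero_smul, add_zero]⟩ (by simp) (by simp)
      simpa using this

variable [IsScalarTower ℝ R V]

/-- The first argument of a cochain extends to a linear map. -/
theorem exists_linear_first {p : ℤ} {F : List (Homog 𝓥) → R} (hF : F ∈ reducedCochains 𝓡 𝓥 p)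
    (n : ℤ) (c : List (Homog 𝓥)) : ∃ φ : V →ₗ[ℝ] R,
      (∀ w : Homog 𝓥, w.deg = n → F (w :: c) = φ w.val) ∧
      ∀ (a : ℤ) (r : R), r ∈ 𝓡 a → ∀ x : Homog 𝓥, n = a + x.deg →
        φ (r • x.val) = (a * p).negOnePow • (r * F (x :: c)) := by
  replace hF : IsReducedCochain 𝓡 𝓥 p F := hF
  let f : 𝓥 n →ₗ[ℝ] R :=
    { toFun := fun v => F (⟨n, v.1, v.2⟩ :: c)
      map_add' := fun v w => hF.add _ _ _ _ rfl rfl rfl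
      map_smul' := fun t v => by
        have := hF.smul 0 (algebraMap ℝ R t) (algebraMap_mem_zero t) ⟨n, v.1, v.2⟩
          ⟨n, (t • v).1, (t • v).2⟩ c (by simp) (by simp)
        simpa [Algebra.smul_def] using this }
  -- Only the values on degree `n` are prescribed; the extension elsewhere is arbitrary. It serves
  -- to apply `F` to linear identities between brackets.
  obtain ⟨φ, hφ⟩ := f.exists_extend
  have h1 : ∀ w : Homog 𝓥, w.deg = n → F (w :: c) = φ w.val := by
    rintro ⟨m, w, hw⟩ rfl
    exact (LinearMap.congr_fun hφ ⟨w, hw⟩).symm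
  refine ⟨φ, h1, fun a r hr x h => ?_⟩
  rw [← hF.smul a r hr x ⟨n, r • x.val, homog_smul_mem hr h⟩ c h rfl, h1 _ rfl]

theorem CurvedLInfty.br_lin (𝔤 : CurvedLInfty 𝓡 dR I 𝓥) {a b : ℤ} {r s : R} {x y z : Homog 𝓥}
    (hr : r ∈ 𝓡 a) (hs : s ∈ 𝓡 b) (hz : ModRel a b r s z x y) (l : List (Homog 𝓥)) :
    𝔤.br (z :: l) = a.negOnePow • r • 𝔤.br (x :: l) + b.negOnePow • s • 𝔤.br (y :: l) +
      if l = [] then dR r • x.val + dR s • y.val else 0 := by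
  rw [𝔤.add ⟨z.deg, r • x.val, homog_smul_mem hr hz.deg_left⟩
        ⟨z.deg, s • y.val, homog_smul_mem hs hz.deg_right⟩ z l rfl rfl hz.val]
  by_cases h : l = []
  · subst h
    rw [𝔤.smul_one a r hr x ⟨z.deg, r • x.val, homog_smul_mem hr hz.deg_left⟩
      hz.deg_left rfl, 𝔤.smul_one b s hs y ⟨z.deg, s • y.val, homog_smul_mem hs hz.deg_right⟩
      hz.deg_right rfl, if_pos rfl]
    abel
  · rw [𝔤.smul a r hr x ⟨z.deg, r • x.val, homog_smul_mem hr hz.deg_left⟩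
      l h hz.deg_left rfl, 𝔤.smul b s hs y ⟨z.deg, s • y.val, homog_smul_mem hs hz.deg_right⟩
      l h hz.deg_right rfl, if_neg h,
      add_zero]

theorem CurvedLInfty.isVectorField (𝔤 : CurvedLInfty 𝓡 dR I 𝓥) :
    IsVectorField 𝓡 Homog.deg ModRel (fun l => l ≠ []) 1 fun l => [𝔤.brH l] where
  deg_eq := by
    intro a w hw
    rw [List.mem_singleton.1 hw]
    rfl
  adm _ _ := List.cons_ne_nil _ _
  swap := by
    intro p F hF x y l₁ l₂ c _
    obtain ⟨φ, h1, -⟩ := exists_linear_first (mem_reducedCochains_iff.2 hF)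
      (𝔤.brH (l₁ ++ x :: y :: l₂)).deg c
    have hd : (𝔤.brH (l₁ ++ y :: x :: l₂)).deg = (𝔤.brH (l₁ ++ x :: y :: l₂)).deg := by
      simp [brH]; ring
    simp only [brSum, List.map_cons, List.map_nil, List.sum_cons, List.sum_nil, add_zero]
    rw [h1 _ rfl, h1 _ hd, ← map_units_smul']
    exact congrArg φ (𝔤.swap x y l₁ l₂)

/-- Passing `r` through the bracket costs `(-1)^i` and through `F` costs `(-1)^(ip)`. The
coefficient `d_R r` has degree `i + 1`, and this accounts for the extra `(-1)^p` in the
inhomogeneous term. -/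
theorem CurvedLInfty.brSum_lin (𝔤 : CurvedLInfty 𝓡 dR I 𝓥) (hR : IsCDGA 𝓡 dR) {p : ℤ}
    {F : List (Homog 𝓥) → R} (hF : F ∈ reducedCochains 𝓡 𝓥 p) {i j : ℤ} {r s : R}
    {x y z : Homog 𝓥} (hr : r ∈ 𝓡 i) (hs : s ∈ 𝓡 j) (hz : ModRel i j r s z x y)
    (a c : List (Homog 𝓥)) : brSum (fun l => [𝔤.brH l]) F (z :: a) c =
      (i * (p + 1)).negOnePow • (r * brSum (fun l => [𝔤.brH l]) F (x :: a) c) +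
      (j * (p + 1)).negOnePow • (s * brSum (fun l => [𝔤.brH l]) F (y :: a) c) + if a = [] then
      p.negOnePow • ((i * p).negOnePow • (dR r * F (x :: c)) +
        (j * p).negOnePow • (dR s * F (y :: c))) else 0 := by
  obtain ⟨φ, h1, h2⟩ := exists_linear_first hF (𝔤.brH (z :: a)).deg c
  have hd : (𝔤.brH (z :: a)).deg = z.deg + wdeg Homog.deg a + 1 := by simp [brH, wdeg]
  have hdx : (𝔤.brH (x :: a)).deg = x.deg + wdeg Homog.deg a + 1 := by simp [brH, wdeg]
  have hdy : (𝔤.brH (y :: a)).deg = y.deg + wdeg Homog.deg a + 1 := by simp [brH, wdeg]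
  have e1 := hz.deg_left
  have e2 := hz.deg_right
  simp only [brSum, List.map_cons, List.map_nil, List.sum_cons, List.sum_nil, add_zero]
  rw [h1 _ rfl]
  change φ (𝔤.br (z :: a)) = _
  rw [𝔤.br_lin hr hs hz a, map_add, map_add, map_units_smul', map_units_smul']
  change _ • φ (r • (𝔤.brH (x :: a)).val) + _ • φ (s • (𝔤.brH (y :: a)).val) + _ = _
  rw [h2 i r hr _ (by omega), h2 j s hs _ (by omega), smul_smul, smul_smul, ← Int.negOnePow_add,
    ← Int.negOnePow_add, mul_add, mul_add, mul_one, mul_one, add_comm i, add_comm j]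
  congr 1
  by_cases h : a = []
  · subst h
    simp only [wdeg_nil] at hd
    rw [if_pos rfl, if_pos rfl, map_add, h2 (i + 1) (dR r) (hR.d_mem _ _ hr) x (by omega),
      h2 (j + 1) (dR s) (hR.d_mem _ _ hs) y (by omega), smul_add, smul_smul, smul_smul,
      ← Int.negOnePow_add, ← Int.negOnePow_add]
    congr 3 <;> ring
  · rw [if_neg h, if_neg h, map_zero]

theorem CurvedLInfty.jacobi_brSum (𝔤 : CurvedLInfty 𝓡 dR I 𝓥) {p : ℤ}
    {F : List (Homog 𝓥) → R} (hF : F ∈ reducedCochains 𝓡 𝓥 p) (A c : List (Homog 𝓥)) :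
    (unshSum Homog.deg A fun a a' => F (𝔤.brH (𝔤.brH a :: a') :: c)) = 0 := by
  obtain ⟨φ, h1, -⟩ := exists_linear_first hF (wdeg Homog.deg A + 2) c
  rw [unshSum_congr (g := fun a a' => φ.toAddMonoidHom (𝔤.br (𝔤.brH a :: a'))) fun a a' hp => ?_,
    ← map_unshSum]
  · have := 𝔤.jacobi A
    exact (congrArg φ this).trans (map_zero φ)
  · refine h1 _ ?_
    rw [← wdeg_perm hp]
    simp [brH, wdeg]
    ring

theorem isComplex_reducedCE (hR : IsCDGA 𝓡 dR) (𝔤 : CurvedLInfty 𝓡 dR I 𝓥) :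
    (reducedCE 𝔤).IsComplex where
  maps p F hF := mem_reducedCochains_iff.2 <|
    𝔤.isVectorField.ceDiff_mem hR admissible_ne_nil (mem_reducedCochains_iff.1 hF)
      fun hr hs hz _ _ => 𝔤.brSum_lin hR hF hr hs hz _ _
  sq p F hF := 𝔤.isVectorField.ceDiff_ceDiff hR admissible_ne_nil (mem_reducedCochains_iff.1 hF)
    fun A c _ => by simpa [brSum] using 𝔤.jacobi_brSum hF A c

end

end CE

/-! ### Operators acting on one letter at a time -/

section Slot

variable {H : Type*} {deg : H → ℤ} {N : Type*} [AddCommGroup N]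

/-- The list of terms of the operation that applies `σ` to words of length one. -/
def slotBr (σ : H → H) : List H → List H
  | [t] => [σ t]
  | _ => []

variable (deg) in
/-- The sum of `± F(v₁, …, σ vᵢ, …, vₙ)`, with the Koszul signs of an operation of degree `e`. -/
def slotSum (e : ℤ) (σ : H → H) : (List H → N) → List H → N
  | _, [] => 0
  | F, t :: l => F (σ t :: l) + (e * deg t).negOnePow • slotSum e σ (fun l' => F (t :: l')) l

theorem slotBr_append_cons_cons (σ : H → H) (x y : H) (l₁ l₂ : List H) :
    slotBr σ (l₁ ++ x :: y :: l₂) = [] := by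
  rcases l₁ with _ | ⟨a, _ | ⟨b, l⟩⟩ <;> rfl

theorem slotSum_congr {e : ℤ} {σ : H → H} {F G : List H → N} {l : List H}
    (h : ∀ l₁ t l₂, l = l₁ ++ t :: l₂ → F (l₁ ++ σ t :: l₂) = G (l₁ ++ σ t :: l₂)) :
    slotSum deg e σ F l = slotSum deg e σ G l := by
  induction l generalizing F G with
  | nil => rfl
  | cons t l ih =>
    simp only [slotSum]
    rw [ih (F := fun l' => F (t :: l')) (G := fun l' => G (t :: l')) fun l₁ s l₂ hl => h (t :: l₁) s l₂ (by simp [hl]), show F (σ t :: l) = G (σ t :: l) from h [] t l rfl]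

theorem slotSum_smul (e : ℤ) (σ : H → H) (u : ℤˣ) (F : List H → N) (l : List H) :
    slotSum deg e σ (fun l' => u • F l') l = u • slotSum deg e σ F l := by
  induction l generalizing F with
  | nil => simp [slotSum]
  | cons t l ih => simp only [slotSum, ih (fun l' => F (t :: l')), smul_add, smul_comm u]

theorem unshSum_right_nil (l : List H) (k : List H → N) :
    unshSum deg l (fun a c => if c = [] then k a else 0) = k l := by
  induction l generalizing k with
  | nil => simp
  | cons v l ih =>
    simp only [unshSum_cons, List.cons_ne_nil, if_false, smul_zero, unshSum_zero, add_zero]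
    exact ih (fun a => k (v :: a))

variable {R : Type*} [Ring R]

/-- In the vector field the chosen letter is first moved to the front and then transformed. Moving
the transformed letter back costs a sign that differs from the first by `e` times the degree of the
preceding letters, which is the sign in `slotSum`. -/
theorem vf_slotBr {e : ℤ} {σ : H → H} (hσ : ∀ t, deg (σ t) = deg t + e) {F : List H → R}
    (hF : ∀ x y l₁ l₂, F (l₁ ++ x :: y :: l₂) =
      (deg x * deg y).negOnePow • F (l₁ ++ y :: x :: l₂)) (l : List H) :
    vf deg (slotBr σ) F l = slotSum deg e σ F l := by
  induction l generalizing F with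
  | nil => simp [vf, slotSum, slotBr, brSum]
  | cons t l ih =>
    rw [vf, unshSum_cons, slotSum, ← ih (fun x y l₁ l₂ => hF x y (t :: l₁) l₂), vf, ← unshSum_smul]
    congr 1
    · rw [← unshSum_left_nil (deg := deg) l fun c => F (σ t :: c)]
      refine unshSum_congr fun a c _ => ?_
      rcases a with _ | ⟨s, a⟩
      · simp [brSum, slotBr]
      · simp [brSum, slotBr]
    · refine unshSum_congr fun a c _ => ?_
      rcases a with _ | ⟨s, _ | ⟨s', a⟩⟩
      · simp [brSum, slotBr]
      · simp only [brSum, slotBr, List.map_cons, List.map_nil, List.sum_cons, List.sum_nil,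
          add_zero, wdeg_cons, wdeg_nil]
        have := hF (σ s) t [] c
        simp only [List.nil_append] at this
        rw [this, smul_smul, ← Int.negOnePow_add, hσ]
        congr 1
        exact negOnePow_congr ⟨deg s * deg t, by ring⟩
      · simp [brSum, slotBr]

end Slot

/-! ### Cochains on `A ⊗ 𝔤` -/

section Tensor

set_option linter.unusedSectionVars false

variable {R : Type} [Ring R] [Algebra ℝ R] {𝓡 : ℤ → Submodule ℝ R} [GradedAlgebra 𝓡]
  {dR : R →ₗ[ℝ] R} {I : Ideal R}
  {V : Type} [AddCommGroup V] [Module ℝ V] [Module R V] {𝓥 : ℤ → Submodule ℝ V}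
  {A : Type} [Ring A] [Algebra ℝ A] {𝓐 : ℤ → Submodule ℝ A} {dA : A →ₗ[ℝ] A}

/-- The relation `z = r x + s y` between pure tensors, where either the left or the right factors
coincide. -/
def TensorRel (a b : ℤ) (r s : R) (z x y : PureTensor 𝓥 𝓐) : Prop :=
  (x.1 = z.1 ∧ y.1 = z.1 ∧
    ModRel a b ((a * z.1.deg).negOnePow • r) ((b * z.1.deg).negOnePow • s) z.2 x.2 y.2) ∨
  (a = 0 ∧ b = 0 ∧ x.2 = z.2 ∧ y.2 = z.2 ∧ z.1.deg = x.1.deg ∧ z.1.deg = y.1.deg ∧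
    ∃ t t' : ℝ, r = algebraMap ℝ R t ∧ s = algebraMap ℝ R t' ∧
      z.1.val = t • x.1.val + t' • y.1.val)

/-- The conditions on admissible words of pure tensors. -/
structure TensorAdmissible (hA : IsCDGA 𝓐 dA) (Adm : List (PureTensor 𝓥 𝓐) → Prop) : Prop where
  perm : ∀ {l l'}, l.Perm l' → Adm l → Adm l'
  comb : ∀ {x y z : Homog 𝓐} {v w u : Homog 𝓥} {l} {t t' : ℝ}, Adm ((x, v) :: l) →
    Adm ((y, w) :: l) → z.deg = x.deg → z.deg = y.deg → z.val = t • x.val + t' • y.val →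
    Adm ((z, u) :: l)
  zero : ∀ {x : Homog 𝓐} {v : Homog 𝓥} {l}, x.val = 0 → (∃ l', Adm l') → Adm ((x, v) :: l)
  prod : ∀ {a c v}, Adm (a ++ c) → Adm ((prodH hA (a.map Prod.fst), v) :: c)
  d : ∀ {t : PureTensor 𝓥 𝓐} {c v}, Adm (t :: c) →
    Adm ((⟨t.1.deg + 1, dA t.1.val, hA.d_mem _ _ t.1.mem⟩, v) :: c)

variable {Adm : List (PureTensor 𝓥 𝓐) → Prop} {hA : IsCDGA 𝓐 dA}

theorem TensorAdmissible.right (h : TensorAdmissible hA Adm) {x : Homog 𝓐} {v w : Homog 𝓥}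
    {l : List (PureTensor 𝓥 𝓐)} (h' : Adm ((x, v) :: l)) : Adm ((x, w) :: l) :=
  h.comb (t := 1) (t' := 0) h' h' rfl rfl (by simp)

theorem TensorAdmissible.admissible (h : TensorAdmissible hA Adm) :
    Admissible (R := R) tdeg TensorRel Adm where
  perm := h.perm
  rel_deg := by
    rintro a b r s x y z (⟨h1, h2, h3⟩ | ⟨rfl, rfl, h1, h2, h3, h4, -⟩)
    · have e1 := h3.deg_left
      have e2 := h3.deg_right
      simp only [tdeg, h1, h2]
      omega
    · simp only [tdeg, h1, h2]
      omega
  rel := by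
    rintro a b r s x y z l (⟨h1, h2, h3⟩ | ⟨rfl, rfl, h1, h2, h3, h4, t, t', -, -, h5⟩) hx hy
    · exact h.comb (t := 1) (t' := 0) (x := x.1) (y := x.1) hx hx (by rw [h1]) (by rw [h1])
        (by simp [h1])
    · exact h.comb (x := x.1) (y := y.1) hx hy h3 h4 h5

section

variable [SetLike.GradedSMul 𝓡 𝓥]

theorem units_smul_mem' {M : Type*} [AddCommGroup M] [Module ℝ M] {p : Submodule ℝ M} (u : ℤˣ)
    {x : M} (h : x ∈ p) : u • x ∈ p := by
  rcases Int.units_eq_one_or u with rfl | rfl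
  · simpa using h
  · simpa using h

theorem units_smul_mul (u : ℤˣ) (r x : R) : (u • r) * x = u • (r * x) := smul_mul_assoc u r x

/-- The sign built into `TensorRel` is that of moving a scalar of `R` past the left factor to reach
the right one; with it, tensor cochains obey the same linearity rule as cochains of `𝔤`. -/
theorem mem_tensorCochains_iff (h : TensorAdmissible hA Adm) {p : ℤ}
    {F : List (PureTensor 𝓥 𝓐) → R} :
    F ∈ tensorCochains 𝓡 𝓥 𝓐 Adm p ↔ IsCochain 𝓡 tdeg TensorRel Adm p F := by
  constructor
  · intro (hF : IsTensorCochain 𝓡 𝓥 𝓐 Adm p F)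
    refine ⟨hF.zero, hF.mem, fun {a b r s x y z l} hr hs hz hx hy => ?_, hF.swap⟩
    obtain ⟨x1, x2⟩ := x
    obtain ⟨y1, y2⟩ := y
    obtain ⟨z1, z2⟩ := z
    rcases hz with ⟨h1, h2, h3⟩ | ⟨rfl, rfl, h1, h2, h3, h4, t, t', rfl, rfl, h5⟩
    · simp only at h1 h2 h3
      subst h1 h2
      have hr' : (a * y1.deg).negOnePow • r ∈ 𝓡 a := units_smul_mem _ hr
      have hs' : (b * y1.deg).negOnePow • s ∈ 𝓡 b := units_smul_mem _ hs
      rw [hF.add_right y1 ⟨z2.deg, ((a * y1.deg).negOnePow • r) • x2.val,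
          homog_smul_mem hr' h3.deg_left⟩
        ⟨z2.deg, ((b * y1.deg).negOnePow • s) • y2.val, homog_smul_mem hs' h3.deg_right⟩ z2 l
        rfl rfl h3.val,
        hF.smul_right a _ hr' y1 x2 ⟨z2.deg, ((a * y1.deg).negOnePow • r) • x2.val,
          homog_smul_mem hr' h3.deg_left⟩ l h3.deg_left rfl,
        hF.smul_right b _ hs' y1 y2 ⟨z2.deg, ((b * y1.deg).negOnePow • s) • y2.val,
          homog_smul_mem hs' h3.deg_right⟩ l h3.deg_right rfl]
      simp only [units_smul_mul, smul_smul, ← Int.negOnePow_add]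
      congr 2
      · exact negOnePow_congr ⟨a * y1.deg, by ring⟩
      · exact negOnePow_congr ⟨b * y1.deg, by ring⟩
    · simp only at h1 h2 h3 h4 h5
      subst h1 h2
      have hx' : t • x1.val ∈ 𝓐 z1.deg := h3 ▸ Submodule.smul_mem _ _ x1.mem
      have hy' : t' • y1.val ∈ 𝓐 z1.deg := h4 ▸ Submodule.smul_mem _ _ y1.mem
      rw [hF.add_left ⟨z1.deg, _, hx'⟩ ⟨z1.deg, _, hy'⟩ z1 y2 l
          (h.comb (t := t) (t' := 0) hx hx h3 h3 (by simp))
          (h.comb (t := t') (t' := 0) hy hy h4 h4 (by simp)) rfl rfl h5,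
        hF.smul_left t x1 ⟨z1.deg, _, hx'⟩ y2 l hx h3 rfl,
        hF.smul_left t' y1 ⟨z1.deg, _, hy'⟩ y2 l hy h4 rfl]
      simp [Algebra.smul_def]
  · intro hF
    -- Admissibility does not depend on the right factors, so on inadmissible words both sides of a
    -- linearity identity in them vanish.
    have hright : ∀ {a : Homog 𝓐} {x z : Homog 𝓥} {l}, ¬ Adm ((a, x) :: l) →
        F ((a, z) :: l) = 0 := fun h' => hF.zero _ fun h'' => h' (h.right h'')
    refine (⟨hF.zero, hF.mem, fun x y z v l hx hy h1 h2 h3 => ?_,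
      fun c x z v l hx h1 h2 => ?_, fun a x y z l h1 h2 h3 => ?_,
      fun e r hr a x z l h1 h2 => ?_, hF.swap⟩ : IsTensorCochain 𝓡 𝓥 𝓐 Adm p F)
    · have := hF.lin (a := 0) (b := 0) (r := 1) (s := 1) (x := (x, v)) (y := (y, v)) (z := (z, v))
        (l := l) SetLike.GradedOne.one_mem SetLike.GradedOne.one_mem
        (Or.inr ⟨rfl, rfl, rfl, rfl, h2, by simp only; omega, 1, 1, by simp, by simp,
          by simpa using h3⟩) hx hy
      simpa using this
    · have := hF.lin (a := 0) (b := 0) (r := algebraMap ℝ R c) (s := algebraMap ℝ R 0)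
        (x := (x, v)) (y := (x, v)) (z := (z, v))
        (l := l) (algebraMap_mem_zero _) (algebraMap_mem_zero _)
        (Or.inr ⟨rfl, rfl, rfl, rfl, h1, h1, c, 0, rfl, rfl, by simpa using h2⟩) hx hx
      simpa [Algebra.smul_def] using this
    · by_cases hx : Adm ((a, x) :: l)
      · have := hF.lin (a := 0) (b := 0) (r := 1) (s := 1) (x := (a, x)) (y := (a, y))
          (z := (a, z)) (l := l) SetLike.GradedOne.one_mem SetLike.GradedOne.one_mem
          (Or.inl ⟨rfl, rfl, by simp only; omega, by simp only; omega, by simpa using h3⟩) hx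
          (h.right hx)
        simpa using this
      · rw [hright hx, hright hx, hright hx, add_zero]
    · by_cases hx : Adm ((a, x) :: l)
      · have := hF.lin (a := e) (b := e) (r := (e * a.deg).negOnePow • r) (s := 0) (x := (a, x))
          (y := (a, x))
          (z := (a, z)) (l := l) (units_smul_mem _ hr) (zero_mem _)
          (Or.inl ⟨rfl, rfl, h1, h1, by simp [smul_smul, h2]⟩) hx hx
        rw [this, units_smul_mul, smul_smul, ← Int.negOnePow_add, zero_mul, smul_zero, add_zero]
        congr 1
        exact negOnePow_congr ⟨0, by ring⟩
      · rw [hright hx, hright hx, mul_zero, smul_zero]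

theorem left_lin (h : TensorAdmissible hA Adm) {p : ℤ} {F : List (PureTensor 𝓥 𝓐) → R}
    (hF : F ∈ tensorCochains 𝓡 𝓥 𝓐 Adm p) {x y z : Homog 𝓐} {v : Homog 𝓥}
    {l : List (PureTensor 𝓥 𝓐)} {t t' : ℝ} (hx : Adm ((x, v) :: l)) (hy : Adm ((y, v) :: l))
    (h1 : z.deg = x.deg) (h2 : z.deg = y.deg) (h3 : z.val = t • x.val + t' • y.val) :
    F ((z, v) :: l) = t • F ((x, v) :: l) + t' • F ((y, v) :: l) := by
  have := ((mem_tensorCochains_iff h).1 hF).lin (a := 0) (b := 0) (r := algebraMap ℝ R t)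
    (s := algebraMap ℝ R t') (x := (x, v)) (y := (y, v)) (z := (z, v)) (algebraMap_mem_zero _)
    (algebraMap_mem_zero _) (Or.inr ⟨rfl, rfl, rfl, rfl, h1, h2, t, t', rfl, rfl, h3⟩) hx hy
  simpa [Algebra.smul_def] using this

theorem left_zero (h : TensorAdmissible hA Adm) {p : ℤ} {F : List (PureTensor 𝓥 𝓐) → R}
    (hF : F ∈ tensorCochains 𝓡 𝓥 𝓐 Adm p) {x : Homog 𝓐} {v : Homog 𝓥}
    {l : List (PureTensor 𝓥 𝓐)} (hx : x.val = 0) : F ((x, v) :: l) = 0 := by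
  by_cases h' : Adm ((x, v) :: l)
  · simpa using left_lin h hF (t := 0) (t' := 0) (z := x) h' h' rfl rfl (by simp [hx])
  · exact IsTensorCochain.zero hF _ h'

theorem left_units (h : TensorAdmissible hA Adm) {p : ℤ} {F : List (PureTensor 𝓥 𝓐) → R}
    (hF : F ∈ tensorCochains 𝓡 𝓥 𝓐 Adm p) {x z : Homog 𝓐} {v : Homog 𝓥}
    {l : List (PureTensor 𝓥 𝓐)} (u : ℤˣ) (h1 : z.deg = x.deg) (h2 : z.val = u • x.val) :
    F ((z, v) :: l) = u • F ((x, v) :: l) := by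
  have hu : u • x.val = ((u : ℤ) : ℝ) • x.val := by
    rw [Units.smul_def, ← Int.cast_smul_eq_zsmul ℝ]
  have hu' : x.val = ((u : ℤ) : ℝ) • z.val := by
    rw [h2, Units.smul_def, ← Int.cast_smul_eq_zsmul ℝ, smul_smul, ← Int.cast_mul,
      ← Units.val_mul, Int.units_mul_self]
    simp
  by_cases h' : Adm ((x, v) :: l)
  · rw [left_lin h hF (t := ((u : ℤ) : ℝ)) (t' := 0) (z := z) h' h' h1 h1 (by simp [h2, hu]),
      zero_smul, add_zero, Units.smul_def, ← Int.cast_smul_eq_zsmul ℝ]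
  · rw [IsTensorCochain.zero hF _ h', IsTensorCochain.zero hF _ fun h'' => h' ?_, smul_zero]
    exact h.comb (t := ((u : ℤ) : ℝ)) (t' := 0) h'' h'' h1.symm h1.symm (by simpa using hu')

/-- The left factor of the first argument of a cochain extends to a linear map. -/
theorem exists_linear_left (h : TensorAdmissible hA Adm) {p : ℤ} {F : List (PureTensor 𝓥 𝓐) → R}
    (hF : F ∈ tensorCochains 𝓡 𝓥 𝓐 Adm p) (n : ℤ) (v : Homog 𝓥) (c : List (PureTensor 𝓥 𝓐)) :
    ∃ φ : A →ₗ[ℝ] R, ∀ x : Homog 𝓐, x.deg = n → Adm ((x, v) :: c) →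
      F ((x, v) :: c) = φ x.val := by
  by_cases h0 : ∃ l, Adm l
  · let S : Submodule ℝ A :=
      { carrier := {x | ∃ hx : x ∈ 𝓐 n, Adm ((⟨n, x, hx⟩, v) :: c)}
        zero_mem' := ⟨zero_mem _, h.zero rfl h0⟩
        add_mem' := by
          rintro x y ⟨hx, hx'⟩ ⟨hy, hy'⟩
          exact ⟨add_mem hx hy, h.comb (t := 1) (t' := 1) hx' hy' rfl rfl (by simp)⟩
        smul_mem' := by
          rintro t x ⟨hx, hx'⟩
          exact ⟨Submodule.smul_mem _ _ hx, h.comb (t := t) (t' := 0) hx' hx' rfl rfl (by simp)⟩ }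
    let f : S →ₗ[ℝ] R :=
      { toFun := fun x => F ((⟨n, x.1, x.2.1⟩, v) :: c)
        map_add' := fun x y => by
          simpa using left_lin h hF (t := 1) (t' := 1) (z := ⟨n, (x + y).1, (x + y).2.1⟩)
            x.2.2 y.2.2 rfl rfl (by simp)
        map_smul' := fun t x => by
          simpa using left_lin h hF (t := t) (t' := 0) (z := ⟨n, (t • x).1, (t • x).2.1⟩)
            x.2.2 x.2.2 rfl rfl (by simp) }
    obtain ⟨φ, hφ⟩ := f.exists_extend
    refine ⟨φ, ?_⟩
    rintro ⟨m, x, hx⟩ rfl hx'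
    exact (LinearMap.congr_fun hφ ⟨x, hx, hx'⟩).symm
  · exact ⟨0, fun x _ hx => (h0 ⟨_, hx⟩).elim⟩

variable [IsScalarTower ℝ R V]

/-- The right factor of the first argument of a cochain extends to a linear map. -/
theorem exists_linear_right {p : ℤ} {F : List (PureTensor 𝓥 𝓐) → R}
    (hF : F ∈ tensorCochains 𝓡 𝓥 𝓐 Adm p) (n : ℤ) (a : Homog 𝓐) (c : List (PureTensor 𝓥 𝓐)) :
    ∃ φ : V →ₗ[ℝ] R, (∀ w : Homog 𝓥, w.deg = n → F ((a, w) :: c) = φ w.val) ∧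
      ∀ (e : ℤ) (r : R), r ∈ 𝓡 e → ∀ x : Homog 𝓥, n = e + x.deg →
        φ (r • x.val) = (e * (p + a.deg)).negOnePow • (r * F ((a, x) :: c)) := by
  replace hF : IsTensorCochain 𝓡 𝓥 𝓐 Adm p F := hF
  let f : 𝓥 n →ₗ[ℝ] R :=
    { toFun := fun v => F ((a, ⟨n, v.1, v.2⟩) :: c)
      map_add' := fun v w => hF.add_right _ _ _ _ _ rfl rfl rfl
      map_smul' := fun t v => by
        have := hF.smul_right 0 (algebraMap ℝ R t) (algebraMap_mem_zero t) a ⟨n, v.1, v.2⟩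
          ⟨n, (t • v).1, (t • v).2⟩ c (by simp) (by simp)
        simpa [Algebra.smul_def] using this }
  obtain ⟨φ, hφ⟩ := f.exists_extend
  have h1 : ∀ w : Homog 𝓥, w.deg = n → F ((a, w) :: c) = φ w.val := by
    rintro ⟨m, w, hw⟩ rfl
    exact (LinearMap.congr_fun hφ ⟨w, hw⟩).symm
  refine ⟨φ, h1, fun e r hr x h => ?_⟩
  rw [← hF.smul_right e r hr a x ⟨n, r • x.val, homog_smul_mem hr h⟩ c h rfl, h1 _ rfl]

end

end Tensor

/-! ### The `L_∞`-structure on `A ⊗ 𝔤` -/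

section TensorBracket

set_option linter.unusedSectionVars false
set_option linter.unusedSimpArgs false

variable {R : Type} [Ring R] [Algebra ℝ R] {𝓡 : ℤ → Submodule ℝ R} [GradedAlgebra 𝓡]
  {dR : R →ₗ[ℝ] R} {I : Ideal R}
  {V : Type} [AddCommGroup V] [Module ℝ V] [Module R V] {𝓥 : ℤ → Submodule ℝ V}
  {A : Type} [Ring A] [Algebra ℝ A] {𝓐 : ℤ → Submodule ℝ A} {dA : A →ₗ[ℝ] A}
  {Adm : List (PureTensor 𝓥 𝓐) → Prop} {hA : IsCDGA 𝓐 dA}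

/-- The total degree of the left factors. -/
abbrev adeg (l : List (PureTensor 𝓥 𝓐)) : ℤ := wdeg (fun t => t.1.deg) l

/-- The total degree of the right factors. -/
abbrev vdeg (l : List (PureTensor 𝓥 𝓐)) : ℤ := wdeg (fun t => t.2.deg) l

theorem wdeg_tdeg (l : List (PureTensor 𝓥 𝓐)) : wdeg tdeg l = adeg l + vdeg l := by
  induction l with
  | nil => rfl
  | cons t l ih => simp only [adeg, vdeg, wdeg_cons, tdeg] at *; rw [ih]; ring

theorem wdeg_map_snd (l : List (PureTensor 𝓥 𝓐)) : wdeg Homog.deg (l.map Prod.snd) = vdeg l := by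
  simp [wdeg, Function.comp_def]

theorem koszulExp_eq (e : ℤ) (l : List (PureTensor 𝓥 𝓐)) :
    koszulExp e l = e * adeg l + koszulExp 0 l := by
  induction l generalizing e with
  | nil => simp [koszulExp]
  | cons t l ih =>
    simp only [koszulExp, adeg, wdeg_cons]
    rw [ih, ih (0 + _)]
    simp only [adeg]
    ring

theorem koszulExp_swap (e : ℤ) (x y : PureTensor 𝓥 𝓐) (l₁ l₂ : List (PureTensor 𝓥 𝓐)) :
    koszulExp e (l₁ ++ x :: y :: l₂) = koszulExp e (l₁ ++ y :: x :: l₂) +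
      (y.1.deg * x.2.deg - x.1.deg * y.2.deg) := by
  induction l₁ generalizing e with
  | nil =>
    simp only [List.nil_append, koszulExp]
    rw [add_right_comm e]
    ring
  | cons t l ih => simp only [List.cons_append, koszulExp, ih, add_assoc]

/-- The product of the left factors. -/
def prodVal (l : List (PureTensor 𝓥 𝓐)) : A := (l.map fun t => t.1.val).prod

@[simp] theorem prodVal_nil : prodVal ([] : List (PureTensor 𝓥 𝓐)) = 1 := rfl

@[simp] theorem prodVal_cons (t : PureTensor 𝓥 𝓐) (l : List (PureTensor 𝓥 𝓐)) :
    prodVal (t :: l) = t.1.val * prodVal l := by simp [prodVal]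

theorem prodH_deg (l : List (PureTensor 𝓥 𝓐)) : (prodH hA (l.map Prod.fst)).deg = adeg l := by
  induction l with
  | nil => rfl
  | cons t l ih => simp [prodH, ih]

theorem prodH_val (l : List (PureTensor 𝓥 𝓐)) : (prodH hA (l.map Prod.fst)).val = prodVal l := by
  induction l with
  | nil => rfl
  | cons t l ih => simp [prodH, ih]

theorem prodVal_mem (hA : IsCDGA 𝓐 dA) (l : List (PureTensor 𝓥 𝓐)) : prodVal l ∈ 𝓐 (adeg l) := by
  rw [← prodH_val (hA := hA), ← prodH_deg (hA := hA)]
  exact (prodH hA _).mem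

theorem prodVal_swap (hA : IsCDGA 𝓐 dA) (x y : PureTensor 𝓥 𝓐) (l₁ l₂ : List (PureTensor 𝓥 𝓐)) :
    prodVal (l₁ ++ x :: y :: l₂) =
      (x.1.deg * y.1.deg).negOnePow • prodVal (l₁ ++ y :: x :: l₂) := by
  induction l₁ with
  | nil =>
    simp only [List.nil_append, prodVal_cons, ← mul_assoc]
    rw [hA.mul_comm _ _ _ _ x.1.mem y.1.mem, smul_mul_assoc]
  | cons t l ih => simp only [List.cons_append, prodVal_cons, ih, mul_smul_comm]

/-- The operation `a ⊗ v ↦ θ(a) ⊗ v` for `θ` of degree `e`. -/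
def mapLeft (θ : A →ₗ[ℝ] A) (e : ℤ) (hθ : ∀ i x, x ∈ 𝓐 i → θ x ∈ 𝓐 (i + e))
    (t : PureTensor 𝓥 𝓐) : PureTensor 𝓥 𝓐 :=
  (⟨t.1.deg + e, θ t.1.val, hθ _ _ t.1.mem⟩, t.2)

theorem tdeg_mapLeft (θ : A →ₗ[ℝ] A) (e : ℤ) (hθ : ∀ i x, x ∈ 𝓐 i → θ x ∈ 𝓐 (i + e))
    (t : PureTensor 𝓥 𝓐) : tdeg (mapLeft θ e hθ t) = tdeg t + e := by
  simp only [tdeg, mapLeft]; ring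

/-- A graded derivation acts on a product of homogeneous elements by the Leibniz rule. -/
theorem slotSum_prodVal {N : Type*} [AddCommGroup N] [Module ℝ N] (hA : IsCDGA 𝓐 dA)
    {θ : A →ₗ[ℝ] A} {e : ℤ} (hθ : ∀ i x, x ∈ 𝓐 i → θ x ∈ 𝓐 (i + e))
    (hder : ∀ i x y, x ∈ 𝓐 i → θ (x * y) = θ x * y + (e * i).negOnePow • (x * θ y))
    (E : ℤ) (φ : A →ₗ[ℝ] N) (l : List (PureTensor 𝓥 𝓐)) :
    slotSum tdeg e (mapLeft θ e hθ) (fun l' => (koszulExp E l').negOnePow • φ (prodVal l')) l =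
      (e * E + koszulExp E l).negOnePow • φ (θ (prodVal l)) := by
  induction l generalizing E φ with
  | nil =>
    have : θ 1 = 0 := by simpa using hder 0 1 1 hA.one_mem
    simp [slotSum, this]
  | cons t l ih =>
    -- The first letter is absorbed: its left factor into the functional `φ`, and the degree of its
    -- right factor into the degree `E` that later left factors have to pass.
    have h1 := ih (E + t.2.deg) (φ ∘ₗ LinearMap.mulLeft ℝ t.1.val)
    simp only [LinearMap.comp_apply, LinearMap.mulLeft_apply] at h1
    have h2 : slotSum tdeg e (mapLeft θ e hθ) (fun l' =>
        (koszulExp E (t :: l')).negOnePow • φ (prodVal (t :: l'))) l =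
        (t.1.deg * E).negOnePow • (e * (E + t.2.deg) + koszulExp (E + t.2.deg) l).negOnePow •
          φ (t.1.val * θ (prodVal l)) := by
      rw [← h1, ← slotSum_smul]
      simp only [koszulExp, prodVal_cons, smul_smul, ← Int.negOnePow_add]
    rw [slotSum, h2, prodVal_cons, prodVal_cons, hder _ _ _ t.1.mem, map_add, map_units_smul',
      smul_add]
    simp only [smul_smul, ← Int.negOnePow_add, koszulExp, mapLeft, tdeg]
    congr 2
    · congr 1; ring
    · exact negOnePow_congr ⟨e * t.2.deg, by ring⟩

/-- Unshuffling words of pure tensors: reordering the left factors produces exactly the sign that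
turns the sum into one over unshuffles of the right factors. -/
theorem unshSum_tensor {N : Type*} [AddCommGroup N] (hA : IsCDGA 𝓐 dA)
    (l : List (PureTensor 𝓥 𝓐)) (g : A → List (Homog 𝓥) → List (Homog 𝓥) → N)
    (hg : ∀ (u : ℤˣ) x a c, g (u • x) a c = u • g x a c) :
    (unshSum tdeg l fun a c => (koszulExp 0 a + koszulExp 0 c + vdeg a * adeg c).negOnePow •
      g (prodVal a * prodVal c) (a.map Prod.snd) (c.map Prod.snd)) =
    (koszulExp 0 l).negOnePow • unshSum Homog.deg (l.map Prod.snd) (g (prodVal l)) := by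
  induction l generalizing g with
  | nil => simp [koszulExp]
  | cons t l ih =>
    have hk : (koszulExp 0 (t :: l)).negOnePow =
        (t.2.deg * adeg l).negOnePow * (koszulExp 0 l).negOnePow := by
      rw [koszulExp, koszulExp_eq, ← Int.negOnePow_add]
      congr 1; ring
    rw [List.map_cons, unshSum_cons, unshSum_cons, smul_add]
    congr 1
    · have := ih (fun x a c => g (t.1.val * x) (t.2 :: a) c) fun u x a c => by
        rw [mul_smul_comm, hg]
      rw [prodVal_cons, hk, mul_smul]
      refine Eq.trans ?_ (congrArg ((t.2.deg * adeg l).negOnePow • ·) this)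
      rw [← unshSum_smul]
      refine unshSum_congr fun a c hp => ?_
      rw [koszulExp, koszulExp_eq, show adeg l = adeg (a ++ c) from (wdeg_perm hp).symm]
      simp only [prodVal_cons, List.map_cons, mul_assoc, smul_smul, ← Int.negOnePow_add, vdeg,
        adeg, wdeg_cons, wdeg_append]
      congr 1
      refine negOnePow_congr ⟨0, by ring⟩
    · have := ih (fun x a c => (t.2.deg * wdeg Homog.deg a).negOnePow •
        g (t.1.val * x) a (t.2 :: c)) fun u x a c => by rw [mul_smul_comm, hg, smul_comm]
      rw [prodVal_cons, hk, mul_smul]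
      refine Eq.trans ?_ (congrArg ((t.2.deg * adeg l).negOnePow • ·) this)
      rw [← unshSum_smul]
      refine unshSum_congr fun a c hp => ?_
      -- The first letter goes to the second half, so its left factor has to be commuted past the
      -- product of the first half.
      have hcomm : prodVal a * (t.1.val * prodVal c) =
          (adeg a * t.1.deg).negOnePow • (t.1.val * (prodVal a * prodVal c)) := by
        rw [← mul_assoc, hA.mul_comm _ _ _ _ (prodVal_mem hA a) t.1.mem, smul_mul_assoc, mul_assoc]
      rw [koszulExp, koszulExp_eq _ c, show adeg l = adeg (a ++ c) from (wdeg_perm hp).symm, prodVal_cons, hcomm, hg, wdeg_tdeg,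
        wdeg_map_snd]
      simp only [List.map_cons, smul_smul, ← Int.negOnePow_add, vdeg,
        adeg, wdeg_cons, wdeg_append, tdeg]
      congr 1
      refine negOnePow_congr ⟨t.1.deg * wdeg (fun t => t.1.deg) a + t.1.deg * wdeg (fun t => t.2.deg) a,
        by ring⟩

/-- The first term of the bracket of `A ⊗ 𝔤`. -/
def mainTerm (hA : IsCDGA 𝓐 dA) (𝔤 : CurvedLInfty 𝓡 dR I 𝓥) (l : List (PureTensor 𝓥 𝓐)) :
    PureTensor 𝓥 𝓐 :=
  (⟨(prodH hA (l.map Prod.fst)).deg,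
    (koszulExp 1 l).negOnePow • (prodH hA (l.map Prod.fst)).val,
    units_smul_mem' _ (prodH hA (l.map Prod.fst)).mem⟩, 𝔤.brH (l.map Prod.snd))

theorem tensorBr_eq (hA : IsCDGA 𝓐 dA) (𝔤 : CurvedLInfty 𝓡 dR I 𝓥) (l : List (PureTensor 𝓥 𝓐)) :
    tensorBr hA 𝔤 l = mainTerm hA 𝔤 l :: slotBr (mapLeft dA 1 hA.d_mem) l := by
  rcases l with _ | ⟨t, _ | ⟨s, l⟩⟩ <;> rfl

theorem mem_slotBr {H : Type*} {σ : H → H} {l : List H} {w : H} (h : w ∈ slotBr σ l) :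
    ∃ t, l = [t] ∧ w = σ t := by
  rcases l with _ | ⟨t, _ | ⟨s, l⟩⟩ <;> simp [slotBr] at h
  exact ⟨t, rfl, h⟩

theorem tdeg_mainTerm (hA : IsCDGA 𝓐 dA) (𝔤 : CurvedLInfty 𝓡 dR I 𝓥)
    (l : List (PureTensor 𝓥 𝓐)) : tdeg (mainTerm hA 𝔤 l) = wdeg tdeg l + 1 := by
  simp only [tdeg, mainTerm, prodH_deg, CurvedLInfty.brH, wdeg_tdeg]
  rw [show ((l.map Prod.snd).map Homog.deg).sum = vdeg l from wdeg_map_snd l]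
  ring

section

variable [SetLike.GradedSMul 𝓡 𝓥] [IsScalarTower ℝ R V]

/-- The product of the left factors as a homogeneous element. -/
def prodHomog (hA : IsCDGA 𝓐 dA) (l : List (PureTensor 𝓥 𝓐)) : Homog 𝓐 :=
  ⟨adeg l, prodVal l, prodVal_mem hA l⟩

theorem eval_mainTerm (h : TensorAdmissible hA Adm) (𝔤 : CurvedLInfty 𝓡 dR I 𝓥) {p : ℤ}
    {F : List (PureTensor 𝓥 𝓐) → R} (hF : F ∈ tensorCochains 𝓡 𝓥 𝓐 Adm p)
    (l c : List (PureTensor 𝓥 𝓐)) : F (mainTerm hA 𝔤 l :: c) =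
      (koszulExp 1 l).negOnePow • F ((prodHomog hA l, 𝔤.brH (l.map Prod.snd)) :: c) :=
  left_units h hF _ (prodH_deg l) (by simp [mainTerm, prodHomog, prodH_val])

/-- Three signs multiply to that of exchanging pure tensors: graded commutativity of `A`, symmetry
of the bracket of `𝔤`, and the change of `koszulExp`, which accounts for the mixed products of left
and right degrees. -/
theorem eval_mainTerm_swap (h : TensorAdmissible hA Adm) (𝔤 : CurvedLInfty 𝓡 dR I 𝓥) {p : ℤ}
    {F : List (PureTensor 𝓥 𝓐) → R} (hF : F ∈ tensorCochains 𝓡 𝓥 𝓐 Adm p)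
    (x y : PureTensor 𝓥 𝓐) (l₁ l₂ c : List (PureTensor 𝓥 𝓐)) :
    F (mainTerm hA 𝔤 (l₁ ++ x :: y :: l₂) :: c) =
      (tdeg x * tdeg y).negOnePow • F (mainTerm hA 𝔤 (l₁ ++ y :: x :: l₂) :: c) := by
  rw [eval_mainTerm h 𝔤 hF, eval_mainTerm h 𝔤 hF]
  have hd : adeg (l₁ ++ x :: y :: l₂) = adeg (l₁ ++ y :: x :: l₂) :=
    wdeg_perm ((List.Perm.swap y x l₂).append_left l₁)
  rw [left_units h hF (x := prodHomog hA (l₁ ++ y :: x :: l₂)) _ hd (prodVal_swap hA x y l₁ l₂)]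
  obtain ⟨φ, h1, -⟩ := exists_linear_right hF
    (𝔤.brH ((l₁ ++ x :: y :: l₂).map Prod.snd)).deg (prodHomog hA (l₁ ++ y :: x :: l₂)) c
  have hd : (𝔤.brH ((l₁ ++ y :: x :: l₂).map Prod.snd)).deg =
      (𝔤.brH ((l₁ ++ x :: y :: l₂).map Prod.snd)).deg := by
    simp [CurvedLInfty.brH]; ring
  have hb : (𝔤.brH ((l₁ ++ x :: y :: l₂).map Prod.snd)).val =
      (x.2.deg * y.2.deg).negOnePow • (𝔤.brH ((l₁ ++ y :: x :: l₂).map Prod.snd)).val := by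
    simpa [CurvedLInfty.brH] using 𝔤.swap x.2 y.2 (l₁.map Prod.snd) (l₂.map Prod.snd)
  rw [h1 _ rfl, h1 _ hd, hb, map_units_smul', koszulExp_swap]
  simp only [smul_smul, ← Int.negOnePow_add]
  congr 1
  exact negOnePow_congr ⟨- x.1.deg * y.2.deg, by simp only [tdeg]; ring⟩

theorem mainTerm_adm (h : TensorAdmissible hA Adm) (𝔤 : CurvedLInfty 𝓡 dR I 𝓥)
    {a c : List (PureTensor 𝓥 𝓐)} (hl : Adm (a ++ c)) : Adm (mainTerm hA 𝔤 a :: c) := by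
  rcases Int.units_eq_one_or (koszulExp 1 a).negOnePow with h' | h'
  · exact h.comb (t := 1) (t' := 0) (h.prod (v := 𝔤.brH (a.map Prod.snd)) hl)
      (h.prod (v := 𝔤.brH (a.map Prod.snd)) hl) rfl rfl (by simp [h'])
  · exact h.comb (t := -1) (t' := 0) (h.prod (v := 𝔤.brH (a.map Prod.snd)) hl)
      (h.prod (v := 𝔤.brH (a.map Prod.snd)) hl) rfl rfl (by simp [h'])

theorem prodHomog_adm (h : TensorAdmissible hA Adm)
    {a c : List (PureTensor 𝓥 𝓐)} {v : Homog 𝓥} (hl : Adm (a ++ c)) :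
    Adm ((prodHomog hA a, v) :: c) :=
  h.comb (t := 1) (t' := 0) (h.prod (v := v) hl) (h.prod (v := v) hl) (prodH_deg a).symm
    (prodH_deg a).symm (by simp [prodHomog, prodH_val])

theorem isVectorField_tensorBr (h : TensorAdmissible hA Adm) (𝔤 : CurvedLInfty 𝓡 dR I 𝓥) :
    IsVectorField 𝓡 tdeg TensorRel Adm 1 (tensorBr hA 𝔤) where
  deg_eq := by
    intro a w hw
    rw [tensorBr_eq, List.mem_cons] at hw
    rcases hw with rfl | hw
    · exact tdeg_mainTerm hA 𝔤 a
    · obtain ⟨t, rfl, rfl⟩ := mem_slotBr hw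
      simpa [wdeg] using tdeg_mapLeft dA 1 hA.d_mem t
  adm := by
    intro a c w hw hl
    rw [tensorBr_eq, List.mem_cons] at hw
    rcases hw with rfl | hw
    · exact mainTerm_adm h 𝔤 hl
    · obtain ⟨t, rfl, rfl⟩ := mem_slotBr hw
      exact h.d hl
  swap := by
    intro p F hF x y l₁ l₂ c hl
    rw [brSum, brSum, tensorBr_eq, tensorBr_eq, slotBr_append_cons_cons, slotBr_append_cons_cons]
    simpa using eval_mainTerm_swap h 𝔤 ((mem_tensorCochains_iff h).2 hF) x y l₁ l₂ c

theorem IsCDGA.d_algebraMap {𝓑 : ℤ → Submodule ℝ R} {d : R →ₗ[ℝ] R} (h : IsCDGA 𝓑 d) (t : ℝ) :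
    d (algebraMap ℝ R t) = 0 := by
  have h1 : d 1 = 0 := by simpa using h.leibniz 0 1 1 h.one_mem
  rw [Algebra.algebraMap_eq_smul_one, map_smul, h1, smul_zero]

theorem brSum_tensorBr (hA : IsCDGA 𝓐 dA) (𝔤 : CurvedLInfty 𝓡 dR I 𝓥)
    (F : List (PureTensor 𝓥 𝓐) → R) (a c : List (PureTensor 𝓥 𝓐)) :
    brSum (tensorBr hA 𝔤) F a c =
      F (mainTerm hA 𝔤 a :: c) + brSum (slotBr (mapLeft dA 1 hA.d_mem)) F a c := by
  simp [brSum, tensorBr_eq]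

/-- For a relation between right factors the argument is that of `CurvedLInfty.brSum_lin` with
additional signs for passing left factors. For one between left factors the scalars are real and
annihilated by `d_R`, so there is no inhomogeneous term. -/
theorem brSum_tensorBr_lin (hR : IsCDGA 𝓡 dR) (h : TensorAdmissible hA Adm)
    (𝔤 : CurvedLInfty 𝓡 dR I 𝓥) {p : ℤ} {F : List (PureTensor 𝓥 𝓐) → R}
    (hF : F ∈ tensorCochains 𝓡 𝓥 𝓐 Adm p) {i j : ℤ} {r s : R} {x y z : PureTensor 𝓥 𝓐}
    {a c : List (PureTensor 𝓥 𝓐)} (hr : r ∈ 𝓡 i) (hs : s ∈ 𝓡 j) (hz : TensorRel i j r s z x y)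
    (hx : Adm (x :: (a ++ c))) (hy : Adm (y :: (a ++ c))) :
    brSum (tensorBr hA 𝔤) F (z :: a) c =
      (i * (p + 1)).negOnePow • (r * brSum (tensorBr hA 𝔤) F (x :: a) c) +
      (j * (p + 1)).negOnePow • (s * brSum (tensorBr hA 𝔤) F (y :: a) c) + if a = [] then
      p.negOnePow • ((i * p).negOnePow • (dR r * F (x :: c)) +
        (j * p).negOnePow • (dR s * F (y :: c))) else 0 := by
  obtain ⟨x1, x2⟩ := x
  obtain ⟨y1, y2⟩ := y
  obtain ⟨z1, z2⟩ := z
  simp only [brSum_tensorBr]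
  rcases hz with ⟨h1, h2, h3⟩ | ⟨rfl, rfl, h1, h2, h3, h4, t, t', rfl, rfl, h5⟩
  · simp only at h1 h2 h3
    subst h1 h2
    have hr' : (i * y1.deg).negOnePow • r ∈ 𝓡 i := units_smul_mem _ hr
    have hs' : (j * y1.deg).negOnePow • s ∈ 𝓡 j := units_smul_mem _ hs
    have e1 := h3.deg_left
    have e2 := h3.deg_right
    have hP : ∀ w : Homog 𝓥, prodHomog hA ((y1, w) :: a) = prodHomog hA ((y1, z2) :: a) :=
      fun w => Homog.ext' (by simp [prodHomog]) (by simp [prodHomog])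
    obtain ⟨φ, f1, f2⟩ := exists_linear_right hF (𝔤.brH (z2 :: a.map Prod.snd)).deg
      (prodHomog hA ((y1, z2) :: a)) c
    have hd : ∀ w : Homog 𝓥, (𝔤.brH (w :: a.map Prod.snd)).deg = w.deg + vdeg a + 1 := fun w => by
      rw [← wdeg_map_snd]; simp [CurvedLInfty.brH, wdeg]
    have hmain : F (mainTerm hA 𝔤 ((y1, z2) :: a) :: c) =
        (i * (p + 1)).negOnePow • (r * F (mainTerm hA 𝔤 ((y1, x2) :: a) :: c)) +
        (j * (p + 1)).negOnePow • (s * F (mainTerm hA 𝔤 ((y1, y2) :: a) :: c)) +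
        if a = [] then p.negOnePow • ((i * p).negOnePow • (dR r * F ((y1, x2) :: c)) +
          (j * p).negOnePow • (dR s * F ((y1, y2) :: c))) else 0 := by
      rw [eval_mainTerm h 𝔤 hF, eval_mainTerm h 𝔤 hF, eval_mainTerm h 𝔤 hF, hP x2, hP y2,
        List.map_cons, List.map_cons, List.map_cons, f1 _ rfl]
      change _ • φ (𝔤.br (z2 :: a.map Prod.snd)) = _
      rw [𝔤.br_lin hr' hs' h3, map_add, map_add, map_units_smul', map_units_smul']
      change _ • (_ • φ (_ • (𝔤.brH (x2 :: a.map Prod.snd)).val) +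
        _ • φ (_ • (𝔤.brH (y2 :: a.map Prod.snd)).val) + _) = _
      rw [f2 i _ hr' _ (by rw [hd, hd]; omega), f2 j _ hs' _ (by rw [hd, hd]; omega), smul_add,
        smul_add]
      have hPd : (prodHomog hA ((y1, z2) :: a)).deg = y1.deg + adeg a := by simp [prodHomog]
      congr 1
      · simp only [units_smul_mul, mul_smul_comm, smul_smul, ← Int.negOnePow_add, koszulExp, hPd]
        rw [koszulExp_eq, koszulExp_eq (1 + x2.deg), koszulExp_eq (1 + y2.deg)]
        congr 2
        · refine negOnePow_congr ⟨i * y1.deg + i * adeg a, ?_⟩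
          rw [e1]; ring
        · refine negOnePow_congr ⟨j * y1.deg + j * adeg a, ?_⟩
          rw [e2]; ring
      · by_cases ha : a = []
        · subst ha
          simp only [List.map_nil, if_true, map_add]
          have hdr : dR ((i * y1.deg).negOnePow • r) ∈ 𝓡 (i + 1) := hR.d_mem _ _ hr'
          have hds : dR ((j * y1.deg).negOnePow • s) ∈ 𝓡 (j + 1) := hR.d_mem _ _ hs'
          have hP1 : prodHomog hA [(y1, z2)] = y1 :=
            Homog.ext' (by simp [prodHomog]) (by simp [prodHomog])
          have hz2 : (𝔤.brH (z2 :: List.map Prod.snd ([] : List (PureTensor 𝓥 𝓐)))).deg =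
            z2.deg + 1 := by simp [CurvedLInfty.brH]
          rw [f2 (i + 1) _ hdr _ (by rw [hz2]; omega), f2 (j + 1) _ hds _ (by rw [hz2]; omega), hP1,
            map_units_smul', map_units_smul']
          simp only [units_smul_mul, smul_add, smul_smul, ← Int.negOnePow_add, koszulExp]
          congr 2
          · exact negOnePow_congr ⟨y1.deg + i * y1.deg, by ring⟩
          · exact negOnePow_congr ⟨y1.deg + j * y1.deg, by ring⟩
        · have : a.map Prod.snd ≠ [] := by simpa using ha
          rw [if_neg this, if_neg ha, map_zero, smul_zero]
    -- Since `dA` raises the degree of the left factor by one, the scalars in the relation acquire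
    -- `(-1)^i` and `(-1)^j`, as an operation of degree one should produce.
    have hd' : brSum (slotBr (mapLeft dA 1 hA.d_mem)) F ((y1, z2) :: a) c =
        (i * (p + 1)).negOnePow •
          (r * brSum (slotBr (mapLeft dA 1 hA.d_mem)) F ((y1, x2) :: a) c) +
        (j * (p + 1)).negOnePow •
          (s * brSum (slotBr (mapLeft dA 1 hA.d_mem)) F ((y1, y2) :: a) c) := by
      rcases a with _ | ⟨b, a⟩
      · simp only [brSum, slotBr, List.map_cons, List.map_nil, List.sum_cons, List.sum_nil,
          add_zero]
        refine (((mem_tensorCochains_iff h).1 hF).lin (x := mapLeft dA 1 hA.d_mem (y1, x2))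
          (y := mapLeft dA 1 hA.d_mem (y1, y2)) (z := mapLeft dA 1 hA.d_mem (y1, z2)) (r := i.negOnePow • r)
          (s := j.negOnePow • s) (units_smul_mem _ hr)
          (units_smul_mem _ hs) (Or.inl ⟨rfl, rfl, e1, e2, ?_⟩) (h.d hx) (h.d hy)).trans ?_
        · simp only [mapLeft]
          rw [h3.val]
          simp only [smul_smul, ← Int.negOnePow_add]
          congr 3
          · exact negOnePow_congr ⟨-i, by ring⟩
          · exact negOnePow_congr ⟨-j, by ring⟩
        · simp only [units_smul_mul, smul_smul, ← Int.negOnePow_add]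
          congr 3
          · ring
          · ring
      · simp [brSum, slotBr]
    rw [hmain, hd', mul_add r, mul_add s, smul_add (i * (p + 1)).negOnePow,
      smul_add (j * (p + 1)).negOnePow]
    generalize (i * (p + 1)).negOnePow = u1, (j * (p + 1)).negOnePow = u2
    abel
  · simp only at h1 h2 h3 h4 h5
    subst h1 h2
    have hmain : F (mainTerm hA 𝔤 ((z1, y2) :: a) :: c) =
        t • F (mainTerm hA 𝔤 ((x1, y2) :: a) :: c) + t' • F (mainTerm hA 𝔤 ((y1, y2) :: a) :: c) := by
      rw [eval_mainTerm h 𝔤 hF, eval_mainTerm h 𝔤 hF, eval_mainTerm h 𝔤 hF]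
      simp only [koszulExp, h3]
      rw [h3] at h4
      rw [h4, smul_comm t, smul_comm t', ← smul_add]
      congr 1
      refine left_lin h hF (prodHomog_adm h (a := (x1, y2) :: a) hx)
        (prodHomog_adm h (a := (y1, y2) :: a) hy) ?_ ?_ ?_
      · simp [prodHomog, h3]
      · simp [prodHomog, h3, h4]
      · simp [prodHomog, h5, add_mul]
    have hd' : brSum (slotBr (mapLeft dA 1 hA.d_mem)) F ((z1, y2) :: a) c =
        t • brSum (slotBr (mapLeft dA 1 hA.d_mem)) F ((x1, y2) :: a) c +
        t' • brSum (slotBr (mapLeft dA 1 hA.d_mem)) F ((y1, y2) :: a) c := by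
      rcases a with _ | ⟨b, a⟩
      · simp only [brSum, slotBr, List.map_cons, List.map_nil, List.sum_cons, List.sum_nil,
          add_zero]
        exact left_lin h hF (h.d hx) (h.d hy) (by simp [h3]) (by simp [h4]) (by simp [h5])
      · simp [brSum, slotBr]
    rw [hmain, hd']
    simp only [hR.d_algebraMap, zero_mul, Int.negOnePow_zero, smul_add, one_smul, smul_zero,
      add_zero, ite_self, mul_add, ← Algebra.smul_def]
    abel

end

end TensorBracket

/-! ### The Jacobi identities and the Chevalley–Eilenberg complex of `A ⊗ 𝔤`. -/

section TensorComplex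

set_option linter.unusedSectionVars false

variable {R : Type} [Ring R] [Algebra ℝ R] {𝓡 : ℤ → Submodule ℝ R} [GradedAlgebra 𝓡]
  {dR : R →ₗ[ℝ] R} {I : Ideal R}
  {V : Type} [AddCommGroup V] [Module ℝ V] [Module R V] {𝓥 : ℤ → Submodule ℝ V}
  {A : Type} [Ring A] [Algebra ℝ A] {𝓐 : ℤ → Submodule ℝ A} {dA : A →ₗ[ℝ] A}
  {Adm : List (PureTensor 𝓥 𝓐) → Prop} {hA : IsCDGA 𝓐 dA}
  [SetLike.GradedSMul 𝓡 𝓥] [IsScalarTower ℝ R V]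

theorem brH_deg (𝔤 : CurvedLInfty 𝓡 dR I 𝓥) (l : List (PureTensor 𝓥 𝓐)) :
    (𝔤.brH (l.map Prod.snd)).deg = vdeg l + 1 := by
  rw [← wdeg_map_snd]
  simp [CurvedLInfty.brH, wdeg]

theorem mapLeft_perm_adm (h : TensorAdmissible hA Adm) {l₁ l₂ c : List (PureTensor 𝓥 𝓐)}
    {t : PureTensor 𝓥 𝓐} (hl : Adm (l₁ ++ t :: l₂ ++ c)) :
    Adm (l₁ ++ mapLeft dA 1 hA.d_mem t :: l₂ ++ c) := by
  have h1 : (l₁ ++ t :: l₂ ++ c).Perm (t :: (l₁ ++ (l₂ ++ c))) := by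
    simp
  have h2 : (l₁ ++ mapLeft dA 1 hA.d_mem t :: l₂ ++ c).Perm
      (mapLeft dA 1 hA.d_mem t :: (l₁ ++ (l₂ ++ c))) := by
    simp
  exact h.perm h2.symm (h.d (h.perm h1 hl))

/-- Up to sign, each nested bracket has the product of all left factors on the left and a nested
bracket of `𝔤` on the right. `unshSum_tensor` makes the left factor common to all terms, and the
Jacobi identity of `𝔤` is then applied under a linear functional of the right factor. -/
theorem jacobi_tensorBr_main (h : TensorAdmissible hA Adm) (𝔤 : CurvedLInfty 𝓡 dR I 𝓥) {p : ℤ}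
    {F : List (PureTensor 𝓥 𝓐) → R} (hF : F ∈ tensorCochains 𝓡 𝓥 𝓐 Adm p)
    (l c : List (PureTensor 𝓥 𝓐)) :
    (unshSum tdeg l fun a a' => F (mainTerm hA 𝔤 (mainTerm hA 𝔤 a :: a') :: c)) = 0 := by
  classical
  -- `unshSum_tensor` requires a function of all of `A`, whereas `F` accepts homogeneous left
  -- factors only; zero is used outside the degree that occurs.
  let g : A → List (Homog 𝓥) → List (Homog 𝓥) → R := fun x va vc =>
    if hx : x ∈ 𝓐 (adeg l) then F ((⟨adeg l, x, hx⟩, 𝔤.brH (𝔤.brH va :: vc)) :: c) else 0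
  have hg : ∀ (u : ℤˣ) x a c, g (u • x) a c = u • g x a c := by
    intro u x va vc
    by_cases hx : x ∈ 𝓐 (adeg l)
    · have hx' : u • x ∈ 𝓐 (adeg l) := units_smul_mem' u hx
      simp only [g, dif_pos hx, dif_pos hx']
      exact left_units h hF u rfl rfl
    · have hx' : u • x ∉ 𝓐 (adeg l) := fun hx' => hx (by
        simpa [smul_smul] using units_smul_mem' u hx')
      simp only [g, dif_neg hx, dif_neg hx', smul_zero]
  have key := unshSum_tensor hA l g hg
  have e1 : (unshSum tdeg l fun a a' => F (mainTerm hA 𝔤 (mainTerm hA 𝔤 a :: a') :: c)) =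
      unshSum tdeg l fun a c => (koszulExp 0 a + koszulExp 0 c + vdeg a * adeg c).negOnePow •
      g (prodVal a * prodVal c) (a.map Prod.snd) (c.map Prod.snd) := by
    refine unshSum_congr fun a a' hp => ?_
    have hd : adeg a + adeg a' = adeg l := by rw [← wdeg_append]; exact wdeg_perm hp
    have hmem : prodVal a * prodVal a' ∈ 𝓐 (adeg l) := by
      rw [← hd]
      exact hA.mul_mem _ _ _ _ (prodVal_mem hA a) (prodVal_mem hA a')
    rw [eval_mainTerm h 𝔤 hF]
    simp only [g, dif_pos hmem]
    rw [left_units h hF (x := ⟨adeg l, _, hmem⟩) (koszulExp 1 a).negOnePow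
      (by simp [prodHomog, mainTerm, prodH_deg, hd])
      (by simp [prodHomog, mainTerm, prodH_val, smul_mul_assoc])]
    rw [smul_smul, ← Int.negOnePow_add, koszulExp]
    simp only [mainTerm, prodH_deg, List.map_cons, brH_deg]
    congr 1
    rw [koszulExp_eq, koszulExp_eq 1]
    exact negOnePow_congr ⟨adeg a + adeg a', by ring⟩
  rw [e1, key]
  have hmem := prodVal_mem hA l
  simp only [g, dif_pos hmem]
  obtain ⟨φ, h1, -⟩ := exists_linear_right hF (vdeg l + 2) ⟨adeg l, prodVal l, hmem⟩ c
  rw [unshSum_congr (g := fun a a' => φ.toAddMonoidHom (𝔤.br (𝔤.brH a :: a'))) fun a a' hp => ?_,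
    ← map_unshSum]
  · rw [show unshSum Homog.deg (l.map Prod.snd) (fun a c => 𝔤.br (𝔤.brH a :: c)) = 0 from
      𝔤.jacobi _, map_zero, smul_zero]
  · refine h1 _ ?_
    rw [← wdeg_map_snd, ← wdeg_perm hp]
    simp [CurvedLInfty.brH, wdeg]
    ring

/-- The Leibniz rule for `dA` on the products in the brackets. -/
theorem jacobi_tensorBr_d (h : TensorAdmissible hA Adm) (𝔤 : CurvedLInfty 𝓡 dR I 𝓥) {p : ℤ}
    {F : List (PureTensor 𝓥 𝓐) → R} (hF : F ∈ tensorCochains 𝓡 𝓥 𝓐 Adm p)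
    (l c : List (PureTensor 𝓥 𝓐)) (hl : Adm (l ++ c)) :
    vf tdeg (slotBr (mapLeft dA 1 hA.d_mem)) (fun l => F (mainTerm hA 𝔤 l :: c)) l =
      - F (mapLeft dA 1 hA.d_mem (mainTerm hA 𝔤 l) :: c) := by
  rw [vf_slotBr (tdeg_mapLeft dA 1 hA.d_mem) fun x y l₁ l₂ =>
    eval_mainTerm_swap h 𝔤 hF x y l₁ l₂ c]
  -- Applying `dA` to one letter changes neither the right factors nor the bracket formed from them,
  -- so all terms are values of one linear functional of the product and `slotSum_prodVal` applies.
  obtain ⟨φ, h1⟩ := exists_linear_left h hF (adeg l + 1) (𝔤.brH (l.map Prod.snd)) c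
  rw [slotSum_congr (G := fun l' => (koszulExp 1 l').negOnePow • φ (prodVal l')) ?_,
    slotSum_prodVal hA hA.d_mem (fun i x y hx => by rw [one_mul]; exact hA.leibniz i x y hx)]
  · have hm : Adm (mapLeft dA 1 hA.d_mem (mainTerm hA 𝔤 l) :: c) := h.d (mainTerm_adm h 𝔤 hl)
    rw [show mapLeft dA 1 hA.d_mem (mainTerm hA 𝔤 l) = ((mapLeft dA 1 hA.d_mem (mainTerm hA 𝔤 l)).1,
      𝔤.brH (l.map Prod.snd)) from rfl] at hm ⊢
    rw [h1 _ (by simp [mapLeft, mainTerm, prodH_deg]) hm]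
    simp only [mapLeft, mainTerm, prodH_val, map_units_smul']
    rw [one_mul, add_comm, Int.negOnePow_succ, Units.neg_smul]
  · rintro l₁ t l₂ rfl
    have hsnd : (l₁ ++ mapLeft dA 1 hA.d_mem t :: l₂).map Prod.snd =
        (l₁ ++ t :: l₂).map Prod.snd := by simp [mapLeft]
    rw [eval_mainTerm h 𝔤 hF, hsnd, h1 _ ?_ ?_]
    · rfl
    · simp [prodHomog, mapLeft]; ring
    · exact prodHomog_adm h (mapLeft_perm_adm h hl)

/-- Nested terms are of four kinds: two brackets of `𝔤`, which vanish by Jacobi; `dA` after a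
bracket and a bracket after `dA`, which cancel by the Leibniz rule; and `dA` twice, which is zero.
-/
theorem jacobi_tensorBr (h : TensorAdmissible hA Adm) (𝔤 : CurvedLInfty 𝓡 dR I 𝓥) {p : ℤ}
    {F : List (PureTensor 𝓥 𝓐) → R} (hF : F ∈ tensorCochains 𝓡 𝓥 𝓐 Adm p)
    (l c : List (PureTensor 𝓥 𝓐)) (hl : Adm (l ++ c)) : (unshSum tdeg l fun a a' =>
      ((tensorBr hA 𝔤 a).map fun w => brSum (tensorBr hA 𝔤) F (w :: a') c).sum) = 0 := by
  have e : ∀ a a', ((tensorBr hA 𝔤 a).map fun w => brSum (tensorBr hA 𝔤) F (w :: a') c).sum =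
      F (mainTerm hA 𝔤 (mainTerm hA 𝔤 a :: a') :: c) +
      ((if a' = [] then F (mapLeft dA 1 hA.d_mem (mainTerm hA 𝔤 a) :: c) else 0) +
      brSum (slotBr (mapLeft dA 1 hA.d_mem)) (fun l => F (mainTerm hA 𝔤 l :: c)) a a') := by
    intro a a'
    rw [tensorBr_eq, List.map_cons, List.sum_cons, brSum_tensorBr, add_assoc]
    congr 1
    congr 1
    · rcases a' with _ | ⟨t, a'⟩
      · simp [brSum, slotBr]
      · simp [brSum, slotBr]
    · rw [brSum]
      congr 1
      refine List.map_congr_left fun w hw => ?_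
      rw [brSum_tensorBr, add_eq_left]
      refine brSum_eq_zero fun w' hw' => ?_
      obtain ⟨t, -, rfl⟩ := mem_slotBr hw
      obtain ⟨t', ht', rfl⟩ := mem_slotBr hw'
      obtain ⟨rfl, -⟩ := List.cons_eq_cons.1 ht'
      exact left_zero h hF (hA.d_d _)
  simp only [e, unshSum_add, jacobi_tensorBr_main h 𝔤 hF, zero_add]
  rw [unshSum_right_nil l fun a => F (mapLeft dA 1 hA.d_mem (mainTerm hA 𝔤 a) :: c)]
  have := jacobi_tensorBr_d h 𝔤 hF l c hl
  rw [vf] at this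
  rw [this, add_neg_cancel]

theorem tensor_maps (hR : IsCDGA 𝓡 dR) (h : TensorAdmissible hA Adm) (𝔤 : CurvedLInfty 𝓡 dR I 𝓥)
    {p : ℤ} {F : List (PureTensor 𝓥 𝓐) → R} (hF : F ∈ tensorCochains 𝓡 𝓥 𝓐 Adm p) :
    ceDiff dR tdeg (tensorBr hA 𝔤) Adm p F ∈ tensorCochains 𝓡 𝓥 𝓐 Adm (p + 1) :=
  (mem_tensorCochains_iff h).2 <| (isVectorField_tensorBr h 𝔤).ceDiff_mem hR h.admissible
    ((mem_tensorCochains_iff h).1 hF) fun hr hs hz hx hy =>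
      brSum_tensorBr_lin hR h 𝔤 hF hr hs hz hx hy

theorem tensor_sq (hR : IsCDGA 𝓡 dR) (h : TensorAdmissible hA Adm) (𝔤 : CurvedLInfty 𝓡 dR I 𝓥)
    {p : ℤ} {F : List (PureTensor 𝓥 𝓐) → R} (hF : F ∈ tensorCochains 𝓡 𝓥 𝓐 Adm p) :
    ceDiff dR tdeg (tensorBr hA 𝔤) Adm (p + 1) (ceDiff dR tdeg (tensorBr hA 𝔤) Adm p F) = 0 :=
  (isVectorField_tensorBr h 𝔤).ceDiff_ceDiff hR h.admissible
    ((mem_tensorCochains_iff h).1 hF) fun l c hl => jacobi_tensorBr h 𝔤 hF l c hl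

end TensorComplex

/-! ### Sums and commutators of operations on single letters. -/

section SlotAlgebra

set_option linter.unusedSectionVars false

variable {H : Type*} {deg : H → ℤ} {N : Type*} [AddCommGroup N]

theorem slotSum_add (e : ℤ) (σ : H → H) (F G : List H → N) (l : List H) :
    slotSum deg e σ (fun l' => F l' + G l') l = slotSum deg e σ F l + slotSum deg e σ G l := by
  induction l generalizing F G with
  | nil => simp [slotSum]
  | cons t l ih =>
    simp only [slotSum, ih (fun l' => F (t :: l')) (fun l' => G (t :: l')), smul_add]
    abel

theorem slotSum_map {N' : Type*} [AddCommGroup N'] (φ : N →+ N') (e : ℤ) (σ : H → H)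
    (F : List H → N) (l : List H) :
    slotSum deg e σ (fun l' => φ (F l')) l = φ (slotSum deg e σ F l) := by
  induction l generalizing F with
  | nil => simp [slotSum]
  | cons t l ih =>
    simp only [slotSum, ih (fun l' => F (t :: l')), map_add, Units.smul_def, map_zsmul]

theorem slotSum_rel {e : ℤ} {σ τ : H → H} {F G : List H → N} {l : List H} (φ : N →+ N)
    (h : ∀ l₁ t l₂, l = l₁ ++ t :: l₂ → F (l₁ ++ σ t :: l₂) = φ (G (l₁ ++ τ t :: l₂))) :
    slotSum deg e σ F l = φ (slotSum deg e τ G l) := by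
  induction l generalizing F G with
  | nil => simp [slotSum]
  | cons t l ih =>
    simp only [slotSum]
    rw [ih (F := fun l' => F (t :: l')) (G := fun l' => G (t :: l')) fun l₁ s l₂ hl =>
      h (t :: l₁) s l₂ (by simp [hl]), map_add, Units.smul_def, Units.smul_def, map_zsmul,
      show F (σ t :: l) = φ (G (τ t :: l)) from h [] t l rfl]

theorem slotSum_comb {e : ℤ} {σ τ ρ : H → H} {F : List H → N} {l : List H} (φ ψ : N →+ N)
    (h : ∀ l₁ t l₂, l = l₁ ++ t :: l₂ → F (l₁ ++ σ t :: l₂) =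
      φ (F (l₁ ++ τ t :: l₂)) + ψ (F (l₁ ++ ρ t :: l₂))) :
    slotSum deg e σ F l = φ (slotSum deg e τ F l) + ψ (slotSum deg e ρ F l) := by
  induction l generalizing F with
  | nil => simp [slotSum]
  | cons t l ih =>
    simp only [slotSum]
    rw [ih (F := fun l' => F (t :: l')) fun l₁ s l₂ hl =>
      h (t :: l₁) s l₂ (by simp [hl]), show F (σ t :: l) = _ from h [] t l rfl]
    simp only [List.nil_append, map_add, Units.smul_def, map_zsmul, smul_add]
    abel

/-- The graded commutator of two operations on letters. -/
theorem slotSum_slotSum {e e' : ℤ} {σ σ' : H → H} (hσ : ∀ t, deg (σ t) = deg t + e)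
    (hσ' : ∀ t, deg (σ' t) = deg t + e') (F : List H → N) (l : List H) :
    slotSum deg e σ (slotSum deg e' σ' F) l + (e * e').negOnePow •
        slotSum deg (e + e') (σ ∘ σ') F l =
      (e * e').negOnePow • slotSum deg e' σ' (slotSum deg e σ F) l +
        slotSum deg (e + e') (σ' ∘ σ) F l := by
  induction l generalizing F with
  | nil => simp [slotSum]
  | cons t l ih =>
    have h := ih fun l' => F (t :: l')
    simp only [slotSum, slotSum_add, slotSum_smul, Function.comp_apply, hσ, hσ', smul_add] at h ⊢
    have h' := congrArg ((e * deg t + e' * deg t).negOnePow • ·) h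
    simp only [smul_add, smul_smul, ← Int.negOnePow_add] at h' ⊢
    have e1 : ((e + e') * deg t).negOnePow = (e * deg t + e' * deg t).negOnePow := by
      congr 1; ring
    have e2 : (e * e' + (e + e') * deg t).negOnePow =
      (e * deg t + e' * deg t + e * e').negOnePow := by congr 1; ring
    have e3 : (e' * (deg t + e)).negOnePow = (e * e' + e' * deg t).negOnePow := by
      congr 1; ring
    have e4 : (e * e' + e * (deg t + e')).negOnePow = (e * deg t).negOnePow :=
      negOnePow_congr ⟨e * e', by ring⟩
    have e5 : (e * e' + (e' * deg t + e * deg t)).negOnePow =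
      (e * deg t + e' * deg t + e * e').negOnePow := by congr 1; ring
    simp only [e1, e2, e3, e4, e5]
    -- To the identity for the tail are added the terms in which one or both of the operations hit
    -- the first letter.
    have := congrArg (fun x => x + F (σ' (σ t) :: l) + (e * e').negOnePow • F (σ (σ' t) :: l) +
      (e * e' + e' * deg t).negOnePow • slotSum deg e' σ' (fun l' => F (σ t :: l')) l +
      (e * deg t).negOnePow • slotSum deg e σ (fun l' => F (σ' t :: l')) l) h'
    refine Eq.trans ?_ (this.trans ?_)
    · abel
    · abel

theorem slotSum_id (F : List H → N) (l : List H) :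
    slotSum deg 0 id F l = (l.length : ℤ) • F l := by
  induction l generalizing F with
  | nil => simp [slotSum]
  | cons t l ih =>
    rw [slotSum, ih fun l' => F (t :: l')]
    simp only [zero_mul, Int.negOnePow_zero, one_smul, List.length_cons, id]
    push_cast
    rw [add_smul, one_smul, add_comm]

variable {R : Type*} [Ring R] [Algebra ℝ R] {𝓡 : ℤ → Submodule ℝ R}
  {Rel : ℤ → ℤ → R → R → H → H → H → Prop} {Adm : List H → Prop}

theorem swap_front {F : List H → R} (hF : ∀ x y l₁ l₂, F (l₁ ++ x :: y :: l₂) =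
      (deg x * deg y).negOnePow • F (l₁ ++ y :: x :: l₂)) (t : H) (l₁ l₂ : List H) :
    F (l₁ ++ t :: l₂) = (deg t * wdeg deg l₁).negOnePow • F (t :: (l₁ ++ l₂)) := by
  induction l₁ generalizing F with
  | nil => simp
  | cons s l₁ ih =>
    have := hF s t [] (l₁ ++ l₂)
    simp only [List.nil_append] at this
    rw [List.cons_append, ih (F := fun l => F (s :: l)) fun x y m₁ m₂ => hF x y (s :: m₁) m₂,
      this, smul_smul, ← Int.negOnePow_add, wdeg_cons, List.cons_append]
    congr 2
    ring

-- The counterpart of `IsVectorField.ceDiff_mem` for a vector field of any degree that is linear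
-- over `R`, without a `d_R` term; it is applied to operations on left factors.
open Classical in
theorem IsVectorField.vf_cochain {p e : ℤ} {b : List H → List H} {F : List H → R}
    (hA : Admissible deg Rel Adm)
    (hb : IsVectorField 𝓡 deg Rel Adm e b) (hF : IsCochain 𝓡 deg Rel Adm p F)
    (hlin : ∀ {i j : ℤ} {r s : R} {x y z : H} {a c : List H}, r ∈ 𝓡 i → s ∈ 𝓡 j →
      Rel i j r s z x y → Adm (x :: (a ++ c)) → Adm (y :: (a ++ c)) → brSum b F (z :: a) c =
      (i * (p + e)).negOnePow • (r * brSum b F (x :: a) c) +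
      (j * (p + e)).negOnePow • (s * brSum b F (y :: a) c)) :
    IsCochain 𝓡 deg Rel Adm (p + e) (fun l => if Adm l then vf deg b F l else 0) where
  zero l h := if_neg h
  mem l := by
    split_ifs
    · exact hb.vf_mem hF l
    · exact zero_mem _
  lin := by
    intro i j r s x y z l hr hs hz hx hy
    rw [if_pos hx, if_pos hy, if_pos (hA.rel hz hx hy),
      hb.vf_lin hA hF hr hs hz hx hy 0 fun a c hp => by
        simpa using hlin hr hs hz (hA.perm (hp.symm.cons x) hx) (hA.perm (hp.symm.cons y) hy)]
    simp
  swap x y l₁ l₂ := by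
    have hperm : (l₁ ++ x :: y :: l₂).Perm (l₁ ++ y :: x :: l₂) :=
      (List.Perm.swap y x l₂).append_left l₁
    by_cases h : Adm (l₁ ++ x :: y :: l₂)
    · rw [if_pos h, if_pos (hA.perm hperm h), hb.vf_swap hA hF _ _ _ _ h]
    · rw [if_neg h, if_neg fun h' => h (hA.perm hperm.symm h'), smul_zero]

end SlotAlgebra

/-! ### Operators on functionals induced by homogeneous operators on `A`. -/

section SlotOps

set_option linter.unusedSectionVars false

variable {R : Type} [Ring R] [Algebra ℝ R] {𝓡 : ℤ → Submodule ℝ R} [GradedAlgebra 𝓡]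
  {dR : R →ₗ[ℝ] R} {I : Ideal R}
  {V : Type} [AddCommGroup V] [Module ℝ V] [Module R V] {𝓥 : ℤ → Submodule ℝ V}
  {A : Type} [Ring A] [Algebra ℝ A] {𝓐 : ℤ → Submodule ℝ A} {dA : A →ₗ[ℝ] A}

/-- A homogeneous linear operator on `A` that preserves admissibility of words. -/
structure SlotOp (𝓐 : ℤ → Submodule ℝ A) (Adm : List (PureTensor 𝓥 𝓐) → Prop) where
  toFun : A →ₗ[ℝ] A
  e : ℤ
  mem : ∀ i x, x ∈ 𝓐 i → toFun x ∈ 𝓐 (i + e)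
  adm : ∀ {t l}, Adm (t :: l) → Adm (mapLeft toFun e mem t :: l)

variable {Adm : List (PureTensor 𝓥 𝓐) → Prop} {hA : IsCDGA 𝓐 dA}

/-- The induced operation on pure tensors. -/
def SlotOp.map (θ : SlotOp 𝓐 Adm) : PureTensor 𝓥 𝓐 → PureTensor 𝓥 𝓐 := mapLeft θ.toFun θ.e θ.mem

theorem SlotOp.tdeg_map (θ : SlotOp 𝓐 Adm) (t : PureTensor 𝓥 𝓐) :
    tdeg (θ.map t) = tdeg t + θ.e := tdeg_mapLeft ..

theorem SlotOp.adm' (h : TensorAdmissible hA Adm) (θ : SlotOp 𝓐 Adm) {t : PureTensor 𝓥 𝓐}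
    {l₁ l₂ : List (PureTensor 𝓥 𝓐)} (hl : Adm (l₁ ++ t :: l₂)) : Adm (l₁ ++ θ.map t :: l₂) :=
  h.perm List.perm_middle.symm (θ.adm (h.perm List.perm_middle hl))

open Classical in
/-- The action of a slot operator on functionals. -/
noncomputable def SlotOp.app (θ : SlotOp 𝓐 Adm) : (List (PureTensor 𝓥 𝓐) → R) →ₗ[ℝ]
    (List (PureTensor 𝓥 𝓐) → R) where
  toFun F l := if Adm l then slotSum tdeg θ.e θ.map F l else 0
  map_add' F G := by
    funext l
    by_cases h : Adm l
    · simp only [h, if_true, Pi.add_apply]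
      exact slotSum_add θ.e θ.map F G l
    · simp [h]
  map_smul' c F := by
    funext l
    by_cases h : Adm l
    · simp only [h, if_true, Pi.smul_apply]
      exact slotSum_map (DistribSMul.toAddMonoidHom R c) θ.e θ.map F l
    · simp [h]

theorem SlotOp.app_of_adm (θ : SlotOp 𝓐 Adm) (F : List (PureTensor 𝓥 𝓐) → R)
    {l : List (PureTensor 𝓥 𝓐)} (h : Adm l) : θ.app F l = slotSum tdeg θ.e θ.map F l :=
  if_pos h

theorem SlotOp.app_of_not (θ : SlotOp 𝓐 Adm) (F : List (PureTensor 𝓥 𝓐) → R)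
    {l : List (PureTensor 𝓥 𝓐)} (h : ¬ Adm l) : θ.app F l = 0 :=
  if_neg h

variable [SetLike.GradedSMul 𝓡 𝓥] [IsScalarTower ℝ R V]

/-- A slot operator acts as the vector field whose only Taylor coefficient is unary (`vf_slotBr`).
It does not touch right factors, so there is no inhomogeneous term. -/
theorem SlotOp.app_mem (h : TensorAdmissible hA Adm) (θ : SlotOp 𝓐 Adm) {p : ℤ}
    {F : List (PureTensor 𝓥 𝓐) → R} (hF : F ∈ tensorCochains 𝓡 𝓥 𝓐 Adm p) :
    θ.app F ∈ tensorCochains 𝓡 𝓥 𝓐 Adm (p + θ.e) := by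
  have hb : IsVectorField 𝓡 tdeg TensorRel Adm θ.e (slotBr θ.map) :=
    { deg_eq := fun hw => by
        obtain ⟨t, rfl, rfl⟩ := mem_slotBr hw
        simpa [wdeg] using θ.tdeg_map t
      adm := fun hw hl => by
        obtain ⟨t, rfl, rfl⟩ := mem_slotBr hw
        exact θ.adm hl
      swap := fun _ x y l₁ l₂ c _ => by
        simp only [brSum, slotBr_append_cons_cons, List.map_nil, List.sum_nil, smul_zero] }
  have hF' := (mem_tensorCochains_iff h).1 hF
  have := hb.vf_cochain h.admissible hF' ?_
  · rw [mem_tensorCochains_iff h]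
    convert this using 1
    funext l
    by_cases hl : Adm l
    · rw [θ.app_of_adm F hl, if_pos hl, vf_slotBr θ.tdeg_map hF'.swap]
    · rw [θ.app_of_not F hl, if_neg hl]
  · intro i j r s x y z a c hr hs hz hx hy
    rcases a with _ | ⟨b, a⟩
    · simp only [brSum, slotBr, List.map_cons, List.map_nil, List.sum_cons, List.sum_nil,
          add_zero]
      have hc : ∀ (i : ℤ) (r x : R), (i * p).negOnePow • ((i * θ.e).negOnePow • r * x) =
          (i * (p + θ.e)).negOnePow • (r * x) := fun i r x => by
        rw [units_smul_mul, smul_smul, ← Int.negOnePow_add, mul_add]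
      rw [← hc, ← hc]
      refine hF'.lin (units_smul_mem _ hr) (units_smul_mem _ hs) ?_ (θ.adm hx) (θ.adm hy)
      rcases hz with ⟨h1, h2, h3⟩ | ⟨rfl, rfl, h1, h2, h3, h4, t, t', rfl, rfl, h5⟩
      · refine Or.inl ⟨?_, ?_, h3.deg_left, h3.deg_right, ?_⟩
        · simp only [SlotOp.map, mapLeft, h1]
        · simp only [SlotOp.map, mapLeft, h2]
        · refine h3.val.trans ?_
          simp only [SlotOp.map, mapLeft, smul_smul, ← Int.negOnePow_add]
          congr 3
          · exact negOnePow_congr ⟨-(i * θ.e), by ring⟩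
          · exact negOnePow_congr ⟨-(j * θ.e), by ring⟩
      · exact Or.inr ⟨rfl, rfl, h1, h2, by simp [SlotOp.map, mapLeft, h3],
          by simp [SlotOp.map, mapLeft, h4], t, t', by simp, by simp,
          by simp [SlotOp.map, mapLeft, h5]⟩
    · simp [brSum, slotBr]

/-- Linearity of a cochain in the left factor of an arbitrary argument. -/
theorem slot_lin (h : TensorAdmissible hA Adm) {p : ℤ} {F : List (PureTensor 𝓥 𝓐) → R}
    (hF : F ∈ tensorCochains 𝓡 𝓥 𝓐 Adm p) {x y z : Homog 𝓐} {v : Homog 𝓥}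
    {l₁ l₂ : List (PureTensor 𝓥 𝓐)} {t t' : ℝ} (hx : Adm (l₁ ++ (x, v) :: l₂))
    (hy : Adm (l₁ ++ (y, v) :: l₂))
    (h1 : z.deg = x.deg) (h2 : z.deg = y.deg) (h3 : z.val = t • x.val + t' • y.val) :
    F (l₁ ++ (z, v) :: l₂) = t • F (l₁ ++ (x, v) :: l₂) + t' • F (l₁ ++ (y, v) :: l₂) := by
  have hs := IsTensorCochain.swap (hF : IsTensorCochain 𝓡 𝓥 𝓐 Adm p F)
  rw [swap_front hs, swap_front hs (x, v), swap_front hs (y, v),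
    left_lin h hF (h.perm List.perm_middle hx) (h.perm List.perm_middle hy) h1 h2 h3]
  simp only [tdeg, ← h1, ← h2, smul_add, smul_comm t, smul_comm t']

theorem slot_units (h : TensorAdmissible hA Adm) {p : ℤ} {F : List (PureTensor 𝓥 𝓐) → R}
    (hF : F ∈ tensorCochains 𝓡 𝓥 𝓐 Adm p) {x z : Homog 𝓐} {v : Homog 𝓥}
    {l₁ l₂ : List (PureTensor 𝓥 𝓐)} (u : ℤˣ) (h1 : z.deg = x.deg) (h2 : z.val = u • x.val) :
    F (l₁ ++ (z, v) :: l₂) = u • F (l₁ ++ (x, v) :: l₂) := by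
  have hs := IsTensorCochain.swap (hF : IsTensorCochain 𝓡 𝓥 𝓐 Adm p F)
  rw [swap_front hs, swap_front hs (x, v), left_units h hF u h1 h2]
  simp only [tdeg, ← h1, smul_comm u]

/-- The graded commutator of two slot operators. -/
theorem SlotOp.app_app (h : TensorAdmissible hA Adm) (θ θ' η : SlotOp 𝓐 Adm) (u : ℤˣ)
    (hu : (θ.e * θ'.e).negOnePow = u) (he : η.e = θ.e + θ'.e)
    (hη : ∀ a, η.toFun a = θ'.toFun (θ.toFun a) - u • θ.toFun (θ'.toFun a)) {p : ℤ}
    {F : List (PureTensor 𝓥 𝓐) → R} (hF : F ∈ tensorCochains 𝓡 𝓥 𝓐 Adm p) :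
    θ.app (θ'.app F) = u • θ'.app (θ.app F) + η.app F := by
  funext l
  by_cases hl : Adm l
  · have key := slotSum_slotSum (deg := tdeg) θ.tdeg_map θ'.tdeg_map F l
    have e1 : ∀ α β : SlotOp 𝓐 Adm, α.app (β.app F) l =
        slotSum tdeg α.e α.map (slotSum tdeg β.e β.map F) l := fun α β => by
      rw [α.app_of_adm _ hl]
      refine slotSum_congr fun l₁ t l₂ hl' => ?_
      rw [β.app_of_adm _ (α.adm' h (hl' ▸ hl))]
    rw [Pi.add_apply, Pi.smul_apply, e1, e1, η.app_of_adm _ hl]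
    rw [hu] at key
    rw [eq_sub_of_add_eq key, add_sub_assoc, he]
    congr 1
    have hu' : ∀ x : A, u • x = ((u : ℤ) : ℝ) • x := fun x => by
      rw [Units.smul_def, ← Int.cast_smul_eq_zsmul ℝ]
    rw [sub_eq_iff_eq_add]
    have := slotSum_comb (deg := tdeg) (e := θ.e + θ'.e) (σ := θ'.map ∘ θ.map) (τ := η.map)
      (ρ := θ.map ∘ θ'.map) (F := F) (l := l) (AddMonoidHom.id R)
      (DistribSMul.toAddMonoidHom R u) ?_
    · exact this
    · intro l₁ t l₂ hl'
      have hη' : θ'.toFun (θ.toFun t.1.val) = (1 : ℝ) • η.toFun t.1.val +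
          ((u : ℤ) : ℝ) • θ.toFun (θ'.toFun t.1.val) := by
        rw [hη, hu']; simp
      have hl1 : Adm (l₁ ++ t :: l₂) := hl' ▸ hl
      have := slot_lin h hF (z := (θ'.map (θ.map t)).1) (x := (η.map t).1)
        (y := (θ.map (θ'.map t)).1) (v := t.2) (l₁ := l₁) (l₂ := l₂) (t := 1)
        (t' := ((u : ℤ) : ℝ)) (η.adm' h hl1) (θ.adm' h (θ'.adm' h hl1))
        (by simp [SlotOp.map, mapLeft, he, add_assoc])
        (by simp [SlotOp.map, mapLeft]; ring) hη'
      simp only [AddMonoidHom.id_apply, DistribSMul.toAddMonoidHom_apply, Function.comp_apply]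
      rw [Units.smul_def, ← Int.cast_smul_eq_zsmul ℝ]
      simp only [one_smul] at this
      exact this
  · simp only [SlotOp.app_of_not _ _ hl, Pi.add_apply, Pi.smul_apply, smul_zero, add_zero]

theorem SlotOp.app_eq_zero (h : TensorAdmissible hA Adm) (θ : SlotOp 𝓐 Adm)
    (h0 : ∀ a, θ.toFun a = 0) {p : ℤ} {F : List (PureTensor 𝓥 𝓐) → R}
    (hF : F ∈ tensorCochains 𝓡 𝓥 𝓐 Adm p) : θ.app F = 0 := by
  funext l
  by_cases hl : Adm l
  · rw [θ.app_of_adm _ hl, slotSum_rel (τ := θ.map) (G := F) (0 : R →+ R)]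
    · rfl
    · intro l₁ t l₂ _
      have hs := IsTensorCochain.swap (hF : IsTensorCochain 𝓡 𝓥 𝓐 Adm p F)
      rw [swap_front hs]
      change _ • F ((_, _) :: _) = _
      rw [left_zero h hF (h0 _)]
      simp
  · exact θ.app_of_not _ hl

/-- The identity of `A` acts as a derivation on words and so counts letters. Division by this number
produces the homotopies. -/
theorem SlotOp.app_one (θ : SlotOp 𝓐 Adm) (he : θ.e = 0) (h1 : ∀ a, θ.toFun a = a)
    {F : List (PureTensor 𝓥 𝓐) → R} {l : List (PureTensor 𝓥 𝓐)} (hl : Adm l) :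
    θ.app F l = (l.length : ℝ) • F l := by
  have : θ.map = id := by
    funext t
    exact Prod.ext (Homog.ext' (by simp [SlotOp.map, mapLeft, he])
      (by simp [SlotOp.map, mapLeft, h1])) rfl
  rw [θ.app_of_adm _ hl, this, he, slotSum_id, natCast_zsmul, Nat.cast_smul_eq_nsmul ℝ]

end SlotOps

/-! ### Functionals on `A ⊗ 𝔤` from functionals on `𝔤` -/

section Push

set_option linter.unusedSectionVars false

variable {R : Type} [Ring R] [Algebra ℝ R] {𝓡 : ℤ → Submodule ℝ R} [GradedAlgebra 𝓡]
  {dR : R →ₗ[ℝ] R} {I : Ideal R}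
  {V : Type} [AddCommGroup V] [Module ℝ V] [Module R V] {𝓥 : ℤ → Submodule ℝ V}
  {A : Type} [Ring A] [Algebra ℝ A] {𝓐 : ℤ → Submodule ℝ A} {dA : A →ₗ[ℝ] A}

open Classical in
/-- The functional `(a₁ ⊗ v₁, …, aₙ ⊗ vₙ) ↦ ± φ(a₁ ⋯ aₙ) F(v₁, …, vₙ)`, for `F` of degree `p`. -/
noncomputable def push (Adm : List (PureTensor 𝓥 𝓐) → Prop) (φ : A →ₗ[ℝ] ℝ) (p : ℤ)
    (F : List (Homog 𝓥) → R) (l : List (PureTensor 𝓥 𝓐)) : R :=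
  if Adm l then (koszulExp p l).negOnePow • (φ (prodVal l) • F (l.map Prod.snd)) else 0

variable {Adm : List (PureTensor 𝓥 𝓐) → Prop} {hA : IsCDGA 𝓐 dA}

theorem push_of_adm (φ : A →ₗ[ℝ] ℝ) (p : ℤ) (F : List (Homog 𝓥) → R)
    {l : List (PureTensor 𝓥 𝓐)} (h : Adm l) : push Adm φ p F l =
      (koszulExp p l).negOnePow • (φ (prodVal l) • F (l.map Prod.snd)) := if_pos h

theorem push_of_not (φ : A →ₗ[ℝ] ℝ) (p : ℤ) (F : List (Homog 𝓥) → R)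
    {l : List (PureTensor 𝓥 𝓐)} (h : ¬ Adm l) : push Adm φ p F l = 0 := if_neg h

theorem push_add (φ : A →ₗ[ℝ] ℝ) (p : ℤ) (F G : List (Homog 𝓥) → R) :
    push Adm φ p (F + G) = push Adm φ p F + push Adm φ p G := by
  funext l
  by_cases h : Adm l <;> simp [push, h, smul_add]

theorem push_smul (φ : A →ₗ[ℝ] ℝ) (p : ℤ) (c : ℝ) (F : List (Homog 𝓥) → R) :
    push Adm φ p (c • F) = c • push Adm φ p F := by
  funext l
  by_cases h : Adm l
  · simp only [push, h, if_true, Pi.smul_apply, smul_comm _ c]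
  · simp [push, h]

/-- As `φ` vanishes outside degree `k`, only words whose left degrees add up to `k` matter. On these
the total left degree may be replaced by `k` in every sign, and the degree drops from `p` to `p -
k`. -/
theorem push_mem (h : TensorAdmissible hA Adm) {φ : A →ₗ[ℝ] ℝ} {k : ℤ}
    (hφ : ∀ i x, x ∈ 𝓐 i → i ≠ k → φ x = 0) {p : ℤ} {F : List (Homog 𝓥) → R}
    (hF : F ∈ reducedCochains 𝓡 𝓥 p) : push Adm φ p F ∈ tensorCochains 𝓡 𝓥 𝓐 Adm (p - k) := by
  replace hF : IsReducedCochain 𝓡 𝓥 p F := hF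
  have hzero : ∀ l : List (PureTensor 𝓥 𝓐), adeg l ≠ k → φ (prodVal l) = 0 := fun l hl =>
    hφ _ _ (prodVal_mem hA l) hl
  have hright : ∀ {a : Homog 𝓐} {v w : Homog 𝓥} {l}, Adm ((a, v) :: l) ↔ Adm ((a, w) :: l) :=
    ⟨h.right, h.right⟩
  refine (⟨fun l hl => push_of_not _ _ _ hl, fun l => ?_, fun x y z v l hx hy h1 h2 h3 => ?_,
    fun c x z v l hx h1 h2 => ?_, fun a x y z l h1 h2 h3 => ?_, fun e r hr a x z l h1 h2 => ?_,
    fun x y l₁ l₂ => ?_⟩ : IsTensorCochain 𝓡 𝓥 𝓐 Adm (p - k) _)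
  · by_cases hl : Adm l
    · rw [push_of_adm _ _ _ hl]
      by_cases hd : adeg l = k
      · have := hF.mem (l.map Prod.snd)
        refine units_smul_mem _ (Submodule.smul_mem _ _ ?_)
        have e : p - k + (l.map tdeg).sum = p + ((l.map Prod.snd).map Homog.deg).sum := by
          rw [show (l.map tdeg).sum = adeg l + vdeg l from wdeg_tdeg l,
            show ((l.map Prod.snd).map Homog.deg).sum = vdeg l from wdeg_map_snd l, hd]
          ring
        rwa [e]
      · simp [hzero l hd]
    · rw [push_of_not _ _ _ hl]
      exact zero_mem _
  · have hz : Adm ((z, v) :: l) :=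
      h.comb (t := 1) (t' := 1) hx hy h2 (by omega) (by simpa using h3)
    rw [push_of_adm _ _ _ hx, push_of_adm _ _ _ hy, push_of_adm _ _ _ hz]
    simp only [koszulExp, h1, h2, h3, prodVal_cons, add_mul, map_add, add_smul, smul_add,
      List.map_cons]
  · have hz : Adm ((z, v) :: l) := h.comb (t := c) (t' := 0) hx hx h1 h1 (by simpa using h2)
    rw [push_of_adm _ _ _ hx, push_of_adm _ _ _ hz]
    simp only [koszulExp, h1, h2, prodVal_cons, smul_mul_assoc, map_smul, smul_assoc,
      List.map_cons, smul_comm c]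
  · by_cases hx : Adm ((a, x) :: l)
    · have hF' := hF.add x y z (l.map Prod.snd) h1 h2 h3
      rw [push_of_adm _ _ _ hx, push_of_adm _ _ _ (hright.1 hx), push_of_adm _ _ _ (hright.1 hx)]
      simp only [koszulExp, h1, h2, prodVal_cons, List.map_cons, hF', smul_add]
    · rw [push_of_not _ _ _ hx, push_of_not _ _ _ fun h' => hx (hright.1 h'),
        push_of_not _ _ _ fun h' => hx (hright.1 h'), add_zero]
  · by_cases hx : Adm ((a, x) :: l)
    · have hF' := hF.smul e r hr x z (l.map Prod.snd) h1 h2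
      rw [push_of_adm _ _ _ hx, push_of_adm _ _ _ (hright.1 hx)]
      by_cases hd : adeg ((a, x) :: l) = k
      · simp only [adeg, wdeg_cons] at hd
        simp only [koszulExp, h1, prodVal_cons, List.map_cons, hF', mul_smul_comm]
        rw [smul_comm (φ _) (e * p).negOnePow, smul_smul, smul_smul, ← Int.negOnePow_add,
          ← Int.negOnePow_add, koszulExp_eq, koszulExp_eq (p + x.deg)]
        congr 1
        refine negOnePow_congr ⟨e * k - e * a.deg, ?_⟩
        rw [← hd]
        simp only [adeg]
        ring
      · simp [show φ (a.val * prodVal l) = 0 by simpa using hzero _ hd]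
    · rw [push_of_not _ _ _ hx, push_of_not _ _ _ fun h' => hx (hright.1 h'), mul_zero, smul_zero]
  · have hperm : (l₁ ++ x :: y :: l₂).Perm (l₁ ++ y :: x :: l₂) :=
      (List.Perm.swap y x l₂).append_left l₁
    by_cases hl : Adm (l₁ ++ x :: y :: l₂)
    · rw [push_of_adm _ _ _ hl, push_of_adm _ _ _ (h.perm hperm hl), prodVal_swap hA, koszulExp_swap,
        map_units_smul']
      simp only [List.map_append, List.map_cons, hF.swap x.2 y.2]
      simp only [smul_assoc, smul_comm (φ _), smul_smul, ← Int.negOnePow_add]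
      congr 1
      exact negOnePow_congr ⟨- x.1.deg * y.2.deg, by simp only [tdeg]; ring⟩
    · rw [push_of_not _ _ _ hl, push_of_not _ _ _ fun h' => hl (h.perm hperm.symm h'), smul_zero]

/-- The action of a derivation of `A`. -/
theorem SlotOp.app_push (h : TensorAdmissible hA Adm) (θ : SlotOp 𝓐 Adm)
    (hder : ∀ i x y, x ∈ 𝓐 i →
      θ.toFun (x * y) = θ.toFun x * y + (θ.e * i).negOnePow • (x * θ.toFun y))
    (φ : A →ₗ[ℝ] ℝ) (p : ℤ) (F : List (Homog 𝓥) → R) :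
    θ.app (push Adm φ p F) = (θ.e * p).negOnePow • push Adm (φ ∘ₗ θ.toFun) p F := by
  funext l
  by_cases hl : Adm l
  · rw [θ.app_of_adm _ hl, Pi.smul_apply, push_of_adm _ _ _ hl]
    have := slotSum_prodVal hA θ.mem hder p
      ((LinearMap.toSpanSingleton ℝ R (F (l.map Prod.snd))) ∘ₗ φ) l
    rw [Int.negOnePow_add, mul_smul] at this
    refine Eq.trans (slotSum_congr fun l₁ t l₂ hl' => ?_) this
    rw [push_of_adm _ _ _ (θ.adm' h (hl' ▸ hl))]
    simp [hl', SlotOp.map, mapLeft]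
  · rw [θ.app_of_not _ hl, Pi.smul_apply, push_of_not _ _ _ hl, smul_zero]

variable [SetLike.GradedSMul 𝓡 𝓥] [IsScalarTower ℝ R V]

/-- The brackets of `𝔤` are collected by `unshSum_tensor`, and the terms with `dA` by the Leibniz
rule in the form of `SlotOp.app_push`. -/
theorem vf_push (h : TensorAdmissible hA Adm) (𝔤 : CurvedLInfty 𝓡 dR I 𝓥) {φ : A →ₗ[ℝ] ℝ} {k : ℤ}
    (hφ : ∀ i x, x ∈ 𝓐 i → i ≠ k → φ x = 0) {p : ℤ} {F : List (Homog 𝓥) → R}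
    (hF : F ∈ reducedCochains 𝓡 𝓥 p) {l : List (PureTensor 𝓥 𝓐)} (hl : Adm l) :
    vf tdeg (tensorBr hA 𝔤) (push Adm φ p F) l =
      (koszulExp (p + 1) l).negOnePow • (φ (prodVal l) •
        vf Homog.deg (fun l => [𝔤.brH l]) F (l.map Prod.snd)) +
      p.negOnePow • push Adm (φ ∘ₗ dA) p F l := by
  have hd := (SlotOp.app_push h (⟨dA, 1, hA.d_mem, h.d⟩ : SlotOp 𝓐 Adm)
    (fun i x y hx => by simpa using hA.leibniz i x y hx) φ p F)
  have hd' := congrFun hd l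
  rw [SlotOp.app_of_adm _ _ hl] at hd'
  have hs := IsTensorCochain.swap (push_mem h hφ hF : IsTensorCochain 𝓡 𝓥 𝓐 Adm (p - k) _)
  rw [← vf_slotBr (SlotOp.tdeg_map _) hs] at hd'
  simp only [Pi.smul_apply, one_mul] at hd'
  rw [← hd', vf, vf, show (brSum (tensorBr hA 𝔤) (push Adm φ p F) :
      List (PureTensor 𝓥 𝓐) → List (PureTensor 𝓥 𝓐) → R) = fun a c =>
      push Adm φ p F (mainTerm hA 𝔤 a :: c) + brSum (slotBr (mapLeft dA 1 hA.d_mem)) _ a c from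
      funext fun a => funext fun c => brSum_tensorBr ..]
  rw [unshSum_add]
  congr 1
  have key := unshSum_tensor hA l (fun x va vc => φ x • F (𝔤.brH va :: vc)) fun u x a c => by
    rw [map_units_smul', smul_assoc]
  rw [show brSum (fun l => [𝔤.brH l]) F = fun a c => F (𝔤.brH a :: c) from
    funext fun a => funext fun c => by simp [brSum]]
  rw [koszulExp_eq, Int.negOnePow_add, mul_smul]
  have e1 : φ (prodVal l) • unshSum Homog.deg (l.map Prod.snd) (fun a c => F (𝔤.brH a :: c)) =
      unshSum Homog.deg (l.map Prod.snd) (fun a c => φ (prodVal l) • F (𝔤.brH a :: c)) :=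
    map_unshSum (DistribSMul.toAddMonoidHom R (φ (prodVal l))) _ _
  rw [e1, ← key, ← unshSum_smul]
  refine unshSum_congr fun a c hp => ?_
  rw [push_of_adm _ _ _ (mainTerm_adm h 𝔤 (h.perm hp.symm hl)), prodVal_cons]
  rw [show adeg l = adeg a + adeg c from (wdeg_perm hp).symm.trans (wdeg_append ..)]
  simp only [mainTerm, koszulExp, prodH_deg, prodH_val, smul_mul_assoc, map_units_smul', brH_deg,
    List.map_cons, smul_assoc, smul_smul, ← Int.negOnePow_add]
  rw [koszulExp_eq, koszulExp_eq 1]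
  congr 1
  refine negOnePow_congr ⟨0, ?_⟩
  simp only [adeg, vdeg]
  ring

/-- On the empty word the vector field gives `F(ℓ₀)`, a constant that the reduced complex discards;
the condition `φ 1 = 0` removes it on the other side as well. -/
theorem ceDiff_push_apply (h : TensorAdmissible hA Adm) (𝔤 : CurvedLInfty 𝓡 dR I 𝓥)
    {φ : A →ₗ[ℝ] ℝ} {k : ℤ} (hφ : ∀ i x, x ∈ 𝓐 i → i ≠ k → φ x = 0) {p : ℤ}
    {F : List (Homog 𝓥) → R} (hF : F ∈ reducedCochains 𝓡 𝓥 p) {l : List (PureTensor 𝓥 𝓐)}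
    (hl : Adm l) (h1 : l = [] → φ 1 = 0) :
    ceDiff dR tdeg (tensorBr hA 𝔤) Adm (p - k) (push Adm φ p F) l = k.negOnePow •
      (push Adm φ (p + 1) ((reducedCE 𝔤).D p F) l - push Adm (φ ∘ₗ dA) p F l) := by
  rw [ceDiff_apply _ _ _ _ hl, vf_push h 𝔤 hφ hF hl,
    push_of_adm _ _ _ hl, push_of_adm φ _ _ hl, smul_add, smul_sub, smul_smul _ p.negOnePow,
    ← Int.negOnePow_add, ← sub_sub]
  congr 1
  · by_cases hd : adeg l = k
    · rcases eq_or_ne l [] with rfl | hne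
      · simp [h1 rfl]
      · simp only [reducedCE]
        rw [ceDiff_apply _ _ _ _ (by simpa using hne), smul_sub, smul_sub, smul_sub,
          map_units_smul', map_smul, smul_comm (φ (prodVal l)) (p.negOnePow)]
        simp only [smul_smul _ _ (φ _ • _), ← Int.negOnePow_add]
        congr 2
        · refine negOnePow_congr ⟨-k, ?_⟩
          rw [koszulExp_eq p, koszulExp_eq (p + 1), hd]; ring
        · exact negOnePow_congr ⟨-k, by ring⟩
    · simp [hφ _ _ (prodVal_mem hA l) hd]
  · congr 1
    exact negOnePow_congr ⟨p - k, by ring⟩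

theorem ceDiff_push (h : TensorAdmissible hA Adm) (𝔤 : CurvedLInfty 𝓡 dR I 𝓥) {φ : A →ₗ[ℝ] ℝ}
    {k : ℤ} (hφ : ∀ i x, x ∈ 𝓐 i → i ≠ k → φ x = 0) (h1 : Adm [] → φ 1 = 0) {p : ℤ}
    {F : List (Homog 𝓥) → R} (hF : F ∈ reducedCochains 𝓡 𝓥 p) :
    ceDiff dR tdeg (tensorBr hA 𝔤) Adm (p - k) (push Adm φ p F) = k.negOnePow •
      (push Adm φ (p + 1) ((reducedCE 𝔤).D p F) - push Adm (φ ∘ₗ dA) p F) := by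
  funext l
  by_cases hl : Adm l
  · exact ceDiff_push_apply h 𝔤 hφ hF hl fun h' => h1 (h' ▸ hl)
  · rw [ceDiff_of_not _ _ _ _ hl, Pi.smul_apply, Pi.sub_apply, push_of_not _ _ _ hl,
      push_of_not _ _ _ hl, sub_zero, smul_zero]

/-- The sign comes from moving `r` past left factors of total degree `k`; it is the Koszul sign in
the linearity statements for the comparison maps. -/
theorem push_smul_left (φ : A →ₗ[ℝ] ℝ) {k : ℤ} (hA : IsCDGA 𝓐 dA)
    (hφ : ∀ i x, x ∈ 𝓐 i → i ≠ k → φ x = 0) (p a : ℤ) (r : R) (F : List (Homog 𝓥) → R) :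
    push Adm φ (p + a) (r • F) = (a * k).negOnePow • r • push Adm φ p F := by
  funext l
  by_cases hl : Adm l
  · rw [Pi.smul_apply, Pi.smul_apply, push_of_adm _ _ _ hl, push_of_adm _ _ _ hl]
    by_cases hd : adeg l = k
    · rw [koszulExp_eq, koszulExp_eq p, hd, Pi.smul_apply, smul_eq_mul, smul_eq_mul, mul_smul_comm,
        mul_smul_comm, smul_smul, ← Int.negOnePow_add]
      congr 2
      ring
    · simp [hφ _ _ (prodVal_mem hA l) hd]
  · rw [Pi.smul_apply, Pi.smul_apply, push_of_not _ _ _ hl, push_of_not _ _ _ hl, smul_zero,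
      smul_zero]

end Push

/-! ### Filtration by powers of the nilpotent ideal -/

section Filtration

variable {R : Type} [Ring R] [Algebra ℝ R]

/-- The right ideal generated by the products of `k` elements of `I`. -/
def idealPow (I : Ideal R) (k : ℕ) : Submodule ℝ R :=
  Submodule.span ℝ {x | ∃ (l : List R) (r : R), l.length = k ∧ (∀ a ∈ l, a ∈ I) ∧ x = l.prod * r}

theorem mem_idealPow_zero (I : Ideal R) (x : R) : x ∈ idealPow I 0 :=
  Submodule.subset_span ⟨[], x, rfl, by simp, by simp⟩

theorem mul_mem_idealPow {I : Ideal R} {k : ℕ} {a x : R} (ha : a ∈ I) (hx : x ∈ idealPow I k) :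
    a * x ∈ idealPow I (k + 1) := by
  induction hx using Submodule.span_induction with
  | mem x h =>
    obtain ⟨l, r, h1, h2, rfl⟩ := h
    refine Submodule.subset_span ⟨a :: l, r, by simp [h1], ?_, by simp [mul_assoc]⟩
    intro b hb
    rcases List.mem_cons.1 hb with rfl | hb
    · exact ha
    · exact h2 b hb
  | zero => simp
  | add x y _ _ hx hy => rw [mul_add]; exact add_mem hx hy
  | smul c x _ hx => rw [mul_smul_comm]; exact Submodule.smul_mem _ _ hx

theorem idealPow_succ_le (I : Ideal R) (k : ℕ) : idealPow I (k + 1) ≤ idealPow I k := by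
  refine Submodule.span_le.2 ?_
  rintro x ⟨l, r, h1, h2, rfl⟩
  rcases List.eq_nil_or_concat l with rfl | ⟨l', a, rfl⟩
  · simp at h1
  · refine Submodule.subset_span ⟨l', a * r, by simpa using h1, fun b hb => h2 b ?_, ?_⟩
    · simp [hb]
    · simp [mul_assoc]

theorem idealPow_antitone (I : Ideal R) : Antitone (idealPow I) :=
  antitone_nat_of_succ_le (idealPow_succ_le I)

theorem idealPow_eq_bot {I : Ideal R} {n : ℕ}
    (h : ∀ l : List R, l.length = n → (∀ x ∈ l, x ∈ I) → l.prod = 0) : idealPow I n = ⊥ := by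
  refine (Submodule.span_eq_bot).2 ?_
  rintro x ⟨l, r, h1, h2, rfl⟩
  rw [h l h1 h2, zero_mul]

variable {H : Type*}

/-- The filtration on functionals for which both `I²` and the length of words count. -/
def IsOrder (I : Ideal R) (m : ℕ) (F : List H → R) : Prop :=
  ∀ l, F l ∈ idealPow I ((m - l.length + 1) / 2)

theorem isOrder_zero (I : Ideal R) (F : List H → R) : IsOrder I 0 F := fun l => by
  rw [show (0 - l.length + 1) / 2 = 0 by omega]
  exact mem_idealPow_zero I _

/-- Order `m` forces the value on a word of length `k` into the power of `I` with exponent `(m - k)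
/ 2` rounded up, which is at least `n` here. -/
theorem IsOrder.eq_zero {I : Ideal R} {n m : ℕ} (hI : idealPow I n = ⊥) {F : List H → R}
    (hF : IsOrder I m F) {l : List H} (h : l.length + 2 * n ≤ m) : F l = 0 := by
  have := idealPow_antitone I (show n ≤ (m - l.length + 1) / 2 by omega) (hF l)
  rwa [hI, Submodule.mem_bot] at this

/-- The functional with the given components in each length. -/
def assemble (F : ℕ → List H → R) (l : List H) : R := F l.length l

/-- A perturbation lemma: if every element of `S'` that `D` maps to `B'` can be moved into `B`,
up to elements of higher order, by subtracting elements of the image of `D`, then so it can be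
without the error. -/
theorem exists_of_step {I : Ideal R} {n : ℕ} (hI : idealPow I n = ⊥)
    {S S' B B' : Submodule ℝ (List H → R)} {D D' : (List H → R) →ₗ[ℝ] (List H → R)}
    (hS : ∀ F : ℕ → List H → R, (∀ n, F n ∈ S) → assemble F ∈ S)
    (hB : ∀ F : ℕ → List H → R, (∀ n, F n ∈ B) → assemble F ∈ B)
    (hD : ∀ (F G : List H → R) (l : List H), (∀ l', l'.length ≤ l.length + 1 → F l' = G l') →
      D F l = D G l)
    (hDS : ∀ y ∈ S, D y ∈ S') (hDD : ∀ y ∈ S, D' (D y) = 0)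
    (hBS : B ≤ S') (hDB : ∀ b ∈ B, D' b ∈ B')
    (step : ∀ (m : ℕ), ∀ x ∈ S', D' x ∈ B' → IsOrder I m x → ∃ y ∈ S, ∃ b ∈ B, IsOrder I m y ∧
      IsOrder I m b ∧ IsOrder I (m + 1) (x - D y - b)) {x : List H → R} (hx : x ∈ S')
    (hDx : D' x ∈ B') : ∃ y ∈ S, x - D y ∈ B := by
  choose! fy hy fb hb h1 h2 h3 using step
  -- The successive remainders: `X m` has order `m`, and its differential stays in `B'` because `D'
  -- D = 0` and `D'` maps `B` to `B'`.
  let X : ℕ → List H → R := fun m => Nat.rec x (fun m x' => x' - D (fy m x') - fb m x') m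
  have hX : ∀ m, X m ∈ S' ∧ D' (X m) ∈ B' ∧ IsOrder I m (X m) := by
    intro m
    induction m with
    | zero => exact ⟨hx, hDx, isOrder_zero I x⟩
    | succ m ih =>
      obtain ⟨i1, i2, i3⟩ := ih
      refine ⟨sub_mem (sub_mem i1 (hDS _ (hy _ _ i1 i2 i3))) (hBS (hb _ _ i1 i2 i3)), ?_,
        h3 _ _ i1 i2 i3⟩
      change D' (X m - D (fy m (X m)) - fb m (X m)) ∈ B'
      rw [map_sub, map_sub, hDD _ (hy _ _ i1 i2 i3), sub_zero]
      exact sub_mem i2 (hDB _ (hb _ _ i1 i2 i3))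
  let Y : ℕ → List H → R := fun m => fy m (X m)
  let Z : ℕ → List H → R := fun m => fb m (X m)
  have hsum : ∀ m, x = X m + D (∑ i ∈ Finset.range m, Y i) + ∑ i ∈ Finset.range m, Z i := by
    intro m
    induction m with
    | zero => simp [X]
    | succ m ih =>
      rw [Finset.sum_range_succ, Finset.sum_range_succ, map_add]
      change x = (X m - D (Y m) - Z m) + _ + _
      nth_rewrite 1 [ih]
      abel
  -- The series is locally finite: on words of length `k` its terms of index at least `k + 2n`
  -- vanish. So `assemble` can use a different partial sum for each length.
  have hfin : ∀ (G : ℕ → List H → R), (∀ m, IsOrder I m (G m)) → ∀ (M : ℕ) (l : List H),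
      l.length + 2 * n ≤ M →
      assemble (fun k => ∑ i ∈ Finset.range (k + 2 * n), G i) l = (∑ i ∈ Finset.range M, G i) l := by
    intro G hG M l hM
    simp only [assemble, Finset.sum_apply]
    refine Finset.sum_subset (by simpa using hM) fun i _ hi => ?_
    exact (hG i).eq_zero hI (by simpa using hi)
  have hYo : ∀ m, IsOrder I m (Y m) := fun m => h1 _ _ (hX m).1 (hX m).2.1 (hX m).2.2
  have hZo : ∀ m, IsOrder I m (Z m) := fun m => h2 _ _ (hX m).1 (hX m).2.1 (hX m).2.2
  refine ⟨assemble fun k => ∑ i ∈ Finset.range (k + 2 * n), Y i,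
    hS _ fun k => sum_mem fun i _ => hy _ _ (hX i).1 (hX i).2.1 (hX i).2.2, ?_⟩
  convert hB (fun k => ∑ i ∈ Finset.range (k + 2 * n), Z i)
    (fun k => sum_mem fun i _ => hb _ _ (hX i).1 (hX i).2.1 (hX i).2.2) using 1
  funext l
  -- The value of `D` on `l` involves words one letter longer, hence the extra one.
  let M := l.length + 1 + 2 * n
  rw [hfin Z hZo M l (by simp only [M]; omega), Pi.sub_apply,
    hD _ (∑ i ∈ Finset.range M, Y i) l fun l' hl' => hfin Y hYo M l' (by simp only [M]; omega)]
  have := congrFun (hsum M) l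
  rw [Pi.add_apply, Pi.add_apply, (hX M).2.2.eq_zero hI (by simp only [M]; omega), zero_add] at this
  rw [this, add_sub_cancel_left]

end Filtration

/-! ### The linear and the nonlinear parts of the differential -/

section Decomposition

set_option linter.unusedSectionVars false

variable {R : Type} [Ring R] [Algebra ℝ R] {𝓡 : ℤ → Submodule ℝ R} [GradedAlgebra 𝓡]
  {dR : R →ₗ[ℝ] R} {I : Ideal R}
  {V : Type} [AddCommGroup V] [Module ℝ V] [Module R V] {𝓥 : ℤ → Submodule ℝ V}
  {A : Type} [Ring A] [Algebra ℝ A] {𝓐 : ℤ → Submodule ℝ A} {dA : A →ₗ[ℝ] A}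
  {Adm : List (PureTensor 𝓥 𝓐) → Prop} {hA : IsCDGA 𝓐 dA}

open Classical in
/-- The part of the differential coming from `d_R` and the unary bracket of `𝔤`. -/
noncomputable def linearPart (hA : IsCDGA 𝓐 dA) (Adm : List (PureTensor 𝓥 𝓐) → Prop)
    (𝔤 : CurvedLInfty 𝓡 dR I 𝓥) (p : ℤ) (F : List (PureTensor 𝓥 𝓐) → R)
    (l : List (PureTensor 𝓥 𝓐)) : R :=
  if Adm l then dR (F l) - p.negOnePow • slotSum tdeg 1 (fun t => mainTerm hA 𝔤 [t]) F l else 0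

open Classical in
/-- The part of the differential coming from the brackets of `𝔤` that are not unary. -/
noncomputable def higherPart (hA : IsCDGA 𝓐 dA) (Adm : List (PureTensor 𝓥 𝓐) → Prop)
    (𝔤 : CurvedLInfty 𝓡 dR I 𝓥) (F : List (PureTensor 𝓥 𝓐) → R)
    (l : List (PureTensor 𝓥 𝓐)) : R :=
  if Adm l then unshSum tdeg l fun a c => if a.length = 1 then 0 else F (mainTerm hA 𝔤 a :: c)
  else 0

/-- The differential of `A` as a slot operator. -/
def dOp (h : TensorAdmissible hA Adm) : SlotOp 𝓐 Adm := ⟨dA, 1, hA.d_mem, h.d⟩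

variable [SetLike.GradedSMul 𝓡 𝓥] [IsScalarTower ℝ R V]

/-- The unary bracket of `𝔤` and `dA` both act on single letters and are turned into slot sums by
`vf_slotBr`; all other brackets form the perturbation. -/
theorem ceDiff_eq (h : TensorAdmissible hA Adm) (𝔤 : CurvedLInfty 𝓡 dR I 𝓥) {p : ℤ}
    {F : List (PureTensor 𝓥 𝓐) → R} (hF : F ∈ tensorCochains 𝓡 𝓥 𝓐 Adm p) :
    ceDiff dR tdeg (tensorBr hA 𝔤) Adm p F =
      linearPart hA Adm 𝔤 p F - p.negOnePow • ((dOp h).app F + higherPart hA Adm 𝔤 F) := by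
  funext l
  by_cases hl : Adm l
  · have hs := IsTensorCochain.swap (hF : IsTensorCochain 𝓡 𝓥 𝓐 Adm p F)
    rw [ceDiff_apply _ _ _ _ hl, Pi.sub_apply, Pi.smul_apply, Pi.add_apply, linearPart, if_pos hl,
      higherPart, if_pos hl, SlotOp.app_of_adm _ _ hl, sub_sub, ← smul_add]
    congr 2
    rw [← vf_slotBr (SlotOp.tdeg_map _) hs, ← vf_slotBr (e := 1) (fun t => ?_) hs, vf, vf, vf,
      ← unshSum_add, ← unshSum_add]
    · refine unshSum_congr fun a c _ => ?_
      rw [brSum_tensorBr]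
      rcases a with _ | ⟨t, _ | ⟨s, a⟩⟩ <;> simp [brSum, slotBr, dOp, SlotOp.map, add_comm]
    · rw [tdeg_mainTerm]
      simp
  · simp [ceDiff_of_not _ _ _ _ hl, linearPart, higherPart, SlotOp.app_of_not _ _ hl, hl]

/-- A bracket of `k` letters replaces them by one, so the length increases only for `k = 0`, and
then by one. -/
theorem ceDiff_congr_length {H : Type*} {deg : H → ℤ} {b : List H → List H} {Adm : List H → Prop}
    (p : ℤ) (F G : List H → R) (l : List H) (h : ∀ l', l'.length ≤ l.length + 1 → F l' = G l') :
    ceDiff dR deg b Adm p F l = ceDiff dR deg b Adm p G l := by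
  by_cases hl : Adm l
  · rw [ceDiff_apply _ _ _ _ hl, ceDiff_apply _ _ _ _ hl, h l (by omega)]
    congr 2
    refine vf_congr fun a c w hp _ => h _ ?_
    have := hp.length_eq
    simp only [List.length_append] at this
    simp
    omega
  · rw [ceDiff_of_not _ _ _ _ hl, ceDiff_of_not _ _ _ _ hl]

/-- An operator on left factors and the unary bracket on right factors commute up to the Koszul
sign. The `p`-dependent sign in the linear part absorbs it. -/
theorem linearPart_app (h : TensorAdmissible hA Adm) (𝔤 : CurvedLInfty 𝓡 dR I 𝓥)
    (θ : SlotOp 𝓐 Adm) {p : ℤ} {F : List (PureTensor 𝓥 𝓐) → R}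
    (hF : F ∈ tensorCochains 𝓡 𝓥 𝓐 Adm p) :
    linearPart hA Adm 𝔤 (p + θ.e) (θ.app F) = θ.app (linearPart hA Adm 𝔤 p F) := by
  funext l
  by_cases hl : Adm l
  · have hσ : ∀ t : PureTensor 𝓥 𝓐, tdeg (mainTerm hA 𝔤 [t]) = tdeg t + 1 := fun t => by
      rw [tdeg_mainTerm]; simp
    have hσa : ∀ {l₁ l₂ : List (PureTensor 𝓥 𝓐)} {t}, Adm (l₁ ++ t :: l₂) →
        Adm (l₁ ++ mainTerm hA 𝔤 [t] :: l₂) := fun {l₁ l₂ t} h' =>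
      h.perm List.perm_middle.symm (mainTerm_adm h 𝔤 (a := [t])
        (show Adm (t :: (l₁ ++ l₂)) from h.perm List.perm_middle h'))
    rw [linearPart, if_pos hl, θ.app_of_adm _ hl, θ.app_of_adm _ hl]
    have e1 : slotSum tdeg θ.e θ.map (linearPart hA Adm 𝔤 p F) l = slotSum tdeg θ.e θ.map
        (fun l' => dR (F l') + (-p.negOnePow) • slotSum tdeg 1 (fun t => mainTerm hA 𝔤 [t]) F l') l :=
      slotSum_congr fun l₁ t l₂ hl' => by
        rw [linearPart, if_pos (θ.adm' h (hl' ▸ hl)), Units.neg_smul, ← sub_eq_add_neg]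
    have e2 : slotSum tdeg 1 (fun t => mainTerm hA 𝔤 [t]) (θ.app F) l =
        slotSum tdeg 1 (fun t => mainTerm hA 𝔤 [t]) (slotSum tdeg θ.e θ.map F) l :=
      slotSum_congr fun l₁ t l₂ hl' => θ.app_of_adm _ (hσa (hl' ▸ hl))
    rw [e1, e2, slotSum_add, slotSum_smul, Units.neg_smul, ← sub_eq_add_neg,
      show slotSum tdeg θ.e θ.map (fun l' => dR (F l')) l = dR (slotSum tdeg θ.e θ.map F l) from
        slotSum_map dR.toAddMonoidHom ..]
    congr 1
    have key := slotSum_slotSum (deg := tdeg) hσ θ.tdeg_map F l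
    -- When both operations hit the same letter the composites agree up to `(-1)^e`, so these terms
    -- of the graded commutator cancel.
    have e3 : slotSum tdeg (1 + θ.e) (θ.map ∘ fun t => mainTerm hA 𝔤 [t]) F l =
        (1 * θ.e).negOnePow • slotSum tdeg (1 + θ.e) ((fun t => mainTerm hA 𝔤 [t]) ∘ θ.map) F l :=
      slotSum_rel (DistribSMul.toAddMonoidHom R (1 * θ.e).negOnePow) fun l₁ t l₂ _ => by
        refine slot_units h hF (x := (mainTerm hA 𝔤 [θ.map t]).1) (v := (mainTerm hA 𝔤 [t]).2) _
          ?_ ?_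
        · simp [SlotOp.map, mainTerm, prodH, mapLeft]
        · simp only [SlotOp.map, mainTerm, prodH, mapLeft, koszulExp, List.map_cons, List.map_nil,
            mul_one, map_units_smul', smul_smul, ← Int.negOnePow_add]
          congr 1
          exact negOnePow_congr ⟨-θ.e, by ring⟩
    rw [e3, add_left_inj] at key
    rw [key, smul_smul, ← Int.negOnePow_add]
    congr 1
    exact negOnePow_congr ⟨θ.e, by ring⟩
  · rw [linearPart, if_neg hl, θ.app_of_not _ hl]

theorem SlotOp.app_isOrder (θ : SlotOp 𝓐 Adm) {m : ℕ} {F : List (PureTensor 𝓥 𝓐) → R}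
    (hF : IsOrder I m F) : IsOrder I m (θ.app F) := by
  intro l
  by_cases hl : Adm l
  · rw [θ.app_of_adm _ hl]
    have : ∀ (q : Submodule ℝ R) (G : List (PureTensor 𝓥 𝓐) → R) (l : List (PureTensor 𝓥 𝓐)),
        (∀ l', l'.length = l.length → G l' ∈ q) → slotSum tdeg θ.e θ.map G l ∈ q := by
      intro q G l
      induction l generalizing G with
      | nil => intro _; exact zero_mem q
      | cons t l ih =>
        intro hG
        exact add_mem (hG _ (by simp)) (units_smul_mem _ (ih _ fun l' hl' => hG _ (by simp [hl'])))
    exact this _ F l fun l' hl' => hl' ▸ hF l'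
  · rw [θ.app_of_not _ hl]
    exact zero_mem _

/-- Rescaling the components of a functional. -/
def lengthScale {H : Type*} (f : ℕ → ℝ) : (List H → R) →ₗ[ℝ] (List H → R) where
  toFun F l := f l.length • F l
  map_add' F G := by funext l; simp
  map_smul' c F := by funext l; simp [smul_comm c]

@[simp] theorem lengthScale_apply {H : Type*} (f : ℕ → ℝ) (F : List H → R) (l : List H) :
    lengthScale f F l = f l.length • F l := rfl

theorem lengthScale_mem {f : ℕ → ℝ} {p : ℤ} {F : List (PureTensor 𝓥 𝓐) → R}
    (hF : F ∈ tensorCochains 𝓡 𝓥 𝓐 Adm p) : lengthScale f F ∈ tensorCochains 𝓡 𝓥 𝓐 Adm p := by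
  replace hF : IsTensorCochain 𝓡 𝓥 𝓐 Adm p F := hF
  refine (⟨fun l h => by simp [hF.zero l h], fun l => Submodule.smul_mem _ _ (hF.mem l),
    fun x y z v l h1 h2 h3 h4 h5 => ?_, fun c x z v l h1 h2 h3 => ?_,
    fun a x y z l h1 h2 h3 => ?_, fun e r hr a x z l h1 h2 => ?_, fun x y l₁ l₂ => ?_⟩ :
    IsTensorCochain 𝓡 𝓥 𝓐 Adm p _)
  · simp only [hF.add_left x y z v l h1 h2 h3 h4 h5, smul_add, List.length_cons]
  · simp only [hF.smul_left c x z v l h1 h2 h3, smul_comm c, List.length_cons]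
  · simp only [hF.add_right a x y z l h1 h2 h3, smul_add, List.length_cons]
  · simp only [hF.smul_right e r hr a x z l h1 h2, List.length_cons,
      mul_smul_comm, smul_comm (f _)]
  · simp only [hF.swap x y l₁ l₂, List.length_append, List.length_cons,
      smul_comm (f _)]

theorem lengthScale_isOrder {H : Type*} (f : ℕ → ℝ) {m : ℕ} {F : List H → R} (hF : IsOrder I m F) :
    IsOrder I m (lengthScale f F) := fun l => Submodule.smul_mem _ _ (hF l)

theorem slotSum_lengthScale {H : Type*} {deg : H → ℤ} (f : ℕ → ℝ) (e : ℤ) (σ : H → H)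
    (F : List H → R) (l : List H) :
    slotSum deg e σ (lengthScale f F) l = f l.length • slotSum deg e σ F l :=
  slotSum_rel (DistribSMul.toAddMonoidHom R (f l.length)) fun l₁ t l₂ h => by simp [h]

theorem SlotOp.app_lengthScale (θ : SlotOp 𝓐 Adm) (f : ℕ → ℝ) (F : List (PureTensor 𝓥 𝓐) → R) :
    θ.app (lengthScale f F) = lengthScale f (θ.app F) := by
  funext l
  by_cases hl : Adm l
  · rw [lengthScale_apply, θ.app_of_adm _ hl, θ.app_of_adm _ hl, slotSum_lengthScale]
  · rw [lengthScale_apply, θ.app_of_not _ hl, θ.app_of_not _ hl, smul_zero]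

theorem linearPart_lengthScale (𝔤 : CurvedLInfty 𝓡 dR I 𝓥) (p : ℤ) (f : ℕ → ℝ)
    (F : List (PureTensor 𝓥 𝓐) → R) :
    linearPart hA Adm 𝔤 p (lengthScale f F) = lengthScale f (linearPart hA Adm 𝔤 p F) := by
  funext l
  by_cases hl : Adm l
  · rw [lengthScale_apply, linearPart, linearPart, if_pos hl, if_pos hl, slotSum_lengthScale,
      lengthScale_apply, map_smul, smul_sub, smul_comm (f _)]
  · rw [lengthScale_apply, linearPart, linearPart, if_neg hl, if_neg hl, smul_zero]

/-- The effect of an operator of degree `-1` that commutes with the linear part. -/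
theorem ceDiff_homotopy (h : TensorAdmissible hA Adm) (𝔤 : CurvedLInfty 𝓡 dR I 𝓥)
    (K : (List (PureTensor 𝓥 𝓐) → R) →ₗ[ℝ] (List (PureTensor 𝓥 𝓐) → R)) {p : ℤ}
    {x : List (PureTensor 𝓥 𝓐) → R} (hx : x ∈ tensorCochains 𝓡 𝓥 𝓐 Adm (p + 1))
    (hKx : K x ∈ tensorCochains 𝓡 𝓥 𝓐 Adm p)
    (hK : linearPart hA Adm 𝔤 p (K x) = K (linearPart hA Adm 𝔤 (p + 1) x)) :
    ceDiff dR tdeg (tensorBr hA 𝔤) Adm p ((p + 1).negOnePow • K x) =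
      (p + 1).negOnePow • K (ceDiff dR tdeg (tensorBr hA 𝔤) Adm (p + 1) x) +
      ((dOp h).app (K x) + K ((dOp h).app x)) +
      (higherPart hA Adm 𝔤 (K x) + K (higherPart hA Adm 𝔤 x)) := by
  -- The prefactor `(-1)^(p+1)` is opposite to the sign of the vector field in degree `p`, so the
  -- other parts of the differential occur as an unsigned anticommutator with `K`.
  rw [map_units_smul', ceDiff_eq h 𝔤 hKx, ceDiff_eq h 𝔤 hx, hK, map_sub, map_units_smul', map_add,
    Int.negOnePow_succ]
  rcases Int.units_eq_one_or p.negOnePow with h' | h' <;> rw [h'] <;>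
    simp only [Units.neg_smul, one_smul, neg_neg] <;> abel

variable [DirectSum.Decomposition 𝓥]

/-- The curvature is a combination of elements `r • w` with `r ∈ I`, and linearity in the first
argument pulls `r` out. -/
theorem eval_curvature_mem (hI : I.IsHomogeneous 𝓡)
    (𝔤 : CurvedLInfty 𝓡 dR I 𝓥) {p : ℤ} {F : List (PureTensor 𝓥 𝓐) → R}
    (hF : F ∈ tensorCochains 𝓡 𝓥 𝓐 Adm p) {k : ℕ} {c : List (PureTensor 𝓥 𝓐)}
    (hk : ∀ t, F (t :: c) ∈ idealPow I k) : F (mainTerm hA 𝔤 [] :: c) ∈ idealPow I (k + 1) := by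
  obtain ⟨φ, h1, h2⟩ := exists_linear_right hF 1 (mainTerm hA 𝔤 []).1 c
  have hd : (mainTerm hA 𝔤 []).2.deg = 1 := by simp [mainTerm, CurvedLInfty.brH]
  have h1' : F (mainTerm hA 𝔤 [] :: c) = φ (𝔤.br []) := h1 _ hd
  -- The elements `r • w` need not be homogeneous, while `φ` is known only in degree one. Projecting
  -- there and decomposing `r` and `w` reduces to homogeneous products; homogeneity of `I` keeps the
  -- components of `r` in `I`.
  let π : V →ₗ[ℝ] V := (𝓥 1).subtype ∘ₗ DirectSum.component ℝ ℤ (fun i => 𝓥 i) 1 ∘ₗ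
    (DirectSum.decomposeLinearEquiv 𝓥).toLinearMap
  have hπ : ∀ v, π v = (DirectSum.decompose 𝓥 v 1 : V) := fun v => rfl
  have hbr : 𝔤.br [] ∈ 𝓥 1 := by simpa using 𝔤.mem []
  have key : ∀ r ∈ I, ∀ w : V, φ (π (r • w)) ∈ idealPow I (k + 1) := by
    intro r hr w
    classical
    rw [← DirectSum.sum_support_decompose 𝓡 r, ← DirectSum.sum_support_decompose 𝓥 w,
      Finset.sum_smul, map_sum, map_sum]
    refine sum_mem fun i _ => ?_
    rw [Finset.smul_sum, map_sum, map_sum]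
    refine sum_mem fun j _ => ?_
    have hm : (DirectSum.decompose 𝓡 r i : R) • (DirectSum.decompose 𝓥 w j : V) ∈ 𝓥 (i + j) := by
      have := SetLike.GradedSMul.smul_mem (A := 𝓡) (B := 𝓥) (DirectSum.decompose 𝓡 r i).2
        (DirectSum.decompose 𝓥 w j).2
      simpa using this
    by_cases hij : i + j = 1
    · rw [hij] at hm
      rw [hπ, DirectSum.decompose_of_mem_same _ hm,
        h2 i _ (DirectSum.decompose 𝓡 r i).2 ⟨j, _, (DirectSum.decompose 𝓥 w j).2⟩ hij.symm]
      exact units_smul_mem _ (mul_mem_idealPow (hI i hr) (hk _))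
    · rw [hπ, DirectSum.decompose_of_mem_ne _ hm hij, map_zero]
      exact zero_mem _
  have key' : ∀ v ∈ Submodule.span R {v : V | ∃ r ∈ I, ∃ w : V, v = r • w}, ∀ s : R,
      φ (π (s • v)) ∈ idealPow I (k + 1) := by
    intro v hv
    induction hv using Submodule.span_induction with
    | mem v hv =>
      obtain ⟨r, hr, w, rfl⟩ := hv
      intro s
      rw [smul_smul]
      exact key _ (I.mul_mem_left s hr) w
    | zero => simp
    | add x y _ _ hx hy => intro s; rw [smul_add, map_add, map_add]; exact add_mem (hx s) (hy s)
    | smul c x _ hx => intro s; rw [smul_smul]; exact hx _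
  rw [h1', ← DirectSum.decompose_of_mem_same 𝓥 hbr, ← hπ, ← one_smul R (𝔤.br [])]
  exact key' _ 𝔤.curvature 1

/-- A bracket of at least two letters evaluates `F` on a shorter word, which costs nothing in the
filtration and gains a unit. The curvature evaluates `F` on a word one letter longer but yields a
factor in `I`, which counts twice. -/
theorem higherPart_isOrder (hI : I.IsHomogeneous 𝓡)
    (𝔤 : CurvedLInfty 𝓡 dR I 𝓥) {p : ℤ} {F : List (PureTensor 𝓥 𝓐) → R}
    (hF : F ∈ tensorCochains 𝓡 𝓥 𝓐 Adm p) {m : ℕ} (hm : IsOrder I m F) :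
    IsOrder I (m + 1) (higherPart hA Adm 𝔤 F) := by
  intro l
  rw [higherPart]
  split_ifs with hl
  · refine unshSum_mem fun a c hp => ?_
    have hlen := hp.length_eq
    rw [List.length_append] at hlen
    split_ifs with ha
    · exact zero_mem _
    · rcases eq_or_ne a [] with rfl | ha'
      · have e := eval_curvature_mem (hA := hA) hI 𝔤 hF (k := (m - (c.length + 1) + 1) / 2) (c := c)
          fun t => hm (t :: c)
        refine idealPow_antitone I ?_ e
        simp at hlen
        omega
      · refine idealPow_antitone I ?_ (hm _)
        have := List.length_pos_iff.2 ha'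
        simp only [List.length_cons]
        omega
  · exact zero_mem _

end Decomposition

/-! ### The truncated de Rham complex -/

section Eps

set_option linter.unusedSectionVars false

variable {R : Type} [Ring R] [Algebra ℝ R] {𝓡 : ℤ → Submodule ℝ R} [GradedAlgebra 𝓡]
  {dR : R →ₗ[ℝ] R} {I : Ideal R}
  {V : Type} [AddCommGroup V] [Module ℝ V] [Module R V] {𝓥 : ℤ → Submodule ℝ V}
  {A : Type} [Ring A] [Algebra ℝ A] {𝓐 : ℤ → Submodule ℝ A} {dA : A →ₗ[ℝ] A}
  {Adm : List (PureTensor 𝓥 𝓐) → Prop} {hA : IsCDGA 𝓐 dA}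

theorem tensorAdmissible_true (hA : IsCDGA 𝓐 dA) :
    TensorAdmissible hA (fun _ : List (PureTensor 𝓥 𝓐) => True) :=
  ⟨fun _ _ => trivial, fun _ _ _ _ _ => trivial, fun _ _ => trivial, fun _ => trivial,
    fun _ => trivial⟩

variable [SetLike.GradedSMul 𝓡 𝓥] [IsScalarTower ℝ R V]

theorem eq_zero_of_mem (h : TensorAdmissible hA Adm) {p : ℤ} {F : List (PureTensor 𝓥 𝓐) → R}
    (hF : F ∈ tensorCochains 𝓡 𝓥 𝓐 Adm p) {t : PureTensor 𝓥 𝓐} {l : List (PureTensor 𝓥 𝓐)}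
    (ht : t ∈ l) (h0 : t.1.val = 0) : F l = 0 := by
  obtain ⟨l₁, l₂, rfl⟩ := List.append_of_mem ht
  rw [swap_front (IsTensorCochain.swap (hF : IsTensorCochain 𝓡 𝓥 𝓐 Adm p F)),
    show t = (t.1, t.2) from rfl, left_zero h hF h0, smul_zero]

theorem prodVal_eq_zero {t : PureTensor 𝓥 𝓐} {l : List (PureTensor 𝓥 𝓐)} (ht : t ∈ l)
    (h0 : t.1.val = 0) : prodVal l = 0 :=
  List.prod_eq_zero (List.mem_map.2 ⟨t, ht, h0⟩)

/-- The words with an entry `ε ⊗ v`. -/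
abbrev HasEps (l : List (PureTensor 𝓥 epsGrading)) : Prop := ∃ t ∈ l, t.1.deg = -1

theorem eps_val_eq_zero (a : Homog epsGrading) (h0 : a.deg ≠ 0) (h1 : a.deg ≠ -1) : a.val = 0 :=
  TrivSqZeroExt.ext (a.mem.1 h0) (a.mem.2 h1)

/-- Having an entry `ε ⊗ v` depends on degrees alone, so forms of positive degree are the forms that
vanish on words without `ε`, and computations may be done with all words admissible. -/
theorem mem_epsCochains_iff {p : ℤ} {F : List (PureTensor 𝓥 epsGrading) → R} :
    F ∈ tensorCochains 𝓡 𝓥 epsGrading HasEps p ↔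
      F ∈ tensorCochains 𝓡 𝓥 epsGrading (fun _ => True) p ∧ ∀ l, ¬ HasEps l → F l = 0 := by
  have hcons : ∀ {x y : Homog epsGrading} {v w : Homog 𝓥} {l}, y.deg = x.deg →
      (HasEps ((x, v) :: l) ↔ HasEps ((y, w) :: l)) := fun h => by simp [HasEps, h]
  constructor
  · intro (h : IsTensorCochain 𝓡 𝓥 epsGrading HasEps p F)
    refine ⟨⟨by simp, h.mem, ?_, ?_, h.add_right, h.smul_right, h.swap⟩, h.zero⟩
    · intro x y z v l _ _ h1 h2 h3
      by_cases hx : HasEps ((x, v) :: l)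
      · exact h.add_left x y z v l hx ((hcons h1).1 hx) h1 h2 h3
      · rw [h.zero _ hx, h.zero _ fun h' => hx ((hcons h1).2 h'),
          h.zero _ fun h' => hx ((hcons h2).2 h'), add_zero]
    · intro c x z v l _ h1 h2
      by_cases hx : HasEps ((x, v) :: l)
      · exact h.smul_left c x z v l hx h1 h2
      · rw [h.zero _ hx, h.zero _ fun h' => hx ((hcons h1).2 h'), smul_zero]
  · rintro ⟨h : IsTensorCochain 𝓡 𝓥 epsGrading _ p F, h0⟩
    exact ⟨h0, h.mem, fun x y z v l _ _ => h.add_left x y z v l trivial trivial,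
      fun c x z v l _ => h.smul_left c x z v l trivial, h.add_right, h.smul_right, h.swap⟩

/-- Brackets and `∂/∂ε` never create an `ε`. Entries of degree other than `0` and `-1` are zero,
which gives the second alternative. -/
theorem not_hasEps_tensorBr (𝔤 : CurvedLInfty 𝓡 dR I 𝓥) {a c : List (PureTensor 𝓥 epsGrading)}
    (hl : ¬ HasEps (a ++ c)) {w : PureTensor 𝓥 epsGrading} (hw : w ∈ tensorBr isCDGA_eps 𝔤 a) :
    ¬ HasEps (w :: c) ∨ w.1.val = 0 := by
  have hc : w.1.deg ≠ -1 → ¬ HasEps (w :: c) := by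
    rintro h1 ⟨t, ht, h2⟩
    rcases List.mem_cons.1 ht with rfl | ht
    · exact h1 h2
    · exact hl ⟨t, List.mem_append_right _ ht, h2⟩
  by_cases h0 : ∀ t ∈ a, t.1.deg = 0
  · refine Or.inl (hc ?_)
    rw [tensorBr_eq, List.mem_cons] at hw
    rcases hw with rfl | hw
    · have : adeg a = 0 := by
        clear hl hc
        induction a with
        | nil => rfl
        | cons t a ih =>
          simp only [adeg, wdeg_cons]
          rw [h0 t (by simp), show wdeg _ a = 0 from ih fun s hs => h0 s (by simp [hs]), add_zero]
      simp [mainTerm, prodH_deg, this]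
    · obtain ⟨t, rfl, rfl⟩ := mem_slotBr hw
      simp [mapLeft, h0 t (by simp)]
  · push Not at h0
    obtain ⟨t, ht, ht0⟩ := h0
    have hv : t.1.val = 0 := eps_val_eq_zero _ ht0 fun h' => hl ⟨t, by simp [ht], h'⟩
    refine Or.inr ?_
    rw [tensorBr_eq, List.mem_cons] at hw
    rcases hw with rfl | hw
    · simp [mainTerm, prodH_val, prodVal_eq_zero ht hv]
    · obtain ⟨t', rfl, rfl⟩ := mem_slotBr hw
      rw [List.mem_singleton] at ht
      simp [mapLeft, ← ht, hv]

theorem ceDiff_eps (𝔤 : CurvedLInfty 𝓡 dR I 𝓥) {p : ℤ} {F : List (PureTensor 𝓥 epsGrading) → R}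
    (hF : F ∈ tensorCochains 𝓡 𝓥 epsGrading HasEps p) :
    ceDiff dR tdeg (tensorBr isCDGA_eps 𝔤) HasEps p F =
      ceDiff dR tdeg (tensorBr isCDGA_eps 𝔤) (fun _ => True) p F := by
  obtain ⟨h1, h2⟩ := mem_epsCochains_iff.1 hF
  funext l
  rw [ceDiff_apply (Adm := fun _ => True) _ _ _ _ trivial]
  by_cases hl : HasEps l
  · rw [ceDiff_apply _ _ _ _ hl]
  · suffices hv : vf tdeg (tensorBr isCDGA_eps 𝔤) F l = 0 by
      rw [ceDiff_of_not _ _ _ _ hl, h2 l hl, map_zero, hv, smul_zero, sub_zero]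
    refine unshSum_eq_zero fun a c hp => brSum_eq_zero fun w hw => ?_
    have hl' : ¬ HasEps (a ++ c) := fun ⟨t, ht, h'⟩ => hl ⟨t, hp.mem_iff.1 ht, h'⟩
    rcases not_hasEps_tensorBr 𝔤 hl' hw with h' | h'
    · exact h2 _ h'
    · exact eq_zero_of_mem (tensorAdmissible_true isCDGA_eps) h1 (List.mem_cons_self) h'

theorem isComplex_truncatedDeRham (hR : IsCDGA 𝓡 dR) (𝔤 : CurvedLInfty 𝓡 dR I 𝓥) :
    (truncatedDeRham 𝔤).IsComplex := by
  have hmaps : ∀ p, ∀ x ∈ (truncatedDeRham 𝔤).S p,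
      (truncatedDeRham 𝔤).D p x ∈ (truncatedDeRham 𝔤).S (p + 1) := by
    intro p x hx
    refine mem_epsCochains_iff.2 ⟨?_, fun l hl => ceDiff_of_not _ _ _ _ hl⟩
    change ceDiff _ _ _ HasEps _ _ ∈ _
    rw [ceDiff_eps 𝔤 hx]
    exact tensor_maps hR (tensorAdmissible_true isCDGA_eps) 𝔤 (mem_epsCochains_iff.1 hx).1
  refine ⟨hmaps, fun p x hx => ?_⟩
  have h1 := ceDiff_eps 𝔤 hx
  have h2 := ceDiff_eps 𝔤 (hmaps p x hx)
  refine h2.trans ?_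
  change ceDiff _ _ _ _ _ (ceDiff _ _ _ HasEps _ _) = 0
  rw [h1]
  exact tensor_sq hR (tensorAdmissible_true isCDGA_eps) 𝔤 (mem_epsCochains_iff.1 hx).1

/-- The coefficient of `ε`. -/
def epsSnd : DualNumber ℝ →ₗ[ℝ] ℝ := TrivSqZeroExt.sndHom ℝ ℝ

/-- The coefficient of `1`. -/
def epsFst : DualNumber ℝ →ₗ[ℝ] ℝ := (TrivSqZeroExt.fstHom ℝ ℝ ℝ).toLinearMap

theorem epsSnd_apply (a : DualNumber ℝ) : epsSnd a = a.snd := rfl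
theorem epsFst_apply (a : DualNumber ℝ) : epsFst a = a.fst := rfl

theorem epsSnd_eq_zero (i : ℤ) (x : DualNumber ℝ) (h : x ∈ epsGrading i) (hi : i ≠ -1) :
    epsSnd x = 0 := h.2 hi

theorem epsFst_eq_zero (i : ℤ) (x : DualNumber ℝ) (h : x ∈ epsGrading i) (hi : i ≠ 0) :
    epsFst x = 0 := h.1 hi

theorem epsFst_comp_epsD : epsFst ∘ₗ epsD = epsSnd := by
  ext; simp [epsFst_apply, epsSnd_apply, epsD]

theorem epsSnd_comp_epsD : epsSnd ∘ₗ epsD = 0 := by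
  ext; simp [epsSnd_apply, epsD]

theorem fst_prodVal (l : List (PureTensor 𝓥 epsGrading)) :
    epsFst (prodVal l) = (l.map fun t => t.1.val.fst).prod := by
  induction l with
  | nil => simp [epsFst_apply]
  | cons t l ih => rw [prodVal_cons, List.map_cons, List.prod_cons, ← ih]; simp [epsFst_apply]

theorem fst_prodVal_of_hasEps {l : List (PureTensor 𝓥 epsGrading)} (h : HasEps l) :
    epsFst (prodVal l) = 0 := by
  obtain ⟨t, ht, h1⟩ := h
  rw [fst_prodVal]
  exact List.prod_eq_zero (List.mem_map.2 ⟨t, ht, t.1.mem.1 (by omega)⟩)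

theorem snd_prodVal_of_not_hasEps {l : List (PureTensor 𝓥 epsGrading)} (h : ¬ HasEps l) :
    epsSnd (prodVal l) = 0 := by
  induction l with
  | nil => simp [epsSnd_apply]
  | cons t l ih =>
    have h1 : (prodVal l).snd = 0 := ih fun ⟨s, hs, h'⟩ => h ⟨s, by simp [hs], h'⟩
    have h2 : t.1.val.snd = 0 := t.1.mem.2 fun h' => h ⟨t, by simp, h'⟩
    simp [epsSnd_apply, h1, h2]

/-- The de Rham differential `F ↦ dF` from functions to one-forms. -/
noncomputable def deRham (p : ℤ) (F : List (Homog 𝓥) → R) :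
    List (PureTensor 𝓥 epsGrading) → R := push (fun _ => True) epsSnd p F

theorem deRham_mem {p : ℤ} {F : List (Homog 𝓥) → R} (hF : F ∈ reducedCochains 𝓡 𝓥 p) :
    deRham p F ∈ tensorCochains 𝓡 𝓥 epsGrading HasEps (p + 1) := by
  refine mem_epsCochains_iff.2 ⟨?_, fun l hl => ?_⟩
  · have := push_mem (tensorAdmissible_true isCDGA_eps) epsSnd_eq_zero hF
    rwa [sub_neg_eq_add] at this
  · rw [deRham, push_of_adm _ _ _ trivial, snd_prodVal_of_not_hasEps hl, zero_smul, smul_zero]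

/-- The coefficient of `ε` vanishes on the image of `∂/∂ε`, so only the term with the differential
of `𝔤` remains. The minus sign is absorbed by the shift in `closedOneForms`. -/
theorem ceDiff_deRham (𝔤 : CurvedLInfty 𝓡 dR I 𝓥) {p : ℤ} {F : List (Homog 𝓥) → R}
    (hF : F ∈ reducedCochains 𝓡 𝓥 p) : (truncatedDeRham 𝔤).D (p + 1) (deRham p F) =
      - deRham (p + 1) ((reducedCE 𝔤).D p F) := by
  have h1 := ceDiff_push (tensorAdmissible_true isCDGA_eps) 𝔤 epsSnd_eq_zero
    (by simp [epsSnd_apply]) hF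
  rw [sub_neg_eq_add] at h1
  refine (ceDiff_eps 𝔤 (deRham_mem hF)).trans (h1.trans ?_)
  have : push (fun _ : List (PureTensor 𝓥 epsGrading) => True) (epsSnd ∘ₗ epsD) p F = 0 := by
    funext l
    simp [push, epsSnd_comp_epsD]
  rw [this, sub_zero]
  simp [deRham]

/-- The element `ε`. -/
def epsH : Homog epsGrading := ⟨-1, DualNumber.eps, by simp [dualGrading]⟩

/-- The unit. -/
def oneH (hA : IsCDGA 𝓐 dA) : Homog 𝓐 := ⟨0, 1, hA.one_mem⟩

theorem prodVal_map_oneH (l : List (Homog 𝓥)) :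
    prodVal (l.map fun v => (oneH hA, v)) = 1 := by
  induction l with
  | nil => rfl
  | cons v l ih => rw [List.map_cons, prodVal_cons, ih]; simp [oneH]

theorem koszulExp_map_oneH (e : ℤ) (l : List (Homog 𝓥)) :
    koszulExp e (l.map fun v => (oneH hA, v)) = 0 := by
  induction l generalizing e with
  | nil => rfl
  | cons v l ih => rw [List.map_cons, koszulExp, ih]; simp [oneH]

/-- Evaluating `dF` on `ε ⊗ v₁, v₂, …, vₙ` recovers `F(v₁, …, vₙ)` up to sign; constants have been
divided out. -/
theorem deRham_eq_zero {p : ℤ} {F : List (Homog 𝓥) → R} (hF : F ∈ reducedCochains 𝓡 𝓥 p)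
    (h : deRham p F = 0) : F = 0 := by
  funext l
  rcases l with _ | ⟨v, l⟩
  · exact IsReducedCochain.nil hF
  · have := congrFun h ((epsH, v) :: l.map fun v => (oneH isCDGA_eps, v))
    rw [deRham, push_of_adm _ _ _ trivial, prodVal_cons, prodVal_map_oneH] at this
    simpa [epsSnd_apply, epsH, Function.comp_def, smul_eq_zero_iff_eq] using this

end Eps

/-! ### The Poincaré lemma for the truncated de Rham complex -/

section EpsStep

set_option linter.unusedSectionVars false

variable {R : Type} [Ring R] [Algebra ℝ R] {𝓡 : ℤ → Submodule ℝ R} [GradedAlgebra 𝓡]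
  {dR : R →ₗ[ℝ] R} {I : Ideal R}
  {V : Type} [AddCommGroup V] [Module ℝ V] [Module R V] {𝓥 : ℤ → Submodule ℝ V}
  {A : Type} [Ring A] [Algebra ℝ A] {𝓐 : ℤ → Submodule ℝ A} {dA : A →ₗ[ℝ] A}
  {Adm : List (PureTensor 𝓥 𝓐) → Prop} {hA : IsCDGA 𝓐 dA}
  [SetLike.GradedSMul 𝓡 𝓥] [IsScalarTower ℝ R V]

/-- Restriction of a cochain to words with trivial left factors. -/
def restrictOne (hA : IsCDGA 𝓐 dA) (G : List (PureTensor 𝓥 𝓐) → R) (l : List (Homog 𝓥)) : R :=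
  G (l.map fun v => (oneH hA, v))

theorem restrictOne_mem {p : ℤ} {G : List (PureTensor 𝓥 𝓐) → R}
    (hG : G ∈ tensorCochains 𝓡 𝓥 𝓐 Adm p) (h0 : G [] = 0) :
    restrictOne hA G ∈ reducedCochains 𝓡 𝓥 p := by
  replace hG : IsTensorCochain 𝓡 𝓥 𝓐 Adm p G := hG
  refine (⟨h0, fun l => ?_, fun x y z l h1 h2 h3 => hG.add_right _ _ _ _ _ h1 h2 h3,
    fun a r hr x z l h1 h2 => ?_, fun x y l₁ l₂ => ?_⟩ : IsReducedCochain 𝓡 𝓥 p (restrictOne hA G))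
  · have := hG.mem (l.map fun v => (oneH hA, v))
    rwa [List.map_map, show (tdeg ∘ fun v : Homog 𝓥 => (oneH hA, v)) = Homog.deg from
      funext fun v => by simp [tdeg, oneH]] at this
  · have := hG.smul_right a r hr (oneH hA) x z (l.map fun v => (oneH hA, v)) h1 h2
    rw [show (oneH hA).deg = 0 from rfl, add_zero] at this
    exact this
  · have := hG.swap (oneH hA, x) (oneH hA, y) (l₁.map fun v => (oneH hA, v))
      (l₂.map fun v => (oneH hA, v))
    simpa [restrictOne, tdeg, oneH] using this

/-- A cochain with constant left factors. -/
theorem eval_of_not_hasEps {p : ℤ} {G : List (PureTensor 𝓥 epsGrading) → R}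
    (hG : G ∈ tensorCochains 𝓡 𝓥 epsGrading (fun _ => True) p) {l : List (PureTensor 𝓥 epsGrading)}
    (hl : ¬ HasEps l) : G l = epsFst (prodVal l) • restrictOne isCDGA_eps G (l.map Prod.snd) := by
  by_cases h0 : ∀ t ∈ l, t.1.deg = 0
  · have key : ∀ (l l₁ : List (PureTensor 𝓥 epsGrading)), (∀ t ∈ l, t.1.deg = 0) →
        G (l₁ ++ l) = epsFst (prodVal l) •
          G (l₁ ++ (l.map Prod.snd).map fun v => (oneH isCDGA_eps, v)) := by
      intro l
      induction l with
      | nil => intro l₁ _; simp [epsFst_apply]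
      | cons t l ih =>
        intro l₁ h0
        obtain ⟨⟨n, a, ha⟩, v⟩ := t
        obtain rfl : n = 0 := h0 _ List.mem_cons_self
        have e1 := slot_lin (tensorAdmissible_true isCDGA_eps) hG (x := oneH isCDGA_eps)
          (y := oneH isCDGA_eps) (z := ⟨0, a, ha⟩) (v := v) (l₁ := l₁) (l₂ := l) (t := a.fst)
          (t' := 0) trivial trivial rfl rfl (TrivSqZeroExt.ext (by simp [oneH])
            (by simp [oneH, ha.2]))
        rw [e1, zero_smul, add_zero]
        have e2 := ih (l₁ ++ [(oneH isCDGA_eps, v)]) fun t ht => h0 t (by simp [ht])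
        simp only [List.append_assoc, List.singleton_append] at e2
        rw [e2, smul_smul]
        simp [epsFst_apply]
    exact key l [] h0
  · push Not at h0
    obtain ⟨t, ht, ht0⟩ := h0
    have hv : t.1.val = 0 := eps_val_eq_zero _ ht0 fun h' => hl ⟨t, ht, h'⟩
    rw [eq_zero_of_mem (tensorAdmissible_true isCDGA_eps) hG ht hv, prodVal_eq_zero ht hv, map_zero,
      zero_smul]

/-- Multiplication by `ε`. -/
def epsOp : SlotOp (𝓥 := 𝓥) epsGrading (fun _ => True) where
  toFun := LinearMap.mulLeft ℝ DualNumber.eps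
  e := -1
  mem i x hx := by
    have := isCDGA_eps.mul_mem (-1) i _ _ epsH.mem hx
    rwa [add_comm] at this
  adm _ := trivial

/-- On `ℝ[ε]` one has `∂_ε ε + ε ∂_ε = 1`, and the identity acts on functionals as the number of
letters. This is Cartan's formula for the Euler field of `B𝔤`. -/
theorem dOp_epsOp {p : ℤ} {F : List (PureTensor 𝓥 epsGrading) → R}
    (hF : F ∈ tensorCochains 𝓡 𝓥 epsGrading (fun _ => True) p) :
    (dOp (tensorAdmissible_true isCDGA_eps)).app (epsOp.app F) +
      epsOp.app ((dOp (tensorAdmissible_true isCDGA_eps)).app F) =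
      lengthScale (fun n => (n : ℝ)) F := by
  have h := tensorAdmissible_true (𝓥 := 𝓥) isCDGA_eps
  let idOp : SlotOp (𝓥 := 𝓥) epsGrading (fun _ => True) :=
    ⟨LinearMap.id, 0, fun i x hx => by simpa using hx, fun _ => trivial⟩
  have e1 := SlotOp.app_app h (dOp h) epsOp idOp (-1)
    (by simp [dOp, epsOp]) (by simp [dOp, epsOp, idOp]) (fun a => ?_) hF
  · rw [e1]
    funext l
    simp only [Units.neg_smul, one_smul, Pi.add_apply, Pi.neg_apply]
    rw [SlotOp.app_one idOp rfl (fun _ => rfl) trivial, lengthScale_apply]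
    abel
  · refine TrivSqZeroExt.ext ?_ ?_ <;> simp [dOp, epsOp, epsD, idOp]

theorem push_isOrder {φ : A →ₗ[ℝ] ℝ} {p : ℤ} {F : List (Homog 𝓥) → R} {m : ℕ}
    (hF : IsOrder I m F) : IsOrder I m (push Adm φ p F) := by
  intro l
  by_cases hl : Adm l
  · rw [push_of_adm _ _ _ hl]
    have := hF (l.map Prod.snd)
    rw [List.length_map] at this
    exact units_smul_mem _ (Submodule.smul_mem _ _ this)
  · rw [push_of_not _ _ _ hl]
    exact zero_mem _

theorem IsOrder.restrictOne {m : ℕ} {G : List (PureTensor 𝓥 𝓐) → R} (hG : IsOrder I m G) :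
    IsOrder I m (restrictOne hA G) := fun l => by
  have := hG (l.map fun v => (oneH hA, v))
  rwa [List.length_map] at this

theorem IsOrder.units_smul {H : Type*} {m : ℕ} {F : List H → R} (u : ℤˣ) (hF : IsOrder I m F) :
    IsOrder I m (u • F) := fun l => units_smul_mem u (hF l)

/-- The Poincaré homotopy applied to `x` gives `z` with `D z = x` on words with `ε`, up to higher
order. But `z` may contain a function, that is, be nonzero on words without `ε`. Removing this
function `c` from `z` changes `D z` by its de Rham differential, which lies in the image. -/
theorem eps_step (hI : I.IsHomogeneous 𝓡) [DirectSum.Decomposition 𝓥] (𝔤 : CurvedLInfty 𝓡 dR I 𝓥)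
    {q : ℤ} {m : ℕ} {x : List (PureTensor 𝓥 epsGrading) → R}
    (hx : x ∈ tensorCochains 𝓡 𝓥 epsGrading HasEps (q + 1))
    (hDx : ∃ F ∈ reducedCochains 𝓡 𝓥 (q + 1), deRham (q + 1) F = (truncatedDeRham 𝔤).D (q + 1) x)
    (hm : IsOrder I m x) :
    ∃ y ∈ tensorCochains 𝓡 𝓥 epsGrading HasEps q, ∃ c ∈ reducedCochains 𝓡 𝓥 q,
      IsOrder I m y ∧ IsOrder I m (deRham (𝓥 := 𝓥) q c) ∧
      IsOrder I (m + 1) (x - (truncatedDeRham 𝔤).D q y - deRham q c) := by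
  have h := tensorAdmissible_true (𝓥 := 𝓥) isCDGA_eps
  obtain ⟨hx', hx0⟩ := mem_epsCochains_iff.1 hx
  let K : (List (PureTensor 𝓥 epsGrading) → R) →ₗ[ℝ] (List (PureTensor 𝓥 epsGrading) → R) :=
    lengthScale (fun n => (n : ℝ)⁻¹) ∘ₗ epsOp.app
  have hKmem : ∀ {r : ℤ} {G : List (PureTensor 𝓥 epsGrading) → R},
      G ∈ tensorCochains 𝓡 𝓥 epsGrading (fun _ => True) (r + 1) →
      K G ∈ tensorCochains 𝓡 𝓥 epsGrading (fun _ => True) r := fun {r G} hG => by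
    have := lengthScale_mem (f := fun n => (n : ℝ)⁻¹) (epsOp.app_mem h hG)
    rwa [show r + 1 + (epsOp (𝓥 := 𝓥)).e = r by simp [epsOp]] at this
  have hKord : ∀ {m : ℕ} {G : List (PureTensor 𝓥 epsGrading) → R}, IsOrder I m G →
      IsOrder I m (K G) := fun hG => lengthScale_isOrder (fun n => (n : ℝ)⁻¹) (epsOp.app_isOrder hG)
  have hKlin : linearPart isCDGA_eps (fun _ => True) 𝔤 q (K x) =
      K (linearPart isCDGA_eps (fun _ => True) 𝔤 (q + 1) x) := by
    have := linearPart_app h 𝔤 epsOp hx'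
    rw [show q + 1 + (epsOp (𝓥 := 𝓥)).e = q by simp [epsOp]] at this
    simp only [K, LinearMap.comp_apply]
    rw [linearPart_lengthScale, this]
  have hhom := ceDiff_homotopy h 𝔤 K hx' (hKmem hx') hKlin
  let z := (q + 1).negOnePow • K x
  have hz : z ∈ tensorCochains 𝓡 𝓥 epsGrading (fun _ => True) q := units_smul_mem' _ (hKmem hx')
  have hzord : IsOrder I m z := (hKord hm).units_smul _
  let c := restrictOne isCDGA_eps z
  have hz0 : z [] = 0 := by simp [z, K]
  have hc : c ∈ reducedCochains 𝓡 𝓥 q := restrictOne_mem hz hz0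
  have hcord : IsOrder I m c := hzord.restrictOne
  -- The function `c` regarded as a form of degree zero; it agrees with `z` on words without `ε`, so
  -- `z - w` has no component of degree zero.
  let w : List (PureTensor 𝓥 epsGrading) → R := push (fun _ => True) epsFst q c
  have hw : w ∈ tensorCochains 𝓡 𝓥 epsGrading (fun _ => True) q := by
    have := push_mem h epsFst_eq_zero hc
    rwa [sub_zero] at this
  have hy : z - w ∈ tensorCochains 𝓡 𝓥 epsGrading HasEps q := by
    refine mem_epsCochains_iff.2 ⟨sub_mem hz hw, fun l hl => ?_⟩
    rw [Pi.sub_apply, eval_of_not_hasEps hz hl, eval_of_not_hasEps hw hl, ← smul_sub]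
    simp only [w, c, restrictOne]
    rw [push_of_adm _ _ _ trivial, koszulExp_map_oneH, prodVal_map_oneH]
    simp [epsFst_apply, Function.comp_def, restrictOne]
  refine ⟨z - w, hy, -c, neg_mem hc, fun l => sub_mem (hzord l) (push_isOrder hcord l),
    push_isOrder fun l => neg_mem (hcord l), fun l => ?_⟩
  by_cases hl : HasEps l
  · have hne : l ≠ [] := by rintro rfl; simp [HasEps] at hl
    have hlen : (l.length : ℝ) ≠ 0 := by simpa using hne
    have e1 : (truncatedDeRham 𝔤).D q (z - w) l =
        ceDiff dR tdeg (tensorBr isCDGA_eps 𝔤) (fun _ => True) q z l -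
        ceDiff dR tdeg (tensorBr isCDGA_eps 𝔤) (fun _ => True) q w l := by
      rw [← Pi.sub_apply, ← map_sub, ← ceDiff_eps 𝔤 hy]
      rfl
    have e2 : ceDiff dR tdeg (tensorBr isCDGA_eps 𝔤) (fun _ => True) q w l = - deRham q c l := by
      have := ceDiff_push_apply h 𝔤 epsFst_eq_zero hc (l := l) trivial fun h' => (hne h').elim
      rw [sub_zero] at this
      rw [this, epsFst_comp_epsD, push_of_adm _ _ _ trivial, fst_prodVal_of_hasEps hl]
      simp [deRham]
    -- The differential of `x` is an exact one-form. Inserting a further `ε` into a word that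
    -- already has one gives zero under the `ε`-coefficient, since `ε² = 0`.
    have e3 : K (ceDiff dR tdeg (tensorBr isCDGA_eps 𝔤) (fun _ => True) (q + 1) x) l = 0 := by
      obtain ⟨F, hF, hF'⟩ := hDx
      rw [← ceDiff_eps 𝔤 hx]
      change K ((truncatedDeRham 𝔤).D (q + 1) x) l = 0
      rw [← hF']
      simp only [K, LinearMap.comp_apply, lengthScale_apply]
      rw [epsOp.app_of_adm _ trivial, slotSum_rel (τ := id) (G := 0) (0 : R →+ R)]
      · simp
      · intro l₁ t l₂ hl'
        have : prodVal (l₁ ++ epsOp.map t :: l₂) = DualNumber.eps * prodVal l := by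
          simp only [prodVal, hl', List.map_append, List.prod_append, List.map_cons,
            List.prod_cons, SlotOp.map, mapLeft, epsOp, LinearMap.mulLeft_apply]
          ring
        rw [deRham, push_of_adm _ _ _ trivial, this]
        have h1 := fst_prodVal_of_hasEps hl
        rw [epsFst_apply] at h1
        simp [epsSnd_apply, h1]
    have e4 := congrFun hhom l
    have e5 : ((dOp h).app (K x) + K ((dOp h).app x)) l = x l := by
      have := congrFun (dOp_epsOp hx') l
      simp only [K, LinearMap.comp_apply, Pi.add_apply, SlotOp.app_lengthScale,
        lengthScale_apply] at this ⊢
      rw [← smul_add, this, smul_smul, inv_mul_cancel₀ hlen, one_smul]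
    have e6 : deRham q (-c) l = - deRham (𝓥 := 𝓥) q c l := by
      have := push_smul (Adm := fun _ : List (PureTensor 𝓥 epsGrading) => True) epsSnd q (-1) c
      have := congrFun this l
      simpa [deRham] using this
    rw [Pi.add_apply, Pi.add_apply, e5, Pi.smul_apply, e3, smul_zero, zero_add] at e4
    change ceDiff dR tdeg (tensorBr isCDGA_eps 𝔤) (fun _ => True) q z l = _ at e4
    rw [Pi.sub_apply, Pi.sub_apply, e1, e2, e4, e6]
    have := add_mem (higherPart_isOrder (hA := isCDGA_eps) (Adm := fun _ => True) hI 𝔤 (hKmem hx') (hKord hm) l)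
      (hKord (higherPart_isOrder (hA := isCDGA_eps) (Adm := fun _ => True) hI 𝔤 hx' hm) l)
    convert neg_mem this using 1
    simp only [Pi.add_apply]
    abel
  · rw [Pi.sub_apply, Pi.sub_apply, hx0 l hl, deRham, push_of_adm _ _ _ trivial,
      snd_prodVal_of_not_hasEps hl, zero_smul, smul_zero, sub_zero, zero_sub]
    refine neg_mem ?_
    rw [show (truncatedDeRham 𝔤).D q (z - w) l = 0 from ceDiff_of_not _ _ _ _ hl]
    exact zero_mem _

theorem assemble_mem {p : ℤ} (F : ℕ → List (PureTensor 𝓥 𝓐) → R)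
    (hF : ∀ n, F n ∈ tensorCochains 𝓡 𝓥 𝓐 Adm p) : assemble F ∈ tensorCochains 𝓡 𝓥 𝓐 Adm p := by
  replace hF : ∀ n, IsTensorCochain 𝓡 𝓥 𝓐 Adm p (F n) := hF
  refine (⟨fun l h => (hF l.length).zero l h, fun l => (hF l.length).mem l,
    fun x y z v l h1 h2 h3 h4 h5 => (hF (l.length + 1)).add_left x y z v l h1 h2 h3 h4 h5,
    fun c x z v l h1 h2 h3 => (hF (l.length + 1)).smul_left c x z v l h1 h2 h3,
    fun a x y z l h1 h2 h3 => (hF (l.length + 1)).add_right a x y z l h1 h2 h3,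
    fun e r hr a x z l h1 h2 => (hF (l.length + 1)).smul_right e r hr a x z l h1 h2, fun x y l₁ l₂ => ?_⟩ :
    IsTensorCochain 𝓡 𝓥 𝓐 Adm p (assemble F))
  have := (hF (l₁ ++ x :: y :: l₂).length).swap x y l₁ l₂
  simpa [assemble] using this

theorem assemble_reducedCochains {p : ℤ} (F : ℕ → List (Homog 𝓥) → R)
    (hF : ∀ n, F n ∈ reducedCochains 𝓡 𝓥 p) : assemble F ∈ reducedCochains 𝓡 𝓥 p := by
  replace hF : ∀ n, IsReducedCochain 𝓡 𝓥 p (F n) := hF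
  refine (⟨(hF 0).nil, fun l => (hF l.length).mem l, fun x y z l h1 h2 h3 => (hF (l.length + 1)).add x y z l h1 h2 h3,
    fun a r hr x z l h1 h2 => (hF (l.length + 1)).smul a r hr x z l h1 h2, fun x y l₁ l₂ => ?_⟩ :
    IsReducedCochain 𝓡 𝓥 p (assemble F))
  have := (hF (l₁ ++ x :: y :: l₂).length).swap x y l₁ l₂
  simpa [assemble] using this

theorem push_assemble (φ : A →ₗ[ℝ] ℝ) (p : ℤ) (F : ℕ → List (Homog 𝓥) → R) :
    push Adm φ p (assemble F) = assemble fun n => push Adm φ p (F n) := by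
  funext l
  simp [push, assemble]

/-- The de Rham differential as a linear map. -/
noncomputable def pushL (Adm : List (PureTensor 𝓥 𝓐) → Prop) (φ : A →ₗ[ℝ] ℝ) (p : ℤ) :
    (List (Homog 𝓥) → R) →ₗ[ℝ] (List (PureTensor 𝓥 𝓐) → R) where
  toFun := push Adm φ p
  map_add' := push_add φ p
  map_smul' := push_smul φ p

/-- Iterates `eps_step` by means of `exists_of_step`, with the exact one-forms as the subspaces `B`
and `B'`. -/
theorem exists_sub_mem_deRham (hR : IsCDGA 𝓡 dR) (hI : IsNilpotentDGIdeal 𝓡 dR I)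
    [DirectSum.Decomposition 𝓥]
    (𝔤 : CurvedLInfty 𝓡 dR I 𝓥) {q : ℤ} {x : List (PureTensor 𝓥 epsGrading) → R}
    (hx : x ∈ (truncatedDeRham 𝔤).S (q + 1))
    (hDx : ∃ F ∈ reducedCochains 𝓡 𝓥 (q + 1), deRham (q + 1) F = (truncatedDeRham 𝔤).D (q + 1) x) :
    ∃ y ∈ (truncatedDeRham 𝔤).S q, ∃ c ∈ reducedCochains 𝓡 𝓥 q,
      deRham q c = x - (truncatedDeRham 𝔤).D q y := by
  obtain ⟨n, hn⟩ := hI.nilpotent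
  have hΩ := isComplex_truncatedDeRham hR 𝔤
  let B : ℤ → Submodule ℝ (List (PureTensor 𝓥 epsGrading) → R) := fun p =>
    (reducedCochains 𝓡 𝓥 p).map (pushL (fun _ => True) epsSnd p)
  obtain ⟨y, hy, c, hc, h⟩ := exists_of_step (idealPow_eq_bot hn) (S := (truncatedDeRham 𝔤).S q)
    (S' := (truncatedDeRham 𝔤).S (q + 1)) (B := B q) (B' := B (q + 1))
    (D := (truncatedDeRham 𝔤).D q) (D' := (truncatedDeRham 𝔤).D (q + 1)) assemble_mem
    (fun F hF => by
      choose G hG hG' using hF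
      refine ⟨assemble G, assemble_reducedCochains _ hG, ?_⟩
      refine (push_assemble _ _ _).trans (congrArg assemble (funext hG')))
    (fun F G l => ceDiff_congr_length q F G l) (hΩ.maps q) (hΩ.sq q)
    (by rintro _ ⟨F, hF, rfl⟩; exact deRham_mem hF)
    (by
      rintro _ ⟨F, hF, rfl⟩
      refine ⟨-(reducedCE 𝔤).D q F, neg_mem ((isComplex_reducedCE hR 𝔤).maps q F hF), ?_⟩
      rw [map_neg]
      exact (ceDiff_deRham 𝔤 hF).symm)
    (fun m x hx ⟨F, hF, hF'⟩ hm => by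
      obtain ⟨y, hy, c, hc, h1, h2, h3⟩ := eps_step hI.homogeneous 𝔤 hx ⟨F, hF, hF'⟩ hm
      exact ⟨y, hy, _, ⟨c, hc, rfl⟩, h1, h2, h3⟩) hx (by
      obtain ⟨F, hF, hF'⟩ := hDx
      exact ⟨F, hF, hF'⟩)
  exact ⟨y, hy, c, hc, h⟩

end EpsStep

noncomputable section ShortcutInstances

/-! Shortcuts for instance search, active only where they are declared as local instances. -/

@[reducible] def ringForms : Ring Forms := inferInstance
@[reducible] def algebraForms : Algebra ℝ Forms := inferInstance
@[reducible] def moduleForms : Module ℝ Forms := inferInstance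
@[reducible] def addCommGroupForms : AddCommGroup Forms := inferInstance
@[reducible] def addCommMonoidForms : AddCommMonoid Forms := inferInstance
@[reducible] def commRingSmooth : CommRing Smooth := inferInstance
@[reducible] def addCommGroupSmooth : AddCommGroup Smooth := inferInstance
@[reducible] def addZeroClassSmooth : AddZeroClass Smooth := inferInstance
@[reducible] def addMonoidSmooth : AddMonoid Smooth := inferInstance
@[reducible] def moduleSmooth : Module Smooth Smooth := inferInstance
@[reducible] def moduleSmoothOp : Module Smoothᵐᵒᵖ Smooth := inferInstance
@[reducible] def smulSmooth : SMul Smooth Smooth := inferInstance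
@[reducible] def smulSmoothOp : SMul Smoothᵐᵒᵖ Smooth := inferInstance
@[reducible] def algebraSmooth : Algebra ℝ Smooth := inferInstance
@[reducible] def smulRealSmooth : SMul ℝ Smooth := inferInstance

end ShortcutInstances

attribute [local instance 10000] ringForms algebraForms moduleForms addCommGroupForms
  addCommMonoidForms commRingSmooth addCommGroupSmooth addZeroClassSmooth addMonoidSmooth
  moduleSmooth moduleSmoothOp smulSmooth smulSmoothOp algebraSmooth smulRealSmooth

/-! ### Operators on forms on the line -/

section FormOps

set_option linter.unusedSectionVars false

variable {R : Type} [Ring R] [Algebra ℝ R] {𝓡 : ℤ → Submodule ℝ R} [GradedAlgebra 𝓡]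
  {dR : R →ₗ[ℝ] R} {I : Ideal R}
  {V : Type} [AddCommGroup V] [Module ℝ V] [Module R V] {𝓥 : ℤ → Submodule ℝ V}

/-- The coefficient of a homogeneous form as a smooth function. -/
def cf (a : Homog formGrading) : Smooth := a.val.fst + a.val.snd

theorem fst_apply_of_cf {a : Homog formGrading} {x : ℝ} (h : (cf a : ℝ → ℝ) x = 0) :
    (a.val.fst : ℝ → ℝ) x = 0 := by
  by_cases h0 : a.deg = 0
  · have h2 : a.val.snd = 0 := a.mem.2 (by omega)
    simpa [cf, h2] using h
  · simp [a.mem.1 h0]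

theorem snd_apply_of_cf {a : Homog formGrading} {x : ℝ} (h : (cf a : ℝ → ℝ) x = 0) :
    (a.val.snd : ℝ → ℝ) x = 0 := by
  by_cases h0 : a.deg = 1
  · have h2 : a.val.fst = 0 := a.mem.1 (by omega)
    simpa [cf, h2] using h
  · simp [a.mem.2 h0]

theorem hasCompactSupport_of_cf {a : Homog formGrading} {g : ℝ → ℝ}
    (ha : HasCompactSupport (cf a : ℝ → ℝ)) (h : ∀ x, (cf a : ℝ → ℝ) x = 0 → g x = 0) :
    HasCompactSupport g :=
  ha.mono fun x hx h' => hx (h x h')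

theorem prod_apply_eq_zero {t : PureTensor 𝓥 formGrading} {l : List (PureTensor 𝓥 formGrading)}
    (ht : t ∈ l) {x : ℝ} (h : (cf t.1 : ℝ → ℝ) x = 0) :
    ((prodVal l).fst : ℝ → ℝ) x = 0 ∧ ((prodVal l).snd : ℝ → ℝ) x = 0 := by
  induction l with
  | nil => simp at ht
  | cons s l ih =>
    rcases List.mem_cons.1 ht with rfl | ht
    · simp [fst_apply_of_cf h, snd_apply_of_cf h]
    · simp [ih ht]

theorem Smooth.deriv_apply (f : Smooth) (x : ℝ) : (Smooth.deriv f : ℝ → ℝ) x = _root_.deriv f x :=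
  rfl

theorem hasCompactSupport_fst {a : Homog formGrading} (ha : HasCompactSupport (cf a : ℝ → ℝ)) :
    HasCompactSupport (a.val.fst : ℝ → ℝ) :=
  hasCompactSupport_of_cf ha fun _ => fst_apply_of_cf

theorem hasCompactSupport_snd {a : Homog formGrading} (ha : HasCompactSupport (cf a : ℝ → ℝ)) :
    HasCompactSupport (a.val.snd : ℝ → ℝ) :=
  hasCompactSupport_of_cf ha fun _ => snd_apply_of_cf

/-- Sums, products and derivatives of forms do not enlarge supports, and one compactly supported
factor makes a product compactly supported. -/
theorem tensorAdmissible_proper :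
    TensorAdmissible isCDGA_forms (Proper : List (PureTensor 𝓥 formGrading) → Prop) where
  perm h := fun ⟨t, ht, h'⟩ => ⟨t, h.mem_iff.1 ht, h'⟩
  comb := by
    rintro x y z v w u l t t' ⟨s, hs, h1⟩ ⟨s', hs', h2⟩ - - h3
    rcases List.mem_cons.1 hs with rfl | hs
    · rcases List.mem_cons.1 hs' with rfl | hs'
      · refine ⟨_, List.mem_cons_self, ?_⟩
        have h1' : HasCompactSupport (fun p => t * (cf x : ℝ → ℝ) p) :=
          hasCompactSupport_of_cf h1 fun p hp => by simp [hp]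
        have h2' : HasCompactSupport (fun p => t' * (cf y : ℝ → ℝ) p) :=
          hasCompactSupport_of_cf h2 fun p hp => by simp [hp]
        have e : coeff z = fun p => t * (cf x : ℝ → ℝ) p + t' * (cf y : ℝ → ℝ) p := by
          funext p
          simp [coeff, cf, h3]
          ring
        rw [e]
        exact h1'.add h2'
      · exact ⟨s', by simp [hs'], h2⟩
    · exact ⟨s, by simp [hs], h1⟩
  zero := by
    rintro x v l h -
    refine ⟨_, List.mem_cons_self, ?_⟩
    have : coeff x = 0 := by
      funext p
      simp [coeff, h]
    simpa [this] using HasCompactSupport.zero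
  prod := by
    rintro a c v ⟨t, ht, h⟩
    rcases List.mem_append.1 ht with ht | ht
    · refine ⟨_, List.mem_cons_self, hasCompactSupport_of_cf h fun p hp => ?_⟩
      have := prod_apply_eq_zero ht hp
      simp [coeff, prodH_val, this.1, this.2]
    · exact ⟨t, by simp [ht], h⟩
  d := by
    rintro ⟨a, w⟩ c v ⟨s, hs, h⟩
    rcases List.mem_cons.1 hs with rfl | hs
    · refine ⟨_, List.mem_cons_self, ?_⟩
      have h1 : HasCompactSupport (deriv (a.val.fst : ℝ → ℝ)) := (hasCompactSupport_fst h).deriv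
      convert h1 using 1
      funext p
      simp [coeff, extD, -DualNumber.inr_eq_smul_eps, Smooth.deriv_apply]
    · exact ⟨s, by simp [hs], h⟩

/-- An operator on forms that does not increase supports, as a slot operator. -/
def formOp (θ : Forms →ₗ[ℝ] Forms) (e : ℤ)
    (mem : ∀ i x, x ∈ formGrading i → θ x ∈ formGrading (i + e))
    (hθ : ∀ a : Homog formGrading, HasCompactSupport (coeff a) →
      HasCompactSupport (((θ a.val).fst + (θ a.val).snd : Smooth) : ℝ → ℝ)) :
    SlotOp (𝓥 := 𝓥) formGrading Proper where
  toFun := θ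
  e := e
  mem := mem
  adm := by
    rintro t l ⟨s, hs, h⟩
    rcases List.mem_cons.1 hs with rfl | hs
    · exact ⟨_, List.mem_cons_self, hθ _ h⟩
    · exact ⟨s, by simp [hs], h⟩

/-- Forms from pairs of linear operators on coefficients. -/
def mkForm (α β γ δ : Smooth →ₗ[ℝ] Smooth) : Forms →ₗ[ℝ] Forms where
  toFun a := (α a.fst + β a.snd, γ a.fst + δ a.snd)
  map_add' a b := TrivSqZeroExt.ext
    (show α (a + b).fst + β (a + b).snd = (α a.fst + β a.snd) + (α b.fst + β b.snd) by
      simp only [TrivSqZeroExt.fst_add, TrivSqZeroExt.snd_add, map_add]; abel)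
    (show γ (a + b).fst + δ (a + b).snd = (γ a.fst + δ a.snd) + (γ b.fst + δ b.snd) by
      simp only [TrivSqZeroExt.fst_add, TrivSqZeroExt.snd_add, map_add]; abel)
  map_smul' c a := TrivSqZeroExt.ext
    (show α (c • a).fst + β (c • a).snd = c • (α a.fst + β a.snd) by simp)
    (show γ (c • a).fst + δ (c • a).snd = c • (γ a.fst + δ a.snd) by simp)

@[simp] theorem fst_mkForm (α β γ δ : Smooth →ₗ[ℝ] Smooth) (a : Forms) :
    (mkForm α β γ δ a).fst = α a.fst + β a.snd := rfl

@[simp] theorem snd_mkForm (α β γ δ : Smooth →ₗ[ℝ] Smooth) (a : Forms) :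
    (mkForm α β γ δ a).snd = γ a.fst + δ a.snd := rfl

/-- The coordinate function. -/
def coordX : Smooth := ⟨fun x => x, (contDiff_id : ContDiff ℝ ∞ fun x : ℝ => x)⟩

theorem deriv_coordX : Smooth.deriv coordX = 1 := by
  ext x
  simp [Smooth.deriv, coordX]

/-- Multiplication by the coordinate function. -/
def mulX : Smooth →ₗ[ℝ] Smooth := LinearMap.mulLeft ℝ coordX

theorem mulX_apply (f : Smooth) : mulX f = coordX * f := rfl

theorem deriv_mulX (f : Smooth) : Smooth.deriv (mulX f) = f + mulX (Smooth.deriv f) := by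
  rw [mulX_apply, Smooth.deriv_mul, deriv_coordX, one_mul, mulX_apply]

theorem hasCompactSupport_mulX {f : Smooth} (hf : HasCompactSupport (f : ℝ → ℝ)) :
    HasCompactSupport (mulX f : ℝ → ℝ) :=
  hf.mono fun x hx h' => hx (by simp [mulX_apply, h'])

theorem hasCompactSupport_deriv {f : Smooth} (hf : HasCompactSupport (f : ℝ → ℝ)) :
    HasCompactSupport (Smooth.deriv f : ℝ → ℝ) := HasCompactSupport.deriv hf

theorem hasCompactSupport_add {f g : Smooth} (hf : HasCompactSupport (f : ℝ → ℝ))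
    (hg : HasCompactSupport (g : ℝ → ℝ)) : HasCompactSupport ((f + g : Smooth) : ℝ → ℝ) :=
  HasCompactSupport.add hf hg

/-- Contraction with `∂/∂x`. -/
def iotaOp : SlotOp (𝓥 := 𝓥) formGrading Proper :=
  formOp (mkForm 0 LinearMap.id 0 0) (-1)
    (fun i x hx => ⟨fun h => by simp [hx.2 (by omega)], fun h => by simp⟩)
    fun a ha => by simpa using hasCompactSupport_snd ha

/-- Exterior multiplication by `dx`. -/
def dxOp : SlotOp (𝓥 := 𝓥) formGrading Proper :=
  formOp (mkForm 0 0 LinearMap.id 0) 1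
    (fun i x hx => ⟨fun h => by simp, fun h => by simp [hx.1 (by omega)]⟩)
    fun a ha => by simpa using hasCompactSupport_fst ha

/-- Multiplication by the coordinate function. -/
def mulXOp : SlotOp (𝓥 := 𝓥) formGrading Proper :=
  formOp (mkForm mulX 0 0 mulX) 0
    (fun i x hx => ⟨fun h => by simp [hx.1 (by omega)], fun h => by simp [hx.2 (by omega)]⟩)
    fun a ha => by simpa [← map_add] using hasCompactSupport_mulX ha

/-- Contraction with the Euler vector field `x ∂/∂x`. -/
def eulerIotaOp : SlotOp (𝓥 := 𝓥) formGrading Proper :=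
  formOp (mkForm 0 mulX 0 0) (-1)
    (fun i x hx => ⟨fun h => by simp [hx.2 (by omega)], fun h => by simp⟩)
    fun a ha => by simpa using hasCompactSupport_mulX (hasCompactSupport_snd ha)

/-- The Lie derivative along the Euler vector field. -/
noncomputable def eulerOp : SlotOp (𝓥 := 𝓥) formGrading Proper :=
  formOp (mkForm (mulX ∘ₗ Smooth.deriv) 0 0 (Smooth.deriv ∘ₗ mulX)) 0
    (fun i x hx => ⟨fun h => by simp [hx.1 (by omega)], fun h => by simp [hx.2 (by omega)]⟩)
    fun a ha => by
      simpa using hasCompactSupport_add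
        (hasCompactSupport_mulX (hasCompactSupport_deriv (hasCompactSupport_fst ha)))
        (hasCompactSupport_deriv (hasCompactSupport_mulX (hasCompactSupport_snd ha)))

/-- The Lie derivative along `∂/∂x`. -/
noncomputable def lieOp : SlotOp (𝓥 := 𝓥) formGrading Proper :=
  formOp (mkForm Smooth.deriv 0 0 Smooth.deriv) 0
    (fun i x hx => ⟨fun h => by simp [hx.1 (by omega)], fun h => by simp [hx.2 (by omega)]⟩)
    fun a ha => by
      simpa using hasCompactSupport_add (hasCompactSupport_deriv (hasCompactSupport_fst ha))
        (hasCompactSupport_deriv (hasCompactSupport_snd ha))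

/-- The identity. -/
def idOp : SlotOp (𝓥 := 𝓥) formGrading Proper :=
  formOp LinearMap.id 0 (fun i x hx => by simpa using hx) fun a ha => ha

/-- The zero operator of degree `e`. -/
def zeroOp (e : ℤ) : SlotOp (𝓥 := 𝓥) formGrading Proper :=
  formOp 0 e (fun i x hx => zero_mem _) fun a ha => by simpa using HasCompactSupport.zero

/-- The exterior derivative. -/
noncomputable def extOp : SlotOp (𝓥 := 𝓥) formGrading Proper := dOp tensorAdmissible_proper

theorem extOp_toFun : (extOp (𝓥 := 𝓥)).toFun = mkForm 0 0 Smooth.deriv 0 :=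
  LinearMap.ext fun a => TrivSqZeroExt.ext
    (by simp [extOp, dOp, extD, -DualNumber.inr_eq_smul_eps])
    (by simp [extOp, dOp, extD, -DualNumber.inr_eq_smul_eps])

theorem iotaOp_toFun : (iotaOp (𝓥 := 𝓥)).toFun = mkForm 0 LinearMap.id 0 0 := rfl
theorem dxOp_toFun : (dxOp (𝓥 := 𝓥)).toFun = mkForm 0 0 LinearMap.id 0 := rfl
theorem mulXOp_toFun : (mulXOp (𝓥 := 𝓥)).toFun = mkForm mulX 0 0 mulX := rfl
theorem eulerIotaOp_toFun : (eulerIotaOp (𝓥 := 𝓥)).toFun = mkForm 0 mulX 0 0 := rfl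
theorem eulerOp_toFun : (eulerOp (𝓥 := 𝓥)).toFun =
    mkForm (mulX ∘ₗ Smooth.deriv) 0 0 (Smooth.deriv ∘ₗ mulX) := rfl
theorem lieOp_toFun : (lieOp (𝓥 := 𝓥)).toFun = mkForm Smooth.deriv 0 0 Smooth.deriv := rfl
theorem idOp_toFun : (idOp (𝓥 := 𝓥)).toFun = LinearMap.id := rfl
theorem zeroOp_toFun (e : ℤ) : (zeroOp (𝓥 := 𝓥) e).toFun = 0 := rfl

variable [SetLike.GradedSMul 𝓡 𝓥] [IsScalarTower ℝ R V] {p : ℤ}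
  {F : List (PureTensor 𝓥 formGrading) → R}

theorem app_idOp (hF : F ∈ tensorCochains 𝓡 𝓥 formGrading Proper p) :
    idOp.app F = lengthScale (fun n => (n : ℝ)) F := by
  funext l
  by_cases hl : Proper l
  · exact idOp.app_one rfl (fun _ => rfl) hl
  · rw [idOp.app_of_not _ hl, lengthScale_apply,
      IsTensorCochain.zero (hF : IsTensorCochain 𝓡 𝓥 formGrading Proper p F) l hl, smul_zero]

theorem app_zeroOp (hF : F ∈ tensorCochains 𝓡 𝓥 formGrading Proper p) (e : ℤ) :
    (zeroOp e).app F = 0 :=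
  (zeroOp e).app_eq_zero tensorAdmissible_proper (fun _ => rfl) hF

theorem graded_commutator (θ θ' η : SlotOp (𝓥 := 𝓥) formGrading Proper) (u : ℤˣ)
    (hF : F ∈ tensorCochains 𝓡 𝓥 formGrading Proper p)
    (hu : (θ.e * θ'.e).negOnePow = u) (he : η.e = θ.e + θ'.e)
    (h1 : ∀ a, (η.toFun a).fst = (θ'.toFun (θ.toFun a)).fst - u • (θ.toFun (θ'.toFun a)).fst)
    (h2 : ∀ a, (η.toFun a).snd = (θ'.toFun (θ.toFun a)).snd - u • (θ.toFun (θ'.toFun a)).snd) :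
    θ.app (θ'.app F) = u • θ'.app (θ.app F) + η.app F :=
  θ.app_app tensorAdmissible_proper θ' η u hu he
    (fun a => TrivSqZeroExt.ext ((h1 a).trans (by simp [Units.smul_def])) ((h2 a).trans (by simp [Units.smul_def]))) hF

/-- Cartan's formula for the vector field `x ∂/∂x` on single forms, transported to functionals. -/
theorem ext_eulerIota (hF : F ∈ tensorCochains 𝓡 𝓥 formGrading Proper p) :
    extOp.app (eulerIotaOp.app F) = -eulerIotaOp.app (extOp.app F) + eulerOp.app F := by
  have := graded_commutator extOp eulerIotaOp eulerOp (-1) hF rfl rfl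
    (fun a => by simp [extOp_toFun, eulerIotaOp_toFun, eulerOp_toFun])
    (fun a => by simp [extOp_toFun, eulerIotaOp_toFun, eulerOp_toFun, deriv_mulX, add_comm])
  simpa using this

theorem ext_iota (hF : F ∈ tensorCochains 𝓡 𝓥 formGrading Proper p) :
    extOp.app (iotaOp.app F) = -iotaOp.app (extOp.app F) + lieOp.app F := by
  have := graded_commutator extOp iotaOp lieOp (-1) hF rfl rfl
    (fun a => by simp [extOp_toFun, iotaOp_toFun, lieOp_toFun])
    (fun a => by simp [extOp_toFun, iotaOp_toFun, lieOp_toFun])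
  simpa using this

/-- On single forms, the commutator of `d` and multiplication by `x` is exterior multiplication by
`dx`. -/
theorem mulX_ext (hF : F ∈ tensorCochains 𝓡 𝓥 formGrading Proper p) :
    mulXOp.app (extOp.app F) = extOp.app (mulXOp.app F) + dxOp.app F := by
  have := graded_commutator mulXOp extOp dxOp 1 hF rfl rfl
    (fun a => by simp [mulXOp_toFun, extOp_toFun, dxOp_toFun])
    (fun a => by simp [mulXOp_toFun, extOp_toFun, dxOp_toFun, deriv_mulX])
  simpa using this

theorem iota_dx (hF : F ∈ tensorCochains 𝓡 𝓥 formGrading Proper p) :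
    iotaOp.app (dxOp.app F) = -dxOp.app (iotaOp.app F) + idOp.app F := by
  have := graded_commutator iotaOp dxOp idOp (-1) hF rfl rfl
    (fun a => by simp [iotaOp_toFun, dxOp_toFun, idOp_toFun])
    (fun a => by simp [iotaOp_toFun, dxOp_toFun, idOp_toFun])
  simpa using this

theorem euler_iota (hF : F ∈ tensorCochains 𝓡 𝓥 formGrading Proper p) :
    eulerOp.app (iotaOp.app F) = iotaOp.app (eulerOp.app F) + iotaOp.app F := by
  have := graded_commutator eulerOp iotaOp iotaOp 1 hF rfl rfl
    (fun a => by simp [eulerOp_toFun, iotaOp_toFun, deriv_mulX])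
    (fun a => by simp [eulerOp_toFun, iotaOp_toFun, deriv_mulX])
  simpa using this

theorem dx_euler (hF : F ∈ tensorCochains 𝓡 𝓥 formGrading Proper p) :
    dxOp.app (eulerOp.app F) = eulerOp.app (dxOp.app F) + dxOp.app F := by
  have := graded_commutator dxOp eulerOp dxOp 1 hF rfl rfl
    (fun a => by simp [dxOp_toFun, eulerOp_toFun, deriv_mulX])
    (fun a => by simp [dxOp_toFun, eulerOp_toFun, deriv_mulX])
  simpa using this

/-- The Heisenberg relation between `d/dx` and `x`. On functionals the commutator is the number of
fields. -/
theorem mulX_lie (hF : F ∈ tensorCochains 𝓡 𝓥 formGrading Proper p) :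
    mulXOp.app (lieOp.app F) = lieOp.app (mulXOp.app F) + idOp.app F := by
  have := graded_commutator mulXOp lieOp idOp 1 hF rfl rfl
    (fun a => by simp [mulXOp_toFun, lieOp_toFun, idOp_toFun, deriv_mulX])
    (fun a => by simp [mulXOp_toFun, lieOp_toFun, idOp_toFun, deriv_mulX])
  simpa using this

theorem iota_iota (hF : F ∈ tensorCochains 𝓡 𝓥 formGrading Proper p) :
    iotaOp.app (iotaOp.app F) = -iotaOp.app (iotaOp.app F) := by
  have := graded_commutator iotaOp iotaOp (zeroOp (-2)) (-1) hF rfl rfl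
    (fun a => by simp [iotaOp_toFun, zeroOp_toFun])
    (fun a => by simp [iotaOp_toFun, zeroOp_toFun])
  simpa [app_zeroOp hF] using this

end FormOps

attribute [local instance 10000] ringForms algebraForms moduleForms addCommGroupForms
  addCommMonoidForms commRingSmooth addCommGroupSmooth addZeroClassSmooth addMonoidSmooth
  moduleSmooth moduleSmoothOp smulSmooth smulSmoothOp algebraSmooth smulRealSmooth

/-! ### Polydifferential densities with constant coefficients -/

section Densities

/-- The smooth functions with compact support. -/
def compactSmooth : Submodule ℝ Smooth where
  carrier := {f | HasCompactSupport (f : ℝ → ℝ)}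
  zero_mem' := HasCompactSupport.zero
  add_mem' hf hg := HasCompactSupport.add hf hg
  smul_mem' c f hf := HasCompactSupport.mono hf fun x hx h' => hx (by
    change c • (f : ℝ → ℝ) x = 0
    rw [h', smul_zero])

theorem integrable_of_compact (f : compactSmooth) :
    MeasureTheory.Integrable ((f : Smooth) : ℝ → ℝ) :=
  (Smooth.contDiff f).continuous.integrable_of_hasCompactSupport f.2

/-- A linear extension to all smooth functions of the integral of compactly supported ones. -/
noncomputable def lineIntegral : Smooth →ₗ[ℝ] ℝ :=
  (LinearMap.exists_extend (p := compactSmooth)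
    { toFun := fun f => ∫ x, ((f : Smooth) : ℝ → ℝ) x
      map_add' := fun f g => MeasureTheory.integral_add (integrable_of_compact f)
        (integrable_of_compact g)
      map_smul' := fun c f => MeasureTheory.integral_smul c ((f : Smooth) : ℝ → ℝ) }).choose

theorem lineIntegral_of_compact {f : Smooth} (hf : f ∈ compactSmooth) :
    lineIntegral f = ∫ x, (f : ℝ → ℝ) x :=
  LinearMap.congr_fun (LinearMap.exists_extend (p := compactSmooth)
    { toFun := fun f => ∫ x, ((f : Smooth) : ℝ → ℝ) x
      map_add' := fun f g => MeasureTheory.integral_add (integrable_of_compact f)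
        (integrable_of_compact g)
      map_smul' := fun c f =>
        MeasureTheory.integral_smul c ((f : Smooth) : ℝ → ℝ) }).choose_spec ⟨f, hf⟩

theorem Smooth.hasDerivAt (f : Smooth) (x : ℝ) :
    HasDerivAt (f : ℝ → ℝ) ((Smooth.deriv f : ℝ → ℝ) x) x :=
  ((contDiff_infty_iff_deriv.1 f.2).1 x).hasDerivAt

theorem deriv_mem_compact {f : Smooth} (hf : f ∈ compactSmooth) :
    Smooth.deriv f ∈ compactSmooth := HasCompactSupport.deriv hf

theorem mul_mem_compact {f g : Smooth} (hf : f ∈ compactSmooth) : f * g ∈ compactSmooth :=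
  HasCompactSupport.mono hf fun x hx h' => hx (by
    change (f : ℝ → ℝ) x * (g : ℝ → ℝ) x = 0
    rw [h', zero_mul])

theorem mul_mem_compact' {f g : Smooth} (hg : g ∈ compactSmooth) : f * g ∈ compactSmooth := by
  rw [mul_comm]
  exact mul_mem_compact hg

theorem lineIntegral_deriv {f : Smooth} (hf : f ∈ compactSmooth) :
    lineIntegral (Smooth.deriv f) = 0 := by
  rw [lineIntegral_of_compact (deriv_mem_compact hf)]
  exact MeasureTheory.integral_eq_zero_of_hasDerivAt_of_integrable (fun x => Smooth.hasDerivAt f x)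
    (integrable_of_compact ⟨_, deriv_mem_compact hf⟩) (integrable_of_compact ⟨f, hf⟩)

/-- The product of iterated derivatives of the given orders. -/
noncomputable def dens : List ℕ → List Smooth → Smooth
  | k :: m, c :: cs => Smooth.deriv^[k] c * dens m cs
  | [], _ => 1
  | _ :: _, [] => 1

@[simp] theorem dens_cons (k : ℕ) (m : List ℕ) (c : Smooth) (cs : List Smooth) :
    dens (k :: m) (c :: cs) = Smooth.deriv^[k] c * dens m cs := rfl

@[simp] theorem dens_nil (cs : List Smooth) : dens [] cs = 1 := by cases cs <;> rfl

theorem deriv_one : Smooth.deriv 1 = 0 := by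
  have := Smooth.deriv_mul 1 1
  simpa using this

theorem deriv_dens {m : List ℕ} {cs : List Smooth} (h : m.length = cs.length) :
    Smooth.deriv (dens m cs) =
      ∑ i ∈ Finset.range cs.length, dens (m.modify i (· + 1)) cs := by
  induction m generalizing cs with
  | nil =>
    cases cs with
    | nil => simp [deriv_one]
    | cons => simp at h
  | cons k m ih =>
    cases cs with
    | nil => simp at h
    | cons c cs =>
      rw [List.length_cons, Finset.sum_range_succ', dens_cons, Smooth.deriv_mul,
        ih (by simpa using h), add_comm, Finset.mul_sum]
      simp [Function.iterate_succ_apply']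

theorem dens_modify_deriv (m : List ℕ) (cs : List Smooth) (h : m.length = cs.length) (i : ℕ) :
    dens m (cs.modify i Smooth.deriv) = dens (m.modify i (· + 1)) cs := by
  induction m generalizing cs i with
  | nil =>
    cases cs with
    | nil => simp
    | cons => simp at h
  | cons k m ih =>
    cases cs with
    | nil => simp at h
    | cons c cs =>
      cases i with
      | zero => simp
      | succ i => simp [ih cs (by simpa using h) i]

theorem iterate_deriv_mulX (k : ℕ) (c : Smooth) :
    Smooth.deriv^[k] (mulX c) = coordX * Smooth.deriv^[k] c +
      (k : ℝ) • Smooth.deriv^[k - 1] c := by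
  induction k with
  | zero => simp [mulX_apply]
  | succ k ih =>
    rw [Function.iterate_succ_apply', ih, map_add, map_smul, ← mulX_apply, deriv_mulX, mulX_apply,
      ← Function.iterate_succ_apply' Smooth.deriv k]
    rcases k with - | k
    · simp [add_comm]
    · simp only [Nat.add_sub_cancel, ← Function.iterate_succ_apply' Smooth.deriv k]
      push_cast
      module

/-- By the Leibniz rule, a factor `x` in one slot becomes an overall factor `x` plus a density with
one derivative fewer in that slot. If there is none to remove, the coefficient is zero and the
truncated subtraction is harmless. -/
theorem dens_modify_mulX (m : List ℕ) (cs : List Smooth) (h : m.length = cs.length) {i : ℕ}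
    (hi : i < cs.length) :
    dens m (cs.modify i mulX) = coordX * dens m cs +
      (m.getD i 0 : ℝ) • dens (m.modify i (· - 1)) cs := by
  induction m generalizing cs i with
  | nil =>
    cases cs with
    | nil => simp at hi
    | cons => simp at h
  | cons k m ih =>
    cases cs with
    | nil => simp at h
    | cons c cs =>
      cases i with
      | zero =>
        simp only [List.modify_zero_cons, dens_cons, iterate_deriv_mulX, List.getD_cons_zero,
          add_mul, smul_mul_assoc, mul_assoc]
      | succ i =>
        simp only [List.modify_succ_cons, dens_cons, List.getD_cons_succ,
          ih cs (by simpa using h) (i := i) (by simpa using hi), mul_add, mul_smul_comm,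
          mul_left_comm coordX]

/-- One of the functions has compact support. -/
def HasCompact (cs : List Smooth) : Prop := ∃ c ∈ cs, c ∈ compactSmooth

theorem iterate_deriv_mem_compact {f : Smooth} (hf : f ∈ compactSmooth) (k : ℕ) :
    Smooth.deriv^[k] f ∈ compactSmooth := by
  induction k with
  | zero => exact hf
  | succ k ih =>
    rw [Function.iterate_succ_apply']
    exact deriv_mem_compact ih

theorem dens_mem_compact {m : List ℕ} {cs : List Smooth} (h : m.length = cs.length)
    (hc : HasCompact cs) : dens m cs ∈ compactSmooth := by
  induction m generalizing cs with
  | nil =>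
    obtain ⟨c, hc, -⟩ := hc
    cases cs with
    | nil => simp at hc
    | cons => simp at h
  | cons k m ih =>
    cases cs with
    | nil => simp at h
    | cons c cs =>
      obtain ⟨b, hb, hb'⟩ := hc
      rcases List.mem_cons.1 hb with rfl | hb
      · exact mul_mem_compact (iterate_deriv_mem_compact hb' k)
      · exact mul_mem_compact' (ih (by simpa using h) ⟨b, hb, hb'⟩)

theorem HasCompact.modify {cs : List Smooth} (h : HasCompact cs) {φ : Smooth → Smooth}
    (hφ : ∀ f ∈ compactSmooth, φ f ∈ compactSmooth) (i : ℕ) : HasCompact (cs.modify i φ) := by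
  induction cs generalizing i with
  | nil => simpa using h
  | cons c cs ih =>
    obtain ⟨b, hb, hb'⟩ := h
    rcases List.mem_cons.1 hb with rfl | hb
    · cases i with
      | zero => exact ⟨φ b, by simp, hφ b hb'⟩
      | succ i => exact ⟨b, by simp, hb'⟩
    · cases i with
      | zero => exact ⟨b, by simp [hb], hb'⟩
      | succ i =>
        obtain ⟨b', h1, h2⟩ := ih ⟨b, hb, hb'⟩ i
        exact ⟨b', by simp [h1], h2⟩

theorem sum_modify_succ {m : List ℕ} {i : ℕ} (hi : i < m.length) :
    (m.modify i (· + 1)).sum = m.sum + 1 := by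
  induction m generalizing i with
  | nil => simp at hi
  | cons k m ih =>
    cases i with
    | zero => simp; omega
    | succ i => simp [ih (i := i) (by simpa using hi)]; omega

theorem sum_modify_pred_le (m : List ℕ) (i : ℕ) : (m.modify i (· - 1)).sum ≤ m.sum := by
  induction m generalizing i with
  | nil => simp
  | cons k m ih =>
    cases i with
    | zero => simp
    | succ i => simpa using ih i

theorem modify_succ_pred {m : List ℕ} {i : ℕ} (hi : i < m.length) (h : m.getD i 0 ≠ 0) :
    (m.modify i (· - 1)).modify i (· + 1) = m := by
  induction m generalizing i with
  | nil => simp at hi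
  | cons k m ih =>
    cases i with
    | zero =>
      rw [List.getD_cons_zero] at h
      simp
      omega
    | succ i => simpa using ih (i := i) (by simpa using hi) (by simpa using h)

/-- Densities of order at most `K` in `n` functions. -/
noncomputable def densities (n K : ℕ) : Submodule ℝ (List Smooth → Smooth) :=
  Submodule.span ℝ {Q | ∃ m : List ℕ, m.length = n ∧ m.sum ≤ K ∧ Q = dens m} ⊔
    ⨅ cs : {cs : List Smooth // cs.length = n}, LinearMap.ker (LinearMap.proj cs.1)

theorem densities_congr {n K : ℕ} {Q Q' : List Smooth → Smooth} (hQ : Q ∈ densities n K)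
    (h : ∀ cs, cs.length = n → Q' cs = Q cs) : Q' ∈ densities n K := by
  rw [show Q' = Q + (Q' - Q) by abel]
  refine add_mem hQ (Submodule.mem_sup_right ?_)
  simp only [Submodule.mem_iInf, LinearMap.mem_ker, LinearMap.proj_apply, Pi.sub_apply, sub_eq_zero]
  exact fun cs => h cs.1 cs.2

theorem dens_mem_densities {n K : ℕ} {m : List ℕ} (h : m.length = n) (h' : m.sum ≤ K) :
    dens m ∈ densities n K :=
  Submodule.mem_sup_left (Submodule.subset_span ⟨m, h, h', rfl⟩)

theorem deriv_mem_densities {n K : ℕ} {Q : List Smooth → Smooth} (hQ : Q ∈ densities n K) :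
    (fun cs => Smooth.deriv (Q cs)) ∈ densities n (K + 1) := by
  suffices h : densities n K ≤ (densities n (K + 1)).comap (Smooth.deriv.compLeft (List Smooth)) from
    h hQ
  refine sup_le (Submodule.span_le.2 ?_) fun Q hQ => ?_
  · rintro _ ⟨m, h1, h2, rfl⟩
    refine densities_congr (Q := ∑ i ∈ Finset.range n, dens (m.modify i (· + 1)))
      (sum_mem fun i hi => dens_mem_densities (by simpa using h1) ?_) fun cs hcs => ?_
    · rw [sum_modify_succ (by simpa [h1] using hi)]
      omega
    · simp only [LinearMap.compLeft_apply, Function.comp_apply]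
      rw [deriv_dens (by omega), hcs, Finset.sum_apply]
  · refine Submodule.mem_sup_right ?_
    simp only [Submodule.mem_iInf, LinearMap.mem_ker, LinearMap.proj_apply] at hQ ⊢
    intro cs
    simp [hQ cs]

/-- The entries selected by a mask, and the remaining ones. -/
def selT {α : Type*} : List Bool → List α → List α
  | true :: b, x :: l => x :: selT b l
  | false :: b, _ :: l => selT b l
  | [], _ => []
  | _ :: _, [] => []

def selF {α : Type*} : List Bool → List α → List α
  | true :: b, _ :: l => selF b l
  | false :: b, x :: l => x :: selF b l
  | [], _ => []
  | _ :: _, [] => []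

/-- Spread a list over the entries not selected by a mask. -/
def spread : List Bool → List ℕ → List ℕ
  | true :: b, m => 0 :: spread b m
  | false :: b, k :: m => k :: spread b m
  | false :: b, [] => 0 :: spread b []
  | [], _ => []

theorem length_spread (b : List Bool) (m : List ℕ) : (spread b m).length = b.length := by
  induction b generalizing m with
  | nil => rfl
  | cons x b ih => cases x <;> cases m <;> simp [spread, ih]

theorem sum_spread_le (b : List Bool) (m : List ℕ) : (spread b m).sum ≤ m.sum := by
  induction b generalizing m with
  | nil => simp [spread]
  | cons x b ih =>
    cases x <;> cases m
    · simpa [spread] using ih []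
    · rename_i k m
      simpa [spread] using ih m
    · simpa [spread] using ih []
    · rename_i k m
      simpa [spread] using ih (k :: m)

theorem dens_spread (b : List Bool) (m : List ℕ) (cs : List Smooth) (h : b.length = cs.length)
    (h' : m.length = (selF b cs).length) :
    dens (spread b m) cs = (selT b cs).prod * dens m (selF b cs) := by
  induction b generalizing m cs with
  | nil =>
    cases cs with
    | nil =>
      cases m with
      | nil => simp [spread, selT, selF]
      | cons => simp [selF] at h'
    | cons => simp at h
  | cons x b ih =>
    cases cs with
    | nil => simp at h
    | cons c cs =>
      cases x
      · cases m with
        | nil => simp [selF] at h'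
        | cons k m =>
          simp only [spread, selT, selF, dens_cons]
          rw [ih m cs (by simpa using h) (by simpa [selF] using h'), mul_left_comm]
      · simp only [spread, selT, selF, dens_cons, Function.iterate_zero, id]
        rw [ih m cs (by simpa using h) (by simpa [selF] using h'), List.prod_cons, mul_assoc]

theorem length_selF {α β : Type*} (b : List Bool) (l : List α) (l' : List β)
    (h : l.length = l'.length) : (selF b l).length = (selF b l').length := by
  induction b generalizing l l' with
  | nil => rfl
  | cons x b ih =>
    rcases l with - | ⟨y, l⟩ <;> rcases l' with - | ⟨y', l'⟩
    · cases x <;> rfl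
    · simp at h
    · simp at h
    · have := ih l l' (by simpa using h)
      cases x <;> simpa [selF] using this

/-- Derivatives of products of some of the functions are densities in all of them. -/
theorem merged_mem_densities {n : ℕ} (b : List Bool) (hb : b.length = n) (k : ℕ) (m : List ℕ)
    (hm : m.length = (selF b b).length) :
    (fun cs => dens (k :: m) ((selT b cs).prod :: selF b cs)) ∈ densities n (k + m.sum) := by
  induction k generalizing m with
  | zero =>
    refine densities_congr (dens_mem_densities (m := spread b m) ((length_spread b m).trans hb)
      ((sum_spread_le b m).trans (by omega))) fun cs hcs => ?_
    rw [dens_spread b m cs (by omega) (hm.trans (length_selF b _ _ (by omega)))]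
    simp
  | succ k ih =>
    -- The next derivative of the product is obtained by differentiating the whole density and
    -- subtracting the terms in which the derivative falls on the remaining functions.
    have h1 := deriv_mem_densities (ih m hm)
    have h2 : ∀ i ∈ Finset.range m.length, (fun cs => dens (k :: m.modify i (· + 1))
        ((selT b cs).prod :: selF b cs)) ∈ densities n (k + m.sum + 1) := fun i hi => by
      have := ih (m.modify i (· + 1)) (by simpa using hm)
      rwa [sum_modify_succ (by simpa using hi), ← add_assoc] at this
    refine densities_congr (?_ : _ ∈ densities n (k + 1 + m.sum))
      (Q := (fun cs => Smooth.deriv (dens (k :: m) ((selT b cs).prod :: selF b cs))) -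
        ∑ i ∈ Finset.range m.length, fun cs => dens (k :: m.modify i (· + 1))
          ((selT b cs).prod :: selF b cs)) fun cs hcs => ?_
    · rw [show k + 1 + m.sum = k + m.sum + 1 by omega]
      exact sub_mem h1 (sum_mem h2)
    · have hl : m.length = (selF b cs).length := hm.trans (length_selF b _ _ (by omega))
      simp only [Pi.sub_apply, Finset.sum_apply, dens_cons, Smooth.deriv_mul,
        Function.iterate_succ_apply']
      rw [deriv_dens hl, ← hl, Finset.mul_sum, add_sub_cancel_right]

end Densities

attribute [local instance 10000] ringForms algebraForms moduleForms addCommGroupForms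
  addCommMonoidForms commRingSmooth addCommGroupSmooth addZeroClassSmooth addMonoidSmooth
  moduleSmooth moduleSmoothOp smulSmooth smulSmoothOp algebraSmooth smulRealSmooth

/-! ### Local functionals of functions with constant coefficients -/

section DiffOps

variable {R : Type*} [AddCommGroup R] [Module ℝ R]

/-- The integral of a monomial in derivatives, with a coefficient. -/
noncomputable def mono (m : List ℕ) (r : R) (cs : List Smooth) : R := lineIntegral (dens m cs) • r

variable (R) in
/-- The functionals vanishing on `n` functions one of which has compact support. -/
def nullOn (n : ℕ) : Submodule ℝ (List Smooth → R) :=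
  ⨅ cs : {cs : List Smooth // cs.length = n ∧ HasCompact cs}, LinearMap.ker (LinearMap.proj cs.1)

theorem mem_nullOn {n : ℕ} {g : List Smooth → R} :
    g ∈ nullOn R n ↔ ∀ cs : List Smooth, cs.length = n → HasCompact cs → g cs = 0 := by
  simp [nullOn]

variable (R) in
/-- The functionals that are integrals of polydifferential operators with constant coefficients of
order at most `K` when applied to `n` functions one of which has compact support. -/
noncomputable def diffOps (n K : ℕ) : Submodule ℝ (List Smooth → R) :=
  Submodule.span ℝ {g | ∃ (m : List ℕ) (r : R), m.length = n ∧ m.sum ≤ K ∧ g = mono m r} ⊔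
    nullOn R n

theorem diffOps_le {n K : ℕ} {P : Submodule ℝ (List Smooth → R)}
    (h1 : ∀ (m : List ℕ) (r : R), m.length = n → m.sum ≤ K → mono m r ∈ P) (h2 : nullOn R n ≤ P) :
    diffOps R n K ≤ P :=
  sup_le (Submodule.span_le.2 fun _ ⟨m, r, hm, hs, h⟩ => h ▸ h1 m r hm hs) h2

theorem mono_mem {n K : ℕ} {m : List ℕ} (h1 : m.length = n) (h2 : m.sum ≤ K) (r : R) :
    mono m r ∈ diffOps R n K :=
  Submodule.mem_sup_left (Submodule.subset_span ⟨m, r, h1, h2, rfl⟩)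

theorem nullOn_le (n K : ℕ) : nullOn R n ≤ diffOps R n K := le_sup_right

theorem diffOps_congr {n K : ℕ} {g g' : List Smooth → R} (hg : g ∈ diffOps R n K)
    (h : ∀ cs : List Smooth, cs.length = n → HasCompact cs → g' cs = g cs) :
    g' ∈ diffOps R n K := by
  rw [show g' = g + (g' - g) by abel]
  refine add_mem hg (nullOn_le n K (mem_nullOn.2 fun cs h1 h2 => ?_))
  rw [Pi.sub_apply, h cs h1 h2, sub_self]

theorem diffOps_mono {n K K' : ℕ} (h : K ≤ K') : diffOps R n K ≤ diffOps R n K' :=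
  diffOps_le (fun _ r h1 h2 => mono_mem h1 (h2.trans h) r) (nullOn_le n K')

theorem densities_comp_mem {n K : ℕ} {Q : List Smooth → Smooth} (hQ : Q ∈ densities n K) (r : R) :
    (fun cs => lineIntegral (Q cs) • r) ∈ diffOps R n K := by
  suffices h : densities n K ≤ (diffOps R n K).comap
      (((LinearMap.toSpanSingleton ℝ R r) ∘ₗ lineIntegral).compLeft (List Smooth)) from h hQ
  refine sup_le (Submodule.span_le.2 ?_) fun Q hQ => ?_
  · rintro _ ⟨m, h1, h2, rfl⟩
    exact mono_mem h1 h2 r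
  · refine nullOn_le n K (mem_nullOn.2 fun cs h1 _ => ?_)
    simp only [Submodule.mem_iInf, LinearMap.mem_ker, LinearMap.proj_apply] at hQ
    simp [hQ ⟨cs, h1⟩]

theorem map_mem_diffOps {n K : ℕ} {R' : Type*} [AddCommGroup R'] [Module ℝ R'] (ψ : R →ₗ[ℝ] R')
    {g : List Smooth → R} (hg : g ∈ diffOps R n K) : (fun cs => ψ (g cs)) ∈ diffOps R' n K := by
  suffices h : diffOps R n K ≤ (diffOps R' n K).comap (ψ.compLeft (List Smooth)) from h hg
  refine diffOps_le (fun m r h1 h2 => ?_) fun g hg => ?_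
  · refine diffOps_congr (mono_mem h1 h2 (ψ r)) fun cs _ _ => ?_
    simp [mono]
  · refine nullOn_le n K (mem_nullOn.2 fun cs h1 h2 => ?_)
    simp [mem_nullOn.1 hg cs h1 h2]

/-- Precomposition as a linear map. -/
def preL (φ : List Smooth → List Smooth) : (List Smooth → R) →ₗ[ℝ] (List Smooth → R) :=
  LinearMap.funLeft ℝ R φ

@[simp] theorem preL_apply (φ : List Smooth → List Smooth) (g : List Smooth → R)
    (cs : List Smooth) : preL φ g cs = g (φ cs) := rfl

theorem preL_nullOn {n n' : ℕ} {φ : List Smooth → List Smooth}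
    (h1 : ∀ cs : List Smooth, cs.length = n → (φ cs).length = n')
    (h2 : ∀ cs : List Smooth, cs.length = n → HasCompact cs → HasCompact (φ cs)) :
    nullOn R n' ≤ (nullOn R n).comap (preL φ) := fun _ hg =>
  mem_nullOn.2 fun cs hn hc => mem_nullOn.1 hg (φ cs) (h1 cs hn) (h2 cs hn hc)

theorem modify_deriv_mem {n K i : ℕ} (hi : i < n) {g : List Smooth → R}
    (hg : g ∈ diffOps R n K) : preL (fun cs => cs.modify i Smooth.deriv) g ∈ diffOps R n (K + 1) := by
  suffices h : diffOps R n K ≤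
    (diffOps R n (K + 1)).comap (preL fun cs => cs.modify i Smooth.deriv) from h hg
  refine diffOps_le (fun m r h1 h2 => ?_)
    ((preL_nullOn (fun cs h => by simpa using h) fun cs _ h => h.modify (fun _ => deriv_mem_compact) i).trans
      (Submodule.comap_mono (nullOn_le n _)))
  refine diffOps_congr (mono_mem (m := m.modify i (· + 1)) (by simpa using h1) ?_ r)
    fun cs hcs _ => ?_
  · rw [sum_modify_succ (by omega)]
    omega
  · simp [mono, dens_modify_deriv m cs (by omega)]

/-- Differentiating each argument in turn differentiates the density, and the integral of a
derivative with compact support vanishes. -/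
theorem sum_modify_deriv_mem {n K : ℕ} {g : List Smooth → R} (hg : g ∈ diffOps R n K) :
    ∑ i ∈ Finset.range n, preL (fun cs => cs.modify i Smooth.deriv) g ∈ nullOn R n := by
  rw [← LinearMap.sum_apply]
  suffices h : diffOps R n K ≤ (nullOn R n).comap (∑ i ∈ Finset.range n,
    preL (R := R) (fun cs => cs.modify i Smooth.deriv)) from h hg
  refine diffOps_le (fun m r h1 h2 => ?_) fun g hg => ?_
  · refine mem_nullOn.2 fun cs hcs hc => ?_
    rw [LinearMap.sum_apply, Finset.sum_apply]
    simp only [preL_apply, mono]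
    rw [← Finset.sum_smul, Finset.sum_congr rfl fun i _ =>
      congrArg lineIntegral (dens_modify_deriv m cs (by omega) i), ← map_sum, ← hcs,
      ← deriv_dens (by omega), lineIntegral_deriv (dens_mem_compact (by omega) hc), zero_smul]
  · rw [Submodule.mem_comap, LinearMap.sum_apply]
    exact sum_mem fun i _ => preL_nullOn (fun cs h => by simpa using h)
      (fun cs _ h => h.modify (fun _ => deriv_mem_compact) i) hg

theorem mulX_mem_compact {f : Smooth} (hf : f ∈ compactSmooth) : mulX f ∈ compactSmooth :=
  hasCompactSupport_mulX hf

/-- Every slot contributes the same overall factor `x`, which cancels when the mean over all slots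
is subtracted. What remains has constant coefficients and no larger order; this is what makes the
homotopy translation invariant. -/
theorem modify_mulX_sub_mem {n K i : ℕ} (hi : i < n) {g : List Smooth → R}
    (hg : g ∈ diffOps R n K) : preL (fun cs => cs.modify i mulX) g -
      (n : ℝ)⁻¹ • ∑ k ∈ Finset.range n, preL (fun cs => cs.modify k mulX) g ∈ diffOps R n K := by
  suffices h : diffOps R n K ≤ (diffOps R n K).comap (preL (fun cs => cs.modify i mulX) -
      (n : ℝ)⁻¹ • ∑ k ∈ Finset.range n, preL (fun cs => cs.modify k mulX)) by
    simpa using h hg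
  have hnull : ∀ j, nullOn R n ≤ (nullOn R n).comap (preL fun cs => cs.modify j mulX) := fun j =>
    preL_nullOn (fun cs h => by simpa using h) fun cs _ h => h.modify (fun _ => mulX_mem_compact) j
  refine diffOps_le (fun m r h1 h2 => ?_) fun g hg => ?_
  · let P : ℕ → List Smooth → R := fun j => (m.getD j 0 : ℝ) • mono (m.modify j (· - 1)) r
    have hP : ∀ j, P j ∈ diffOps R n K := fun j =>
      Submodule.smul_mem _ _ (mono_mem (by simpa using h1) ((sum_modify_pred_le m j).trans h2) r)
    refine diffOps_congr (g := P i - (n : ℝ)⁻¹ • ∑ k ∈ Finset.range n, P k)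
      (sub_mem (hP i) (Submodule.smul_mem _ _ (sum_mem fun k _ => hP k))) fun cs hcs hc => ?_
    have key : ∀ j, j < n → mono m r (cs.modify j mulX) =
        lineIntegral (coordX * dens m cs) • r + P j cs := fun j hj => by
      simp only [mono, P, Pi.smul_apply]
      rw [dens_modify_mulX m cs (by omega) (by omega), map_add, map_smul, add_smul, smul_eq_mul,
        mul_smul]
    have hn : (n : ℝ) ≠ 0 := by
      have : n ≠ 0 := by omega
      exact_mod_cast this
    simp only [LinearMap.sub_apply, LinearMap.smul_apply, LinearMap.sum_apply, Pi.sub_apply,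
      Pi.smul_apply, Finset.sum_apply, preL_apply]
    rw [key i hi, Finset.sum_congr rfl fun j hj => key j (Finset.mem_range.1 hj),
      Finset.sum_add_distrib, Finset.sum_const, Finset.card_range, ← Nat.cast_smul_eq_nsmul ℝ,
      smul_add, smul_smul (n : ℝ)⁻¹ (n : ℝ), inv_mul_cancel₀ hn, one_smul]
    abel
  · refine nullOn_le n K ?_
    simp only [LinearMap.sub_apply, LinearMap.smul_apply, LinearMap.sum_apply]
    exact sub_mem (hnull i hg) (Submodule.smul_mem _ _ (sum_mem fun k _ => hnull k hg))

/-- The Euler operator on functionals of `n` functions. -/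
noncomputable def eulerL (R : Type*) [AddCommGroup R] [Module ℝ R] (n : ℕ) :
    Module.End ℝ (List Smooth → R) :=
  ∑ i ∈ Finset.range n, preL fun cs => cs.modify i (mulX ∘ₗ Smooth.deriv)

theorem eulerL_apply (n : ℕ) (g : List Smooth → R) (cs : List Smooth) : eulerL R n g cs =
    ∑ i ∈ Finset.range n, g (cs.modify i (mulX ∘ₗ Smooth.deriv)) := by
  rw [eulerL, LinearMap.sum_apply, Finset.sum_apply]
  rfl

theorem eulerL_nullOn (n : ℕ) : nullOn R n ≤ (nullOn R n).comap (eulerL R n) := fun g hg => by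
  rw [Submodule.mem_comap, eulerL, LinearMap.sum_apply]
  exact sum_mem fun i _ => preL_nullOn (fun cs h => by simpa using h)
    (fun cs _ h => h.modify (fun _ h => mulX_mem_compact (deriv_mem_compact h)) i) hg

theorem sum_getD (m : List ℕ) : ∑ i ∈ Finset.range m.length, (m.getD i 0 : ℝ) = m.sum := by
  induction m with
  | nil => simp
  | cons k m ih =>
    rw [List.length_cons, Finset.sum_range_succ', List.sum_cons, Nat.cast_add, ← ih]
    simp [add_comm]

/-- Replacing each `cᵢ` in turn by `x cᵢ'` yields `x` times the derivative of the density plus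
`m.sum` times the density. Integration by parts turns the first into minus the density, hence the
eigenvalue `m.sum - 1`. -/
theorem eulerL_mono {n : ℕ} {m : List ℕ} (h1 : m.length = n) (r : R) :
    eulerL R n (mono m r) - ((m.sum : ℝ) - 1) • mono m r ∈ nullOn R n := by
  refine mem_nullOn.2 fun cs hcs hc => ?_
  have key : ∀ i ∈ Finset.range n, dens m (cs.modify i (mulX ∘ₗ Smooth.deriv)) =
      coordX * dens (m.modify i (· + 1)) cs + (m.getD i 0 : ℝ) • dens m cs := fun i hi => by
    have hi' := Finset.mem_range.1 hi
    rw [show cs.modify i (mulX ∘ₗ Smooth.deriv) = (cs.modify i Smooth.deriv).modify i mulX by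
      rw [List.modify_modify_eq]; rfl, dens_modify_mulX _ _ (by simp; omega) (by simp; omega),
      dens_modify_deriv _ _ (by omega), dens_modify_deriv _ _ (by simp; omega)]
    by_cases h0 : m.getD i 0 = 0
    · rw [h0]
      simp
    · rw [modify_succ_pred (by omega) h0]
  have h2 : lineIntegral (coordX * Smooth.deriv (dens m cs)) = - lineIntegral (dens m cs) := by
    have hd := dens_mem_compact (m := m) (cs := cs) (by omega) hc
    have := lineIntegral_deriv (mulX_mem_compact hd)
    rw [deriv_mulX, map_add, mulX_apply] at this
    linarith
  rw [Pi.sub_apply, eulerL_apply, Pi.smul_apply]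
  simp only [mono]
  rw [← Finset.sum_smul, Finset.sum_congr rfl fun i hi => congrArg lineIntegral (key i hi),
    ← map_sum, Finset.sum_add_distrib, ← Finset.mul_sum, ← Finset.sum_smul, ← h1, sum_getD,
    h1, ← hcs, ← deriv_dens (by omega), map_add, h2, map_smul, smul_smul, ← sub_smul, smul_eq_mul]
  rw [show -lineIntegral (dens m cs) + ↑m.sum * lineIntegral (dens m cs) -
    ((m.sum : ℝ) - 1) * lineIntegral (dens m cs) = 0 by ring, zero_smul]

theorem HasCompact.merge {b : List Bool} {cs : List Smooth} (hb : b.length = cs.length)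
    (h : HasCompact cs) : HasCompact ((selT b cs).prod :: selF b cs) := by
  induction b generalizing cs with
  | nil =>
    obtain ⟨c, hc, -⟩ := h
    cases cs <;> simp at hb hc
  | cons x b ih =>
    cases cs with
    | nil => simp at hb
    | cons c cs =>
      obtain ⟨d, hd, hd'⟩ := h
      rcases List.mem_cons.1 hd with rfl | hd
      · cases x
        · exact ⟨d, by simp [selF], hd'⟩
        · exact ⟨_, List.mem_cons_self, by simpa [selT] using mul_mem_compact hd'⟩
      · obtain ⟨e, he, he'⟩ := ih (by simpa using hb) ⟨d, hd, hd'⟩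
        rcases List.mem_cons.1 he with rfl | he
        · refine ⟨_, List.mem_cons_self, ?_⟩
          cases x
          · exact he'
          · simpa [selT] using mul_mem_compact' he'
        · cases x
          · exact ⟨e, by simp [selF, he], he'⟩
          · exact ⟨e, by simp [selF, he], he'⟩

/-- A bracket multiplies the coefficients of its arguments. Derivatives of this product expand into
densities in all functions without raising the order. -/
theorem merge_mem_diffOps {n K : ℕ} {b : List Bool} (hb : b.length = n) {g : List Smooth → R}
    (hg : g ∈ diffOps R ((selF b b).length + 1) K) :
    preL (fun cs => (selT b cs).prod :: selF b cs) g ∈ diffOps R n K := by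
  suffices h : diffOps R ((selF b b).length + 1) K ≤ (diffOps R n K).comap
    (preL fun cs => (selT b cs).prod :: selF b cs) from h hg
  refine diffOps_le (fun m r h1 h2 => ?_) ((preL_nullOn (fun cs h => ?_) fun cs h hc =>
    hc.merge (by omega)).trans (Submodule.comap_mono (nullOn_le n _)))
  · cases m with
    | nil => simp at h1
    | cons k m =>
      refine diffOps_mono ?_ (densities_comp_mem (merged_mem_densities b hb k m (by simpa using h1)) r)
      simpa using h2
  · simpa using length_selF b cs b (by omega)

/-- The index set depends only on `n` and `K`, as `IsLocal` demands: the derivative orders may not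
depend on the elements of `𝔤[1]`, only the coefficients may. -/
theorem exists_coefficients {n K : ℕ} {g : List Smooth → R} (hg : g ∈ diffOps R n K) :
    ∃ r : (Fin n → Fin (K + 1)) → R, ∀ cs : List Smooth, cs.length = n → HasCompact cs →
      g cs = ∑ m, lineIntegral (dens (List.ofFn fun i => (m i : ℕ)) cs) • r m := by
  let L : ((Fin n → Fin (K + 1)) → R) →ₗ[ℝ] (List Smooth → R) :=
    { toFun := fun r cs => ∑ m, lineIntegral (dens (List.ofFn fun i => (m i : ℕ)) cs) • r m
      map_add' := fun r r' => by
        funext cs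
        simp [Finset.sum_add_distrib]
      map_smul' := fun c r => by
        funext cs
        simp [Finset.smul_sum, smul_comm c] }
  have h : diffOps R n K ≤ LinearMap.range L ⊔ nullOn R n := by
    refine diffOps_le (fun m r h1 h2 => Submodule.mem_sup_left ?_) le_sup_right
    subst h1
    have hle : ∀ i : Fin m.length, m[i] < K + 1 := fun i =>
      Nat.lt_succ_of_le ((List.single_le_sum (by simp) _ (List.getElem_mem i.2)).trans h2)
    refine ⟨Pi.single (fun i => ⟨m[i], hle i⟩) r, ?_⟩
    funext cs
    change ∑ m', _ = _
    rw [Finset.sum_eq_single fun i => ⟨m[i], hle i⟩]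
    · simp [mono]
    · intro m' _ hm'
      rw [Pi.single_eq_of_ne hm', smul_zero]
    · simp
  obtain ⟨_, ⟨r, rfl⟩, z, hz, hgz⟩ := Submodule.mem_sup.1 (h hg)
  refine ⟨r, fun cs h1 h2 => ?_⟩
  rw [← hgz, Pi.add_apply, mem_nullOn.1 hz cs h1 h2, add_zero]
  rfl

/-- A polynomial in an operator, on an eigenvector modulo an invariant subspace. -/
theorem aeval_sub_eval_smul_mem {M : Type*} [AddCommGroup M] [Module ℝ M] {A : Module.End ℝ M}
    {N : Submodule ℝ M} (hN : N ≤ N.comap A) {μ : ℝ} {g : M} (hg : A g - μ • g ∈ N)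
    (q : Polynomial ℝ) : Polynomial.aeval A q g - q.eval μ • g ∈ N := by
  induction q using Polynomial.induction_on' with
  | add p q hp hq =>
    have := add_mem hp hq
    simp only [map_add, LinearMap.add_apply, Polynomial.eval_add, add_smul]
    convert this using 1
    abel
  | monomial k c =>
    induction k with
    | zero => simp [Module.algebraMap_end_apply]
    | succ k ih =>
      have h1 : A _ ∈ N := hN ih
      have h2 := Submodule.smul_mem N (c * μ ^ k) hg
      have := add_mem h1 h2
      rw [Polynomial.aeval_monomial] at this ⊢
      simp only [Polynomial.eval_monomial, map_sub, map_smul, Module.End.mul_apply,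
        Module.algebraMap_end_apply, pow_succ'] at this ⊢
      convert this using 1
      module

end DiffOps

attribute [local instance 10000] ringForms algebraForms moduleForms addCommGroupForms
  addCommMonoidForms commRingSmooth addCommGroupSmooth addZeroClassSmooth addMonoidSmooth
  moduleSmooth moduleSmoothOp smulSmooth smulSmoothOp algebraSmooth smulRealSmooth

/-! ### Functionals with constant coefficients on words of forms -/

section Masks

variable {H : Type*} {deg : H → ℤ}

/-- All masks of a given length. -/
def masks : ℕ → List (List Bool)
  | 0 => [[]]
  | n + 1 => (masks n).map (true :: ·) ++ (masks n).map (false :: ·)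

theorem length_of_mem_masks {n : ℕ} {b : List Bool} (h : b ∈ masks n) : b.length = n := by
  induction n generalizing b with
  | zero => simpa [masks] using h
  | succ n ih =>
    simp only [masks, List.mem_append, List.mem_map] at h
    rcases h with ⟨b, hb, rfl⟩ | ⟨b, hb, rfl⟩ <;> simp [ih hb]

/-- The exponent of the Koszul sign of an unshuffle. -/
def maskExp : List Bool → List ℤ → ℤ
  | true :: b, _ :: ds => maskExp b ds
  | false :: b, d :: ds => d * (selT b ds).sum + maskExp b ds
  | [], _ => 0
  | _ :: _, [] => 0

theorem map_selT {α β : Type*} (f : α → β) (b : List Bool) (l : List α) :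
    (selT b l).map f = selT b (l.map f) := by
  induction b generalizing l with
  | nil => cases l <;> rfl
  | cons x b ih => cases l <;> cases x <;> simp [selT, ih]

/-- The index set is independent of the letters, so for fixed degrees the sum is a fixed combination
of functionals of the coefficient functions. -/
theorem unshSum_eq_masks {N : Type*} [AddCommGroup N] (l : List H) (f : List H → List H → N) :
    unshSum deg l f = ((masks l.length).map fun b =>
      (maskExp b (l.map deg)).negOnePow • f (selT b l) (selF b l)).sum := by
  induction l generalizing f with
  | nil => simp [masks, maskExp, selT, selF]
  | cons v l ih =>
    rw [unshSum_cons, ih, ih]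
    simp only [List.length_cons, masks, List.map_append, List.sum_append, List.map_map,
      Function.comp_def, List.map_cons, maskExp, selT, selF, Int.negOnePow_add, mul_smul]
    congr 3
    funext b
    rw [smul_comm, wdeg, map_selT]

theorem length_selT {α β : Type*} (b : List Bool) (l : List α) (l' : List β)
    (h : l.length = l'.length) : (selT b l).length = (selT b l').length := by
  induction b generalizing l l' with
  | nil => rfl
  | cons x b ih =>
    rcases l with - | ⟨y, l⟩ <;> rcases l' with - | ⟨y', l'⟩
    · cases x <;> rfl
    · simp at h
    · simp at h
    · have := ih l l' (by simpa using h)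
      cases x <;> simpa [selT] using this

theorem selT_zipWith {α β γ : Type*} (f : α → β → γ) (b : List Bool) (l : List α) (l' : List β) :
    selT b (List.zipWith f l l') = List.zipWith f (selT b l) (selT b l') := by
  induction b generalizing l l' with
  | nil => simp [selT]
  | cons x b ih =>
    rcases l with - | ⟨y, l⟩
    · cases x <;> simp [selT]
    · rcases l' with - | ⟨y', l'⟩ <;> cases x <;> simp [selT, ih]

theorem selF_zipWith {α β γ : Type*} (f : α → β → γ) (b : List Bool) (l : List α) (l' : List β) :
    selF b (List.zipWith f l l') = List.zipWith f (selF b l) (selF b l') := by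
  induction b generalizing l l' with
  | nil => simp [selF]
  | cons x b ih =>
    rcases l with - | ⟨y, l⟩
    · cases x <;> simp [selF]
    · rcases l' with - | ⟨y', l'⟩ <;> cases x <;> simp [selF, ih]

theorem length_selF_le (b : List Bool) : (selF b b).length ≤ b.length := by
  have : ∀ (b : List Bool) (l : List Bool), (selF b l).length ≤ l.length := by
    intro b
    induction b with
    | nil => simp [selF]
    | cons x b ih =>
      intro l
      rcases l with - | ⟨y, l⟩
      · cases x <;> simp [selF]
      · have := ih l
        cases x <;> simp [selF] <;> omega
  exact this b b

theorem slotSum_eq_sum {N : Type*} [AddCommGroup N] (e : ℤ) (σ : H → H) (F : List H → N)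
    (l : List H) : slotSum deg e σ F l =
      ∑ i ∈ Finset.range l.length, (e * wdeg deg (l.take i)).negOnePow • F (l.modify i σ) := by
  induction l generalizing F with
  | nil => simp [slotSum]
  | cons t l ih =>
    rw [slotSum, ih, List.length_cons, Finset.sum_range_succ', add_comm, Finset.smul_sum]
    simp [mul_add, Int.negOnePow_add, mul_smul]

end Masks

/-! ### Words of forms with prescribed degrees, and the functionals `constLocal`. -/

section Words

set_option linter.unusedSectionVars false

variable {R : Type} [Ring R] [Algebra ℝ R] {𝓡 : ℤ → Submodule ℝ R} [GradedAlgebra 𝓡]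
  {dR : R →ₗ[ℝ] R} {I : Ideal R}
  {V : Type} [AddCommGroup V] [Module ℝ V] [Module R V] {𝓥 : ℤ → Submodule ℝ V}

/-- The homogeneous form of the given degree with the given coefficient. -/
def formOf (d : ℤ) (c : Smooth) : Homog formGrading :=
  ⟨d, (if d = 0 then c else 0, if d = 1 then c else 0),
    ⟨fun h => by simp [TrivSqZeroExt.fst, h], fun h => by simp [TrivSqZeroExt.snd, h]⟩⟩

@[simp] theorem formOf_deg (d : ℤ) (c : Smooth) : (formOf d c).deg = d := rfl

theorem formOf_fst (d : ℤ) (c : Smooth) : (formOf d c).val.fst = if d = 0 then c else 0 := rfl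

theorem formOf_snd (d : ℤ) (c : Smooth) : (formOf d c).val.snd = if d = 1 then c else 0 := rfl

theorem formOf_eq_zero {d : ℤ} (h0 : d ≠ 0) (h1 : d ≠ 1) (c : Smooth) : (formOf d c).val = 0 :=
  TrivSqZeroExt.ext (if_neg h0) (if_neg h1)

theorem formOf_cf (a : Homog formGrading) : formOf a.deg (cf a) = a := by
  refine Homog.ext' rfl (TrivSqZeroExt.ext ?_ ?_)
  · rw [formOf_fst]
    split_ifs with h
    · simp [cf, a.mem.2 (by omega)]
    · exact (a.mem.1 h).symm
  · rw [formOf_snd]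
    split_ifs with h
    · simp [cf, a.mem.1 (by omega)]
    · exact (a.mem.2 h).symm

/-- The word of forms with given degrees, coefficients and elements of `𝔤[1]`. -/
def word (s : List (ℤ × Homog 𝓥)) (cs : List Smooth) : List (PureTensor 𝓥 formGrading) :=
  List.zipWith (fun t c => (formOf t.1 c, t.2)) s cs

@[simp] theorem word_nil : word ([] : List (ℤ × Homog 𝓥)) [] = [] := rfl

@[simp] theorem word_cons (t : ℤ × Homog 𝓥) (s : List (ℤ × Homog 𝓥)) (c : Smooth)
    (cs : List Smooth) : word (t :: s) (c :: cs) = (formOf t.1 c, t.2) :: word s cs := rfl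

theorem length_word {s : List (ℤ × Homog 𝓥)} {cs : List Smooth} (h : cs.length = s.length) :
    (word s cs).length = s.length := by
  simp [word, h]

theorem word_eq (l : List (PureTensor 𝓥 formGrading)) :
    word (l.map fun t => (t.1.deg, t.2)) (l.map fun t => cf t.1) = l := by
  induction l with
  | nil => rfl
  | cons t l ih => simp [ih, formOf_cf]

theorem word_map {β : Type*} {f : PureTensor 𝓥 formGrading → β} {g : ℤ × Homog 𝓥 → β}
    (hf : ∀ t c, f (formOf t.1 c, t.2) = g t) {s : List (ℤ × Homog 𝓥)} {cs : List Smooth}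
    (h : cs.length = s.length) : (word s cs).map f = s.map g := by
  induction s generalizing cs with
  | nil => simp [word]
  | cons t s ih =>
    rcases cs with - | ⟨c, cs⟩
    · simp at h
    · simp [hf, ih (by simpa using h)]

theorem cf_mem_compact_iff {a : Homog formGrading} :
    cf a ∈ compactSmooth ↔ HasCompactSupport (coeff a) := Iff.rfl

theorem coeff_formOf_compact {d : ℤ} {c : Smooth} (h : c ∈ compactSmooth) :
    HasCompactSupport (coeff (formOf d c)) := by
  rw [← cf_mem_compact_iff, cf, formOf_fst, formOf_snd]
  refine add_mem ?_ ?_ <;> split_ifs <;> first | exact h | exact zero_mem _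

theorem proper_word {s : List (ℤ × Homog 𝓥)} {cs : List Smooth} (h : cs.length = s.length)
    (hc : HasCompact cs) : Proper (word s cs) := by
  induction s generalizing cs with
  | nil =>
    obtain ⟨c, hc, -⟩ := hc
    rw [List.length_eq_zero_iff.1 h] at hc
    simp at hc
  | cons t s ih =>
    rcases cs with - | ⟨c, cs⟩
    · simp at h
    · obtain ⟨b, hb, hb'⟩ := hc
      rcases List.mem_cons.1 hb with rfl | hb
      · exact ⟨_, List.mem_cons_self, coeff_formOf_compact hb'⟩
      · obtain ⟨t', h1, h2⟩ := ih (by simpa using h) ⟨b, hb, hb'⟩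
        exact ⟨t', List.mem_cons_of_mem _ h1, h2⟩

theorem hasCompact_of_proper {l : List (PureTensor 𝓥 formGrading)} (h : Proper l) :
    HasCompact (l.map fun t => cf t.1) := by
  obtain ⟨t, ht, h'⟩ := h
  exact ⟨cf t.1, List.mem_map.2 ⟨t, ht, rfl⟩, h'⟩

theorem word_modify {s : List (ℤ × Homog 𝓥)} {cs : List Smooth} (i : ℕ)
    {σ : PureTensor 𝓥 formGrading → PureTensor 𝓥 formGrading} {d : ℤ × Homog 𝓥} {e : ℤ}
    (hi : s[i]? = some d) (op : Smooth → Smooth) (h : ∀ c, σ (formOf d.1 c, d.2) =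
      (formOf (d.1 + e) (op c), d.2)) (hl : cs.length = s.length) :
    (word s cs).modify i σ = word (s.modify i fun t => (t.1 + e, t.2)) (cs.modify i op) := by
  induction s generalizing cs i with
  | nil => simp at hi
  | cons t s ih =>
    rcases cs with - | ⟨c, cs⟩
    · simp at hl
    · cases i with
      | zero =>
        simp only [List.getElem?_cons_zero, Option.some.injEq] at hi
        subst hi
        simp [h]
      | succ i =>
        simp only [List.getElem?_cons_succ] at hi
        simp [ih i hi (by simpa using hl)]

/-- The product vanishes identically if there are two one-forms or a degree other than `0` and `1`;
otherwise its coefficient is the product of the coefficients. The alternative is decided by `s`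
alone. -/
theorem prodVal_word (s : List (ℤ × Homog 𝓥)) :
    (∀ cs : List Smooth, cs.length = s.length → prodVal (word s cs) =
      (formOf (s.map Prod.fst).sum cs.prod).val) ∨
    ∀ cs : List Smooth, cs.length = s.length → prodVal (word s cs) = 0 := by
  induction s with
  | nil =>
    refine Or.inl fun cs h => ?_
    rw [List.length_eq_zero_iff.1 h]
    exact TrivSqZeroExt.ext rfl rfl
  | cons t s ih =>
    have hcons : ∀ {P : List Smooth → Prop}, (∀ c cs, cs.length = s.length → P (c :: cs)) →
        ∀ cs : List Smooth, cs.length = (t :: s).length → P cs := fun {P} h cs hcs => by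
      rcases cs with - | ⟨c, cs⟩
      · simp at hcs
      · exact h c cs (by simpa using hcs)
    rcases ih with ih | ih
    · by_cases h0 : t.1 = 0
      · refine Or.inl (hcons fun c cs hcs => ?_)
        rw [word_cons, prodVal_cons, ih cs hcs]
        refine TrivSqZeroExt.ext ?_ ?_
        · simp [formOf_fst, h0]
        · simp [formOf_fst, formOf_snd, h0]
      · by_cases h1 : t.1 = 1
        · by_cases hs : (s.map Prod.fst).sum = 0
          · refine Or.inl (hcons fun c cs hcs => ?_)
            rw [word_cons, prodVal_cons, ih cs hcs]
            refine TrivSqZeroExt.ext ?_ ?_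
            · simp [formOf_fst, h1, hs]
            · simp [formOf_fst, formOf_snd, h1, hs]
          · refine Or.inr (hcons fun c cs hcs => ?_)
            rw [word_cons, prodVal_cons, ih cs hcs]
            refine TrivSqZeroExt.ext ?_ ?_ <;> simp [formOf_fst, h1, hs]
        · refine Or.inr (hcons fun c cs hcs => ?_)
          rw [word_cons, prodVal_cons, formOf_eq_zero h0 h1, zero_mul]
    · refine Or.inr (hcons fun c cs hcs => ?_)
      rw [word_cons, prodVal_cons, ih cs hcs, mul_zero]

variable (R) in
/-- Evaluation on words with given degrees and elements of `𝔤[1]`. -/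
def evalWord (s : List (ℤ × Homog 𝓥)) :
    (List (PureTensor 𝓥 formGrading) → R) →ₗ[ℝ] (List Smooth → R) :=
  LinearMap.funLeft ℝ R (word s)

@[simp] theorem evalWord_apply (s : List (ℤ × Homog 𝓥)) (F : List (PureTensor 𝓥 formGrading) → R)
    (cs : List Smooth) : evalWord R s F cs = F (word s cs) := rfl

variable (R 𝓥) in
/-- The functionals whose components are integrals of polydifferential operators with constant
coefficients of bounded order. -/
def constLocal : Submodule ℝ (List (PureTensor 𝓥 formGrading) → R) where
  carrier := {F | ∀ n : ℕ, ∃ K : ℕ, ∀ s : List (ℤ × Homog 𝓥), s.length = n →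
    evalWord R s F ∈ diffOps R n K}
  zero_mem' n := ⟨0, fun s _ => by simp⟩
  add_mem' := by
    intro F G hF hG n
    obtain ⟨K, hK⟩ := hF n
    obtain ⟨K', hK'⟩ := hG n
    refine ⟨max K K', fun s hs => ?_⟩
    rw [map_add]
    exact add_mem (diffOps_mono (le_max_left K K') (hK s hs))
      (diffOps_mono (le_max_right K K') (hK' s hs))
  smul_mem' := by
    intro c F hF n
    obtain ⟨K, hK⟩ := hF n
    refine ⟨K, fun s hs => ?_⟩
    rw [map_smul]
    exact Submodule.smul_mem _ _ (hK s hs)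

theorem assemble_constLocal {F : ℕ → List (PureTensor 𝓥 formGrading) → R}
    (hF : ∀ n, F n ∈ constLocal R 𝓥) : assemble F ∈ constLocal R 𝓥 := fun n => by
  obtain ⟨K, hK⟩ := hF n n
  refine ⟨K, fun s hs => diffOps_congr (hK s hs) fun cs h1 _ => ?_⟩
  rw [evalWord_apply, assemble, length_word (by omega), hs, evalWord_apply]

theorem lengthScale_constLocal (f : ℕ → ℝ) {F : List (PureTensor 𝓥 formGrading) → R}
    (hF : F ∈ constLocal R 𝓥) : lengthScale f F ∈ constLocal R 𝓥 :=
  assemble_constLocal (F := fun n => f n • F) fun _ => Submodule.smul_mem _ _ hF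

theorem comp_constLocal (ψ : R →ₗ[ℝ] R) {F : List (PureTensor 𝓥 formGrading) → R}
    (hF : F ∈ constLocal R 𝓥) : (fun l => ψ (F l)) ∈ constLocal R 𝓥 := fun n => by
  obtain ⟨K, hK⟩ := hF n
  exact ⟨K, fun s hs => map_mem_diffOps ψ (hK s hs)⟩

variable [SetLike.GradedSMul 𝓡 𝓥] [IsScalarTower ℝ R V] {p : ℤ}
  {F : List (PureTensor 𝓥 formGrading) → R}

theorem slot_zero (hF : F ∈ tensorCochains 𝓡 𝓥 formGrading Proper p)
    {l : List (PureTensor 𝓥 formGrading)} {t : PureTensor 𝓥 formGrading} (ht : t ∈ l)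
    (h0 : t.1.val = 0) : F l = 0 := by
  obtain ⟨l₁, l₂, rfl⟩ := List.append_of_mem ht
  rw [swap_front (IsTensorCochain.swap (hF : IsTensorCochain 𝓡 𝓥 formGrading Proper p F))]
  obtain ⟨a, v⟩ := t
  rw [left_zero tensorAdmissible_proper hF h0, smul_zero]

theorem mem_word_of_getElem? {s : List (ℤ × Homog 𝓥)} {cs : List Smooth} {i : ℕ} {d : ℤ × Homog 𝓥}
    (hi : s[i]? = some d) (hl : cs.length = s.length) : ∃ c, (formOf d.1 c, d.2) ∈ word s cs := by
  have hi' := (List.getElem?_eq_some_iff.1 hi).1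
  refine ⟨cs[i], List.mem_iff_getElem.2 ⟨i, by rw [length_word hl]; exact hi', ?_⟩⟩
  simp [word, (List.getElem?_eq_some_iff.1 hi).2]

theorem evalWord_eq_zero (hF : F ∈ tensorCochains 𝓡 𝓥 formGrading Proper p)
    {s : List (ℤ × Homog 𝓥)} {d : ℤ × Homog 𝓥} (hd : d ∈ s) (h0 : d.1 ≠ 0) (h1 : d.1 ≠ 1)
    {cs : List Smooth} (hl : cs.length = s.length) : F (word s cs) = 0 := by
  obtain ⟨i, hi, rfl⟩ := List.mem_iff_getElem.1 hd
  obtain ⟨c, hc⟩ := mem_word_of_getElem? (List.getElem?_eq_getElem hi) hl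
  exact slot_zero hF hc (formOf_eq_zero h0 h1 c)

theorem app_word (θ : SlotOp (𝓥 := 𝓥) formGrading Proper)
    {s : List (ℤ × Homog 𝓥)} {cs : List Smooth} (hl : cs.length = s.length) (hc : HasCompact cs) :
    θ.app F (word s cs) = ∑ i ∈ Finset.range s.length,
      (θ.e * ((s.take i).map fun t => t.1 + t.2.deg).sum).negOnePow •
        F ((word s cs).modify i θ.map) := by
  rw [θ.app_of_adm _ (proper_word hl hc), slotSum_eq_sum, length_word hl]
  refine Finset.sum_congr rfl fun i _ => ?_
  rw [wdeg, show (word s cs).take i = word (s.take i) (cs.take i) from List.take_zipWith,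
    word_map (g := fun t => t.1 + t.2.deg) (fun t c => rfl) (by simp [hl])]

/-- Operators that act on coefficients by the identity or the derivative preserve the functionals
with constant coefficients. -/
theorem app_constLocal (θ : SlotOp (𝓥 := 𝓥) formGrading Proper)
    (hθ : ∀ d : ℤ, d = 0 ∨ d = 1 → (∀ c, θ.toFun (formOf d c).val = 0) ∨
      (∀ c, θ.toFun (formOf d c).val = (formOf (d + θ.e) c).val) ∨
      ∀ c, θ.toFun (formOf d c).val = (formOf (d + θ.e) (Smooth.deriv c)).val)
    (hF : F ∈ tensorCochains 𝓡 𝓥 formGrading Proper p) (hF' : F ∈ constLocal R 𝓥) :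
    θ.app F ∈ constLocal R 𝓥 := fun n => by
  obtain ⟨K, hK⟩ := hF' n
  refine ⟨K + 1, fun s hs => ?_⟩
  by_cases hs' : ∃ d ∈ s, d.1 ≠ 0 ∧ d.1 ≠ 1
  · obtain ⟨d, hd, h0, h1⟩ := hs'
    exact nullOn_le _ _ (mem_nullOn.2 fun cs hcs _ =>
      evalWord_eq_zero (θ.app_mem tensorAdmissible_proper hF) hd h0 h1 (by omega))
  push Not at hs'
  have key : ∀ i ∈ Finset.range n, (fun cs => F ((word s cs).modify i θ.map)) ∈
      diffOps R n (K + 1) := fun i hi => by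
    have hi' : i < s.length := by rw [hs]; exact Finset.mem_range.1 hi
    have hsi : s[i]? = some s[i] := List.getElem?_eq_getElem hi'
    have hd : s[i].1 = 0 ∨ s[i].1 = 1 := by
      by_contra! h
      exact h.2 (hs' _ (List.getElem_mem hi') h.1)
    rcases hθ _ hd with h | h | h
    · refine nullOn_le _ _ (mem_nullOn.2 fun cs hcs _ => ?_)
      have hw : i < (word s cs).length := by rw [length_word (by omega)]; exact hi'
      refine slot_zero (t := θ.map (word s cs)[i]) hF ?_ ?_
      · rw [List.mem_iff_getElem]
        exact ⟨i, by simpa using hw, by simp⟩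
      · simpa [SlotOp.map, mapLeft, word] using h cs[i]
    · refine diffOps_congr (diffOps_mono (Nat.le_succ K) (hK (s.modify i fun t => (t.1 + θ.e, t.2)) (by simpa)))
        fun cs hcs _ => ?_
      rw [word_modify i hsi id (fun c => Prod.ext (Homog.ext' rfl (h c)) rfl) (by omega)]
      simp
    · refine diffOps_congr (modify_deriv_mem (Finset.mem_range.1 hi)
        (hK (s.modify i fun t => (t.1 + θ.e, t.2)) (by simpa))) fun cs hcs _ => ?_
      rw [word_modify i hsi Smooth.deriv (fun c => Prod.ext (Homog.ext' rfl (h c)) rfl) (by omega)]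
      simp
  refine diffOps_congr (sum_mem fun i hi => units_smul_mem' ((θ.e * ((s.take i).map fun t =>
    t.1 + t.2.deg).sum).negOnePow) (key i hi)) fun cs hcs hc => ?_
  rw [evalWord_apply, app_word θ (by omega) hc, Finset.sum_apply, hs]
  rfl

theorem extOp_constLocal (hF : F ∈ tensorCochains 𝓡 𝓥 formGrading Proper p)
    (hF' : F ∈ constLocal R 𝓥) : extOp.app F ∈ constLocal R 𝓥 := by
  refine app_constLocal _ (fun d hd => ?_) hF hF'
  rw [extOp_toFun]
  rcases hd with rfl | rfl
  · exact Or.inr (Or.inr fun c => TrivSqZeroExt.ext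
      (by simp [formOf_fst, extOp, dOp]) (by simp [formOf_fst, formOf_snd, extOp, dOp]))
  · exact Or.inl fun c => TrivSqZeroExt.ext (by simp) (by simp [formOf_fst])

theorem iotaOp_constLocal (hF : F ∈ tensorCochains 𝓡 𝓥 formGrading Proper p)
    (hF' : F ∈ constLocal R 𝓥) : iotaOp.app F ∈ constLocal R 𝓥 := by
  refine app_constLocal _ (fun d hd => ?_) hF hF'
  rw [iotaOp_toFun]
  rcases hd with rfl | rfl
  · exact Or.inl fun c => TrivSqZeroExt.ext (by simp [formOf_snd]) (by simp)
  · exact Or.inr (Or.inl fun c => TrivSqZeroExt.ext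
      (by simp [formOf_fst, formOf_snd, iotaOp, formOp])
      (by simp [formOf_snd, iotaOp, formOp]))

theorem dxOp_constLocal (hF : F ∈ tensorCochains 𝓡 𝓥 formGrading Proper p)
    (hF' : F ∈ constLocal R 𝓥) : dxOp.app F ∈ constLocal R 𝓥 := by
  refine app_constLocal _ (fun d hd => ?_) hF hF'
  rw [dxOp_toFun]
  rcases hd with rfl | rfl
  · exact Or.inr (Or.inl fun c => TrivSqZeroExt.ext
      (by simp [formOf_fst, dxOp, formOp]) (by simp [formOf_fst, formOf_snd, dxOp, formOp]))
  · exact Or.inl fun c => TrivSqZeroExt.ext (by simp) (by simp [formOf_fst])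

theorem koszulExp_word (e : ℤ) {s : List (ℤ × Homog 𝓥)} {cs : List Smooth}
    (h : cs.length = s.length) : koszulExp e (word s cs) =
      koszulExp e (s.map fun t => ((formOf t.1 0, t.2) : PureTensor 𝓥 formGrading)) := by
  induction s generalizing e cs with
  | nil => simp [word]
  | cons t s ih =>
    rcases cs with - | ⟨c, cs⟩
    · simp at h
    · simp [koszulExp, ih _ (show cs.length = s.length by simpa using h)]

theorem vf_tensorBr (𝔤 : CurvedLInfty 𝓡 dR I 𝓥)
    (hF : F ∈ tensorCochains 𝓡 𝓥 formGrading Proper p) {l : List (PureTensor 𝓥 formGrading)}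
    (hl : Proper l) : vf tdeg (tensorBr isCDGA_forms 𝔤) F l =
      unshSum tdeg l (fun a c => F (mainTerm isCDGA_forms 𝔤 a :: c)) + extOp.app F l := by
  rw [extOp.app_of_adm _ hl,
    ← vf_slotBr extOp.tdeg_map (IsTensorCochain.swap
      (hF : IsTensorCochain 𝓡 𝓥 formGrading Proper p F)), vf, vf, ← unshSum_add]
  exact unshSum_congr fun a c _ => brSum_tensorBr ..

/-- Unless the product of the bracketed forms vanishes identically, the bracket merges the selected
coefficients into one product, so `merge_mem_diffOps` applies. -/
theorem mainTerm_diffOps (𝔤 : CurvedLInfty 𝓡 dR I 𝓥)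
    (hF : F ∈ tensorCochains 𝓡 𝓥 formGrading Proper p) {n K : ℕ}
    (hK : ∀ s : List (ℤ × Homog 𝓥), s.length ≤ n + 1 → evalWord R s F ∈ diffOps R s.length K)
    (s : List (ℤ × Homog 𝓥)) (hs : s.length = n) (b : List Bool) (hb : b.length = n) :
    (fun cs => F (mainTerm isCDGA_forms 𝔤 (selT b (word s cs)) :: selF b (word s cs))) ∈
      diffOps R n K := by
  have hT : ∀ {cs : List Smooth}, cs.length = n → (selT b cs).length = (selT b s).length :=
    fun h => length_selT b _ _ (by omega)
  have hFl : ∀ {cs : List Smooth}, cs.length = n → (selF b cs).length = (selF b s).length :=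
    fun h => length_selF b _ _ (by omega)
  have eT : ∀ cs, selT b (word s cs) = word (selT b s) (selT b cs) := selT_zipWith _ b s
  have eF : ∀ cs, selF b (word s cs) = word (selF b s) (selF b cs) := selF_zipWith _ b s
  rcases prodVal_word (selT b s) with h | h
  · let t : ℤ × Homog 𝓥 := (((selT b s).map Prod.fst).sum, 𝔤.brH ((selT b s).map Prod.snd))
    have hlen : (selF b b).length = (selF b s).length := length_selF b _ _ (by omega)
    have hle := length_selF_le b
    have h1 := hK (t :: selF b s) (by simp; omega)
    rw [List.length_cons, ← hlen] at h1
    refine diffOps_congr (units_smul_mem' (koszulExp 1 ((selT b s).map fun t =>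
      ((formOf t.1 0, t.2) : PureTensor 𝓥 formGrading))).negOnePow (merge_mem_diffOps hb h1))
      fun cs hcs _ => ?_
    rw [eT, eF, eval_mainTerm tensorAdmissible_proper 𝔤 hF, koszulExp_word _ (hT hcs)]
    simp only [Pi.smul_apply, preL_apply, evalWord_apply, word_cons]
    congr 3
    refine Prod.ext (Homog.ext' ?_ (h _ (hT hcs))) (congrArg 𝔤.brH
      (word_map (fun _ _ => rfl) (hT hcs)))
    simp only [prodHomog, formOf_deg, adeg, wdeg, t]
    rw [word_map (g := Prod.fst) (fun _ _ => rfl) (hT hcs)]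
  · refine nullOn_le _ _ (mem_nullOn.2 fun cs hcs _ => ?_)
    rw [eT, eF, eval_mainTerm tensorAdmissible_proper 𝔤 hF,
      left_zero tensorAdmissible_proper hF (h _ (hT hcs)), smul_zero]

theorem ceDiff_constLocal (𝔤 : CurvedLInfty 𝓡 dR I 𝓥)
    (hF : F ∈ tensorCochains 𝓡 𝓥 formGrading Proper p) (hF' : F ∈ constLocal R 𝓥) :
    ceDiff dR tdeg (tensorBr isCDGA_forms 𝔤) Proper p F ∈ constLocal R 𝓥 := by
  have h3 : (fun l => unshSum tdeg l fun a c => F (mainTerm isCDGA_forms 𝔤 a :: c)) ∈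
      constLocal R 𝓥 := fun n => by
    choose K hK using hF'
    -- Brackets of a word of length `n` produce words of every length up to `n + 1`; the sum
    -- dominates the bounds for all of them.
    refine ⟨∑ j ∈ Finset.range (n + 2), K j, fun s hs => ?_⟩
    have hK' : ∀ s : List (ℤ × Homog 𝓥), s.length ≤ n + 1 →
        evalWord R s F ∈ diffOps R s.length (∑ j ∈ Finset.range (n + 2), K j) := fun s hs =>
      diffOps_mono (Finset.single_le_sum (f := K) (fun _ _ => Nat.zero_le _)
        (Finset.mem_range.2 (by omega))) (hK _ s rfl)
    refine diffOps_congr (g := ((masks n).map fun b cs => (maskExp b (s.map fun t =>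
      t.1 + t.2.deg)).negOnePow • F (mainTerm isCDGA_forms 𝔤 (selT b (word s cs)) ::
        selF b (word s cs))).sum) (list_sum_mem fun g hg => ?_) fun cs hcs _ => ?_
    · obtain ⟨b, hb, rfl⟩ := List.mem_map.1 hg
      exact units_smul_mem' _ (mainTerm_diffOps 𝔤 hF hK' s hs b (length_of_mem_masks hb))
    · rw [evalWord_apply, unshSum_eq_masks, length_word (by omega), hs,
        word_map (g := fun t => t.1 + t.2.deg) (fun _ _ => rfl) (by omega), Pi.list_sum_apply,
        List.map_map]
      rfl
  have h4 : (fun l => dR (F l)) - p.negOnePow • ((fun l => unshSum tdeg l fun a c =>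
      F (mainTerm isCDGA_forms 𝔤 a :: c)) + extOp.app F) ∈ constLocal R 𝓥 :=
    sub_mem (comp_constLocal dR hF')
      (units_smul_mem' _ (add_mem h3 (extOp_constLocal hF hF')))
  intro n
  obtain ⟨K, hK⟩ := h4 n
  refine ⟨K, fun s hs => diffOps_congr (hK s hs) fun cs hcs hc => ?_⟩
  have hw := proper_word (s := s) (by omega) hc
  rw [evalWord_apply, ceDiff_apply _ _ _ _ hw, vf_tensorBr 𝔤 hF hw]
  rfl

end Words

attribute [local instance 10000] ringForms algebraForms moduleForms addCommGroupForms
  addCommMonoidForms commRingSmooth addCommGroupSmooth addZeroClassSmooth addMonoidSmooth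
  moduleSmooth moduleSmoothOp smulSmooth smulSmoothOp algebraSmooth smulRealSmooth

/-! ### Translation-invariant local functionals have constant coefficients -/

section NormalForm

theorem Smooth.translate_mul (t : ℝ) (f g : Smooth) :
    Smooth.translate t (f * g) = Smooth.translate t f * Smooth.translate t g := rfl

theorem translate_mem_compact (t : ℝ) {f : Smooth} (hf : f ∈ compactSmooth) :
    Smooth.translate t f ∈ compactSmooth :=
  HasCompactSupport.comp_homeomorph hf (Homeomorph.addRight t)

theorem lineIntegral_translate (t : ℝ) {f : Smooth} (hf : f ∈ compactSmooth) :
    lineIntegral (Smooth.translate t f) = lineIntegral f := by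
  rw [lineIntegral_of_compact hf, lineIntegral_of_compact (translate_mem_compact t hf)]
  exact MeasureTheory.integral_add_right_eq_self (f : ℝ → ℝ) t

theorem iterate_deriv_translate (t : ℝ) (k : ℕ) (f : Smooth) :
    Smooth.deriv^[k] (Smooth.translate t f) = Smooth.translate t (Smooth.deriv^[k] f) := by
  induction k with
  | zero => rfl
  | succ k ih => rw [Function.iterate_succ_apply', Function.iterate_succ_apply', ih,
      Smooth.deriv_translate]

theorem dens_translate (t : ℝ) (m : List ℕ) (cs : List Smooth) :
    dens m (cs.map (Smooth.translate t)) = Smooth.translate t (dens m cs) := by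
  induction m generalizing cs with
  | nil => simp only [dens_nil]; rfl
  | cons k m ih =>
    cases cs with
    | nil => rfl
    | cons c cs =>
      rw [List.map_cons, dens_cons, dens_cons, ih, Smooth.translate_mul, iterate_deriv_translate]

theorem iterate_deriv_apply (k : ℕ) (f : Smooth) :
    (Smooth.deriv^[k] f : ℝ → ℝ) = iteratedDeriv k (f : ℝ → ℝ) := by
  rw [iteratedDeriv_eq_iterate]
  induction k with
  | zero => rfl
  | succ k ih =>
    rw [Function.iterate_succ_apply', Function.iterate_succ_apply', ← ih]
    rfl

theorem dens_ofFn {n : ℕ} (m : Fin n → ℕ) (cs : Fin n → Smooth) (x : ℝ) :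
    (dens (List.ofFn m) (List.ofFn cs) : ℝ → ℝ) x = ∏ i, iteratedDeriv (m i) (cs i : ℝ → ℝ) x := by
  induction n with
  | zero => simp
  | succ n ih =>
    rw [List.ofFn_succ, List.ofFn_succ, dens_cons, Fin.prod_univ_succ, ← ih, ← iterate_deriv_apply]
    rfl

theorem HasCompact.translate {cs : List Smooth} (h : HasCompact cs) (t : ℝ) :
    HasCompact (cs.map (Smooth.translate t)) := by
  obtain ⟨c, hc, hc'⟩ := h
  exact ⟨_, List.mem_map_of_mem hc, translate_mem_compact t hc'⟩

/-- The fundamental lemma of the calculus of variations. -/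
theorem eq_zero_of_lineIntegral_mul {B : Smooth}
    (h : ∀ f ∈ compactSmooth, lineIntegral (f * B) = 0) : B = 0 := by
  have hB : Continuous (B : ℝ → ℝ) := (Smooth.contDiff B).continuous
  have h1 := ae_eq_zero_of_integral_contDiff_smul_eq_zero (μ := MeasureTheory.volume)
    hB.locallyIntegrable fun g hg hg' => by
      have h2 := h ⟨g, hg⟩ hg'
      rw [lineIntegral_of_compact (mul_mem_compact (f := ⟨g, hg⟩) hg')] at h2
      simpa using h2
  exact Subtype.ext (Continuous.ae_eq_iff_eq _ hB continuous_zero |>.1 h1)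

variable {R : Type} [AddCommGroup R] [Module ℝ R]

/-- The functional given by a sum of integrals of densities with variable coefficients. -/
noncomputable def repSum (T : List (Smooth × List ℕ × R)) (cs : List Smooth) : R :=
  (T.map fun t => lineIntegral (t.1 * dens (0 :: t.2.1) cs) • t.2.2).sum

variable (R) in
/-- The local functionals of `k + 1` functions that do not differentiate the first one. -/
def normalOps (k K : ℕ) : Submodule ℝ (List Smooth → R) where
  carrier := {g | ∃ T : List (Smooth × List ℕ × R), (∀ t ∈ T, t.2.1.length = k ∧ t.2.1.sum ≤ K) ∧
    ∀ cs : List Smooth, cs.length = k + 1 → HasCompact cs → g cs = repSum T cs}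
  zero_mem' := ⟨[], by simp, fun _ _ _ => rfl⟩
  add_mem' := by
    rintro g g' ⟨T, h1, h2⟩ ⟨T', h1', h2'⟩
    refine ⟨T ++ T', fun t ht => (List.mem_append.1 ht).elim (h1 t) (h1' t), fun cs hcs hc => ?_⟩
    rw [Pi.add_apply, h2 cs hcs hc, h2' cs hcs hc, repSum, repSum, repSum, List.map_append,
      List.sum_append]
  smul_mem' := by
    rintro a g ⟨T, h1, h2⟩
    refine ⟨T.map fun t => (t.1, t.2.1, a • t.2.2), fun t ht => ?_, fun cs hcs hc => ?_⟩
    · obtain ⟨t', ht', rfl⟩ := List.mem_map.1 ht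
      exact h1 t' ht'
    · rw [Pi.smul_apply, h2 cs hcs hc, repSum, repSum, List.map_map, List.smul_sum, List.map_map]
      simp [Function.comp_def, smul_comm a]

theorem normalOps_congr {k K : ℕ} {g g' : List Smooth → R} (hg : g ∈ normalOps R k K)
    (h : ∀ cs : List Smooth, cs.length = k + 1 → HasCompact cs → g' cs = g cs) :
    g' ∈ normalOps R k K := by
  obtain ⟨T, h1, h2⟩ := hg
  exact ⟨T, h1, fun cs hcs hc => (h cs hcs hc).trans (h2 cs hcs hc)⟩

theorem normalOps_mono {k K K' : ℕ} (h : K ≤ K') : normalOps R k K ≤ normalOps R k K' :=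
  fun _ ⟨T, h1, h2⟩ => ⟨T, fun t ht => ⟨(h1 t ht).1, (h1 t ht).2.trans h⟩, h2⟩

/-- Integration by parts. -/
theorem mem_normalOps (j : ℕ) (c : Smooth) (m : List ℕ) (r : R) :
    (fun cs => lineIntegral (c * dens (j :: m) cs) • r) ∈ normalOps R m.length (j + m.sum) := by
  induction j generalizing c m with
  | zero => exact ⟨[(c, m, r)], by simp, fun cs _ _ => by simp [repSum]⟩
  | succ j ih =>
    have h1 := ih (Smooth.deriv c) m
    have h2 : ∀ i ∈ Finset.range m.length,
        (fun cs => lineIntegral (c * dens (j :: m.modify i (· + 1)) cs) • r) ∈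
          normalOps R m.length (j + 1 + m.sum) := fun i hi => by
      have := ih c (m.modify i (· + 1))
      rw [sum_modify_succ (Finset.mem_range.1 hi), List.length_modify] at this
      rwa [show j + 1 + m.sum = j + (m.sum + 1) by omega]
    refine normalOps_congr (neg_mem (add_mem (normalOps_mono (by omega) h1) (sum_mem h2)))
      fun cs hcs hc => ?_
    rcases cs with - | ⟨f, cs⟩
    · simp at hcs
    · have hl : m.length = cs.length := by simpa using hcs.symm
      have hd : c * (Smooth.deriv^[j] f * dens m cs) ∈ compactSmooth :=
        mul_mem_compact' (dens_mem_compact (m := j :: m) (cs := f :: cs) (by simp [hl]) hc)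
      have h3 := lineIntegral_deriv hd
      rw [Smooth.deriv_mul, Smooth.deriv_mul, deriv_dens hl, mul_add, map_add, map_add,
        Finset.mul_sum, Finset.mul_sum, map_sum, ← Function.iterate_succ_apply' Smooth.deriv] at h3
      simp only [Pi.neg_apply, Pi.add_apply, Finset.sum_apply, dens_cons]
      rw [← Finset.sum_smul, ← add_smul, ← neg_smul, hl]
      congr 1
      linarith

theorem map_repSum (φ : R →ₗ[ℝ] ℝ) (T : List (Smooth × List ℕ × R)) (f : Smooth)
    (cs : List Smooth) : φ (repSum T (f :: cs)) =
      lineIntegral (f * (T.map fun t => φ t.2.2 • (t.1 * dens t.2.1 cs)).sum) := by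
  rw [repSum, map_list_sum, ← List.sum_map_mul_left, map_list_sum, List.map_map, List.map_map]
  congr 2
  funext t
  simp [mul_left_comm, mul_comm]

/-- A translation-invariant local functional has constant coefficients. -/
theorem diffOps_of_translate {k K : ℕ} {g : List Smooth → R} (hg : g ∈ normalOps R k K)
    (ht : ∀ (t : ℝ) (cs : List Smooth), cs.length = k + 1 → HasCompact cs →
      g (cs.map (Smooth.translate t)) = g cs) : g ∈ diffOps R (k + 1) K := by
  obtain ⟨T, h1, h2⟩ := hg
  have key : ∀ (φ : R →ₗ[ℝ] ℝ) (cs : List Smooth), cs.length = k →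
      (T.map fun t => φ t.2.2 • (t.1 * dens t.2.1 cs)).sum =
        (T.map fun t => φ t.2.2 • ((t.1 : ℝ → ℝ) 0 • dens t.2.1 cs)).sum := fun φ cs hcs => by
    -- The first function is not differentiated and may be any test function. So translation
    -- invariance of the integral becomes an identity of its cofactors, with the coefficients
    -- translated.
    have h3 : ∀ a : ℝ, (T.map fun t => φ t.2.2 • (Smooth.translate (-a) t.1 * dens t.2.1 cs)).sum -
        (T.map fun t => φ t.2.2 • (t.1 * dens t.2.1 cs)).sum = 0 := fun a => by
      refine eq_zero_of_lineIntegral_mul fun f hf => ?_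
      have h4 : HasCompact (f :: cs) := ⟨f, List.mem_cons_self, hf⟩
      have h5 := ht a (f :: cs) (by simp [hcs]) h4
      rw [h2 _ (by simp [hcs]) (h4.translate a), h2 _ (by simp [hcs]) h4] at h5
      have h6 := congrArg φ h5
      rw [List.map_cons, map_repSum, map_repSum] at h6
      rw [mul_sub, map_sub, sub_eq_zero, ← h6, ← lineIntegral_translate a (mul_mem_compact hf),
        Smooth.translate_mul]
      congr 2
      rw [map_list_sum, List.map_map]
      congr 2
      funext t
      simp only [Function.comp_apply, map_smul, Smooth.translate_mul, dens_translate]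
      congr 2
      ext x
      simp [Smooth.translate]
    refine Subtype.ext (funext fun x => ?_)
    let ev : Smooth →+ ℝ := ⟨⟨fun f => (f : ℝ → ℝ) x, rfl⟩, fun _ _ => rfl⟩
    -- At the point `x`, translating by `x` replaces each coefficient by its value at `0`.
    have h7 := congrArg ev (h3 x)
    change ev _ = ev _
    rw [map_sub, map_zero, sub_eq_zero] at h7
    rw [← h7, map_list_sum, map_list_sum, List.map_map, List.map_map]
    congr 2
    funext t
    simp [ev, Smooth.translate]
  refine diffOps_congr (g := (T.map fun t => mono (0 :: t.2.1) ((t.1 : ℝ → ℝ) 0 • t.2.2)).sum)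
    (list_sum_mem fun g hg => ?_) fun cs hcs hc => ?_
  · obtain ⟨t, ht, rfl⟩ := List.mem_map.1 hg
    exact mono_mem (by simp [(h1 t ht).1]) (by simpa using (h1 t ht).2) _
  · rcases cs with - | ⟨f, cs⟩
    · simp at hcs
    -- Elements of `R` are separated by real linear functionals, so the identity can be checked for
    -- scalar-valued functionals.
    · rw [h2 _ hcs hc, ← sub_eq_zero, ← Module.forall_dual_apply_eq_zero_iff ℝ]
      intro φ
      rw [map_sub, sub_eq_zero, map_repSum, key φ cs (by simpa using hcs), Pi.list_sum_apply,
        map_list_sum, ← List.sum_map_mul_left, map_list_sum, List.map_map, List.map_map,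
        List.map_map]
      congr 2
      funext t
      simp [mono, mul_comm, mul_left_comm]
      ring

end NormalForm

/-! ### Locality together with translation invariance amounts to `constLocal`. -/

section Membership

set_option linter.unusedSectionVars false

variable {R : Type} [Ring R] [Algebra ℝ R] {𝓡 : ℤ → Submodule ℝ R} [GradedAlgebra 𝓡]
  {dR : R →ₗ[ℝ] R} {I : Ideal R}
  {V : Type} [AddCommGroup V] [Module ℝ V] [Module R V] {𝓥 : ℤ → Submodule ℝ V}
  {F : List (PureTensor 𝓥 formGrading) → R}

theorem translateH_formOf (t : ℝ) (d : ℤ) (c : Smooth) :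
    translateH t (formOf d c) = formOf d (Smooth.translate t c) := by
  refine Homog.ext' rfl (TrivSqZeroExt.ext ?_ ?_)
  · simp only [translateH, translateForm, LinearMap.coe_mk, AddHom.coe_mk, TrivSqZeroExt.fst_add,
      TrivSqZeroExt.fst_inl, TrivSqZeroExt.fst_inr, add_zero, formOf_fst]
    split_ifs <;> simp
  · simp only [translateH, translateForm, LinearMap.coe_mk, AddHom.coe_mk, TrivSqZeroExt.snd_add,
      TrivSqZeroExt.snd_inl, TrivSqZeroExt.snd_inr, zero_add, formOf_snd]
    split_ifs <;> simp

theorem word_translate (t : ℝ) (s : List (ℤ × Homog 𝓥)) (cs : List Smooth) :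
    (word s cs).map (fun φ => (translateH t φ.1, φ.2)) = word s (cs.map (Smooth.translate t)) := by
  induction s generalizing cs with
  | nil => simp [word]
  | cons d s ih =>
    cases cs with
    | nil => simp [word]
    | cons c cs => simp [ih, translateH_formOf]

theorem invariant_of_constLocal (hF : F ∈ constLocal R 𝓥) : F ∈ invariantFunctionals R 𝓥 := by
  intro t l hl
  have hc := hasCompact_of_proper hl
  rw [← word_eq l, word_translate]
  obtain ⟨K, hK⟩ := hF l.length
  obtain ⟨r, hr⟩ := exists_coefficients (hK (l.map fun t => (t.1.deg, t.2)) (by simp))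
  have h1 := hr _ (by simp) hc
  have h2 := hr _ (by simp) (hc.translate t)
  rw [evalWord_apply] at h1 h2
  rw [h1, h2]
  refine Finset.sum_congr rfl fun m _ => ?_
  rw [dens_translate, lineIntegral_translate t (dens_mem_compact (by simp) hc)]

theorem local_of_constLocal (hF : F ∈ constLocal R 𝓥) : F ∈ localFunctionals R 𝓥 := by
  intro n
  obtain ⟨K, hK⟩ := hF n
  have h : ∀ s : Fin n → ℤ × Homog 𝓥, ∃ r : (Fin n → Fin (K + 1)) → R, ∀ cs : List Smooth,
      cs.length = n → HasCompact cs → evalWord R (List.ofFn s) F cs =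
        ∑ m, lineIntegral (dens (List.ofFn fun i => (m i : ℕ)) cs) • r m := fun s =>
    exists_coefficients (hK (List.ofFn s) (by simp))
  choose r hr using h
  refine ⟨Fin n → Fin (K + 1), inferInstance, fun _ => 1, fun m i => m i, fun m s => r s m,
    fun φ hφ => ?_⟩
  have hc := hasCompact_of_proper hφ
  have h1 := hr (fun i => ((φ i).1.deg, (φ i).2)) _ (by simp) hc
  rw [evalWord_apply, show List.ofFn (fun i => ((φ i).1.deg, (φ i).2)) =
    (List.ofFn φ).map fun t => (t.1.deg, t.2) by rw [List.map_ofFn]; rfl, word_eq] at h1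
  rw [h1]
  refine Finset.sum_congr rfl fun m _ => ?_
  rw [lineIntegral_of_compact (dens_mem_compact (by simp) hc), List.map_ofFn]
  congr 2
  funext x
  rw [dens_ofFn, OneMemClass.coe_one, Pi.one_apply, one_mul]
  rfl

/-- Integration by parts frees the first function of derivatives, and invariance then makes the
coefficients constant. The order is bounded by the finitely many derivative orders in the local
representation, uniformly in `s`. -/
theorem constLocal_of_local {p : ℤ} [SetLike.GradedSMul 𝓡 𝓥] [IsScalarTower ℝ R V]
    (hF : F ∈ tensorCochains 𝓡 𝓥 formGrading Proper p) (h1 : F ∈ localFunctionals R 𝓥)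
    (h2 : F ∈ invariantFunctionals R 𝓥) : F ∈ constLocal R 𝓥 := by
  intro n
  obtain ⟨ι, _, c, m, P, h⟩ := h1 n
  refine ⟨∑ α, (List.ofFn (m α)).sum, fun s hs => ?_⟩
  rcases n with - | k
  · refine nullOn_le _ _ (mem_nullOn.2 fun cs hcs hc => ?_)
    obtain ⟨b, hb, -⟩ := hc
    rw [List.length_eq_zero_iff.1 hcs] at hb
    simp at hb
  by_cases hs' : ∃ d ∈ s, d.1 ≠ 0 ∧ d.1 ≠ 1
  · obtain ⟨d, hd, h0, h1⟩ := hs'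
    exact nullOn_le _ _ (mem_nullOn.2 fun cs hcs _ => evalWord_eq_zero hF hd h0 h1 (by omega))
  push Not at hs'
  refine diffOps_of_translate (normalOps_congr (g := ∑ α, fun cs =>
    lineIntegral (c α * dens (List.ofFn (m α)) cs) • P α fun i => s[i]) (sum_mem fun α _ => ?_)
    fun cs hcs hc => ?_) fun t cs hcs hc => ?_
  · have := mem_normalOps (m α 0) (c α) (List.ofFn fun i => m α i.succ) (P α fun i => s[i])
    rw [← List.ofFn_succ (f := m α), List.length_ofFn] at this
    refine normalOps_mono ?_ this
    refine le_trans ?_ (Finset.single_le_sum (f := fun α => (List.ofFn (m α)).sum)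
      (fun _ _ => Nat.zero_le _) (Finset.mem_univ α))
    simp only [List.ofFn_succ (f := m α), List.sum_cons, le_refl]
  · let φ : Fin (k + 1) → PureTensor 𝓥 formGrading := fun i => (formOf s[i].1 cs[i], s[i].2)
    have hφ : word s cs = List.ofFn φ := by
      refine List.ext_getElem (by simp [word, hs, hcs]) fun i _ _ => ?_
      rw [List.getElem_ofFn]
      simp [word, φ]
    have hp := proper_word (s := s) (by omega) hc
    rw [evalWord_apply, hφ, h φ (hφ ▸ hp), Finset.sum_apply]
    refine Finset.sum_congr rfl fun α _ => ?_
    have hcf : ∀ i, cf (φ i).1 = cs[i] := fun i => by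
      have := hs' _ (List.getElem_mem (l := s) (n := i) (by omega))
      by_cases h0 : s[i].1 = 0
      · have h0' : s[(i : ℕ)].1 = 0 := h0
        simp [φ, cf, formOf_fst, formOf_snd, h0']
      · have h0' : s[(i : ℕ)].1 = 1 := this h0
        simp [φ, cf, formOf_fst, formOf_snd, h0']
    have hcs' : cs = List.ofFn fun i => cf (φ i).1 := by
      simp only [hcf]
      refine List.ext_getElem (by simp [hcs]) fun i _ _ => ?_
      rw [List.getElem_ofFn]
      rfl
    rw [lineIntegral_of_compact (mul_mem_compact' (dens_mem_compact (by simp [hcs]) hc))]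
    congr 2
    funext x
    rw [MulMemClass.coe_mul, Pi.mul_apply]
    conv_rhs => rw [hcs', dens_ofFn]
    rfl
  · rw [evalWord_apply, evalWord_apply, ← word_translate]
    exact h2 t _ (proper_word (by omega) hc)

end Membership

attribute [local instance 10000] ringForms algebraForms moduleForms addCommGroupForms
  addCommMonoidForms commRingSmooth addCommGroupSmooth addZeroClassSmooth addMonoidSmooth
  moduleSmooth moduleSmoothOp smulSmooth smulSmoothOp algebraSmooth smulRealSmooth

/-! ### The homotopy operator -/

section HomotopyOperator

set_option linter.unusedSectionVars false

variable {R : Type} [Ring R] [Algebra ℝ R] {𝓡 : ℤ → Submodule ℝ R} [GradedAlgebra 𝓡]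
  {dR : R →ₗ[ℝ] R} {I : Ideal R}
  {V : Type} [AddCommGroup V] [Module ℝ V] [Module R V] {𝓥 : ℤ → Submodule ℝ V}
  [SetLike.GradedSMul 𝓡 𝓥] [IsScalarTower ℝ R V] {p : ℤ}
  {F : List (PureTensor 𝓥 formGrading) → R}

variable (𝓡 𝓥) in
/-- The translation-invariant local functionals of degree `p`. -/
def fieldCochains (p : ℤ) : Submodule ℝ (List (PureTensor 𝓥 formGrading) → R) :=
  tensorCochains 𝓡 𝓥 formGrading Proper p ⊓ constLocal R 𝓥

theorem mem_obstruction_iff (𝔤 : CurvedLInfty 𝓡 dR I 𝓥) :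
    F ∈ (obstructionDeformation 𝔤).S p ↔ F ∈ fieldCochains 𝓡 𝓥 p :=
  ⟨fun h => ⟨h.1.1, constLocal_of_local h.1.1 h.1.2 h.2⟩,
    fun h => ⟨⟨h.1, local_of_constLocal h.2⟩, invariant_of_constLocal h.2⟩⟩

theorem isComplex_obstructionDeformation (hR : IsCDGA 𝓡 dR) (𝔤 : CurvedLInfty 𝓡 dR I 𝓥) :
    (obstructionDeformation 𝔤).IsComplex where
  maps p x hx := by
    obtain ⟨h1, h2⟩ := (mem_obstruction_iff 𝔤).1 hx
    exact (mem_obstruction_iff 𝔤).2 ⟨tensor_maps hR tensorAdmissible_proper 𝔤 h1,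
      ceDiff_constLocal 𝔤 h1 h2⟩
  sq p x hx := tensor_sq hR tensorAdmissible_proper 𝔤 ((mem_obstruction_iff 𝔤).1 hx).1

theorem app_mem_of_e {θ : SlotOp (𝓥 := 𝓥) formGrading Proper} {q : ℤ}
    (hF : F ∈ tensorCochains 𝓡 𝓥 formGrading Proper p) (h : q = p + θ.e) :
    θ.app F ∈ tensorCochains 𝓡 𝓥 formGrading Proper q := h ▸ θ.app_mem tensorAdmissible_proper hF

theorem extOp_mem (hF : F ∈ tensorCochains 𝓡 𝓥 formGrading Proper p) :
    extOp.app F ∈ tensorCochains 𝓡 𝓥 formGrading Proper (p + 1) := app_mem_of_e hF rfl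

theorem dxOp_mem (hF : F ∈ tensorCochains 𝓡 𝓥 formGrading Proper p) :
    dxOp.app F ∈ tensorCochains 𝓡 𝓥 formGrading Proper (p + 1) := app_mem_of_e hF rfl

theorem iotaOp_mem (hF : F ∈ tensorCochains 𝓡 𝓥 formGrading Proper (p + 1)) :
    iotaOp.app F ∈ tensorCochains 𝓡 𝓥 formGrading Proper p :=
  app_mem_of_e hF (show p = p + 1 + -1 by ring)

theorem eulerIotaOp_mem (hF : F ∈ tensorCochains 𝓡 𝓥 formGrading Proper (p + 1)) :
    eulerIotaOp.app F ∈ tensorCochains 𝓡 𝓥 formGrading Proper p :=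
  app_mem_of_e hF (show p = p + 1 + -1 by ring)

theorem mulXOp_mem (hF : F ∈ tensorCochains 𝓡 𝓥 formGrading Proper p) :
    mulXOp.app F ∈ tensorCochains 𝓡 𝓥 formGrading Proper p :=
  app_mem_of_e hF (show p = p + 0 by ring)

theorem eulerOp_mem (hF : F ∈ tensorCochains 𝓡 𝓥 formGrading Proper p) :
    eulerOp.app F ∈ tensorCochains 𝓡 𝓥 formGrading Proper p :=
  app_mem_of_e hF (show p = p + 0 by ring)

theorem eq_zero_of_evalWord (hF : F ∈ tensorCochains 𝓡 𝓥 formGrading Proper p)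
    {l : List (PureTensor 𝓥 formGrading)} (h : ∀ (s : List (ℤ × Homog 𝓥)) (cs : List Smooth),
      s.length = l.length → cs.length = s.length → HasCompact cs →
      (∀ d ∈ s, d.1 = 0 ∨ d.1 = 1) → F (word s cs) = 0) : F l = 0 := by
  by_cases hl : Proper l
  · rw [← word_eq l]
    by_cases hs : ∀ d ∈ l.map fun t => (t.1.deg, t.2), d.1 = 0 ∨ d.1 = 1
    · exact h _ _ (by simp) (by simp) (hasCompact_of_proper hl) hs
    · push Not at hs
      obtain ⟨d, hd, h0, h1⟩ := hs
      exact evalWord_eq_zero hF hd h0 h1 (by simp)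
  · exact IsTensorCochain.zero (hF : IsTensorCochain 𝓡 𝓥 formGrading Proper p F) l hl

theorem app_word_of_e_eq_zero (θ : SlotOp (𝓥 := 𝓥) formGrading Proper) (he : θ.e = 0)
    (op : Smooth → Smooth) (h : ∀ d c, θ.toFun (formOf d c).val = (formOf d (op c)).val)
    {s : List (ℤ × Homog 𝓥)} {cs : List Smooth} (hl : cs.length = s.length) (hc : HasCompact cs) :
    θ.app F (word s cs) = ∑ i ∈ Finset.range s.length, F (word s (cs.modify i op)) := by
  rw [app_word θ hl hc]
  refine Finset.sum_congr rfl fun i hi => ?_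
  rw [word_modify i (List.getElem?_eq_getElem (Finset.mem_range.1 hi)) (e := 0) op
    (fun c => Prod.ext (Homog.ext' (by simp [SlotOp.map, mapLeft, he]) (by
      rw [add_zero]
      exact h _ c)) rfl) hl, he, zero_mul, Int.negOnePow_zero, one_smul,
    show (fun t : ℤ × Homog 𝓥 => (t.1 + 0, t.2)) = id by funext t; simp, List.modify_id]

theorem mulXOp_word {s : List (ℤ × Homog 𝓥)} {cs : List Smooth} (hl : cs.length = s.length)
    (hc : HasCompact cs) : mulXOp.app F (word s cs) =
      ∑ i ∈ Finset.range s.length, F (word s (cs.modify i mulX)) :=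
  app_word_of_e_eq_zero mulXOp rfl mulX (fun d c => TrivSqZeroExt.ext
    (by simp [mulXOp_toFun, formOf_fst, apply_ite mulX])
    (by simp [mulXOp_toFun, formOf_snd, apply_ite mulX])) hl hc

/-- Infinitesimal translation invariance: the sum over all slots is the integral of a total
derivative. -/
theorem lieOp_eq_zero (hF : F ∈ fieldCochains 𝓡 𝓥 p) : lieOp.app F = 0 := by
  funext l
  refine eq_zero_of_evalWord (app_mem_of_e hF.1 (q := p) (add_zero p).symm) fun s cs hs hcs hc _ => ?_
  rw [app_word_of_e_eq_zero lieOp rfl Smooth.deriv (fun d c => TrivSqZeroExt.ext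
    (by simp [lieOp_toFun, formOf_fst, apply_ite Smooth.deriv])
    (by simp [lieOp_toFun, formOf_snd, apply_ite Smooth.deriv])) hcs hc]
  obtain ⟨K, hK⟩ := hF.2 s.length
  have := mem_nullOn.1 (sum_modify_deriv_mem (hK s rfl)) cs hcs hc
  simpa using this

variable (R 𝓥) in
/-- Division by the number of fields. -/
noncomputable def average : (List (PureTensor 𝓥 formGrading) → R) →ₗ[ℝ]
    (List (PureTensor 𝓥 formGrading) → R) := lengthScale fun n => (n : ℝ)⁻¹

theorem average_mem (hF : F ∈ tensorCochains 𝓡 𝓥 formGrading Proper p) :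
    average R 𝓥 F ∈ tensorCochains 𝓡 𝓥 formGrading Proper p := lengthScale_mem hF

theorem app_average (θ : SlotOp (𝓥 := 𝓥) formGrading Proper) :
    θ.app (average R 𝓥 F) = average R 𝓥 (θ.app F) := θ.app_lengthScale _ F

theorem average_idOp (hF : F ∈ tensorCochains 𝓡 𝓥 formGrading Proper p) :
    average R 𝓥 (idOp.app F) = F := by
  funext l
  rw [app_idOp hF, average, lengthScale_apply, lengthScale_apply, smul_smul]
  rcases l with - | ⟨t, l⟩
  · rw [IsTensorCochain.zero (hF : IsTensorCochain 𝓡 𝓥 formGrading Proper p F) []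
      (by simp [Proper]), smul_zero]
  · rw [inv_mul_cancel₀ (by simp; positivity), one_smul]

variable (R 𝓥) in
/-- Contraction with the Euler vector field around the center of mass of the fields. -/
noncomputable def homotopyOp : (List (PureTensor 𝓥 formGrading) → R) →ₗ[ℝ]
    (List (PureTensor 𝓥 formGrading) → R) :=
  eulerIotaOp.app - average R 𝓥 ∘ₗ iotaOp.app ∘ₗ mulXOp.app

theorem homotopyOp_apply : homotopyOp R 𝓥 F =
    eulerIotaOp.app F - average R 𝓥 (iotaOp.app (mulXOp.app F)) := rfl

theorem homotopyOp_mem' (hF : F ∈ tensorCochains 𝓡 𝓥 formGrading Proper (p + 1)) :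
    homotopyOp R 𝓥 F ∈ tensorCochains 𝓡 𝓥 formGrading Proper p :=
  sub_mem (eulerIotaOp_mem hF) (average_mem (iotaOp_mem (mulXOp_mem hF)))

/-- In each slot a one-form is contracted and multiplied by its position minus the mean position. By
`modify_mulX_sub_mem` the result has constant coefficients again; functions are annihilated by the
contraction. -/
theorem homotopyOp_mem (hF : F ∈ fieldCochains 𝓡 𝓥 (p + 1)) :
    homotopyOp R 𝓥 F ∈ fieldCochains 𝓡 𝓥 p := by
  refine ⟨homotopyOp_mem' hF.1, fun n => ?_⟩
  obtain ⟨K, hK⟩ := hF.2 n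
  refine ⟨K, fun s hs => ?_⟩
  by_cases hs' : ∃ d ∈ s, d.1 ≠ 0 ∧ d.1 ≠ 1
  · obtain ⟨d, hd, h0, h1⟩ := hs'
    exact nullOn_le _ _ (mem_nullOn.2 fun cs hcs _ =>
      evalWord_eq_zero (homotopyOp_mem' hF.1) hd h0 h1 (by omega))
  push Not at hs'
  have key : ∀ i ∈ Finset.range n, (fun cs => F ((word s cs).modify i eulerIotaOp.map) -
      (n : ℝ)⁻¹ • mulXOp.app F ((word s cs).modify i iotaOp.map)) ∈ diffOps R n K := fun i hi => by
    have hi' : i < s.length := by rw [hs]; exact Finset.mem_range.1 hi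
    have hsi : s[i]? = some s[i] := List.getElem?_eq_getElem hi'
    by_cases h0 : s[i].1 = 0
    · refine nullOn_le _ _ (mem_nullOn.2 fun cs hcs _ => ?_)
      have hw : i < (word s cs).length := by rw [length_word (by omega)]; exact hi'
      have hz : ∀ θ : SlotOp (𝓥 := 𝓥) formGrading Proper,
          (∀ c, θ.toFun (formOf 0 c).val = 0) → ∀ {G : List (PureTensor 𝓥 formGrading) → R},
          G ∈ tensorCochains 𝓡 𝓥 formGrading Proper (p + 1) →
            G ((word s cs).modify i θ.map) = 0 := fun θ hθ G hG => by
        refine slot_zero (t := θ.map (word s cs)[i]) hG ?_ ?_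
        · rw [List.mem_iff_getElem]
          exact ⟨i, by simpa using hw, by simp⟩
        · simpa [SlotOp.map, mapLeft, word, h0] using hθ cs[i]
      rw [hz _ (fun c => TrivSqZeroExt.ext (by simp [eulerIotaOp_toFun, formOf_snd])
        (by simp [eulerIotaOp_toFun])) hF.1, hz _ (fun c => TrivSqZeroExt.ext
        (by simp [iotaOp_toFun, formOf_snd]) (by simp [iotaOp_toFun])) (mulXOp_mem hF.1), smul_zero,
        sub_zero]
    · have h1 : s[i].1 = 1 := hs' _ (List.getElem_mem hi') h0
      refine diffOps_congr (modify_mulX_sub_mem (Finset.mem_range.1 hi)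
        (hK (s.modify i fun t => (t.1 + -1, t.2)) (by simpa))) fun cs hcs hc => ?_
      rw [word_modify i hsi (e := -1) mulX (fun c => Prod.ext (Homog.ext' rfl
          (TrivSqZeroExt.ext (by simp [SlotOp.map, mapLeft, eulerIotaOp_toFun, formOf_fst,
            formOf_snd, h1]) (by simp [SlotOp.map, mapLeft, eulerIotaOp_toFun, formOf_snd, h1])))
          rfl) (by omega),
        word_modify i hsi (e := -1) id (fun c => Prod.ext (Homog.ext' rfl
          (TrivSqZeroExt.ext (by simp [SlotOp.map, mapLeft, iotaOp_toFun, formOf_fst,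
            formOf_snd, h1]) (by simp [SlotOp.map, mapLeft, iotaOp_toFun, formOf_snd, h1])))
          rfl) (by omega), List.modify_id, mulXOp_word (by simp; omega) hc]
      simp [hs]
  refine diffOps_congr (sum_mem fun i hi => units_smul_mem' ((-1 * ((s.take i).map fun t =>
    t.1 + t.2.deg).sum).negOnePow) (key i hi)) fun cs hcs hc => ?_
  rw [evalWord_apply, homotopyOp_apply, Pi.sub_apply, average, lengthScale_apply,
    length_word (by omega), hs, app_word _ (by omega) hc, app_word _ (by omega) hc,
    Finset.sum_apply, hs, Finset.smul_sum, ← Finset.sum_sub_distrib]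
  refine Finset.sum_congr rfl fun i _ => ?_
  rw [Pi.smul_apply, smul_sub, smul_comm (n : ℝ)⁻¹]
  rfl

variable (R 𝓥) in
/-- The projection to the functionals that depend on the one-forms through their sum only. -/
noncomputable def oneProj : Module.End ℝ (List (PureTensor 𝓥 formGrading) → R) :=
  average R 𝓥 ∘ₗ iotaOp.app ∘ₗ dxOp.app

variable (R 𝓥) in
/-- The scaling weight. -/
noncomputable def weightOp : Module.End ℝ (List (PureTensor 𝓥 formGrading) → R) :=
  eulerOp.app + 1

variable (R 𝓥) in
/-- The commutator of the exterior derivative and the homotopy operator. -/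
noncomputable def laplaceOp : Module.End ℝ (List (PureTensor 𝓥 formGrading) → R) :=
  extOp.app ∘ₗ homotopyOp R 𝓥 + homotopyOp R 𝓥 ∘ₗ extOp.app

theorem oneProj_apply : oneProj R 𝓥 F = average R 𝓥 (iotaOp.app (dxOp.app F)) := rfl

theorem weightOp_apply : weightOp R 𝓥 F = eulerOp.app F + F := rfl

theorem laplaceOp_apply : laplaceOp R 𝓥 F =
    extOp.app (homotopyOp R 𝓥 F) + homotopyOp R 𝓥 (extOp.app F) := rfl

theorem oneProj_mem (hF : F ∈ fieldCochains 𝓡 𝓥 p) : oneProj R 𝓥 F ∈ fieldCochains 𝓡 𝓥 p :=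
  ⟨average_mem (iotaOp_mem (dxOp_mem hF.1)), lengthScale_constLocal (fun n => (n : ℝ)⁻¹)
    (iotaOp_constLocal (dxOp_mem hF.1) (dxOp_constLocal hF.1 hF.2))⟩

theorem weightOp_mem' (hF : F ∈ tensorCochains 𝓡 𝓥 formGrading Proper p) :
    weightOp R 𝓥 F ∈ tensorCochains 𝓡 𝓥 formGrading Proper p := add_mem (eulerOp_mem hF) hF

theorem laplaceOp_mem' (hF : F ∈ tensorCochains 𝓡 𝓥 formGrading Proper (p + 1)) :
    laplaceOp R 𝓥 F ∈ tensorCochains 𝓡 𝓥 formGrading Proper (p + 1) :=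
  add_mem (extOp_mem (homotopyOp_mem' hF)) (homotopyOp_mem' (extOp_mem hF))

theorem laplaceOp_mem (hF : F ∈ fieldCochains 𝓡 𝓥 (p + 1)) :
    laplaceOp R 𝓥 F ∈ fieldCochains 𝓡 𝓥 (p + 1) := by
  have h1 := homotopyOp_mem hF
  exact add_mem ⟨extOp_mem h1.1, extOp_constLocal h1.1 h1.2⟩
    (homotopyOp_mem ⟨extOp_mem hF.1, extOp_constLocal hF.1 hF.2⟩)

/-- The Euler part gives the Lie derivative by Cartan's formula. In the mean part, `d/dx` kills `F`,
so commuting it past `x` leaves the number of fields, whose average is the summand `1` of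
`weightOp`; commuting `d` past `x` leaves `dx`, whose contraction averages to `oneProj`. -/
theorem laplaceOp_eq (hF : F ∈ fieldCochains 𝓡 𝓥 (p + 1)) :
    laplaceOp R 𝓥 F = weightOp R 𝓥 F - oneProj R 𝓥 F := by
  have hY := mulXOp_mem hF.1
  have h2 := ext_eulerIota hF.1
  have h3 := ext_iota hY
  have h4 := mulX_ext hF.1
  have h5 := mulX_lie hF.1
  rw [lieOp_eq_zero hF, map_zero, eq_comm, add_eq_zero_iff_eq_neg] at h5
  have h6 := average_idOp hF.1
  rw [laplaceOp_apply, homotopyOp_apply, homotopyOp_apply, map_sub, app_average, h2, h3, h4, h5,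
    map_add, map_add, map_add, map_neg, map_neg, h6, weightOp_apply, oneProj_apply]
  abel

theorem iota_iota_eq (hF : F ∈ tensorCochains 𝓡 𝓥 formGrading Proper p) :
    iotaOp.app (iotaOp.app F) = 0 := by
  have h := iota_iota hF
  rw [eq_neg_iff_add_eq_zero, ← two_smul ℝ] at h
  exact (smul_eq_zero.1 h).resolve_left two_ne_zero

/-- From `ι dx + dx ι = n` on functionals of `n` fields and `ι² = 0` it follows that `ι dx ι = n ι`.
-/
theorem oneProj_oneProj (hF : F ∈ tensorCochains 𝓡 𝓥 formGrading Proper p) :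
    oneProj R 𝓥 (oneProj R 𝓥 F) = oneProj R 𝓥 F := by
  have hd := dxOp_mem hF
  have h1 := iota_dx (iotaOp_mem hd)
  rw [iota_iota_eq hd, map_zero, neg_zero, zero_add] at h1
  rw [oneProj_apply, oneProj_apply, app_average, app_average, h1, average_idOp (iotaOp_mem hd)]

/-- Contraction and multiplication by `dx` shift the weight by one in opposite directions. -/
theorem weightOp_oneProj (hF : F ∈ tensorCochains 𝓡 𝓥 formGrading Proper p) :
    weightOp R 𝓥 (oneProj R 𝓥 F) = oneProj R 𝓥 (weightOp R 𝓥 F) := by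
  rw [oneProj_apply, oneProj_apply, weightOp_apply, weightOp_apply, app_average,
    euler_iota (dxOp_mem hF), map_add dxOp.app, dx_euler hF]
  simp only [map_add]

/-- Exterior multiplication lowers the weight by one. -/
theorem weightOp_dx (hF : F ∈ tensorCochains 𝓡 𝓥 formGrading Proper p) :
    weightOp R 𝓥 (dxOp.app F) = dxOp.app (weightOp R 𝓥 F - F) := by
  rw [weightOp_apply, weightOp_apply, add_sub_cancel_right, dx_euler hF]

end HomotopyOperator

attribute [local instance 10000] ringForms algebraForms moduleForms addCommGroupForms
  addCommMonoidForms commRingSmooth addCommGroupSmooth addZeroClassSmooth addMonoidSmooth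
  moduleSmooth moduleSmoothOp smulSmooth smulSmoothOp algebraSmooth smulRealSmooth

/-! ### Polynomials in operators -/

section Polynomials

open Polynomial

variable {M M' : Type*} [AddCommGroup M] [Module ℝ M] [AddCommGroup M'] [Module ℝ M']

theorem aeval_mem {A : Module.End ℝ M} {S : Submodule ℝ M} (hS : S ≤ S.comap A) (q : ℝ[X]) {x : M}
    (hx : x ∈ S) : aeval A q x ∈ S := by
  induction q using Polynomial.induction_on' with
  | add p q hp hq => simpa using add_mem hp hq
  | monomial k c =>
    induction k with
    | zero => simpa [Module.algebraMap_end_apply] using S.smul_mem c hx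
    | succ k ih =>
      have h1 : A _ ∈ S := hS ih
      rw [aeval_monomial] at h1 ⊢
      simpa only [pow_succ', Module.End.mul_apply, Module.algebraMap_end_apply, map_smul] using h1

/-- The operators are defined on all functions of words, but their relations hold only on cochains
and only modulo functionals vanishing on admissible arguments; hence the subspaces `S` and `N`. -/
theorem aeval_intertwine (ρ : M →ₗ[ℝ] M') {A : Module.End ℝ M} {A' : Module.End ℝ M'}
    {S : Submodule ℝ M} {N : Submodule ℝ M'} (hS : S ≤ S.comap A) (hN : N ≤ N.comap A')
    (h : ∀ x ∈ S, ρ (A x) - A' (ρ x) ∈ N) (q : ℝ[X]) {x : M} (hx : x ∈ S) :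
    ρ (aeval A q x) - aeval A' q (ρ x) ∈ N := by
  induction q using Polynomial.induction_on' with
  | add p q hp hq =>
    have := add_mem hp hq
    simp only [map_add, LinearMap.add_apply]
    convert this using 1
    abel
  | monomial k c =>
    induction k generalizing x with
    | zero => simp [Module.algebraMap_end_apply]
    | succ k ih =>
      have h1 := ih (hS hx)
      have h2 := aeval_mem hN (monomial k c) (h x hx)
      have := add_mem h1 h2
      simp only [aeval_monomial, pow_succ, Module.End.mul_apply, map_sub] at this ⊢
      simpa using this

theorem aeval_intertwine_eq (ρ : M →ₗ[ℝ] M') {A : Module.End ℝ M} {A' : Module.End ℝ M'}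
    {S : Submodule ℝ M} (hS : S ≤ S.comap A) (h : ∀ x ∈ S, ρ (A x) = A' (ρ x)) (q : ℝ[X]) {x : M}
    (hx : x ∈ S) : ρ (aeval A q x) = aeval A' q (ρ x) := by
  have := aeval_intertwine ρ (A := A) (A' := A') hS (N := ⊥) (by simp)
    (fun x hx => by simp [h x hx]) q hx
  simpa [sub_eq_zero] using this

theorem aeval_eigen {A : Module.End ℝ M} {μ : ℝ} {g : M} (hg : A g = μ • g) (q : ℝ[X]) :
    aeval A q g = q.eval μ • g := by
  have := aeval_sub_eval_smul_mem (A := A) (N := ⊥) (by simp) (by simpa [sub_eq_zero] using hg) q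
  simpa [sub_eq_zero] using this

theorem exists_eval_zero_eq_one (S : Finset ℝ) (h : (0 : ℝ) ∉ S) :
    ∃ q : ℝ[X], q.eval 0 = 1 ∧ ∀ a ∈ S, q.eval a = 0 := by
  refine ⟨C (∏ a ∈ S, (-a))⁻¹ * ∏ a ∈ S, (X - C a), ?_, fun a ha => ?_⟩
  · have : ∏ a ∈ S, (-a) ≠ 0 := Finset.prod_ne_zero_iff.2 fun a ha h0 => h (by
      rw [← neg_eq_zero.1 h0]
      exact ha)
    simp [eval_prod, inv_mul_cancel₀ this]
  · have h0 : ∏ b ∈ S, (X - C b : ℝ[X]).eval a = 0 := Finset.prod_eq_zero ha (by simp)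
    rw [eval_mul, eval_prod, h0, mul_zero]

end Polynomials

/-! ### The weight decomposition -/

section Weights

open Polynomial

set_option linter.unusedSectionVars false

variable {R : Type} [Ring R] [Algebra ℝ R] {𝓡 : ℤ → Submodule ℝ R} [GradedAlgebra 𝓡]
  {dR : R →ₗ[ℝ] R} {I : Ideal R}
  {V : Type} [AddCommGroup V] [Module ℝ V] [Module R V] {𝓥 : ℤ → Submodule ℝ V}
  [SetLike.GradedSMul 𝓡 𝓥] [IsScalarTower ℝ R V] {p : ℤ}
  {F : List (PureTensor 𝓥 formGrading) → R}

/-- The number of one-forms in a word. -/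
def oneCount (s : List (ℤ × Homog 𝓥)) : ℕ := (s.map fun d => d.1.toNat).sum

theorem oneCount_le {s : List (ℤ × Homog 𝓥)} (h : ∀ d ∈ s, d.1 = 0 ∨ d.1 = 1) :
    oneCount s ≤ s.length := by
  have := List.sum_le_card_nsmul (s.map fun d => d.1.toNat) 1 (by
    simp only [List.mem_map]
    rintro _ ⟨d, hd, rfl⟩
    have := h d hd
    omega)
  simpa [oneCount] using this

theorem eq_zero_of_oneCount {s : List (ℤ × Homog 𝓥)} (h : ∀ d ∈ s, d.1 = 0 ∨ d.1 = 1)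
    (h0 : oneCount s = 0) : ∀ d ∈ s, d.1 = 0 := fun d hd => by
  have := List.sum_eq_zero_iff.1 h0 _ (List.mem_map_of_mem hd)
  have := h d hd
  omega

theorem cf_formOf {d : ℤ} (hd : d = 0 ∨ d = 1) (c : Smooth) : cf (formOf d c) = c := by
  rcases hd with rfl | rfl <;> simp [cf, formOf_fst, formOf_snd]

/-- The Lie derivative of `g dx` along `x ∂/∂x` is `(x g' + g) dx`, so each one-form contributes one
more copy of `F`; `toNat` of the degree counts it. -/
theorem eval_modify_euler (hF : F ∈ tensorCochains 𝓡 𝓥 formGrading Proper p)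
    {s : List (ℤ × Homog 𝓥)} (hs : ∀ d ∈ s, d.1 = 0 ∨ d.1 = 1) {cs : List Smooth}
    (hl : cs.length = s.length) (hc : HasCompact cs) {i : ℕ} (hi : i < s.length) :
    F ((word s cs).modify i eulerOp.map) = F (word s (cs.modify i (mulX ∘ₗ Smooth.deriv))) +
      (((s.map fun d => d.1.toNat).getD i 0 : ℕ) : ℝ) • F (word s cs) := by
  have hd := hs _ (List.getElem_mem hi)
  have h1 := word_modify (cs := cs) i (List.getElem?_eq_getElem hi) (e := 0)
    (σ := fun t => (formOf t.1.deg ((mulX ∘ₗ Smooth.deriv) (cf t.1)), t.2))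
    (mulX ∘ₗ Smooth.deriv) (fun c => by simp [cf_formOf hd]) hl
  rw [show (fun t : ℤ × Homog 𝓥 => (t.1 + 0, t.2)) = id by funext t; simp, List.modify_id] at h1
  have hw : i < (word s cs).length := by rw [length_word hl]; exact hi
  have h2 : word s cs = (word s cs).modify i id := (List.modify_id _ _).symm
  have h3 := proper_word hl hc
  have h4 := proper_word (s := s) (cs := cs.modify i (mulX ∘ₗ Smooth.deriv)) (by simpa using hl)
    (hc.modify (fun _ h => mulX_mem_compact (deriv_mem_compact h)) i)
  have e1 : (word s cs)[i] = (formOf s[i].1 cs[i], s[i].2) := by simp [word]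
  have e2 : (((s.map fun d => d.1.toNat).getD i 0 : ℕ) : ℝ) = s[i].1.toNat := by
    rw [List.getD_eq_getElem _ _ (by simpa using hi), List.getElem_map]
  rw [List.modify_eq_take_cons_drop hw] at h1 h2
  rw [← h1] at h4
  rw [h2] at h3
  rw [e2, ← h1, show F (word s cs) = F _ from congrArg F h2, List.modify_eq_take_cons_drop hw]
  simp only [e1, id] at h3 h4 ⊢
  rw [cf_formOf hd] at h4 ⊢
  have := slot_lin tensorAdmissible_proper hF (x := formOf s[i].1 ((mulX ∘ₗ Smooth.deriv) cs[i]))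
    (y := formOf s[i].1 cs[i]) (z := (eulerOp.map (formOf s[i].1 cs[i], s[i].2)).1) (t := 1)
    (t' := s[i].1.toNat) h4 h3 (add_zero _) (add_zero _) ?_
  · rw [one_smul] at this
    exact this
  · change (eulerOp (𝓥 := 𝓥)).toFun _ = _
    rw [eulerOp_toFun]
    rcases hd with hd | hd
    · rw [hd]
      refine TrivSqZeroExt.ext ?_ ?_ <;> simp [formOf_fst, formOf_snd]
    · rw [hd]
      refine TrivSqZeroExt.ext ?_ ?_ <;> simp [formOf_fst, formOf_snd, deriv_mulX, add_comm]

variable (R) in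
/-- The action of the scaling weight on functionals of coefficients. -/
noncomputable def weightL (s : List (ℤ × Homog 𝓥)) : Module.End ℝ (List Smooth → R) :=
  eulerL R s.length + ((oneCount s : ℝ) + 1) • 1

theorem weightL_nullOn (s : List (ℤ × Homog 𝓥)) :
    nullOn R s.length ≤ (nullOn R s.length).comap (weightL R s) := fun _ hg =>
  Submodule.add_mem (nullOn R s.length) (eulerL_nullOn _ hg) (Submodule.smul_mem _ _ hg)

theorem evalWord_weightOp (hF : F ∈ tensorCochains 𝓡 𝓥 formGrading Proper p)
    {s : List (ℤ × Homog 𝓥)} (hs : ∀ d ∈ s, d.1 = 0 ∨ d.1 = 1) :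
    evalWord R s (weightOp R 𝓥 F) - weightL R s (evalWord R s F) ∈ nullOn R s.length := by
  refine mem_nullOn.2 fun cs hl hc => ?_
  rw [Pi.sub_apply, evalWord_apply, weightOp_apply, Pi.add_apply, app_word _ hl hc,
    Finset.sum_congr rfl fun i hi => by
      rw [eval_modify_euler hF hs hl hc (Finset.mem_range.1 hi),
        show (eulerOp (𝓥 := 𝓥)).e = 0 from rfl, zero_mul, Int.negOnePow_zero, one_smul],
    Finset.sum_add_distrib, ← Finset.sum_smul]
  have := sum_getD (s.map fun d => d.1.toNat)
  rw [List.length_map] at this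
  rw [this, weightL, LinearMap.add_apply, Pi.add_apply, eulerL_apply, LinearMap.smul_apply,
    Module.End.one_apply, Pi.smul_apply, oneCount, evalWord_apply, add_smul, one_smul]
  simp only [evalWord_apply]
  abel

theorem evalWord_aeval (hF : F ∈ tensorCochains 𝓡 𝓥 formGrading Proper p)
    {s : List (ℤ × Homog 𝓥)} (hs : ∀ d ∈ s, d.1 = 0 ∨ d.1 = 1) (q : ℝ[X]) :
    evalWord R s (aeval (weightOp R 𝓥) q F) - aeval (weightL R s) q (evalWord R s F) ∈
      nullOn R s.length :=
  aeval_intertwine (evalWord R s) (S := tensorCochains 𝓡 𝓥 formGrading Proper p)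
    (fun _ h => weightOp_mem' h) (weightL_nullOn s) (fun _ h => evalWord_weightOp h hs) q hF

/-- The eigenvalue `m.sum - 1` of the Euler operator, plus the number of one-forms, plus one. -/
theorem aeval_weightL_mono {s : List (ℤ × Homog 𝓥)} {m : List ℕ} (hm : m.length = s.length) (r : R)
    (q : ℝ[X]) : aeval (weightL R s) q (mono m r) -
      q.eval ((m.sum + oneCount s : ℕ) : ℝ) • mono m r ∈ nullOn R s.length := by
  refine aeval_sub_eval_smul_mem (weightL_nullOn s) ?_ q
  convert eulerL_mono hm r using 1
  rw [weightL, LinearMap.add_apply, LinearMap.smul_apply, Module.End.one_apply]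
  push_cast
  module

/-- On words of fixed length, the weights are natural numbers and bounded. -/
theorem exists_weight_bound (hF : F ∈ fieldCochains 𝓡 𝓥 p) (n : ℕ) : ∃ N : ℕ, ∀ q : ℝ[X],
    (∀ j : ℕ, j ≤ N → q.eval (j : ℝ) = 0) → ∀ l, l.length = n → aeval (weightOp R 𝓥) q F l = 0 := by
  obtain ⟨K, hK⟩ := hF.2 n
  refine ⟨K + n, fun q hq l hl => ?_⟩
  refine eq_zero_of_evalWord (aeval_mem (fun _ h => weightOp_mem' h) q hF.1)
    fun s cs hs hcs hc hd => ?_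
  have hsn : s.length = n := hs.trans hl
  have h1 : diffOps R s.length K ≤ (nullOn R s.length).comap (aeval (weightL R s) q) := by
    refine diffOps_le (fun m r hm hm' => ?_) fun g hg => aeval_mem (weightL_nullOn s) q hg
    have := aeval_weightL_mono hm r q
    have hle := oneCount_le hd
    rwa [hq _ (by omega), zero_smul, sub_zero] at this
  have h2 := add_mem (evalWord_aeval hF.1 hd q) (h1 (by rw [hsn]; exact hK s hsn))
  rw [sub_add_cancel] at h2
  exact mem_nullOn.1 h2 cs hcs hc

theorem dens_eq_prod {m : List ℕ} {cs : List Smooth} (hl : m.length = cs.length) (h0 : m.sum = 0) :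
    dens m cs = cs.prod := by
  induction m generalizing cs with
  | nil => rw [List.length_eq_zero_iff.1 hl.symm, dens_nil, List.prod_nil]
  | cons k m ih =>
    rcases cs with - | ⟨c, cs⟩
    · simp at hl
    · simp only [List.sum_cons, Nat.add_eq_zero_iff] at h0
      rw [dens_cons, h0.1, ih (by simpa using hl) h0.2, List.prod_cons]
      rfl

/-- Functionals of weight zero only depend on the integral of the product of the functions. -/
theorem eval_of_weight_zero (hF : F ∈ fieldCochains 𝓡 𝓥 p) (h0 : weightOp R 𝓥 F = 0)
    {s : List (ℤ × Homog 𝓥)} (hs : ∀ d ∈ s, d.1 = 0 ∨ d.1 = 1) :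
    ∃ r : R, (oneCount s ≠ 0 → r = 0) ∧ ∀ cs : List Smooth, cs.length = s.length →
      HasCompact cs → F (word s cs) = lineIntegral cs.prod • r := by
  obtain ⟨K, hK⟩ := hF.2 s.length
  -- The polynomial of the projection onto weight zero. It fixes `F` and kills every monomial that
  -- has a derivative or a one-form, so only the undifferentiated product survives.
  obtain ⟨q, hq0, hq⟩ := exists_eval_zero_eq_one
    ((Finset.Icc 1 (K + s.length)).image fun j : ℕ => (j : ℝ)) (by simp)
  have hq' : ∀ j : ℕ, j ≠ 0 → j ≤ K + s.length → q.eval (j : ℝ) = 0 := fun j h1 h2 =>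
    hq _ (Finset.mem_image_of_mem _ (Finset.mem_Icc.2 ⟨by omega, h2⟩))
  let P : Submodule ℝ (List Smooth → R) :=
    { carrier := {g | ∃ r : R, (oneCount s ≠ 0 → r = 0) ∧ ∀ cs : List Smooth,
        cs.length = s.length → HasCompact cs → g cs = lineIntegral cs.prod • r}
      zero_mem' := ⟨0, by simp, by simp⟩
      add_mem' := by
        rintro g g' ⟨r, h1, h2⟩ ⟨r', h1', h2'⟩
        refine ⟨r + r', fun h => by rw [h1 h, h1' h, add_zero], fun cs h3 h4 => ?_⟩
        rw [Pi.add_apply, h2 cs h3 h4, h2' cs h3 h4, smul_add]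
      smul_mem' := by
        rintro a g ⟨r, h1, h2⟩
        refine ⟨a • r, fun h => by rw [h1 h, smul_zero], fun cs h3 h4 => ?_⟩
        rw [Pi.smul_apply, h2 cs h3 h4, smul_comm] }
  have hnull : nullOn R s.length ≤ P := fun g hg =>
    ⟨0, fun _ => rfl, fun cs h1 h2 => by rw [mem_nullOn.1 hg cs h1 h2, smul_zero]⟩
  have h1 : diffOps R s.length K ≤ P.comap (aeval (weightL R s) q) := by
    refine diffOps_le (fun m r hm hm' => ?_) fun g hg =>
      hnull (aeval_mem (weightL_nullOn s) q hg)
    have h2 := hnull (aeval_weightL_mono hm r q)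
    have hle := oneCount_le hs
    suffices h3 : q.eval ((m.sum + oneCount s : ℕ) : ℝ) • mono m r ∈ P by
      have := add_mem h2 h3
      rwa [sub_add_cancel] at this
    by_cases hj : m.sum + oneCount s = 0
    · refine Submodule.smul_mem _ _ ⟨r, by omega, fun cs hcs _ => ?_⟩
      rw [mono, dens_eq_prod (by omega) (by omega)]
    · rw [hq' _ hj (by omega), zero_smul]
      exact zero_mem _
  have h2 : aeval (weightOp R 𝓥) q F = F := by
    rw [aeval_eigen (μ := 0) (by rw [h0, zero_smul]), hq0, one_smul]
  have h3 := add_mem (hnull (evalWord_aeval hF.1 hs q)) (h1 (hK s rfl))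
  rw [sub_add_cancel, h2] at h3
  exact h3

/-- On words of fixed length, the eigenvalues of the Laplacian are integers. -/
theorem exists_laplace_bound (hF : F ∈ fieldCochains 𝓡 𝓥 (p + 1)) (n : ℕ) : ∃ N : ℕ, ∀ q : ℝ[X],
    (∀ j : ℤ, -1 ≤ j → j ≤ N → q.eval (j : ℝ) = 0) → ∀ l, l.length = n →
      aeval (laplaceOp R 𝓥) q F l = 0 := by
  have hP := oneProj_mem hF
  obtain ⟨N₀, h0⟩ := exists_weight_bound (sub_mem hF hP) n
  obtain ⟨N₁, h1⟩ := exists_weight_bound hP n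
  refine ⟨N₀ + N₁, fun q hq l hl => ?_⟩
  let O : Submodule ℝ (List (PureTensor 𝓥 formGrading) → R) := fieldCochains 𝓡 𝓥 (p + 1)
  have hT : ∀ x ∈ O, laplaceOp R 𝓥 x = weightOp R 𝓥 x - oneProj R 𝓥 x := fun x hx => laplaceOp_eq hx
  have hPT : ∀ x ∈ O, oneProj R 𝓥 (laplaceOp R 𝓥 x) =
      weightOp R 𝓥 (oneProj R 𝓥 x) - oneProj R 𝓥 x := fun x hx => by
    rw [hT x hx, map_sub, oneProj_oneProj hx.1, weightOp_oneProj hx.1]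
  -- On the kernel of the projection `oneProj` the Laplacian is the weight; on its image, treated
  -- next, it is the weight minus one. This is the source of the bound `-1`.
  have e0 : aeval (laplaceOp R 𝓥) q (F - oneProj R 𝓥 F) =
      aeval (weightOp R 𝓥) q (F - oneProj R 𝓥 F) := by
    refine aeval_intertwine_eq LinearMap.id (S := O ⊓ LinearMap.ker (oneProj R 𝓥))
      (fun x hx => ⟨laplaceOp_mem hx.1, ?_⟩) (fun x hx => ?_) q ⟨sub_mem hF hP, ?_⟩
    · rw [SetLike.mem_coe, LinearMap.mem_ker, hPT x hx.1, LinearMap.mem_ker.1 hx.2, map_zero,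
        sub_zero]
    · rw [LinearMap.id_apply, LinearMap.id_apply, hT x hx.1, LinearMap.mem_ker.1 hx.2, sub_zero]
    · rw [SetLike.mem_coe, LinearMap.mem_ker, map_sub, oneProj_oneProj hF.1, sub_self]
  have e1 : aeval (laplaceOp R 𝓥) q (oneProj R 𝓥 F) =
      aeval (weightOp R 𝓥) (q.comp (X - 1)) (oneProj R 𝓥 F) := by
    rw [aeval_comp]
    refine aeval_intertwine_eq LinearMap.id (S := O ⊓ LinearMap.ker (oneProj R 𝓥 - 1))
      (fun x hx => ⟨laplaceOp_mem hx.1, ?_⟩) (fun x hx => ?_) q ⟨hP, ?_⟩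
    · have h2 : oneProj R 𝓥 x = x := by simpa [sub_eq_zero] using hx.2
      rw [SetLike.mem_coe, LinearMap.mem_ker, LinearMap.sub_apply, hPT x hx.1, h2, hT x hx.1, h2]
      exact sub_self _
    · have h2 : oneProj R 𝓥 x = x := by simpa [sub_eq_zero] using hx.2
      rw [LinearMap.id_apply, LinearMap.id_apply, hT x hx.1, h2]
      simp
    · rw [SetLike.mem_coe, LinearMap.mem_ker, LinearMap.sub_apply, oneProj_oneProj hF.1]
      exact sub_self _
  rw [show F = (F - oneProj R 𝓥 F) + oneProj R 𝓥 F by abel, map_add, e0, e1, Pi.add_apply,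
    h0 q (fun j hj => by
      have := hq j (by omega) (by push_cast; omega)
      simpa using this) l hl,
    h1 _ (fun j hj => by
      have := hq (j - 1) (by omega) (by push_cast; omega)
      simpa using this) l hl, add_zero]

end Weights

attribute [local instance 10000] ringForms algebraForms moduleForms addCommGroupForms
  addCommMonoidForms commRingSmooth addCommGroupSmooth addZeroClassSmooth addMonoidSmooth
  moduleSmooth moduleSmoothOp smulSmooth smulSmoothOp algebraSmooth smulRealSmooth


/-! ### The functionals `∫ a₁ ⋯ aₙ c(v₁, …, vₙ)` -/

section Pushforward

set_option linter.unusedSectionVars false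

variable {R : Type} [Ring R] [Algebra ℝ R] {𝓡 : ℤ → Submodule ℝ R} [GradedAlgebra 𝓡]
  {dR : R →ₗ[ℝ] R} {I : Ideal R}
  {V : Type} [AddCommGroup V] [Module ℝ V] [Module R V] {𝓥 : ℤ → Submodule ℝ V}
  {p : ℤ} {c : List (Homog 𝓥) → R}

/-- Integration of the function part of a form. -/
noncomputable def intFst : Forms →ₗ[ℝ] ℝ where
  toFun a := lineIntegral a.fst
  map_add' a b := by rw [TrivSqZeroExt.fst_add, map_add]
  map_smul' r a := by rw [TrivSqZeroExt.fst_smul, map_smul, RingHom.id_apply]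

/-- Integration of forms. -/
noncomputable def intSnd : Forms →ₗ[ℝ] ℝ where
  toFun a := lineIntegral a.snd
  map_add' a b := by rw [TrivSqZeroExt.snd_add, map_add]
  map_smul' r a := by rw [TrivSqZeroExt.snd_smul, map_smul, RingHom.id_apply]

theorem intFst_apply (a : Forms) : intFst a = lineIntegral a.fst := rfl

theorem intSnd_apply (a : Forms) : intSnd a = lineIntegral a.snd := rfl

theorem intFst_eq_zero (i : ℤ) (x : Forms) (h : x ∈ formGrading i) (hi : i ≠ 0) :
    intFst x = 0 := by rw [intFst_apply, h.1 hi, map_zero]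

theorem intSnd_eq_zero (i : ℤ) (x : Forms) (h : x ∈ formGrading i) (hi : i ≠ 1) :
    intSnd x = 0 := by rw [intSnd_apply, h.2 hi, map_zero]

theorem intFst_comp_iota : intFst ∘ₗ (iotaOp (𝓥 := 𝓥)).toFun = intSnd :=
  LinearMap.ext fun a => by
    simp [iotaOp_toFun, intFst_apply, intSnd_apply]

theorem intFst_comp_extD : intFst ∘ₗ extD = 0 :=
  LinearMap.ext fun a => by
    simp [intFst_apply, extD, -DualNumber.inr_eq_smul_eps]

/-- Integration over the line of `c` applied to fields with total form degree zero, `dx` being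
omitted. -/
noncomputable def zeroCochain (p : ℤ) (c : List (Homog 𝓥) → R) :
    List (PureTensor 𝓥 formGrading) → R := push Proper intFst p c

/-- Integration over the line of `c` applied to fields. -/
noncomputable def oneCochain (p : ℤ) (c : List (Homog 𝓥) → R) :
    List (PureTensor 𝓥 formGrading) → R := push Proper intSnd p c

theorem iota_push (φ : Forms →ₗ[ℝ] ℝ) : iotaOp.app (push Proper φ p c) =
    (-1 * p).negOnePow • push Proper (φ ∘ₗ (iotaOp (𝓥 := 𝓥)).toFun) p c :=
  SlotOp.app_push tensorAdmissible_proper iotaOp (fun i x y hx => by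
    change mkForm 0 LinearMap.id 0 0 _ = mkForm 0 LinearMap.id 0 0 _ * y +
      (-1 * i).negOnePow • (x * mkForm 0 LinearMap.id 0 0 y)
    by_cases hi : i = 0
    · subst hi
      refine TrivSqZeroExt.ext ?_ ?_
      · simp [hx.2, mul_comm, add_comm]
      · simp [hx.2]
    · by_cases hi' : i = 1
      · subst hi'
        refine TrivSqZeroExt.ext ?_ ?_
        · simp [hx.1, mul_comm]
        · simp [hx.1, mul_comm]
      · have : x = 0 := TrivSqZeroExt.ext (hx.1 hi) (hx.2 hi')
        subst this
        refine TrivSqZeroExt.ext ?_ ?_ <;> simp) φ p c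

theorem eulerIota_push (φ : Forms →ₗ[ℝ] ℝ) : eulerIotaOp.app (push Proper φ p c) =
    (-1 * p).negOnePow • push Proper (φ ∘ₗ (eulerIotaOp (𝓥 := 𝓥)).toFun) p c :=
  SlotOp.app_push tensorAdmissible_proper eulerIotaOp (fun i x y hx => by
    change mkForm 0 mulX 0 0 _ = mkForm 0 mulX 0 0 _ * y +
      (-1 * i).negOnePow • (x * mkForm 0 mulX 0 0 y)
    by_cases hi : i = 0
    · subst hi
      refine TrivSqZeroExt.ext ?_ ?_
      · simp [hx.2, mulX_apply, mul_left_comm]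
      · simp [hx.2]
    · by_cases hi' : i = 1
      · subst hi'
        refine TrivSqZeroExt.ext ?_ ?_
        · simp [hx.1, mulX_apply, mul_comm, mul_left_comm]
        · simp [hx.1, mulX_apply, mul_left_comm, mul_assoc]
      · have : x = 0 := TrivSqZeroExt.ext (hx.1 hi) (hx.2 hi')
        subst this
        refine TrivSqZeroExt.ext ?_ ?_ <;> simp) φ p c

theorem oneCochain_eq : oneCochain p c = (-1 * p).negOnePow • iotaOp.app (zeroCochain p c) := by
  rw [zeroCochain, iota_push, intFst_comp_iota, smul_smul, ← Int.negOnePow_add,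
    Int.negOnePow_even _ ⟨-1 * p, rfl⟩, one_smul]
  rfl

theorem prodVal_mulX (l₁ : List (PureTensor 𝓥 formGrading)) (t : PureTensor 𝓥 formGrading)
    (l₂ : List (PureTensor 𝓥 formGrading)) : prodVal (l₁ ++ mulXOp.map t :: l₂) =
      (mulXOp (𝓥 := 𝓥)).toFun (prodVal (l₁ ++ t :: l₂)) := by
  induction l₁ with
  | nil =>
    rw [List.nil_append, List.nil_append, prodVal_cons, prodVal_cons]
    change mkForm mulX 0 0 mulX _ * _ = mkForm mulX 0 0 mulX _
    refine TrivSqZeroExt.ext ?_ ?_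
    · simp [mulX_apply, mul_assoc]
    · simp [mulX_apply]
      ring
  | cons a l ih =>
    rw [List.cons_append, List.cons_append, prodVal_cons, prodVal_cons, ih]
    change _ * mkForm mulX 0 0 mulX _ = mkForm mulX 0 0 mulX _
    refine TrivSqZeroExt.ext ?_ ?_
    · simp [mulX_apply, mul_left_comm]
    · simp [mulX_apply]
      ring

theorem koszulExp_mulX (e : ℤ) (l₁ : List (PureTensor 𝓥 formGrading))
    (t : PureTensor 𝓥 formGrading) (l₂ : List (PureTensor 𝓥 formGrading)) :
    koszulExp e (l₁ ++ mulXOp.map t :: l₂) = koszulExp e (l₁ ++ t :: l₂) := by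
  induction l₁ generalizing e with
  | nil =>
    change (t.1.deg + 0) * e + _ = t.1.deg * e + _
    rw [add_zero]
    rfl
  | cons a l ih => simp only [List.cons_append, koszulExp, ih]

/-- A factor `x` in any slot multiplies the product of the forms in the same way, so all slots
contribute equally. -/
theorem mulX_push (φ : Forms →ₗ[ℝ] ℝ) : mulXOp.app (push Proper φ p c) =
    lengthScale (fun n => (n : ℝ)) (push Proper (φ ∘ₗ (mulXOp (𝓥 := 𝓥)).toFun) p c) := by
  funext l
  by_cases hl : Proper l
  · rw [SlotOp.app_of_adm _ _ hl, lengthScale_apply]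
    refine (slotSum_rel (τ := id) (G := push Proper (φ ∘ₗ (mulXOp (𝓥 := 𝓥)).toFun) p c)
      (AddMonoidHom.id R) fun l₁ t l₂ h => ?_).trans ?_
    · subst h
      rw [push_of_adm _ _ _ (SlotOp.adm' tensorAdmissible_proper mulXOp hl), id, push_of_adm _ _ _ hl,
        AddMonoidHom.id_apply, prodVal_mulX, koszulExp_mulX]
      simp only [List.map_append, List.map_cons]
      rfl
    · rw [AddMonoidHom.id_apply]
      refine (slotSum_id _ _).trans ?_
      rw [Int.cast_smul_eq_zsmul ℝ (l.length : ℤ) _ |>.symm, Int.cast_natCast]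
  · rw [SlotOp.app_of_not _ _ hl, lengthScale_apply, push_of_not _ _ _ hl, smul_zero]

variable [SetLike.GradedSMul 𝓡 𝓥] [IsScalarTower ℝ R V]

/-- The functional sees only the product of its fields, for which the position of each field and the
mean position act alike. Hence the homotopy annihilates the image of the comparison maps. -/
theorem homotopyOp_push (φ : Forms →ₗ[ℝ] ℝ) :
    homotopyOp R 𝓥 (push Proper φ p c) = 0 := by
  rw [homotopyOp_apply, eulerIota_push, mulX_push, SlotOp.app_lengthScale, iota_push,
    sub_eq_zero, show (φ ∘ₗ (mulXOp (𝓥 := 𝓥)).toFun) ∘ₗ (iotaOp (𝓥 := 𝓥)).toFun =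
      φ ∘ₗ (eulerIotaOp (𝓥 := 𝓥)).toFun from LinearMap.ext fun a => congrArg φ
        (TrivSqZeroExt.ext (by simp [eulerIotaOp_toFun, mulXOp_toFun, iotaOp_toFun])
          (by simp [eulerIotaOp_toFun, mulXOp_toFun, iotaOp_toFun]))]
  funext l
  rw [average, lengthScale_apply, lengthScale_apply, smul_smul]
  rcases l with - | ⟨t, l⟩
  · rw [Pi.smul_apply, push_of_not _ _ _ (by simp [Proper]), smul_zero, smul_zero]
  · rw [inv_mul_cancel₀ (by simp; positivity), one_smul]

open Classical in
theorem zeroCochain_mem (hc : c ∈ reducedCochains 𝓡 𝓥 p) :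
    zeroCochain p c ∈ fieldCochains 𝓡 𝓥 p := by
  refine ⟨?_, fun n => ⟨0, fun s hs => ?_⟩⟩
  · have := push_mem tensorAdmissible_proper intFst_eq_zero hc
    rwa [sub_zero] at this
  · refine diffOps_congr (mono_mem (m := List.replicate n 0) (by simp) (by simp)
      (if ∀ cs : List Smooth, cs.length = s.length → prodVal (word s cs) =
        (formOf (s.map Prod.fst).sum cs.prod).val then (koszulExp p (s.map fun t =>
          ((formOf t.1 0, t.2) : PureTensor 𝓥 formGrading))).negOnePow •
            (if (s.map Prod.fst).sum = 0 then c (s.map Prod.snd) else 0) else 0))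
      fun cs hcs hc => ?_
    have hl : cs.length = s.length := by omega
    rw [evalWord_apply, zeroCochain, push_of_adm _ _ _ (proper_word hl hc), koszulExp_word p hl, mono,
      dens_eq_prod (by simp [hcs]) (by simp), word_map (g := Prod.snd) (fun _ _ => rfl) hl]
    split_ifs with h h0
    · rw [h cs hl, intFst_apply, formOf_fst, if_pos h0, smul_comm]
    · rw [h cs hl, intFst_apply, formOf_fst, if_neg h0, map_zero, zero_smul, smul_zero, smul_zero]
    · rw [(prodVal_word s).resolve_left h cs hl, map_zero, zero_smul, smul_zero, smul_zero]

theorem oneCochain_mem (hc : c ∈ reducedCochains 𝓡 𝓥 (p + 1)) :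
    oneCochain (p + 1) c ∈ fieldCochains 𝓡 𝓥 p := by
  have h := zeroCochain_mem hc
  rw [oneCochain_eq]
  exact units_smul_mem' _ ⟨iotaOp_mem h.1, iotaOp_constLocal h.1 h.2⟩

theorem ceDiff_zeroCochain (𝔤 : CurvedLInfty 𝓡 dR I 𝓥) (hc : c ∈ reducedCochains 𝓡 𝓥 p) :
    (obstructionDeformation 𝔤).D p (zeroCochain p c) =
      zeroCochain (p + 1) ((reducedCE 𝔤).D p c) := by
  have := ceDiff_push tensorAdmissible_proper 𝔤 intFst_eq_zero (by simp [Proper]) hc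
  rw [sub_zero, Int.negOnePow_zero, one_smul, intFst_comp_extD] at this
  refine this.trans ?_
  rw [show push Proper 0 p c = 0 by funext l; simp [push], sub_zero]
  rfl

/-- Stokes' theorem: the product has compact support because one factor does. -/
theorem intSnd_extD_prodVal {l : List (PureTensor 𝓥 formGrading)} (hl : Proper l) :
    intSnd (extD (prodVal l)) = 0 := by
  obtain ⟨t, ht, h⟩ := hl
  rw [intSnd_apply, extD]
  simp only [LinearMap.coe_mk, AddHom.coe_mk, TrivSqZeroExt.snd_inr]
  exact lineIntegral_deriv (hasCompactSupport_of_cf h fun x hx => (prod_apply_eq_zero ht hx).1)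

theorem ceDiff_oneCochain (𝔤 : CurvedLInfty 𝓡 dR I 𝓥) (hc : c ∈ reducedCochains 𝓡 𝓥 (p + 1)) :
    (obstructionDeformation 𝔤).D p (oneCochain (p + 1) c) =
      -oneCochain (p + 1 + 1) ((reducedCE 𝔤).D (p + 1) c) := by
  have := ceDiff_push tensorAdmissible_proper 𝔤 intSnd_eq_zero (by simp [Proper]) hc
  rw [add_sub_cancel_right, Int.negOnePow_one, Units.neg_smul, one_smul] at this
  refine this.trans (congrArg Neg.neg ?_)
  rw [show push Proper (intSnd ∘ₗ extD) (p + 1) c = 0 from ?_, sub_zero]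
  · rfl
  · funext l
    by_cases hl : Proper l
    · rw [push_of_adm _ _ _ hl, LinearMap.comp_apply, intSnd_extD_prodVal hl, zero_smul, smul_zero]
      rfl
    · exact push_of_not _ _ _ hl

end Pushforward

attribute [local instance 10000] ringForms algebraForms moduleForms addCommGroupForms
  addCommMonoidForms commRingSmooth addCommGroupSmooth addZeroClassSmooth addMonoidSmooth
  moduleSmooth moduleSmoothOp smulSmooth smulSmoothOp algebraSmooth smulRealSmooth


/-! ### Functionals annihilated by the Laplacian -/

section Harmonic

set_option linter.unusedSectionVars false

variable {R : Type} [Ring R] [Algebra ℝ R] {𝓡 : ℤ → Submodule ℝ R} [GradedAlgebra 𝓡]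
  {dR : R →ₗ[ℝ] R} {I : Ideal R}
  {V : Type} [AddCommGroup V] [Module ℝ V] [Module R V] {𝓥 : ℤ → Submodule ℝ V}
  {p : ℤ} {c : List (Homog 𝓥) → R}

theorem exists_bump : ∃ ρ ∈ compactSmooth, lineIntegral ρ = 1 := by
  let f : ContDiffBump (0 : ℝ) := default
  let ρ : Smooth := ⟨f.normed MeasureTheory.volume, f.contDiff_normed⟩
  have hρ : ρ ∈ compactSmooth := f.hasCompactSupport_normed
  exact ⟨ρ, hρ, (lineIntegral_of_compact hρ).trans f.integral_normed⟩

/-- A smooth function with compact support and integral one. -/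
noncomputable def bump : Smooth := exists_bump.choose

theorem bump_mem : bump ∈ compactSmooth := exists_bump.choose_spec.1

theorem lineIntegral_bump : lineIntegral bump = 1 := exists_bump.choose_spec.2

/-- `n` functions whose product is the bump function. -/
noncomputable def bumps : ℕ → List Smooth
  | 0 => []
  | n + 1 => bump :: List.replicate n 1

theorem length_bumps (n : ℕ) : (bumps n).length = n := by
  cases n <;> simp [bumps]

theorem hasCompact_bumps (n : ℕ) : HasCompact (bumps (n + 1)) :=
  ⟨bump, by simp [bumps], bump_mem⟩

theorem lineIntegral_prod_bumps (n : ℕ) : lineIntegral (bumps (n + 1)).prod = 1 := by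
  simp [bumps, lineIntegral_bump]

/-- The elements `v₁, …, vₙ` as entries of form degree zero. -/
def zeroWord (l : List (Homog 𝓥)) : List (ℤ × Homog 𝓥) := l.map fun v => (0, v)

theorem length_zeroWord (l : List (Homog 𝓥)) : (zeroWord l).length = l.length := by simp [zeroWord]

theorem zeroWord_deg (l : List (Homog 𝓥)) : ∀ d ∈ zeroWord l, d.1 = 0 := by
  simp [zeroWord]

theorem prodVal_zeroWord {l : List (Homog 𝓥)} {cs : List Smooth} (h : cs.length = l.length) :
    (prodVal (word (zeroWord l) cs)).fst = cs.prod := by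
  induction l generalizing cs with
  | nil =>
    rw [List.length_eq_zero_iff.1 h]
    rfl
  | cons v l ih =>
    rcases cs with - | ⟨b, cs⟩
    · simp at h
    · rw [List.prod_cons, ← ih (cs := cs) (by simpa using h)]
      change (prodVal ((formOf 0 b, v) :: word (zeroWord l) cs)).fst = _
      rw [prodVal_cons, TrivSqZeroExt.fst_mul, formOf_fst, if_pos rfl]

theorem koszulExp_zeroWord (e : ℤ) (l : List (Homog 𝓥)) (cs : List Smooth) :
    koszulExp e (word (zeroWord l) cs) = 0 := by
  induction l generalizing cs e with
  | nil => rfl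
  | cons v l ih =>
    rcases cs with - | ⟨b, cs⟩
    · rfl
    · change 0 * e + koszulExp (e + v.deg) (word (zeroWord l) cs) = 0
      rw [ih, zero_mul, add_zero]

theorem zeroCochain_zeroWord {l : List (Homog 𝓥)} {cs : List Smooth} (h : cs.length = l.length)
    (hc : HasCompact cs) : zeroCochain p c (word (zeroWord l) cs) =
      lineIntegral cs.prod • c l := by
  rw [zeroCochain, push_of_adm _ _ _ (proper_word (by rwa [length_zeroWord]) hc),
    koszulExp_zeroWord, Int.negOnePow_zero, one_smul, intFst_apply, prodVal_zeroWord h,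
    word_map (g := Prod.snd) (fun _ _ => rfl) (by rwa [length_zeroWord])]
  simp [zeroWord]

/-- The restriction of a functional to constant fields, with one of them cut off. -/
noncomputable def cutOff (F : List (PureTensor 𝓥 formGrading) → R) (l : List (Homog 𝓥)) : R :=
  F (word (zeroWord l) (bumps l.length))

variable [SetLike.GradedSMul 𝓡 𝓥] [IsScalarTower ℝ R V]
  {F : List (PureTensor 𝓥 formGrading) → R}

/-- In weight zero, `F` depends on the functions through the integral of their product alone. The
cut-off functions have product `bump` of integral one, so the coefficient is `cutOff F`. -/
theorem eval_zeroWord (hF : F ∈ fieldCochains 𝓡 𝓥 p) (h0 : weightOp R 𝓥 F = 0)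
    {l : List (Homog 𝓥)} {cs : List Smooth} (hl : cs.length = l.length) (hc : HasCompact cs) :
    F (word (zeroWord l) cs) = lineIntegral cs.prod • cutOff F l := by
  obtain ⟨r, -, hr⟩ := eval_of_weight_zero hF h0 (s := zeroWord l)
    fun d hd => Or.inl (zeroWord_deg l d hd)
  rcases l with - | ⟨v, l⟩
  · obtain ⟨b, hb, -⟩ := hc
    rw [List.length_eq_zero_iff.1 hl] at hb
    simp at hb
  · rw [hr cs (by rwa [length_zeroWord]) hc, cutOff, hr (bumps (v :: l).length)
      (by rw [length_zeroWord, length_bumps]) (hasCompact_bumps _), List.length_cons, lineIntegral_prod_bumps, one_smul]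

theorem cutOff_mem (hF : F ∈ fieldCochains 𝓡 𝓥 p) (h0 : weightOp R 𝓥 F = 0) :
    cutOff F ∈ reducedCochains 𝓡 𝓥 p := by
  have hF' : IsTensorCochain 𝓡 𝓥 formGrading Proper p F := hF.1
  refine (⟨hF'.zero _ (by simp [zeroWord, word, Proper]), fun l => ?_,
    fun x y z l h1 h2 h3 => hF'.add_right _ _ _ _ _ h1 h2 h3, fun a r hr x z l h1 h2 => ?_,
    fun x y l₁ l₂ => ?_⟩ : IsReducedCochain 𝓡 𝓥 p (cutOff F))
  · have := hF'.mem (word (zeroWord l) (bumps l.length))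
    rw [word_map (f := tdeg) (g := fun t => t.1 + t.2.deg) (fun _ _ => rfl)
      (by rw [length_zeroWord, length_bumps])] at this
    rw [zeroWord, List.map_map, show (fun t : ℤ × Homog 𝓥 => t.1 + t.2.deg) ∘ (fun v => (0, v)) =
      Homog.deg by funext v; simp] at this
    exact this
  · have := hF'.smul_right a r hr (formOf 0 bump) x z (word (zeroWord l) (List.replicate l.length 1))
      h1 h2
    rw [show p + (formOf 0 bump).deg = p from add_zero p] at this
    exact this
  -- Exchanging two fields also exchanges their coefficients, which are not all equal. Since only
  -- the product of the coefficients matters in weight zero, they can be put back in order.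
  · obtain ⟨cs, b, b', cs', hcs, h⟩ : ∃ (cs : List Smooth) (b b' : Smooth) (cs' : List Smooth),
        bumps (l₁ ++ x :: y :: l₂).length = cs ++ b :: b' :: cs' ∧ cs.length = l₁.length := by
      have hn := length_bumps (l₁ ++ x :: y :: l₂).length
      generalize bumps (l₁ ++ x :: y :: l₂).length = bs at hn
      simp only [List.length_append, List.length_cons] at hn
      refine ⟨bs.take l₁.length, bs[l₁.length], bs[l₁.length + 1], bs.drop (l₁.length + 2), ?_,
        by simp; omega⟩
      rw [List.getElem_cons_drop, List.getElem_cons_drop, List.take_append_drop]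
    have hsplit : ∀ (x y : Homog 𝓥) (b b' : Smooth),
        word (zeroWord (l₁ ++ x :: y :: l₂)) (cs ++ b :: b' :: cs') = word (zeroWord l₁) cs ++
          (formOf 0 b, x) :: (formOf 0 b', y) :: word (zeroWord l₂) cs' := fun x y b b' => by
      rw [word, zeroWord, List.map_append, List.zipWith_append (by simp [h])]
      rfl
    have hlen := congrArg List.length hcs
    rw [length_bumps] at hlen
    have hc : HasCompact (cs ++ b :: b' :: cs') := by
      rw [← hcs]
      have : (l₁ ++ x :: y :: l₂).length = (l₁ ++ y :: l₂).length + 1 := by simp; omega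
      rw [this]
      exact hasCompact_bumps _
    have hc' : HasCompact (cs ++ b' :: b :: cs') := by
      obtain ⟨d, hd, hd'⟩ := hc
      exact ⟨d, by simp at hd ⊢; tauto, hd'⟩
    have e1 : cutOff F (l₁ ++ x :: y :: l₂) = F (word (zeroWord (l₁ ++ x :: y :: l₂))
      (cs ++ b :: b' :: cs')) := by rw [cutOff, hcs]
    have e2 : cutOff F (l₁ ++ y :: x :: l₂) = F (word (zeroWord (l₁ ++ y :: x :: l₂))
        (cs ++ b' :: b :: cs')) := by
      rw [eval_zeroWord hF h0 (by simpa using hlen.symm) hc',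
        show (cs ++ b' :: b :: cs').prod = (bumps (l₁ ++ y :: x :: l₂).length).prod by
          rw [show (l₁ ++ y :: x :: l₂).length = (l₁ ++ x :: y :: l₂).length by simp, hcs]
          simp only [List.prod_append, List.prod_cons]
          ring]
      rw [show (l₁ ++ y :: x :: l₂).length = (l₁ ++ x :: l₂).length + 1 by simp; omega,
        lineIntegral_prod_bumps, one_smul]
    rw [e1, e2, hsplit, hsplit, hF'.swap]
    congr 2
    simp [tdeg, formOf]

/-- Both sides have weight-zero form: on words of functions they agree by `eval_zeroWord`, and on
words containing a one-form both vanish. -/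
theorem zeroCochain_cutOff (hF : F ∈ fieldCochains 𝓡 𝓥 p) (h0 : weightOp R 𝓥 F = 0) :
    zeroCochain p (cutOff F) = F := by
  have hm := zeroCochain_mem (cutOff_mem hF h0)
  rw [← sub_eq_zero]
  funext l
  refine eq_zero_of_evalWord (sub_mem hm.1 hF.1) fun s cs hs hcs hc hd => ?_
  rw [Pi.sub_apply, sub_eq_zero]
  by_cases h : oneCount s = 0
  · obtain ⟨v, rfl⟩ : ∃ v, s = zeroWord v := ⟨s.map Prod.snd, by
      rw [zeroWord, List.map_map]
      refine (List.map_id s).symm.trans (List.map_congr_left fun d hd' => Prod.ext ?_ rfl)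
      exact eq_zero_of_oneCount hd h d hd'⟩
    rw [length_zeroWord] at hcs
    rw [eval_zeroWord hF h0 hcs hc, zeroCochain_zeroWord hcs hc]
  · obtain ⟨r, hr, hr'⟩ := eval_of_weight_zero hF h0 hd
    rw [hr' cs hcs hc, hr h, smul_zero, zeroCochain, push_of_adm _ _ _ (proper_word hcs hc),
      intFst_eq_zero _ _ (prodVal_mem isCDGA_forms _), zero_smul, smul_zero]
    intro h1
    refine h ?_
    rw [adeg, wdeg, word_map (g := Prod.fst) (fun _ _ => rfl) hcs] at h1
    rw [oneCount, ← Nat.cast_inj (R := ℤ), Nat.cast_list_sum, List.map_map, Nat.cast_zero, ← h1]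
    refine congrArg List.sum (List.map_congr_left fun d hd' => ?_)
    rcases hd d hd' with h | h <;> simp [h]

theorem lengthScale_reducedCochains (f : ℕ → ℝ) (hc : c ∈ reducedCochains 𝓡 𝓥 p) :
    lengthScale f c ∈ reducedCochains 𝓡 𝓥 p :=
  assemble_reducedCochains (fun n => f n • c) fun _ => Submodule.smul_mem _ _ hc

theorem push_lengthScale (φ : Forms →ₗ[ℝ] ℝ) (f : ℕ → ℝ) :
    push Proper φ p (lengthScale f c) = lengthScale f (push Proper φ p c) := by
  funext l
  by_cases hl : Proper l
  · rw [push_of_adm _ _ _ hl, lengthScale_apply, lengthScale_apply, push_of_adm _ _ _ hl,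
      List.length_map, smul_comm (f _), smul_comm (f _)]
  · rw [lengthScale_apply, push_of_not _ _ _ hl, push_of_not _ _ _ hl, smul_zero]

theorem push_units_smul (φ : Forms →ₗ[ℝ] ℝ) (u : ℤˣ) :
    push Proper φ p (u • c) = u • push Proper φ p c := by
  rcases Int.units_eq_one_or u with rfl | rfl
  · simp
  · rw [Units.neg_smul, one_smul, Units.neg_smul, one_smul, ← neg_one_smul ℝ, push_smul, neg_one_smul]

/-- Multiplication by `dx` lowers the weight to zero, where `zeroCochain_cutOff` applies. As `F` is
the average of `ι dx F`, contracting and dividing by the number of fields gives `F` back as an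
integral of one-forms. -/
theorem exists_oneCochain (hF : F ∈ fieldCochains 𝓡 𝓥 p) (h1 : weightOp R 𝓥 F = F)
    (h2 : oneProj R 𝓥 F = F) : ∃ c ∈ reducedCochains 𝓡 𝓥 (p + 1), oneCochain (p + 1) c = F := by
  have hu : dxOp.app F ∈ fieldCochains 𝓡 𝓥 (p + 1) := ⟨dxOp_mem hF.1, dxOp_constLocal hF.1 hF.2⟩
  have hw : weightOp R 𝓥 (dxOp.app F) = 0 := by rw [weightOp_dx hF.1, h1, sub_self, map_zero]
  refine ⟨(-1 * (p + 1)).negOnePow • lengthScale (fun n => (n : ℝ)⁻¹) (cutOff (dxOp.app F)),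
    units_smul_mem' _ (lengthScale_reducedCochains _ (cutOff_mem hu hw)), ?_⟩
  rw [oneCochain, push_units_smul, push_lengthScale, ← intFst_comp_iota (𝓥 := 𝓥)]
  have h3 : iotaOp.app (zeroCochain (p + 1) (cutOff (dxOp.app F))) = iotaOp.app (dxOp.app F) := by
    rw [zeroCochain_cutOff hu hw]
  rw [zeroCochain, iota_push] at h3
  conv_rhs => rw [← h2, oneProj_apply, ← h3]
  rw [average, map_units_smul']

/-- The functionals annihilated by the Laplacian are integrals of cochains of `𝔤`. -/
theorem exists_of_laplaceOp_eq_zero (hF : F ∈ fieldCochains 𝓡 𝓥 p) (h0 : laplaceOp R 𝓥 F = 0) :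
    ∃ c ∈ reducedCochains 𝓡 𝓥 p, ∃ c' ∈ reducedCochains 𝓡 𝓥 (p + 1),
      zeroCochain p c + oneCochain (p + 1) c' = F := by
  obtain ⟨q, rfl⟩ : ∃ q, p = q + 1 := ⟨p - 1, by ring⟩
  have hP := oneProj_mem hF
  have hw := (laplaceOp_eq hF).symm.trans h0
  rw [sub_eq_zero] at hw
  have h1 : weightOp R 𝓥 (oneProj R 𝓥 F) = oneProj R 𝓥 F := by
    rw [weightOp_oneProj hF.1, hw, oneProj_oneProj hF.1]
  obtain ⟨c', hc', h⟩ := exists_oneCochain hP h1 (oneProj_oneProj hF.1)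
  have h2 : weightOp R 𝓥 (F - oneProj R 𝓥 F) = 0 := by rw [map_sub, hw, h1, sub_self]
  exact ⟨_, cutOff_mem (sub_mem hF hP) h2, c', hc', by
    rw [zeroCochain_cutOff (sub_mem hF hP) h2, h, sub_add_cancel]⟩

end Harmonic

attribute [local instance 10000] ringForms algebraForms moduleForms addCommGroupForms
  addCommMonoidForms commRingSmooth addCommGroupSmooth addZeroClassSmooth addMonoidSmooth
  moduleSmooth moduleSmoothOp smulSmooth smulSmoothOp algebraSmooth smulRealSmooth


/-! ### Operators that preserve the length of words -/

section LengthPreserving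

variable {R : Type} [Ring R] [Algebra ℝ R] {H : Type*}

variable (R H) in
/-- The operators that act on each component separately. -/
def lengthPreserving : Subalgebra ℝ (Module.End ℝ (List H → R)) :=
  Subalgebra.centralizer ℝ (Set.range lengthScale)

theorem mem_lengthPreserving {A : Module.End ℝ (List H → R)} :
    A ∈ lengthPreserving R H ↔ ∀ f F, A (lengthScale f F) = lengthScale f (A F) := by
  rw [lengthPreserving, Subalgebra.mem_centralizer_iff]
  constructor
  · intro h f F
    exact (LinearMap.congr_fun (h _ ⟨f, rfl⟩) F).symm
  · rintro h _ ⟨f, rfl⟩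
    exact LinearMap.ext fun F => (h f F).symm

/-- Rescaling by the indicator function of the length `n` isolates one component. This permits a
polynomial in the Laplacian that depends on the length. -/
theorem congr_of_lengthPreserving {A : Module.End ℝ (List H → R)} (hA : A ∈ lengthPreserving R H)
    {F G : List H → R} {n : ℕ} (h : ∀ l, l.length = n → F l = G l) {l : List H}
    (hl : l.length = n) : A F l = A G l := by
  have e : lengthScale (fun k => if k = n then 1 else 0) F =
      lengthScale (fun k => if k = n then 1 else 0) G := by
    funext l'
    rw [lengthScale_apply, lengthScale_apply]
    split_ifs with h'
    · rw [h l' h']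
    · rw [zero_smul, zero_smul]
  have e' := congrFun (congrArg A e) l
  rw [mem_lengthPreserving.1 hA, mem_lengthPreserving.1 hA, lengthScale_apply, lengthScale_apply,
    if_pos hl, one_smul, one_smul] at e'
  exact e'

/-- The operator that acts on words of length `n` by `A n`. -/
def assembleL (A : ℕ → Module.End ℝ (List H → R)) : Module.End ℝ (List H → R) where
  toFun F := assemble fun n => A n F
  map_add' F G := by funext l; simp [assemble]
  map_smul' c F := by funext l; simp [assemble]

/-- The functions of given order, as a subspace. -/
def orderSubmodule (I : Ideal R) (m : ℕ) : Submodule ℝ (List H → R) where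
  carrier := {F | IsOrder I m F}
  zero_mem' _ := zero_mem _
  add_mem' hF hG l := add_mem (hF l) (hG l)
  smul_mem' c _ hF l := Submodule.smul_mem _ c (hF l)

end LengthPreserving

/-! ### The reduction step -/

section FieldStep

open Polynomial

set_option linter.unusedSectionVars false

variable {R : Type} [Ring R] [Algebra ℝ R] {𝓡 : ℤ → Submodule ℝ R} [GradedAlgebra 𝓡]
  {dR : R →ₗ[ℝ] R} {I : Ideal R}
  {V : Type} [AddCommGroup V] [Module ℝ V] [Module R V] {𝓥 : ℤ → Submodule ℝ V}
  [SetLike.GradedSMul 𝓡 𝓥] [IsScalarTower ℝ R V] {p : ℤ}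
  {F : List (PureTensor 𝓥 formGrading) → R}

theorem app_lengthPreserving (θ : SlotOp (𝓥 := 𝓥) formGrading Proper) :
    (θ.app : Module.End ℝ (List (PureTensor 𝓥 formGrading) → R)) ∈ lengthPreserving R _ :=
  mem_lengthPreserving.2 θ.app_lengthScale

theorem average_lengthPreserving : average R 𝓥 ∈ lengthPreserving R _ :=
  mem_lengthPreserving.2 fun f F => by
    funext l
    rw [average, lengthScale_apply, lengthScale_apply, lengthScale_apply, lengthScale_apply,
      smul_comm]

theorem homotopyOp_lengthPreserving : homotopyOp R 𝓥 ∈ lengthPreserving R _ :=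
  sub_mem (app_lengthPreserving _) (mul_mem average_lengthPreserving
    (mul_mem (app_lengthPreserving _) (app_lengthPreserving _)))

theorem laplaceOp_lengthPreserving : laplaceOp R 𝓥 ∈ lengthPreserving R _ :=
  add_mem (mul_mem (app_lengthPreserving _) homotopyOp_lengthPreserving)
    (mul_mem homotopyOp_lengthPreserving (app_lengthPreserving _))

theorem ext_ext (hF : F ∈ tensorCochains 𝓡 𝓥 formGrading Proper p) :
    extOp.app (extOp.app F) = 0 := by
  have := graded_commutator extOp extOp (zeroOp 2) (-1) hF rfl rfl
    (fun a => by simp [extOp_toFun, zeroOp_toFun]) (fun a => by simp [extOp_toFun, zeroOp_toFun])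
  rw [app_zeroOp hF, add_zero, Units.neg_smul, one_smul, eq_neg_iff_add_eq_zero, ← two_smul ℝ] at this
  exact (smul_eq_zero.1 this).resolve_left two_ne_zero

theorem laplaceOp_mem_tensorCochains (hF : F ∈ tensorCochains 𝓡 𝓥 formGrading Proper p) :
    laplaceOp R 𝓥 F ∈ tensorCochains 𝓡 𝓥 formGrading Proper p := by
  obtain ⟨q, rfl⟩ : ∃ q, p = q + 1 := ⟨p - 1, by ring⟩
  exact laplaceOp_mem' hF

theorem laplaceOp_mem_fieldCochains (hF : F ∈ fieldCochains 𝓡 𝓥 p) :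
    laplaceOp R 𝓥 F ∈ fieldCochains 𝓡 𝓥 p := by
  obtain ⟨q, rfl⟩ : ∃ q, p = q + 1 := ⟨p - 1, by ring⟩
  exact laplaceOp_mem hF

theorem ext_laplaceOp (hF : F ∈ tensorCochains 𝓡 𝓥 formGrading Proper p) :
    extOp.app (laplaceOp R 𝓥 F) = laplaceOp R 𝓥 (extOp.app F) := by
  obtain ⟨q, rfl⟩ : ∃ q, p = q + 1 := ⟨p - 1, by ring⟩
  rw [laplaceOp_apply, laplaceOp_apply, map_add, ext_ext (homotopyOp_mem' hF), ext_ext hF, map_zero,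
    zero_add, add_zero]

theorem homotopyOp_isOrder {m : ℕ} (hF : IsOrder I m F) : IsOrder I m (homotopyOp R 𝓥 F) :=
  Submodule.sub_mem (orderSubmodule I m) (x := eulerIotaOp.app F) (eulerIotaOp.app_isOrder hF)
    (lengthScale_isOrder (fun n => (n : ℝ)⁻¹) (iotaOp.app_isOrder (mulXOp.app_isOrder hF)))

theorem laplaceOp_isOrder {m : ℕ} (hF : IsOrder I m F) : IsOrder I m (laplaceOp R 𝓥 F) :=
  Submodule.add_mem (orderSubmodule I m) (x := extOp.app (homotopyOp R 𝓥 F))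
    (extOp.app_isOrder (homotopyOp_isOrder hF)) (homotopyOp_isOrder (extOp.app_isOrder hF))

/-- The linear part of the differential, as a linear map. -/
noncomputable def linearPartL (𝔤 : CurvedLInfty 𝓡 dR I 𝓥) (p : ℤ) :
    Module.End ℝ (List (PureTensor 𝓥 formGrading) → R) where
  toFun := linearPart isCDGA_forms Proper 𝔤 p
  map_add' F G := by
    funext l
    by_cases h : Proper l
    · simp only [linearPart, if_pos h, Pi.add_apply, map_add]
      rw [show slotSum tdeg 1 (fun t => mainTerm isCDGA_forms 𝔤 [t]) (F + G) l = _ from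
        slotSum_add _ _ F G l, smul_add]
      abel
    · simp [linearPart, if_neg h]
  map_smul' c F := by
    funext l
    by_cases h : Proper l
    · simp only [linearPart, if_pos h, Pi.smul_apply, map_smul, RingHom.id_apply]
      rw [show slotSum tdeg 1 (fun t => mainTerm isCDGA_forms 𝔤 [t]) (c • F) l = _ from
        slotSum_map (DistribSMul.toAddMonoidHom R c) _ _ F l, smul_sub, smul_comm c]
      rfl
    · simp [linearPart, if_neg h]

theorem linearPartL_lengthPreserving (𝔤 : CurvedLInfty 𝓡 dR I 𝓥) :
    linearPartL 𝔤 p ∈ lengthPreserving R _ :=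
  mem_lengthPreserving.2 (linearPart_lengthScale 𝔤 p)

theorem linearPartL_app (𝔤 : CurvedLInfty 𝓡 dR I 𝓥) (θ : SlotOp (𝓥 := 𝓥) formGrading Proper)
    (hF : F ∈ tensorCochains 𝓡 𝓥 formGrading Proper p) {q : ℤ} (h : q = p + θ.e) :
    linearPartL 𝔤 q (θ.app F) = θ.app (linearPartL 𝔤 p F) := by
  subst h
  exact linearPart_app tensorAdmissible_proper 𝔤 θ hF

theorem linearPartL_homotopyOp (𝔤 : CurvedLInfty 𝓡 dR I 𝓥)
    (hF : F ∈ tensorCochains 𝓡 𝓥 formGrading Proper (p + 1)) :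
    linearPartL 𝔤 p (homotopyOp R 𝓥 F) = homotopyOp R 𝓥 (linearPartL 𝔤 (p + 1) F) := by
  have h : p = p + 1 + -1 := by ring
  rw [homotopyOp_apply, homotopyOp_apply, map_sub, average,
    mem_lengthPreserving.1 (linearPartL_lengthPreserving 𝔤),
    linearPartL_app 𝔤 eulerIotaOp hF h, linearPartL_app 𝔤 iotaOp (mulXOp_mem hF) h,
    linearPartL_app 𝔤 mulXOp hF (add_zero _).symm]

theorem linearPartL_laplaceOp (𝔤 : CurvedLInfty 𝓡 dR I 𝓥)
    (hF : F ∈ tensorCochains 𝓡 𝓥 formGrading Proper p) :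
    linearPartL 𝔤 p (laplaceOp R 𝓥 F) = laplaceOp R 𝓥 (linearPartL 𝔤 p F) := by
  obtain ⟨q, rfl⟩ : ∃ q, p = q + 1 := ⟨p - 1, by ring⟩
  rw [laplaceOp_apply, laplaceOp_apply, map_add, linearPartL_app 𝔤 extOp (homotopyOp_mem' hF) (q := q + 1) rfl,
    linearPartL_homotopyOp 𝔤 hF, linearPartL_homotopyOp 𝔤 (extOp_mem hF),
    linearPartL_app 𝔤 extOp hF (q := q + 1 + 1) rfl]

variable (𝓡 𝓥) in
/-- The functionals that come from cochains of `𝔤`. -/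
noncomputable def cochainFunctionals (p : ℤ) :
    Submodule ℝ (List (PureTensor 𝓥 formGrading) → R) :=
  (reducedCochains 𝓡 𝓥 p).map (pushL Proper intFst p) ⊔
    (reducedCochains 𝓡 𝓥 (p + 1)).map (pushL Proper intSnd (p + 1))

theorem mem_cochainFunctionals : F ∈ cochainFunctionals 𝓡 𝓥 p ↔
    ∃ c ∈ reducedCochains 𝓡 𝓥 p, ∃ c' ∈ reducedCochains 𝓡 𝓥 (p + 1),
      zeroCochain p c + oneCochain (p + 1) c' = F := by
  rw [cochainFunctionals, Submodule.mem_sup]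
  constructor
  · rintro ⟨_, ⟨c, hc, rfl⟩, _, ⟨c', hc', rfl⟩, h⟩
    exact ⟨c, hc, c', hc', h⟩
  · rintro ⟨c, hc, c', hc', h⟩
    exact ⟨_, ⟨c, hc, rfl⟩, _, ⟨c', hc', rfl⟩, h⟩

theorem homotopyOp_eq_zero (hF : F ∈ cochainFunctionals 𝓡 𝓥 p) : homotopyOp R 𝓥 F = 0 := by
  obtain ⟨c, -, c', -, rfl⟩ := mem_cochainFunctionals.1 hF
  rw [map_add, zeroCochain, oneCochain, homotopyOp_push, homotopyOp_push, add_zero]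

/-- A functional is homotopic to one in the image of the cochains of `𝔤`, up to terms of higher
order. -/
theorem field_step (hI : I.IsHomogeneous 𝓡) [DirectSum.Decomposition 𝓥]
    (𝔤 : CurvedLInfty 𝓡 dR I 𝓥) {m : ℕ} (hF : F ∈ fieldCochains 𝓡 𝓥 (p + 1))
    (hDF : (obstructionDeformation 𝔤).D (p + 1) F ∈ cochainFunctionals 𝓡 𝓥 (p + 1 + 1))
    (hm : IsOrder I m F) : ∃ y ∈ fieldCochains 𝓡 𝓥 p, ∃ z ∈ cochainFunctionals 𝓡 𝓥 (p + 1),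
      IsOrder I m y ∧ IsOrder I m z ∧
        IsOrder I (m + 1) (F - (obstructionDeformation 𝔤).D p y - z) := by
  choose N hN using exists_laplace_bound hF
  -- On words of length `n`, `s n` is one at the eigenvalue `0` of the Laplacian and zero at the
  -- other eigenvalues, so `s n` of the Laplacian projects onto its kernel.
  choose s hs0 hs using fun n => exists_eval_zero_eq_one
    (((Finset.Icc (-1) (N n : ℤ)).erase 0).image fun j : ℤ => (j : ℝ)) (by simp)
  have hkill : ∀ n l, l.length = n → aeval (laplaceOp R 𝓥) (X * s n) F l = 0 := fun n l hl =>
    hN n _ (fun j h1 h2 => by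
      rw [eval_mul, eval_X]
      by_cases hj : j = 0
      · simp [hj]
      · rw [hs n _ (Finset.mem_image_of_mem _ (Finset.mem_erase.2 ⟨hj, Finset.mem_Icc.2 ⟨h1, h2⟩⟩)),
          mul_zero]) l hl
  -- As `1 - s n` vanishes at `0` it is divisible by `X`; the quotient inverts the Laplacian off its
  -- kernel.
  have hq : ∀ n, X * (1 - s n).divX = 1 - s n := fun n => by
    have := X_mul_divX_add (1 - s n)
    rwa [coeff_zero_eq_eval_zero, eval_sub, eval_one, hs0, sub_self, C_0, add_zero] at this
  let q : ℕ → ℝ[X] := fun n => (1 - s n).divX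
  let A : ℕ → Module.End ℝ (List (PureTensor 𝓥 formGrading) → R) := fun n =>
    aeval (laplaceOp R 𝓥) (q n)
  let K : Module.End ℝ (List (PureTensor 𝓥 formGrading) → R) := assembleL A * homotopyOp R 𝓥
  let z : List (PureTensor 𝓥 formGrading) → R := assemble fun n => aeval (laplaceOp R 𝓥) (s n) F
  have hz : z ∈ fieldCochains 𝓡 𝓥 (p + 1) := by
    have := fun n => aeval_mem (fun x hx => laplaceOp_mem_fieldCochains hx) (s n) hF
    exact ⟨assemble_mem _ fun n => (this n).1, assemble_constLocal fun n => (this n).2⟩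
  have hz0 : laplaceOp R 𝓥 z = 0 := by
    funext l
    rw [congr_of_lengthPreserving laplaceOp_lengthPreserving (G := aeval (laplaceOp R 𝓥) (s l.length) F)
      (fun l' hl' => by change aeval (laplaceOp R 𝓥) (s l'.length) F l' = _; rw [hl']) rfl,
      Pi.zero_apply, ← hkill l.length l rfl, map_mul, aeval_X]
    rfl
  have hKmem : K F ∈ fieldCochains 𝓡 𝓥 p := by
    have := fun n => aeval_mem (fun x hx => laplaceOp_mem_fieldCochains hx) (q n) (homotopyOp_mem hF)
    exact ⟨assemble_mem _ fun n => (this n).1, assemble_constLocal fun n => (this n).2⟩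
  have hord : ∀ {k : ℕ} (r : ℝ[X]) {G : List (PureTensor 𝓥 formGrading) → R}, IsOrder I k G →
      IsOrder I k (aeval (laplaceOp R 𝓥) r G) := fun {k} r {G} hG =>
    aeval_mem (S := orderSubmodule I k) (fun x hx => laplaceOp_isOrder hx) r hG
  have hKord : ∀ {k : ℕ} {G : List (PureTensor 𝓥 formGrading) → R}, IsOrder I k G →
      IsOrder I k (K G) := fun hG l => hord (q l.length) (homotopyOp_isOrder hG) l
  have hK : linearPartL 𝔤 p (K F) = K (linearPartL 𝔤 (p + 1) F) := by
    funext l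
    rw [congr_of_lengthPreserving (linearPartL_lengthPreserving 𝔤) (G := A l.length (homotopyOp R 𝓥 F))
      (fun l' hl' => by change A l'.length (homotopyOp R 𝓥 F) l' = _; rw [hl']) rfl,
      aeval_intertwine_eq (linearPartL 𝔤 p) (S := tensorCochains 𝓡 𝓥 formGrading Proper p)
        (fun x hx => laplaceOp_mem_tensorCochains hx) (fun x hx => linearPartL_laplaceOp 𝔤 hx) _
        (homotopyOp_mem' hF.1), linearPartL_homotopyOp 𝔤 hF.1]
    rfl
  -- Polynomials in the Laplacian commute with `d`, so the left side is `q(Δ) Δ F = (1 - s(Δ)) F` in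
  -- each length.
  have hhom : extOp.app (K F) + K (extOp.app F) = F - z := by
    funext l
    rw [Pi.add_apply, congr_of_lengthPreserving (app_lengthPreserving extOp)
      (G := A l.length (homotopyOp R 𝓥 F))
      (fun l' hl' => by change A l'.length (homotopyOp R 𝓥 F) l' = _; rw [hl']) rfl,
      aeval_intertwine_eq extOp.app (S := tensorCochains 𝓡 𝓥 formGrading Proper p)
        (fun x hx => laplaceOp_mem_tensorCochains hx) (fun x hx => ext_laplaceOp hx) _
        (homotopyOp_mem' hF.1)]
    change (A l.length (extOp.app (homotopyOp R 𝓥 F)) + A l.length (homotopyOp R 𝓥 (extOp.app F))) l = _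
    rw [← map_add, ← laplaceOp_apply]
    have h1 : A l.length (laplaceOp R 𝓥 F) = aeval (laplaceOp R 𝓥) (X * q l.length) F := by
      rw [mul_comm, map_mul, aeval_X]
      rfl
    rw [h1, hq, map_sub, map_one]
    rfl
  have hD := ceDiff_homotopy tensorAdmissible_proper 𝔤 K hF.1 hKmem.1 hK
  have h0 : K (ceDiff dR tdeg (tensorBr isCDGA_forms 𝔤) Proper (p + 1) F) = 0 := by
    change assembleL A (homotopyOp R 𝓥 ((obstructionDeformation 𝔤).D (p + 1) F)) = 0
    rw [homotopyOp_eq_zero hDF, map_zero]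
  rw [h0, smul_zero, zero_add] at hD
  refine ⟨(p + 1).negOnePow • K F, units_smul_mem' _ hKmem, z,
    mem_cochainFunctionals.2 (exists_of_laplaceOp_eq_zero hz hz0), IsOrder.units_smul _ (hKord hm),
    fun l => hord (s l.length) hm l, ?_⟩
  change IsOrder I (m + 1) (F - ceDiff dR tdeg (tensorBr isCDGA_forms 𝔤) Proper p _ - z)
  rw [hD, show (dOp tensorAdmissible_proper).app (K F) + K ((dOp tensorAdmissible_proper).app F) =
    F - z from hhom]
  have := Submodule.neg_mem (orderSubmodule I (m + 1)) (Submodule.add_mem (orderSubmodule I (m + 1))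
    (higherPart_isOrder (hA := isCDGA_forms) (Adm := Proper) hI 𝔤 hKmem.1 (hKord hm))
    (hKord (higherPart_isOrder (hA := isCDGA_forms) (Adm := Proper) hI 𝔤 hF.1 hm)))
  change _ ∈ orderSubmodule I (m + 1)
  convert this using 1
  abel

theorem exists_sub_mem_cochainFunctionals (hR : IsCDGA 𝓡 dR) (hI : IsNilpotentDGIdeal 𝓡 dR I)
    [DirectSum.Decomposition 𝓥] (𝔤 : CurvedLInfty 𝓡 dR I 𝓥)
    (hF : F ∈ (obstructionDeformation 𝔤).S (p + 1))
    (hDF : (obstructionDeformation 𝔤).D (p + 1) F ∈ cochainFunctionals 𝓡 𝓥 (p + 1 + 1)) :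
    ∃ y ∈ (obstructionDeformation 𝔤).S p,
      F - (obstructionDeformation 𝔤).D p y ∈ cochainFunctionals 𝓡 𝓥 (p + 1) := by
  obtain ⟨n, hn⟩ := hI.nilpotent
  have hO := isComplex_obstructionDeformation hR 𝔤
  have hC := isComplex_reducedCE hR 𝔤
  refine exists_of_step (idealPow_eq_bot hn) (S := (obstructionDeformation 𝔤).S p)
    (S' := (obstructionDeformation 𝔤).S (p + 1)) (B := cochainFunctionals 𝓡 𝓥 (p + 1))
    (B' := cochainFunctionals 𝓡 𝓥 (p + 1 + 1))
    (D := (obstructionDeformation 𝔤).D p) (D' := (obstructionDeformation 𝔤).D (p + 1))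
    (fun F hF => ?_) (fun F hF => ?_) (fun F G l => ceDiff_congr_length p F G l) (hO.maps p) (hO.sq p)
    (fun b hb => ?_) (fun b hb => ?_) (fun m x hx hDx hm => ?_) hF hDF
  · have := fun n => (mem_obstruction_iff 𝔤).1 (hF n)
    exact (mem_obstruction_iff 𝔤).2
      ⟨assemble_mem _ fun n => (this n).1, assemble_constLocal fun n => (this n).2⟩
  · choose c hc c' hc' h using fun n => mem_cochainFunctionals.1 (hF n)
    refine mem_cochainFunctionals.2 ⟨assemble c, assemble_reducedCochains _ hc, assemble c',
      assemble_reducedCochains _ hc', ?_⟩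
    rw [zeroCochain, oneCochain, push_assemble, push_assemble]
    funext l
    exact congrFun (h l.length) l
  · obtain ⟨c, hc, c', hc', rfl⟩ := mem_cochainFunctionals.1 hb
    exact (mem_obstruction_iff 𝔤).2 (add_mem (zeroCochain_mem hc) (oneCochain_mem hc'))
  · obtain ⟨c, hc, c', hc', rfl⟩ := mem_cochainFunctionals.1 hb
    refine mem_cochainFunctionals.2 ⟨_, hC.maps _ c hc, -_, neg_mem (hC.maps _ c' hc'), ?_⟩
    rw [map_add, ceDiff_zeroCochain 𝔤 hc, ceDiff_oneCochain 𝔤 hc']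
    exact congrArg _ (map_neg (pushL Proper intSnd (p + 1 + 1 + 1)) _)
  · obtain ⟨y, hy, z, hz, h1, h2, h3⟩ := field_step hI.homogeneous 𝔤 ((mem_obstruction_iff 𝔤).1 hx) hDx hm
    exact ⟨y, (mem_obstruction_iff 𝔤).2 hy, z, hz, h1, h2, h3⟩

end FieldStep

attribute [local instance 10000] ringForms algebraForms moduleForms addCommGroupForms
  addCommMonoidForms commRingSmooth addCommGroupSmooth addZeroClassSmooth addMonoidSmooth
  moduleSmooth moduleSmoothOp smulSmooth smulSmoothOp algebraSmooth smulRealSmooth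


/-! ### Injectivity -/

section Injectivity

set_option linter.unusedSectionVars false

variable {R : Type} [Ring R] [Algebra ℝ R] {𝓡 : ℤ → Submodule ℝ R} [GradedAlgebra 𝓡]
  {V : Type} [AddCommGroup V] [Module ℝ V] [Module R V] {𝓥 : ℤ → Submodule ℝ V}
  [SetLike.GradedSMul 𝓡 𝓥] [IsScalarTower ℝ R V] {p : ℤ} {c c' : List (Homog 𝓥) → R}

theorem oneCochain_zeroWord (l : List (Homog 𝓥)) {cs : List Smooth} (h : cs.length = l.length)
    (hc : HasCompact cs) : oneCochain p c (word (zeroWord l) cs) = 0 := by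
  have hl : cs.length = (zeroWord l).length := by rwa [length_zeroWord]
  rw [oneCochain, push_of_adm _ _ _ (proper_word hl hc),
    intSnd_eq_zero _ _ (prodVal_mem isCDGA_forms _), zero_smul, smul_zero]
  rw [adeg, wdeg, word_map (g := Prod.fst) (fun _ _ => rfl) hl]
  simp [zeroWord, Function.comp_def]

theorem oneCochain_eq_zero (hc : c ∈ reducedCochains 𝓡 𝓥 p) (h : oneCochain p c = 0) : c = 0 := by
  funext l
  rcases l with - | ⟨v, l⟩
  · exact IsReducedCochain.nil (hc : IsReducedCochain 𝓡 𝓥 p c)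
  · have e := congrFun h (word ((1, v) :: zeroWord l) (bumps (l.length + 1)))
    have hl : (bumps (l.length + 1)).length = ((1, v) :: zeroWord l).length := by
      rw [length_bumps, List.length_cons, length_zeroWord]
    rw [oneCochain, push_of_adm _ _ _ (proper_word hl (hasCompact_bumps _)),
      word_map (g := Prod.snd) (fun _ _ => rfl) hl] at e
    have e2 : intSnd (prodVal (word ((1, v) :: zeroWord l) (bumps (l.length + 1)))) = 1 := by
      change intSnd (prodVal ((formOf 1 bump, v) :: word (zeroWord l) (List.replicate l.length 1))) = 1
      rw [prodVal_cons, intSnd_apply, TrivSqZeroExt.snd_mul, formOf_fst, formOf_snd,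
        prodVal_zeroWord (by simp)]
      simp [lineIntegral_bump]
    rw [e2, one_smul, Pi.zero_apply] at e
    have e' := (smul_eq_zero_iff_eq _).1 e
    simpa [zeroWord, Function.comp_def] using e'

/-- Words of functions see only `zeroCochain`, which recovers `c` on the cut-off functions; then a
word with a single one-form recovers `c'`. -/
theorem cochainFunctionals_injective (hc : c ∈ reducedCochains 𝓡 𝓥 p)
    (hc' : c' ∈ reducedCochains 𝓡 𝓥 (p + 1)) (h : zeroCochain p c + oneCochain (p + 1) c' = 0) :
    c = 0 ∧ c' = 0 := by
  have h0 : c = 0 := by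
    funext l
    rcases l with - | ⟨v, l⟩
    · exact IsReducedCochain.nil (hc : IsReducedCochain 𝓡 𝓥 p c)
    · have e := congrFun h (word (zeroWord (v :: l)) (bumps (l.length + 1)))
      have h1 := oneCochain_zeroWord (p := p + 1) (c := c') (v :: l) (length_bumps _)
        (hasCompact_bumps l.length)
      have h2 := zeroCochain_zeroWord (p := p) (c := c) (l := v :: l) (length_bumps _)
        (hasCompact_bumps l.length)
      rw [List.length_cons] at h1 h2
      rwa [Pi.add_apply, h1, h2, lineIntegral_prod_bumps, one_smul, add_zero] at e
  refine ⟨h0, oneCochain_eq_zero hc' ?_⟩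
  rwa [h0, show zeroCochain p (0 : List (Homog 𝓥) → R) = 0 from map_zero (pushL Proper intFst p),
    zero_add] at h

end Injectivity

/-! ### Cochain complexes of real vector spaces -/

section CochainComplexes

/-- The refinement is the fibre product of `A` and `N` over `M`; it surjects onto `A` precisely
because preimages exist elementwise. -/
theorem exists_lift_up_to_refinement {A M N : ModuleCat.{0} ℝ} (x : A ⟶ M) (g : N ⟶ M)
    (h : ∀ a, ∃ n, g.hom n = x.hom a) :
    ∃ (A' : ModuleCat.{0} ℝ) (π : A' ⟶ A) (_ : Epi π) (n : A' ⟶ N), π ≫ x = n ≫ g := by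
  let W : Submodule ℝ (A × N) := LinearMap.ker (x.hom ∘ₗ LinearMap.fst ℝ A N -
    g.hom ∘ₗ LinearMap.snd ℝ A N)
  refine ⟨ModuleCat.of ℝ W, ModuleCat.ofHom (LinearMap.fst ℝ A N ∘ₗ W.subtype), ?_,
    ModuleCat.ofHom (LinearMap.snd ℝ A N ∘ₗ W.subtype), ?_⟩
  · rw [ModuleCat.epi_iff_surjective]
    intro a
    obtain ⟨n, hn⟩ := h a
    exact ⟨⟨(a, n), by simp [W, hn]⟩, rfl⟩
  · ext w
    have := w.2
    rw [LinearMap.mem_ker, LinearMap.sub_apply, sub_eq_zero] at this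
    exact this

variable {K L M : CochainComplex (ModuleCat.{0} ℝ) ℤ}

theorem comm_apply (f : K ⟶ L) (i j : ℤ) (x : K.X i) :
    (f.f j).hom ((K.d i j).hom x) = (L.d i j).hom ((f.f i).hom x) := by
  rw [← LinearMap.comp_apply, ← ModuleCat.hom_comp, ← LinearMap.comp_apply, ← ModuleCat.hom_comp,
    f.comm]

/-- An injective chain map is a quasi-isomorphism if cochains whose differential is in the image are
in the image, up to coboundaries. -/
theorem quasiIso_of_injective (f : K ⟶ L) (hf : ∀ p, Function.Injective (f.f p).hom)
    (h : ∀ (p : ℤ) (x : L.X (p + 1)),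
      (∃ a, (f.f (p + 1 + 1)).hom a = (L.d (p + 1) (p + 1 + 1)).hom x) →
        ∃ y a, x - (L.d p (p + 1)).hom y = (f.f (p + 1)).hom a) : QuasiIso f := by
  refine ⟨fun j => ?_⟩
  obtain ⟨i, rfl⟩ : ∃ i, j = i + 1 := ⟨j - 1, by ring⟩
  obtain ⟨k, rfl⟩ : ∃ k, i = k + 1 := ⟨i - 1, by ring⟩
  rw [quasiIsoAt_iff_isIso_homologyMap]
  have hprev : (ComplexShape.up ℤ).prev (k + 1 + 1) = k + 1 := by simp
  have hnext : (ComplexShape.up ℤ).next (k + 1 + 1) = k + 1 + 1 + 1 := by simp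
  have hdd : ∀ {K : CochainComplex (ModuleCat.{0} ℝ) ℤ} (i j k : ℤ) (x : K.X i),
      (K.d j k).hom ((K.d i j).hom x) = 0 := fun {K} i j k x => by
    rw [← LinearMap.comp_apply, ← ModuleCat.hom_comp, K.d_comp_d]
    rfl
  -- If `f x = d y`, then `d y` lies in the image, so `y` differs from some `f c` by a coboundary.
  -- Hence `f x = f (d c)`, and injectivity gives `x = d c`.
  have h1 : Mono (HomologicalComplex.homologyMap f (k + 1 + 1)) := by
    rw [HomologicalComplex.mono_homologyMap_iff_up_to_refinements f _ _ _ hprev hnext]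
    intro A x hx y hy
    refine exists_lift_up_to_refinement x _ fun a => ?_
    have e : (f.f (k + 1 + 1)).hom (x.hom a) = (L.d (k + 1) (k + 1 + 1)).hom (y.hom a) :=
      LinearMap.congr_fun (congrArg ModuleCat.Hom.hom hy) a
    obtain ⟨w, c, hc⟩ := h k (y.hom a) ⟨_, e⟩
    refine ⟨c, hf _ ?_⟩
    rw [comm_apply, ← hc, map_sub, hdd, sub_zero, e]
  have h2 : Epi (HomologicalComplex.homologyMap f (k + 1 + 1)) := by
    rw [HomologicalComplex.epi_homologyMap_iff_up_to_refinements f _ _ _ hprev hnext]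
    intro A y hy
    obtain ⟨A', π, hπ, n, hn⟩ := exists_lift_up_to_refinement (N := ModuleCat.of ℝ
      (K.X (k + 1 + 1) × L.X (k + 1))) y (ModuleCat.ofHom ((f.f (k + 1 + 1)).hom.coprod
        (L.d (k + 1) (k + 1 + 1)).hom)) fun a => by
      have e : (L.d (k + 1 + 1) (k + 1 + 1 + 1)).hom (y.hom a) = 0 :=
        LinearMap.congr_fun (congrArg ModuleCat.Hom.hom hy) a
      obtain ⟨w, c, hc⟩ := h (k + 1) (y.hom a) ⟨0, by rw [map_zero, e]⟩
      exact ⟨(c, w), by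
        change (f.f (k + 1 + 1)).hom c + (L.d (k + 1) (k + 1 + 1)).hom w = _
        rw [← hc, sub_add_cancel]⟩
    have hn' : π ≫ y = (n ≫ ModuleCat.ofHom (LinearMap.fst ℝ _ _)) ≫ f.f (k + 1 + 1) +
        (n ≫ ModuleCat.ofHom (LinearMap.snd ℝ _ _)) ≫ L.d (k + 1) (k + 1 + 1) := by
      rw [hn]
      rfl
    refine ⟨A', π, hπ, n ≫ ModuleCat.ofHom (LinearMap.fst ℝ _ _), ?_,
      n ≫ ModuleCat.ofHom (LinearMap.snd ℝ _ _), hn'⟩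
    -- The preimage of a cocycle is a cocycle by injectivity in the next degree.
    have : Mono (f.f (k + 1 + 1 + 1)) := (ModuleCat.mono_iff_injective _).2 (hf _)
    rw [← cancel_mono (f.f (k + 1 + 1 + 1)), Category.assoc, ← f.comm, ← Category.assoc,
      ← sub_eq_iff_eq_add.2 hn', Preadditive.sub_comp, Category.assoc, hy]
    simp
  exact isIso_of_mono_of_epi _

theorem biprod_desc_apply (f : K ⟶ M) (g : L ⟶ M) (p : ℤ) (x : (K ⊞ L).X p) :
    ((biprod.desc f g).f p).hom x =
      (f.f p).hom (((biprod.fst : K ⊞ L ⟶ K).f p).hom x) +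
        (g.f p).hom (((biprod.snd : K ⊞ L ⟶ L).f p).hom x) := by
  have : (biprod.desc f g).f p = (biprod.fst : K ⊞ L ⟶ K).f p ≫ f.f p +
      (biprod.snd : K ⊞ L ⟶ L).f p ≫ g.f p := by
    rw [biprod.desc_eq]
    rfl
  rw [this]
  rfl

theorem exists_biprod_apply (p : ℤ) (a : K.X p) (b : L.X p) : ∃ x : (K ⊞ L).X p,
    ((biprod.fst : K ⊞ L ⟶ K).f p).hom x = a ∧ ((biprod.snd : K ⊞ L ⟶ L).f p).hom x = b := by
  have h : ∀ {X Y Z : ModuleCat.{0} ℝ} (f : X ⟶ Y) (g : Y ⟶ Z) (x : X),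
    g.hom (f.hom x) = (f ≫ g).hom x := fun _ _ _ => rfl
  refine ⟨((biprod.inl : K ⟶ K ⊞ L).f p).hom a + ((biprod.inr : L ⟶ K ⊞ L).f p).hom b, ?_, ?_⟩
  · rw [map_add, h, h]
    simp
  · rw [map_add, h, h]
    simp

theorem biprod_ext_apply (p : ℤ) {x y : (K ⊞ L).X p}
    (h1 : ((biprod.fst : K ⊞ L ⟶ K).f p).hom x = ((biprod.fst : K ⊞ L ⟶ K).f p).hom y)
    (h2 : ((biprod.snd : K ⊞ L ⟶ L).f p).hom x = ((biprod.snd : K ⊞ L ⟶ L).f p).hom y) : x = y := by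
  have h : ∀ z : (K ⊞ L).X p, z = ((biprod.inl : K ⟶ K ⊞ L).f p).hom
      (((biprod.fst : K ⊞ L ⟶ K).f p).hom z) + ((biprod.inr : L ⟶ K ⊞ L).f p).hom
      (((biprod.snd : K ⊞ L ⟶ L).f p).hom z) := fun z =>
    (LinearMap.congr_fun (congrArg ModuleCat.Hom.hom (HomologicalComplex.biprod_total_f K L p)) z).symm
  rw [h x, h y, h1, h2]

/-- A chain map, from its components. -/
def homOfComm (φ : ∀ p, K.X p ⟶ L.X p)
    (h : ∀ p (x : K.X p), (L.d p (p + 1)).hom ((φ p).hom x) = (φ (p + 1)).hom ((K.d p (p + 1)).hom x)) :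
    K ⟶ L where
  f := φ
  comm' := by
    rintro i _ rfl
    ext x
    exact h i x

theorem ComplexData.IsComplex.val_d {M : Type} [AddCommGroup M] [Module ℝ M] {K : ComplexData M}
    (h : K.IsComplex) (p : ℤ) (x : h.cpx.X p) :
    h.val (p + 1) ((h.cpx.d p (p + 1)).hom x) = K.D p (h.val p x) := by
  have : h.cpx.d p (p + 1) = ModuleCat.ofHom ((K.D p).restrict (h.maps p)) :=
    CochainComplex.of_d (fun p => ModuleCat.of ℝ (K.S p))
      (fun p => ModuleCat.ofHom ((K.D p).restrict (h.maps p))) p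
  rw [this]
  rfl

theorem ComplexData.IsComplex.val_shift_d {M : Type} [AddCommGroup M] [Module ℝ M]
    {K : ComplexData M} (h : K.IsComplex) (p : ℤ) (x : h.cpx.X (p + 1)) :
    h.val (p + 1 + 1) (((h.cpx⟦(1 : ℤ)⟧).d p (p + 1)).hom x) = -K.D (p + 1) (h.val (p + 1) x) := by
  rw [CochainComplex.shiftFunctor_obj_d', Int.negOnePow_one]
  rw [← h.val_d (p + 1) x]
  change h.val (p + 1 + 1) (((-1 : ℤˣ) • h.cpx.d (p + 1) (p + 1 + 1)).hom x) = _
  rw [Units.neg_smul, one_smul]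
  rfl

theorem ComplexData.IsComplex.val_injective {M : Type} [AddCommGroup M] [Module ℝ M]
    {K : ComplexData M} (h : K.IsComplex) (p : ℤ) : Function.Injective (h.val p) :=
  Subtype.val_injective

/-- A cochain, from an element of the underlying space. -/
def ComplexData.IsComplex.ofMem {M : Type} [AddCommGroup M] [Module ℝ M] {K : ComplexData M}
    (h : K.IsComplex) (p : ℤ) (x : M) (hx : x ∈ K.S p) : h.cpx.X p := (⟨x, hx⟩ : K.S p)

/-- The biproduct of a quasi-isomorphism and its shift is a quasi-isomorphism. -/
theorem quasiIso_biprod_map {K' L' : CochainComplex (ModuleCat.{0} ℝ) ℤ} (f : K ⟶ L) (g : K' ⟶ L')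
    [QuasiIso f] [QuasiIso g] : QuasiIso (biprod.map f g) := by
  refine ⟨fun i => ?_⟩
  rw [quasiIsoAt_iff_isIso_homologyMap]
  open HomologicalComplex in
  refine ⟨homologyMap biprod.fst i ≫ inv (homologyMap f i) ≫ homologyMap biprod.inl i +
    homologyMap biprod.snd i ≫ inv (homologyMap g i) ≫ homologyMap biprod.inr i, ?_, ?_⟩
  · rw [Preadditive.comp_add, ← homologyMap_comp_assoc, ← homologyMap_comp_assoc, biprod.map_fst,
      biprod.map_snd, homologyMap_comp_assoc, homologyMap_comp_assoc, IsIso.hom_inv_id_assoc,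
      IsIso.hom_inv_id_assoc, ← homologyMap_comp, ← homologyMap_comp, ← homologyMap_add,
      biprod.total, homologyMap_id]
  · rw [Preadditive.add_comp, Category.assoc, Category.assoc, Category.assoc, Category.assoc,
      ← homologyMap_comp, ← homologyMap_comp, biprod.inl_map, biprod.inr_map, homologyMap_comp,
      homologyMap_comp, IsIso.inv_hom_id_assoc, IsIso.inv_hom_id_assoc, ← homologyMap_comp,
      ← homologyMap_comp, ← homologyMap_add, biprod.total, homologyMap_id]

end CochainComplexes

/-! ### The tensor product with the invariant forms -/

section InvariantForms

variable {K K' K'' : CochainComplex (ModuleCat.{0} ℝ) ℤ}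

theorem tensorHom_add_id (L : CochainComplex (ModuleCat.{0} ℝ) ℤ) (f g : K ⟶ K') :
    HomologicalComplex.tensorHom (f + g) (𝟙 L) = HomologicalComplex.tensorHom f (𝟙 L) + HomologicalComplex.tensorHom g (𝟙 L) := by
  ext i : 1
  apply HomologicalComplex.mapBifunctor.hom_ext
  intro i₁ i₂ h
  simp

theorem tensorHom_comp_id (L : CochainComplex (ModuleCat.{0} ℝ) ℤ) (f : K ⟶ K') (g : K' ⟶ K'') :
    HomologicalComplex.tensorHom (f ≫ g) (𝟙 L) = HomologicalComplex.tensorHom f (𝟙 L) ≫ HomologicalComplex.tensorHom g (𝟙 L) := by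
  ext i : 1
  apply HomologicalComplex.mapBifunctor.hom_ext
  intro i₁ i₂ h
  simp

theorem tensorHom_id_id (K L : CochainComplex (ModuleCat.{0} ℝ) ℤ) :
    HomologicalComplex.tensorHom (𝟙 K) (𝟙 L) = 𝟙 (HomologicalComplex.tensorObj K L) := by
  ext i : 1
  apply HomologicalComplex.mapBifunctor.hom_ext
  intro i₁ i₂ h
  simp

/-- Maps exhibiting a complex as a direct sum induce an isomorphism to the biproduct. -/
noncomputable def biprodIso (i₁ : K ⟶ K'') (i₂ : K' ⟶ K'') (p₁ : K'' ⟶ K) (p₂ : K'' ⟶ K')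
    (h₁ : i₁ ≫ p₁ = 𝟙 K) (h₂ : i₂ ≫ p₂ = 𝟙 K') (h : p₁ ≫ i₁ + p₂ ≫ i₂ = 𝟙 K'') : K'' ≅ K ⊞ K' where
  hom := biprod.lift p₁ p₂
  inv := biprod.desc i₁ i₂
  hom_inv_id := by rw [biprod.lift_desc, h]
  inv_hom_id := by
    have h12 : i₁ ≫ p₂ = 0 := by
      have := congrArg (fun f => i₁ ≫ f ≫ p₂) h
      simp only [Preadditive.add_comp, Preadditive.comp_add, Category.assoc, Category.id_comp, h₂,
        Category.comp_id, reassoc_of% h₁] at this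
      simpa using this
    have h21 : i₂ ≫ p₁ = 0 := by
      have := congrArg (fun f => i₂ ≫ f ≫ p₁) h
      simp only [Preadditive.add_comp, Preadditive.comp_add, Category.assoc, Category.id_comp, h₁,
        Category.comp_id, reassoc_of% h₂] at this
      simpa using this
    apply biprod.hom_ext' <;> apply biprod.hom_ext <;> simp [h₁, h₂, h12, h21]

/-- The complex `ℝ` in degree zero. -/
noncomputable abbrev unitComplex : CochainComplex (ModuleCat.{0} ℝ) ℤ :=
  HomologicalComplex.tensorUnit (ModuleCat.{0} ℝ) (ComplexShape.up ℤ)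

theorem mem_invariant_zero (c : ℝ) :
    (TrivSqZeroExt.inl (algebraMap ℝ Smooth c) : Forms) ∈ invariantForms.S 0 := by
  refine ⟨by simp [dualGrading], ?_⟩
  simp only [SetLike.mem_coe, Submodule.mem_iInf, LinearMap.mem_ker, LinearMap.sub_apply,
    LinearMap.id_apply, sub_eq_zero]
  intro t
  refine TrivSqZeroExt.ext ?_ ?_
  · simp [translateForm, -DualNumber.inr_eq_smul_eps]
    rfl
  · simp [translateForm, -DualNumber.inr_eq_smul_eps]

theorem mem_invariant_one (c : ℝ) :
    (TrivSqZeroExt.inr (algebraMap ℝ Smooth c) : Forms) ∈ invariantForms.S 1 := by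
  refine ⟨by simp [dualGrading, -DualNumber.inr_eq_smul_eps], ?_⟩
  simp only [SetLike.mem_coe, Submodule.mem_iInf, LinearMap.mem_ker, LinearMap.sub_apply,
    LinearMap.id_apply, sub_eq_zero]
  intro t
  refine TrivSqZeroExt.ext ?_ ?_
  · simp [translateForm, -DualNumber.inr_eq_smul_eps]
  · simp [translateForm, -DualNumber.inr_eq_smul_eps]
    rfl

theorem invariant_apply {i : ℤ} {a : Forms} (h : a ∈ invariantForms.S i) (x : ℝ) :
    (a.fst : ℝ → ℝ) x = (a.fst : ℝ → ℝ) 0 ∧ (a.snd : ℝ → ℝ) x = (a.snd : ℝ → ℝ) 0 := by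
  have := h.2
  simp only [SetLike.mem_coe, Submodule.mem_iInf, LinearMap.mem_ker, LinearMap.sub_apply,
    LinearMap.id_apply, sub_eq_zero] at this
  have h1 := congrArg TrivSqZeroExt.fst (this x)
  have h2 := congrArg TrivSqZeroExt.snd (this x)
  simp [translateForm, -DualNumber.inr_eq_smul_eps] at h1 h2
  constructor
  · have := congrFun (congrArg Subtype.val h1) 0
    simpa [Smooth.translate] using this
  · have := congrFun (congrArg Subtype.val h2) 0
    simpa [Smooth.translate] using this

/-- Translation-invariant coefficients are constant, so their derivatives vanish. -/
theorem invariant_d (i j : ℤ) : isComplex_invariantForms.cpx.d i j = 0 := by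
  by_cases h : i + 1 = j
  · subst h
    ext x
    refine isComplex_invariantForms.val_injective _ ?_
    rw [isComplex_invariantForms.val_d]
    have h0 := x.2
    refine TrivSqZeroExt.ext ?_ ?_
    · rfl
    · refine Subtype.ext (funext fun y => ?_)
      change _root_.deriv ((isComplex_invariantForms.val i x).fst : ℝ → ℝ) y = 0
      rw [show ((isComplex_invariantForms.val i x).fst : ℝ → ℝ) = fun _ =>
        ((isComplex_invariantForms.val i x).fst : ℝ → ℝ) 0 from
          funext fun z => (invariant_apply h0 z).1]
      simp
  · exact isComplex_invariantForms.cpx.shape _ _ h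

theorem invariant_shift_d (i j : ℤ) : (isComplex_invariantForms.cpx⟦(1 : ℤ)⟧).d i j = 0 := by
  rw [CochainComplex.shiftFunctor_obj_d', invariant_d, smul_zero]
  rfl

/-- The invariant functions are the constants. -/
noncomputable def constFun : 𝟙_ (ModuleCat.{0} ℝ) ≅ isComplex_invariantForms.cpx.X 0 where
  hom := ModuleCat.ofHom (X := ℝ) (Y := invariantForms.S 0)
    { toFun := fun c => ⟨TrivSqZeroExt.inl (algebraMap ℝ Smooth c), mem_invariant_zero c⟩
      map_add' := fun a b => Subtype.ext (by simp)
      map_smul' := fun a b => Subtype.ext (by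
        refine TrivSqZeroExt.ext ?_ ?_
        · simp [Algebra.algebraMap_eq_smul_one, mul_smul]
        · simp) }
  inv := ModuleCat.ofHom (X := invariantForms.S 0) (Y := ℝ)
    { toFun := fun a => (a.1.fst : ℝ → ℝ) 0
      map_add' := fun a b => rfl
      map_smul' := fun a b => rfl }
  hom_inv_id := by
    ext
    rfl
  inv_hom_id := by
    ext a
    refine Subtype.ext (TrivSqZeroExt.ext (Subtype.ext (funext fun y => ?_)) ?_)
    · exact (invariant_apply a.2 y).1.symm
    · exact (a.2.1.2 (by decide)).symm

/-- The invariant one-forms are the multiples of `dx`. -/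
noncomputable def constForm : 𝟙_ (ModuleCat.{0} ℝ) ≅ (isComplex_invariantForms.cpx⟦(1 : ℤ)⟧).X 0 where
  hom := ModuleCat.ofHom (X := ℝ) (Y := invariantForms.S 1)
    { toFun := fun c => ⟨TrivSqZeroExt.inr (algebraMap ℝ Smooth c), mem_invariant_one c⟩
      map_add' := fun a b => Subtype.ext (by
        refine TrivSqZeroExt.ext ?_ ?_
        · simp [-DualNumber.inr_eq_smul_eps]
        · simp [-DualNumber.inr_eq_smul_eps])
      map_smul' := fun a b => Subtype.ext (by
        refine TrivSqZeroExt.ext ?_ ?_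
        · simp [-DualNumber.inr_eq_smul_eps]
        · simp [-DualNumber.inr_eq_smul_eps, Algebra.algebraMap_eq_smul_one, mul_smul]) }
  inv := ModuleCat.ofHom (X := invariantForms.S 1) (Y := ℝ)
    { toFun := fun a => (a.1.snd : ℝ → ℝ) 0
      map_add' := fun a b => rfl
      map_smul' := fun a b => rfl }
  hom_inv_id := by
    ext
    rfl
  inv_hom_id := by
    ext a
    refine Subtype.ext (TrivSqZeroExt.ext ?_ (Subtype.ext (funext fun y => ?_)))
    · exact (Submodule.mem_inf.1 a.2).1.1 (by decide) |>.symm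
    · exact (invariant_apply a.2 y).2.symm

theorem invariant_subsingleton {i : ℤ} (h0 : i ≠ 0) (h1 : i ≠ 1) (a : invariantForms.S i) : a = 0 :=
  Subtype.ext (TrivSqZeroExt.ext (a.2.1.1 h0) (a.2.1.2 h1))

section Single

variable {A : ModuleCat.{0} ℝ} (φ : A ≅ K.X 0)
  (h : ∀ k, (ComplexShape.up ℤ).Rel 0 k → φ.hom ≫ K.d 0 k = 0)
  (h' : ∀ k, (ComplexShape.up ℤ).Rel k 0 → K.d k 0 ≫ φ.inv = 0)

theorem single_comp :
    HomologicalComplex.mkHomFromSingle φ.hom h ≫ HomologicalComplex.mkHomToSingle φ.inv h' = 𝟙 _ := by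
  apply HomologicalComplex.from_single_hom_ext
  simp

theorem comp_single_zero : (HomologicalComplex.mkHomToSingle φ.inv h' ≫
    HomologicalComplex.mkHomFromSingle φ.hom h).f 0 = 𝟙 _ := by
  simp

theorem comp_single_of_ne {p : ℤ} (hp : p ≠ 0) : (HomologicalComplex.mkHomToSingle φ.inv h' ≫
    HomologicalComplex.mkHomFromSingle φ.hom h).f p = 0 := by
  rw [HomologicalComplex.comp_f, (HomologicalComplex.isZero_single_obj_X _ _ _ _ hp).eq_of_tgt
    ((HomologicalComplex.mkHomToSingle φ.inv h').f p) 0, zero_comp]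

end Single

theorem hom_constForm_d (k : ℤ) (_ : (ComplexShape.up ℤ).Rel 0 k) :
    constForm.hom ≫ (isComplex_invariantForms.cpx⟦(1 : ℤ)⟧).d 0 k = 0 := by
  rw [invariant_shift_d, comp_zero]

theorem d_inv_constForm (k : ℤ) (_ : (ComplexShape.up ℤ).Rel k 0) :
    (isComplex_invariantForms.cpx⟦(1 : ℤ)⟧).d k 0 ≫ constForm.inv = 0 := by
  rw [invariant_shift_d, zero_comp]

theorem hom_constFun_d (k : ℤ) (_ : (ComplexShape.up ℤ).Rel 0 k) :
    constFun.hom ≫ isComplex_invariantForms.cpx.d 0 k = 0 := by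
  rw [invariant_d, comp_zero]

theorem d_inv_constFun (k : ℤ) (_ : (ComplexShape.up ℤ).Rel k 0) :
    isComplex_invariantForms.cpx.d k 0 ≫ constFun.inv = 0 := by
  rw [invariant_d, zero_comp]

/-- The shifted invariant forms are the sum of `ℝ dx` and `ℝ[1]`. -/
noncomputable def invariantIso :
    isComplex_invariantForms.cpx⟦(1 : ℤ)⟧ ≅ unitComplex ⊞ unitComplex⟦(1 : ℤ)⟧ :=
  biprodIso
    (HomologicalComplex.mkHomFromSingle constForm.hom hom_constForm_d)
    ((HomologicalComplex.mkHomFromSingle constFun.hom hom_constFun_d)⟦(1 : ℤ)⟧')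
    (HomologicalComplex.mkHomToSingle constForm.inv d_inv_constForm)
    ((HomologicalComplex.mkHomToSingle constFun.inv d_inv_constFun)⟦(1 : ℤ)⟧')
    (single_comp _ _ _)
    (by
      rw [← Functor.map_comp, single_comp]
      exact CategoryTheory.Functor.map_id _ _)
    (by
      rw [← Functor.map_comp]
      ext1 p
      change (HomologicalComplex.mkHomToSingle constForm.inv d_inv_constForm ≫
          HomologicalComplex.mkHomFromSingle constForm.hom hom_constForm_d).f p +
        (show (isComplex_invariantForms.cpx⟦(1 : ℤ)⟧).X p ⟶
            (isComplex_invariantForms.cpx⟦(1 : ℤ)⟧).X p from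
          (HomologicalComplex.mkHomToSingle constFun.inv d_inv_constFun ≫
            HomologicalComplex.mkHomFromSingle constFun.hom hom_constFun_d).f (p + 1)) = 𝟙 _
      -- After the shift, `dx` sits in degree `0` and the constants in degree `-1`; all other terms
      -- are zero.
      by_cases h0 : p = 0
      · subst h0
        rw [comp_single_zero, comp_single_of_ne _ _ _ (by decide)]
        exact add_zero _
      · rw [comp_single_of_ne _ _ _ h0]
        refine (zero_add _).trans ?_
        by_cases h1 : p = -1
        · subst h1
          exact comp_single_zero _ _ _
        · ext a
          have : ∀ a b : (isComplex_invariantForms.cpx⟦(1 : ℤ)⟧).X p, a = b := fun a b =>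
            (invariant_subsingleton (i := p + 1) (by omega) (by omega) a).trans
              (invariant_subsingleton (i := p + 1) (by omega) (by omega) b).symm
          exact this _ _)

/-- Tensoring with a complex preserves direct sums. -/
noncomputable def tensorBiprodIso (L : CochainComplex (ModuleCat.{0} ℝ) ℤ) (f : K'' ≅ K ⊞ K') :
    HomologicalComplex.tensorObj K'' L ≅
      HomologicalComplex.tensorObj K L ⊞ HomologicalComplex.tensorObj K' L :=
  biprodIso (HomologicalComplex.tensorHom (biprod.inl ≫ f.inv) (𝟙 L))
    (HomologicalComplex.tensorHom (biprod.inr ≫ f.inv) (𝟙 L))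
    (HomologicalComplex.tensorHom (f.hom ≫ biprod.fst) (𝟙 L))
    (HomologicalComplex.tensorHom (f.hom ≫ biprod.snd) (𝟙 L))
    (by
      rw [← tensorHom_comp_id, ← tensorHom_id_id]
      simp)
    (by
      rw [← tensorHom_comp_id, ← tensorHom_id_id]
      simp)
    (by
      rw [← tensorHom_comp_id, ← tensorHom_comp_id, ← tensorHom_add_id, ← tensorHom_id_id]
      congr 1
      have h := congrArg (fun g => f.hom ≫ g ≫ f.inv) (biprod.total (X := K) (Y := K'))
      simp only [Preadditive.add_comp, Preadditive.comp_add, Category.assoc, Category.id_comp,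
        Iso.hom_inv_id] at h ⊢
      exact h)

/-- The tensor product of the shifted invariant forms with a complex. -/
noncomputable def tensorInvariantIso (L : CochainComplex (ModuleCat.{0} ℝ) ℤ) :
    HomologicalComplex.tensorObj (isComplex_invariantForms.cpx⟦(1 : ℤ)⟧) L ≅ L ⊞ L⟦(1 : ℤ)⟧ :=
  tensorBiprodIso L invariantIso ≪≫ biprod.mapIso (HomologicalComplex.leftUnitor L)
    (CochainComplex.mapBifunctorShift₁Iso unitComplex L (curriedTensor (ModuleCat.{0} ℝ)) 1 ≪≫
      (shiftFunctor _ (1 : ℤ)).mapIso (HomologicalComplex.leftUnitor L))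

end InvariantForms

/-! ### The quasi-isomorphisms -/

section QuasiIsomorphisms

set_option linter.unusedSectionVars false

variable {R : Type} [Ring R] [Algebra ℝ R] {𝓡 : ℤ → Submodule ℝ R} [GradedAlgebra 𝓡]
  {dR : R →ₗ[ℝ] R} {I : Ideal R}
  {V : Type} [AddCommGroup V] [Module ℝ V] [Module R V] [IsScalarTower ℝ R V]
  {𝓥 : ℤ → Submodule ℝ V} [DirectSum.Decomposition 𝓥] [SetLike.GradedSMul 𝓡 𝓥]
  [Module.Finite R V] [Module.Projective R V]
  {𝔤 : CurvedLInfty 𝓡 dR I 𝓥}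

/-- The map `F ↦ ((φ) ↦ ∫ F(φ))` on the parts of form degree zero. -/
noncomputable def zeroMap (hC : (reducedCE 𝔤).IsComplex) (hO : (obstructionDeformation 𝔤).IsComplex) :
    hC.cpx ⟶ hO.cpx :=
  homOfComm (fun p => ModuleCat.ofHom (X := (reducedCE 𝔤).S p) (Y := (obstructionDeformation 𝔤).S p)
      ((pushL Proper intFst p).restrict fun _ hc => (mem_obstruction_iff 𝔤).2 (zeroCochain_mem hc)))
    fun p x => hO.val_injective _ <| (hO.val_d p _).trans <|
      (ceDiff_zeroCochain 𝔤 x.2).trans (congrArg (zeroCochain (p + 1)) (hC.val_d p x).symm)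

/-- Integration over the line of a cochain applied to the fields. -/
noncomputable def oneMap (hC : (reducedCE 𝔤).IsComplex) (hO : (obstructionDeformation 𝔤).IsComplex) :
    hC.cpx⟦(1 : ℤ)⟧ ⟶ hO.cpx :=
  homOfComm (fun p => ModuleCat.ofHom (X := (reducedCE 𝔤).S (p + 1))
      (Y := (obstructionDeformation 𝔤).S p)
      ((pushL Proper intSnd (p + 1)).restrict fun _ hc =>
        (mem_obstruction_iff 𝔤).2 (oneCochain_mem hc)))
    fun p x => hO.val_injective _ <| (hO.val_d p _).trans <|
      (ceDiff_oneCochain 𝔤 x.2).trans <| by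
        have h := congrArg (pushL Proper intSnd (p + 1 + 1)) (hC.val_shift_d p x)
        rw [map_neg] at h
        exact h.symm

/-- The de Rham differential, from reduced cochains to closed one-forms. -/
noncomputable def deRhamMap (hC : (reducedCE 𝔤).IsComplex) (hΩ : (truncatedDeRham 𝔤).IsComplex) :
    hC.cpx ⟶ closedOneForms hΩ :=
  homOfComm (L := hΩ.cpx⟦(1 : ℤ)⟧) (fun p => ModuleCat.ofHom (X := (reducedCE 𝔤).S p)
      (Y := (truncatedDeRham 𝔤).S (p + 1))
      ((pushL (fun _ => True) epsSnd p).restrict fun _ hc => deRham_mem hc))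
    fun p x => hΩ.val_injective _ <| (hΩ.val_shift_d p _).trans <|
      (congrArg Neg.neg (ceDiff_deRham 𝔤 x.2)).trans <| (neg_neg _).trans
        (congrArg (deRham (p + 1)) (hC.val_d p x).symm)

theorem quasiIso_desc (hR : IsCDGA 𝓡 dR) (hI : IsNilpotentDGIdeal 𝓡 dR I)
    (hC : (reducedCE 𝔤).IsComplex) (hO : (obstructionDeformation 𝔤).IsComplex) :
    QuasiIso (biprod.desc (zeroMap hC hO) (oneMap hC hO)) := by
  have hval : ∀ p (x : (hC.cpx ⊞ hC.cpx⟦(1 : ℤ)⟧).X p),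
      hO.val p (((biprod.desc (zeroMap hC hO) (oneMap hC hO)).f p).hom x) =
        zeroCochain p (hC.val p
          (((biprod.fst : hC.cpx ⊞ hC.cpx⟦(1 : ℤ)⟧ ⟶ hC.cpx).f p).hom x)) +
        oneCochain (p + 1) (hC.val (p + 1)
          (((biprod.snd : hC.cpx ⊞ hC.cpx⟦(1 : ℤ)⟧ ⟶ hC.cpx⟦(1 : ℤ)⟧).f p).hom x)) := fun p x =>
    congrArg (hO.val p) (biprod_desc_apply _ _ p x)
  refine quasiIso_of_injective _ (fun p => ?_) fun p x hx => ?_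
  · rw [← LinearMap.ker_eq_bot, LinearMap.ker_eq_bot']
    intro x hx
    have h0 := hval p x
    rw [hx] at h0
    obtain ⟨h1, h2⟩ := cochainFunctionals_injective (Subtype.prop _) (Subtype.prop _) h0.symm
    exact biprod_ext_apply p ((hC.val_injective p (a₂ := 0) h1).trans (map_zero _).symm)
      ((hC.val_injective (p + 1) (a₂ := 0) h2).trans (map_zero _).symm)
  · obtain ⟨a, ha⟩ := hx
    obtain ⟨y, hy, h⟩ := exists_sub_mem_cochainFunctionals hR hI 𝔤 (F := hO.val (p + 1) x)
      x.2 (mem_cochainFunctionals.2 ⟨_, Subtype.prop _, _, Subtype.prop _,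
        (hval _ a).symm.trans ((congrArg (hO.val _) ha).trans (hO.val_d _ x))⟩)
    obtain ⟨c, hc, c', hc', e⟩ := mem_cochainFunctionals.1 h
    obtain ⟨b, hb, hb'⟩ := exists_biprod_apply (K := hC.cpx) (L := hC.cpx⟦(1 : ℤ)⟧) (p + 1)
      (hC.ofMem _ c hc) (hC.ofMem _ c' hc')
    refine ⟨hO.ofMem p y hy, b, hO.val_injective _ ?_⟩
    rw [hval, hb, hb']
    exact (congrArg (hO.val (p + 1) x - ·) (hO.val_d p (hO.ofMem p y hy))).trans e.symm

theorem quasiIso_deRhamMap (hR : IsCDGA 𝓡 dR) (hI : IsNilpotentDGIdeal 𝓡 dR I)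
    (hC : (reducedCE 𝔤).IsComplex) (hΩ : (truncatedDeRham 𝔤).IsComplex) :
    QuasiIso (deRhamMap hC hΩ) := by
  refine quasiIso_of_injective _ (fun p => ?_) fun p x hx => ?_
  · rw [← LinearMap.ker_eq_bot, LinearMap.ker_eq_bot']
    intro x hx
    exact hC.val_injective _ (deRham_eq_zero (Subtype.prop x) (congrArg (hΩ.val (p + 1)) hx))
  · obtain ⟨a, ha⟩ := hx
    -- The shifted complex has the opposite differential, hence the signs of `a` and `y` below.
    have h1 : deRham (p + 1 + 1) (hC.val _ a) = -(truncatedDeRham 𝔤).D (p + 1 + 1)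
        (hΩ.val (p + 1 + 1) x) :=
      (congrArg (hΩ.val (p + 1 + 1 + 1)) ha).trans (hΩ.val_shift_d (p + 1) x)
    obtain ⟨y, hy, c, hc, e⟩ := exists_sub_mem_deRham hR hI 𝔤 (x := hΩ.val (p + 1 + 1) x)
      x.2 ⟨-hC.val _ a, Submodule.neg_mem _ (Subtype.prop a), by
        rw [← neg_neg ((truncatedDeRham 𝔤).D (p + 1 + 1) _), ← h1]
        exact map_neg (pushL (fun _ => True) epsSnd (p + 1 + 1)) _⟩
    refine ⟨hΩ.ofMem (p + 1) (-y) (Submodule.neg_mem _ hy), hC.ofMem (p + 1) c hc,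
      hΩ.val_injective _ ?_⟩
    refine (congrArg (hΩ.val (p + 1 + 1) x - ·) (hΩ.val_shift_d p (hΩ.ofMem _ (-y) _))).trans ?_
    refine Eq.trans ?_ e.symm
    change _ - -(truncatedDeRham 𝔤).D (p + 1) (-y) = _
    rw [map_neg, neg_neg]

theorem isRLinear_zeroMap (hC : (reducedCE 𝔤).IsComplex) (hO : (obstructionDeformation 𝔤).IsComplex) :
    IsRLinear 𝓡 hC.val hO.val 0 (zeroMap hC hO) := fun a r _ p x _ hy =>
  (congrArg (zeroCochain (p + a)) hy).trans
    (push_smul_left intFst isCDGA_forms intFst_eq_zero p a r (hC.val p x))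

theorem isRLinear_oneMap (hC : (reducedCE 𝔤).IsComplex) (hO : (obstructionDeformation 𝔤).IsComplex) :
    IsRLinear 𝓡 (fun p => hC.val (p + 1)) hO.val 1 (oneMap hC hO) := fun a r _ p x _ hy =>
  (congrArg (oneCochain (p + a + 1)) hy).trans <| by
    rw [add_right_comm]
    exact push_smul_left intSnd isCDGA_forms intSnd_eq_zero (p + 1) a r (hC.val (p + 1) x)

theorem isRLinear_deRhamMap (hC : (reducedCE 𝔤).IsComplex) (hΩ : (truncatedDeRham 𝔤).IsComplex) :
    IsRLinear 𝓡 hC.val (fun p => hΩ.val (p + 1)) 1 (deRhamMap hC hΩ) := fun a r _ p x _ hy =>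
  (congrArg (deRham (p + a)) hy).trans <| by
    rw [show (a * 1).negOnePow = (a * -1).negOnePow by simp]
    exact push_smul_left epsSnd isCDGA_eps epsSnd_eq_zero p a r (hC.val p x)

end QuasiIsomorphisms

end ChernSimons

theorem mainTheorem8
    {R : Type} [Ring R] [Algebra ℝ R] (𝓡 : ℤ → Submodule ℝ R) [GradedAlgebra 𝓡]
    (dR : R →ₗ[ℝ] R) (hR : IsCDGA 𝓡 dR)
    (I : Ideal R) (hI : IsNilpotentDGIdeal 𝓡 dR I)
    {V : Type} [AddCommGroup V] [Module ℝ V] [Module R V] [IsScalarTower ℝ R V]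
    (𝓥 : ℤ → Submodule ℝ V) [DirectSum.Decomposition 𝓥] [SetLike.GradedSMul 𝓡 𝓥]
    [Module.Finite R V] [Module.Projective R V]
    (𝔤 : CurvedLInfty 𝓡 dR I 𝓥) :
    ∃ (hC : (reducedCE 𝔤).IsComplex) (hO : (obstructionDeformation 𝔤).IsComplex)
      (hΩ : (truncatedDeRham 𝔤).IsComplex)
      (e : HomologicalComplex.tensorObj (isComplex_invariantForms.cpx⟦(1 : ℤ)⟧) hC.cpx ≅
        hC.cpx ⊞ hC.cpx⟦(1 : ℤ)⟧)
      (f₀ : hC.cpx ⟶ hO.cpx) (f₁ : hC.cpx⟦(1 : ℤ)⟧ ⟶ hO.cpx) (g : hC.cpx ⟶ closedOneForms hΩ),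
      QuasiIso (e.hom ≫ biprod.desc f₀ f₁) ∧
      QuasiIso (biprod.desc f₀ f₁) ∧
      QuasiIso g ∧
      QuasiIso (biprod.map g (g⟦(1 : ℤ)⟧')) ∧
      IsRLinear 𝓡 hC.val hO.val 0 f₀ ∧
      IsRLinear 𝓡 (fun p => hC.val (p + 1)) hO.val 1 f₁ ∧
      IsRLinear 𝓡 hC.val (fun p => hΩ.val (p + 1)) 1 g := by
  have hC := isComplex_reducedCE hR 𝔤
  have hO := isComplex_obstructionDeformation hR 𝔤
  have hΩ := isComplex_truncatedDeRham hR 𝔤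
  have h1 := quasiIso_desc hR hI hC hO
  have h2 := quasiIso_deRhamMap hR hI hC hΩ
  exact ⟨hC, hO, hΩ, tensorInvariantIso hC.cpx, zeroMap hC hO, oneMap hC hO, deRhamMap hC hΩ,
    inferInstance, h1, h2, quasiIso_biprod_map _ _, isRLinear_zeroMap hC hO, isRLinear_oneMap hC hO,
    isRLinear_deRhamMap hC hΩ⟩
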